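/- Let $K$ be an algebraically closed field of characteristic $0$, let $X$ be a threefold over $K$ (an integral separated $K$-scheme of finite type of dimension $3$), and let $B, C \subset X$ be two curves (irreducible closed subsets of dimension $1$, with the reduced structure) which meet only in one point $p$. Assume that $X$, $B$ and $C$ are nonsingular at $p$ and that the tangent lines of $B$ and $C$ at $p$ are distinct. Let $$\widetilde X = \mathrm{Bl}_C\,\mathrm{Bl}_B X \xrightarrow{\pi_2} \mathrm{Bl}_B X \xrightarrow{\pi_1} X, \qquad \widetilde X^+ = \mathrm{Bl}_B\,\mathrm{Bl}_C X \to \mathrm{Bl}_C X \to X$$ be the blow-ups of $X$ along $B$ and $C$ in the two orders, where the second center is always the strict transform of the other curve. (The blow-up of a scheme along a closed subscheme is the universal morphism under which the inverse image of the center is an effective Cartier divisor; these blow-ups exist.) Let $\mathfrak b \subset \widetilde X$ be the strict transform under $\pi_2$ of the fiber $\pi_1^{-1}(p)$. Then: 1. $\mathfrak b \cong \mathbb P^1$ over $K$, and the normal bundle $N_{\mathfrak b/\widetilde X}$ is isomorphic to $\mathcal O_{\mathbb P^1}(-1) \oplus \mathcal O_{\mathbb P^1}(-1)$. 2. There is exactly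 one rational map $\phi : \widetilde X \dashrightarrow \widetilde X^+$ over $X$, and it is an Atiyah flop with flopping curve $\mathfrak b$. That is, $\widetilde X$ is regular along $\mathfrak b$, and there are a curve $\mathfrak c^+ \cong \mathbb P^1$ in $\widetilde X^+$, with normal bundle $\mathcal O(-1)\oplus\mathcal O(-1)$ and with $\widetilde X^+$ regular along it, and a scheme $W$ with morphisms $a : W \to \widetilde X$ and $b : W \to \widetilde X^+$, such that $a$ is the blow-up along $\mathfrak b$ and $b$ is the blow-up along $\mathfrak c^+$, the two exceptional divisors are the same divisor $E$, the morphism $(a,b) : E \to \mathfrak b \times_K \mathfrak c^+$ is an isomorphism, and $\phi$ is given by an isomorphism $\widetilde X \setminus \mathfrak b \to \widetilde X^+ \setminus \mathfrak c^+$ with $\phi \circ a = b$ on $W \setminus E$. -/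

import Mathlib

universe u

open CategoryTheory Limits TopologicalSpace AlgebraicGeometry Opposite

noncomputable section

namespace AtiyahFlop

/-! ### The dual of a sheaf of modules -/

section Dual
variable {X : Scheme.{u}} (M : X.Modules)

/-- Sections over `U` of the sheaf `ℋom(M, 𝒪_X)`: homomorphisms from the restriction of `M` to `U`
to the restriction of `𝒪_X` to `U`, given by their components on the open subsets of `U`. -/
def dualSections (U : X.Opens) :
    AddSubgroup (∀ V : {V : X.Opens // V ≤ U}, Γ(M, V.1) →ₗ[Γ(X, V.1)] Γ(X, V.1)) where
  carrier := {φ | ∀ (V W : {V : X.Opens // V ≤ U}) (h : W.1 ≤ V.1) (m : Γ(M, V.1)),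
    φ W (M.presheaf.map (homOfLE h).op m) = X.presheaf.map (homOfLE h).op (φ V m)}
  zero_mem' V W h m := by simp
  add_mem' ha hb V W h m := by simp [ha V W h m, hb V W h m]
  neg_mem' ha V W h m := by simp [ha V W h m]

/-- `Γ(X, U)` acts on the values. -/
instance (U : X.Opens) : Module Γ(X, U) (dualSections M U) where
  smul r φ := ⟨fun V ↦ X.presheaf.map (homOfLE V.2).op r • φ.1 V, fun V W h m ↦ by
    have : X.presheaf.map (homOfLE W.2).op r =
        X.presheaf.map (homOfLE h).op (X.presheaf.map (homOfLE V.2).op r) := by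
      rw [← CommRingCat.comp_apply, ← Functor.map_comp]; rfl
    simp [φ.2 V W h m, this]⟩
  one_smul φ := by
    ext V m
    exact (congrArg (· * φ.1 V m) (map_one (X.presheaf.map (homOfLE V.2).op).hom)).trans (one_mul _)
  mul_smul r s φ := by
    ext V m
    exact (congrArg (· * φ.1 V m) (map_mul (X.presheaf.map (homOfLE V.2).op).hom r s)).trans
      (mul_assoc _ _ _)
  smul_zero r := by
    ext V m
    exact mul_zero _
  smul_add r φ ψ := by
    ext V m
    exact mul_add _ _ _
  add_smul r s φ := by
    ext V m
    exact (congrArg (· * φ.1 V m) (map_add (X.presheaf.map (homOfLE V.2).op).hom r s)).trans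
      (add_mul _ _ _)
  zero_smul φ := by
    ext V m
    exact (congrArg (· * φ.1 V m) (map_zero (X.presheaf.map (homOfLE V.2).op).hom)).trans
      (zero_mul _)

/-- Restriction of a homomorphism to a smaller open set. -/
def dualRestrict {U U' : X.Opens} (h : U' ≤ U) : dualSections M U →+ dualSections M U' where
  toFun φ := ⟨fun V ↦ φ.1 ⟨V.1, V.2.trans h⟩, fun V W hWV m ↦
    φ.2 ⟨V.1, V.2.trans h⟩ ⟨W.1, W.2.trans h⟩ hWV m⟩
  map_zero' := rfl
  map_add' _ _ := rfl

/-- The presheaf of abelian groups underlying `ℋom(M, 𝒪_X)`. -/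
def dualPresheafAb : TopCat.Presheaf Ab.{u} X where
  obj U := AddCommGrpCat.of (dualSections M U.unop)
  map f := AddCommGrpCat.ofHom (dualRestrict M f.unop.le)

instance (U : X.Opensᵒᵖ) : Module (X.ringCatSheaf.obj.obj U) ((dualPresheafAb M).obj U) :=
  inferInstanceAs (Module Γ(X, U.unop) (dualSections M U.unop))

/-- The presheaf of modules underlying `ℋom(M, 𝒪_X)`. -/
def dualPresheaf : X.PresheafOfModules :=
  PresheafOfModules.ofPresheaf (dualPresheafAb M) fun U U' f r φ ↦ by
    refine Subtype.ext (funext fun V ↦ LinearMap.ext fun m ↦ ?_)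
    have h (r : Γ(X, U.unop)) : X.presheaf.map (homOfLE (V.2.trans f.unop.le)).op r =
        X.presheaf.map (homOfLE V.2).op (X.presheaf.map f r) := by
      rw [← CommRingCat.comp_apply, ← Functor.map_comp]; rfl
    exact congrArg (· * φ.1 ⟨V.1, V.2.trans f.unop.le⟩ m) (h r)

theorem dualPresheafAb_isSheaf : (dualPresheafAb M).IsSheaf := by
  rw [TopCat.Presheaf.isSheaf_iff_isSheaf_comp (forget AddCommGrpCat)]
  apply TopCat.Presheaf.isSheaf_of_isSheafUniqueGluing_types
  intro ι U sf hsf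
  change ∀ i, dualSections M (U i) at sf
  have hc (i j : ι) (W : X.Opens) (hi : W ≤ U i) (hj : W ≤ U j) :
      (sf i).1 ⟨W, hi⟩ = (sf j).1 ⟨W, hj⟩ :=
    congrArg (fun φ : dualSections M (U i ⊓ U j) ↦ φ.1 ⟨W, le_inf hi hj⟩) (hsf i j)
  have hres (i : ι) (V W : X.Opens) (hV : V ≤ U i) (h : W ≤ V) (m : Γ(M, V)) :=
    (sf i).2 ⟨V, hV⟩ ⟨W, h.trans hV⟩ h m
  have hrX (V W T : X.Opens) (h : W ≤ V) (h' : T ≤ W) (r : Γ(X, V)) :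
      X.presheaf.map (homOfLE h').op (X.presheaf.map (homOfLE h).op r) =
        X.presheaf.map (homOfLE (h'.trans h)).op r := by
    rw [← CommRingCat.comp_apply, ← Functor.map_comp]; rfl
  have hrM (V W T : X.Opens) (h : W ≤ V) (h' : T ≤ W) (r : Γ(M, V)) :
      M.presheaf.map (homOfLE h').op (M.presheaf.map (homOfLE h).op r) =
        M.presheaf.map (homOfLE (h'.trans h)).op r := by
    rw [← AddCommGrpCat.comp_apply, ← Functor.map_comp]; rfl
  have hcov (V : X.Opens) (hV : V ≤ iSup U) : V ≤ ⨆ i, V ⊓ U i := by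
    rw [← inf_iSup_eq]; exact le_inf le_rfl hV
  have hsep (V : X.Opens) (hV : V ≤ iSup U) (a b : Γ(X, V))
      (hab : ∀ i, X.presheaf.map (homOfLE (inf_le_left : V ⊓ U i ≤ V)).op a =
        X.presheaf.map (homOfLE (inf_le_left : V ⊓ U i ≤ V)).op b) : a = b :=
    X.sheaf.eq_of_locally_eq' (fun i ↦ V ⊓ U i) V (fun i ↦ homOfLE inf_le_left) (hcov V hV) a b hab
  have hex (V : X.Opens) (hV : V ≤ iSup U) (m : Γ(M, V)) : ∃ g : Γ(X, V), ∀ i,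
      X.presheaf.map (homOfLE (inf_le_left : V ⊓ U i ≤ V)).op g =
        (sf i).1 ⟨V ⊓ U i, inf_le_right⟩ (M.presheaf.map (homOfLE inf_le_left).op m) := by
    obtain ⟨g, hg, -⟩ := X.sheaf.existsUnique_gluing' (fun i ↦ V ⊓ U i) V
      (fun i ↦ homOfLE inf_le_left) (hcov V hV)
      (fun i ↦ (sf i).1 ⟨V ⊓ U i, inf_le_right⟩ (M.presheaf.map (homOfLE inf_le_left).op m)) (by
        intro i j
        have hi : (V ⊓ U i) ⊓ (V ⊓ U j) ≤ V ⊓ U i := inf_le_left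
        have hj : (V ⊓ U i) ⊓ (V ⊓ U j) ≤ V ⊓ U j := inf_le_right
        refine (hres i _ _ inf_le_right hi _).symm.trans
          (Eq.trans ?_ (hres j _ _ inf_le_right hj _))
        rw [hrM, hrM, hc i j])
    exact ⟨g, hg⟩
  choose g hg using hex
  refine ⟨⟨fun V ↦
    { toFun := g V.1 V.2
      map_add' := fun a b ↦ hsep _ V.2 _ _ fun i ↦ by simp [hg]
      map_smul' := fun r a ↦ hsep _ V.2 _ _ fun i ↦ by simp [hg] }, ?_⟩, ?_, ?_⟩
  · intro V W h m
    refine hsep _ W.2 _ _ fun i ↦ ?_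
    change X.presheaf.map _ (g W.1 W.2 _) = X.presheaf.map _ (X.presheaf.map _ (g V.1 V.2 m))
    have h' : W.1 ⊓ U i ≤ V.1 ⊓ U i := inf_le_inf_right _ h
    rw [hg, hrX, ← hrX V.1 (V.1 ⊓ U i) (W.1 ⊓ U i) inf_le_left h', hg, ← hres i _ _ _ h', hrM, hrM]
  · intro i
    refine Subtype.ext (funext fun V ↦ LinearMap.ext fun m ↦ ?_)
    have hV : V.1 ≤ iSup U := V.2.trans (le_iSup U i)
    refine hsep _ hV _ _ fun j ↦ ?_
    refine (hg V.1 hV m j).trans ?_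
    rw [← hres i _ _ V.2 inf_le_left, hc i j]
  · intro s hs
    refine Subtype.ext (funext fun V ↦ LinearMap.ext fun m ↦ ?_)
    refine hsep _ V.2 _ _ fun i ↦ ?_
    refine Eq.trans ?_ (hg V.1 V.2 m i).symm
    have h1 := congrArg (fun φ : dualSections M (U i) ↦ φ.1 ⟨V.1 ⊓ U i, inf_le_right⟩) (hs i)
    have h2 := s.2 V ⟨V.1 ⊓ U i, inf_le_left.trans V.2⟩ inf_le_left m
    exact h2.symm.trans (LinearMap.congr_fun h1 _)

/-- The dual `ℋom(M, 𝒪_X)` of a sheaf of modules `M`. -/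
def dual : X.Modules where
  val := dualPresheaf M
  isSheaf := dualPresheafAb_isSheaf M

end Dual

/-! ### Conormal and normal sheaves -/

section Normal
variable {Z Y : Scheme.{u}} (i : Z ⟶ Y)

/-- The homomorphism `𝒪_Y ⟶ i_* 𝒪_Z` given by a morphism `i : Z ⟶ Y`. -/
def structureMap : (SheafOfModules.unit Y.ringCatSheaf : Y.Modules) ⟶
    (Scheme.Modules.pushforward i).obj (SheafOfModules.unit Z.ringCatSheaf : Z.Modules) :=
  SheafOfModules.unitToPushforwardObjUnit i.toRingCatSheafHom

/-- The conormal sheaf `i^* I`, that is `I / I²`, of a closed immersion `i : Z ⟶ Y` with ideal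
sheaf `I`, the kernel of `𝒪_Y ⟶ i_* 𝒪_Z`. -/
def conormalSheaf : Z.Modules := (Scheme.Modules.pullback i).obj (kernel (structureMap i))

/-- The normal sheaf `ℋom(I / I², 𝒪_Z)` of a closed immersion `i : Z ⟶ Y`. -/
def normalSheaf : Z.Modules := dual (conormalSheaf i)

end Normal

/-! ### Twisting sheaves -/

section Twist

open ProjectiveSpectrum

variable {A : Type u} {σ : Type*} [CommRing A] [SetLike σ A] [AddSubgroupClass σ A]
variable (𝒜 : ℕ → σ) [GradedRing 𝒜] (n : ℤ)

instance (x : ProjectiveSpectrum.top 𝒜) : x.asHomogeneousIdeal.toIdeal.IsPrime := x.isPrime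

/-- The local ring `A_x` of the graded ring `A` at a point `x` of `Proj A`. -/
abbrev TwistFiber (x : ProjectiveSpectrum.top 𝒜) : Type u :=
  Localization.AtPrime x.asHomogeneousIdeal.toIdeal

/-- `f` is given by one fraction `r / s` with `r` and `s` homogeneous and `deg r = deg s + n`. -/
def IsTwistFraction {U : Opens (ProjectiveSpectrum.top 𝒜)}
    (f : ∀ x : U, TwistFiber 𝒜 x.1) : Prop :=
  ∃ (i j : ℕ) (_ : (i : ℤ) = j + n) (r : 𝒜 i) (s : 𝒜 j)
    (hs : ∀ x : U, s.1 ∉ x.1.asHomogeneousIdeal),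
    ∀ x : U, f x = Localization.mk r.1 ⟨s.1, hs x⟩

/-- Being a fraction of degree `n` is stable under restriction. -/
def twistPrelocal : TopCat.PrelocalPredicate (TwistFiber 𝒜) where
  pred f := IsTwistFraction 𝒜 n f
  res := by
    rintro V U i f ⟨a, b, h, r, s, hs, w⟩
    exact ⟨a, b, h, r, s, (hs <| i ·), (w <| i ·)⟩

/-- Being locally a fraction of degree `n`. -/
def twistLocal : TopCat.LocalPredicate (TwistFiber 𝒜) := (twistPrelocal 𝒜 n).sheafify

theorem exists_denominator (x : ProjectiveSpectrum.top 𝒜) :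
    ∃ (i j : ℕ) (_ : (i : ℤ) = j + n) (s : 𝒜 j), s.1 ∉ x.asHomogeneousIdeal := by
  have : ∃ d : ℕ, 0 < d ∧ ∃ s ∈ 𝒜 d, s ∉ x.asHomogeneousIdeal := by
    by_contra! h
    refine x.not_irrelevant_le ?_
    refine (HomogeneousIdeal.irrelevant_le _).mpr fun d hd a ha ↦ ?_
    exact h d hd a ha
  obtain ⟨d, hd, s, hs, hsx⟩ := this
  refine ⟨(n.natAbs * d + n).toNat, n.natAbs * d, ?_, ⟨s ^ n.natAbs, ?_⟩, ?_⟩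
  · have : (n.natAbs : ℤ) ≤ n.natAbs * d := by
      exact_mod_cast Nat.le_mul_of_pos_right _ hd
    rw [Int.toNat_of_nonneg (by omega)]
    push_cast
    rfl
  · simpa using SetLike.pow_mem_graded n.natAbs hs
  · exact fun h ↦ hsx (x.isPrime.mem_of_pow_mem _ h)

/-- Sections of `𝒪(n)` over `U`: functions on `U` that are locally fractions of degree `n`. -/
def twistSections (U : Opens (ProjectiveSpectrum.top 𝒜)) :
    AddSubgroup (∀ x : U, TwistFiber 𝒜 x.1) where
  carrier := {f | (twistLocal 𝒜 n).pred f}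
  zero_mem' x := by
    obtain ⟨i, j, h, s, hs⟩ := exists_denominator 𝒜 n x.1
    exact ⟨U ⊓ ProjectiveSpectrum.basicOpen 𝒜 s.1, ⟨x.2, hs⟩, Opens.infLELeft _ _, i, j, h, 0, s,
      fun y ↦ y.2.2, fun y ↦ (Localization.mk_zero _).symm⟩
  add_mem' {a b} ha hb x := by
    obtain ⟨Va, ma, ia, i, j, h, r, s, hs, w⟩ := ha x
    obtain ⟨Vb, mb, ib, i', j', h', r', s', hs', w'⟩ := hb x
    refine ⟨Va ⊓ Vb, ⟨ma, mb⟩, Opens.infLELeft _ _ ≫ ia, j + i', j + j', by push_cast; omega,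
      ⟨s.1 * r'.1 + s'.1 * r.1, add_mem (SetLike.mul_mem_graded s.2 r'.2) ?_⟩,
      ⟨s.1 * s'.1, SetLike.mul_mem_graded s.2 s'.2⟩, fun y ↦ ?_, fun y ↦ ?_⟩
    · have e : j + i' = j' + i := by omega
      rw [e]
      exact SetLike.mul_mem_graded s'.2 r.2
    · exact y.1.asHomogeneousIdeal.toIdeal.primeCompl.mul_mem (hs ⟨y.1, y.2.1⟩) (hs' ⟨y.1, y.2.2⟩)
    · exact (congrArg₂ (· + ·) (w ⟨y.1, y.2.1⟩) (w' ⟨y.1, y.2.2⟩)).trans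
        (Localization.add_mk _ _ _ _)
  neg_mem' {a} ha x := by
    obtain ⟨V, m, k, i, j, h, r, s, hs, w⟩ := ha x
    exact ⟨V, m, k, i, j, h, ⟨-r.1, neg_mem r.2⟩, s, hs, fun y ↦
      (congrArg (- ·) (w y)).trans (Localization.neg_mk _ _)⟩

theorem smul_mem_twistSections {U : Opens (ProjectiveSpectrum.top 𝒜)}
    (f : (Proj.structureSheaf 𝒜).1.obj (op U)) (s : twistSections 𝒜 n U) :
    (fun x : U ↦ (f.1 x).val * s.1 x) ∈ twistSections 𝒜 n U := by
  intro x
  obtain ⟨Va, ma, ia, i, r, s', hs, w⟩ := f.2 x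
  obtain ⟨Vb, mb, ib, i', j', h', r', t', hs', w'⟩ := s.2 x
  refine ⟨Va ⊓ Vb, ⟨ma, mb⟩, Opens.infLELeft _ _ ≫ ia, i + i', i + j', by push_cast; omega,
      ⟨r.1 * r'.1, SetLike.mul_mem_graded r.2 r'.2⟩,
      ⟨s'.1 * t'.1, SetLike.mul_mem_graded s'.2 t'.2⟩, fun y ↦ ?_, fun y ↦ ?_⟩
  · exact y.1.asHomogeneousIdeal.toIdeal.primeCompl.mul_mem (hs ⟨y.1, y.2.1⟩) (hs' ⟨y.1, y.2.2⟩)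
  · refine (congrArg₂ (· * ·) (congrArg HomogeneousLocalization.val (w ⟨y.1, y.2.1⟩))
      (w' ⟨y.1, y.2.2⟩)).trans ?_
    exact (congrArg (· * _) (HomogeneousLocalization.val_mk _)).trans (Localization.mk_mul _ _ _ _)

/-- The structure sheaf (locally fractions of degree `0`) acts by multiplication. -/
instance twistModule (U : Opens (ProjectiveSpectrum.top 𝒜)) :
    Module ((Proj.structureSheaf 𝒜).1.obj (op U)) (twistSections 𝒜 n U) where
  smul f s := ⟨_, smul_mem_twistSections 𝒜 n f s⟩
  one_smul s := Subtype.ext <| funext fun x ↦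
    (congrArg (· * s.1 x) (HomogeneousLocalization.val_one)).trans (one_mul _)
  mul_smul _ _ s := Subtype.ext <| funext fun x ↦
    (congrArg (· * s.1 x) (HomogeneousLocalization.val_mul _ _)).trans (mul_assoc _ _ _)
  smul_zero _ := Subtype.ext <| funext fun _ ↦ mul_zero _
  smul_add _ _ _ := Subtype.ext <| funext fun _ ↦ mul_add _ _ _
  add_smul _ _ s := Subtype.ext <| funext fun x ↦
    (congrArg (· * s.1 x) (HomogeneousLocalization.val_add _ _)).trans (add_mul _ _ _)
  zero_smul s := Subtype.ext <| funext fun x ↦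
    (congrArg (· * s.1 x) (HomogeneousLocalization.val_zero)).trans (zero_mul _)

/-- The presheaf of abelian groups underlying `𝒪(n)`. -/
def twistPresheafAb : TopCat.Presheaf Ab.{u} (Proj 𝒜) where
  obj U := AddCommGrpCat.of (twistSections 𝒜 n U.unop)
  map f := AddCommGrpCat.ofHom
    { toFun := fun s ↦ ⟨fun x ↦ s.1 (f.unop x), (twistLocal 𝒜 n).res f.unop _ s.2⟩
      map_zero' := rfl
      map_add' := fun _ _ ↦ rfl }

instance (U : (Proj 𝒜).Opensᵒᵖ) :
    Module ((Proj 𝒜).ringCatSheaf.obj.obj U) ((twistPresheafAb 𝒜 n).obj U) :=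
  twistModule 𝒜 n U.unop

/-- Serre's twisting sheaf `𝒪(n)` on `Proj A`. -/
def twist : (Proj 𝒜).Modules where
  val := PresheafOfModules.ofPresheaf (twistPresheafAb 𝒜 n) fun _ _ _ _ _ ↦ rfl
  isSheaf := (TopCat.Presheaf.isSheaf_iff_isSheaf_comp (forget AddCommGrpCat) _).2
    (TopCat.subsheafToTypes (twistLocal 𝒜 n)).2

end Twist

/-! ### The projective line -/

attribute [local instance] MvPolynomial.gradedAlgebra

/-- The projective line over `K`. -/
def projectiveLine (K : Type u) [Field K] : Scheme.{u} :=
  Proj (MvPolynomial.homogeneousSubmodule (Fin 2) K)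

/-- The structure morphism of the projective line. -/
def projectiveLineToSpec (K : Type u) [Field K] : projectiveLine K ⟶ Spec (.of K) :=
  Proj.toSpecZero (MvPolynomial.homogeneousSubmodule (Fin 2) K) ≫
    Spec.map (CommRingCat.ofHom
      (algebraMap K (MvPolynomial.homogeneousSubmodule (Fin 2) K 0)))

/-- The line bundle `𝒪(n)` on the projective line. -/
def lineBundle (K : Type u) [Field K] (n : ℤ) : (projectiveLine K).Modules :=
  twist (MvPolynomial.homogeneousSubmodule (Fin 2) K) n

/-! ### Closed subsets as subschemes, tangent spaces, strict transforms -/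

/-- A closed subset with its reduced scheme structure. -/
def reducedSubscheme {X : Scheme.{u}} (Z : Closeds X) : Scheme.{u} :=
  (Scheme.IdealSheafData.vanishingIdeal Z).subscheme

/-- The inclusion of a closed subset with its reduced scheme structure. -/
def reducedι {X : Scheme.{u}} (Z : Closeds X) : reducedSubscheme Z ⟶ X :=
  (Scheme.IdealSheafData.vanishingIdeal Z).subschemeι

/-- The Zariski tangent space at `p` of the reduced closed subscheme `Z` of `X`, as a subspace of
the tangent space `(𝔪 / 𝔪²)ᵛ` of `X` at `p`: the tangent vectors that kill all functions which
vanish on `Z`. -/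
def tangentSpace {X : Scheme.{u}} (Z : Closeds X) (p : X) :
    Submodule (IsLocalRing.ResidueField (X.presheaf.stalk p))
      (Module.Dual (IsLocalRing.ResidueField (X.presheaf.stalk p))
        (IsLocalRing.CotangentSpace (X.presheaf.stalk p))) where
  carrier := {v | ∀ (U : X.affineOpens) (hp : p ∈ U.1) (f : Γ(X, U)),
    f ∈ (Scheme.IdealSheafData.vanishingIdeal Z).ideal U →
    ∀ hf : X.presheaf.germ U.1 p hp f ∈ IsLocalRing.maximalIdeal (X.presheaf.stalk p),
      v ((IsLocalRing.maximalIdeal (X.presheaf.stalk p)).toCotangent ⟨_, hf⟩) = 0}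
  add_mem' ha hb U hp f hf hm := by simp [ha U hp f hf hm, hb U hp f hf hm]
  zero_mem' U hp f hf hm := rfl
  smul_mem' r v hv U hp f hf hm := by simp [hv U hp f hf hm]

/-- The strict transform under `π : Y ⟶ X` of `V`, with respect to the center `Z`: the closure of
the preimage of `V ∖ Z`. -/
def strictTransform {X Y : Scheme.{u}} (π : Y ⟶ X) (Z V : Set X) : Closeds Y :=
  Closeds.closure (π ⁻¹' (V \ Z))

/-! ### Blow-ups -/

/-- The ideal sheaf of an effective Cartier divisor: locally generated by one nonzerodivisor. -/
def IsEffectiveCartier {Y : Scheme.{u}} (I : Y.IdealSheafData) : Prop :=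
  ∀ y : Y, ∃ U : Y.affineOpens, y ∈ U.1 ∧
    ∃ f ∈ nonZeroDivisors Γ(Y, U), I.ideal U = Ideal.span {f}

/-- `π : Y ⟶ X` is the blow-up of `X` along the closed subscheme with ideal sheaf `I`: the inverse
image of the center is an effective Cartier divisor, and every morphism to `X` with this property
factors uniquely through `π`. -/
structure IsBlowup {X Y : Scheme.{u}} (π : Y ⟶ X) (I : X.IdealSheafData) : Prop where
  isEffectiveCartier : IsEffectiveCartier (I.comap π)
  existsUnique_lift : ∀ {T : Scheme.{u}} (g : T ⟶ X), IsEffectiveCartier (I.comap g) →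
    ∃! h : T ⟶ Y, h ≫ π = g

/-- The two blow-ups `Bl_C Bl_B X ⟶ Bl_B X ⟶ X`; the center of the second one is the strict
transform of `C`. -/
structure IteratedBlowup {X : Scheme.{u}} (B C : Closeds X) where
  /-- `Bl_B X` -/
  X₁ : Scheme.{u}
  /-- `Bl_C Bl_B X` -/
  X₂ : Scheme.{u}
  /-- the blow-up of `B` -/
  π₁ : X₁ ⟶ X
  /-- the blow-up of the strict transform of `C` -/
  π₂ : X₂ ⟶ X₁
  isBlowup₁ : IsBlowup π₁ (Scheme.IdealSheafData.vanishingIdeal B)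
  isBlowup₂ : IsBlowup π₂ (Scheme.IdealSheafData.vanishingIdeal (strictTransform π₁ B C))

namespace IteratedBlowup

variable {X : Scheme.{u}} {B C : Closeds X} (Y : IteratedBlowup B C)

/-- The composite `Bl_C Bl_B X ⟶ X`. -/
def toBase : Y.X₂ ⟶ X := Y.π₂ ≫ Y.π₁

/-- The strict transform in `Bl_C Bl_B X` of the fiber of `Bl_B X ⟶ X` over `p`. -/
def fiberCurve (p : X) : Closeds Y.X₂ :=
  strictTransform Y.π₂ (strictTransform Y.π₁ B C) (Y.π₁ ⁻¹' {p})

end IteratedBlowup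

/-! ### Atiyah flops -/

section Flop

variable {K : Type u} [Field K]

/-- `c` is a smooth rational curve in the `K`-scheme `Y` with normal bundle `𝒪(-1) ⊕ 𝒪(-1)`. -/
def HasNormalBundleNegOneNegOne {Y : Scheme.{u}} (s : Y ⟶ Spec (.of K)) (c : Closeds Y) : Prop :=
  ∃ e : projectiveLine K ≅ reducedSubscheme c,
    e.hom ≫ reducedι c ≫ s = projectiveLineToSpec K ∧
    Nonempty ((Scheme.Modules.pullback e.hom).obj (normalSheaf (reducedι c)) ≅
      lineBundle K (-1) ⊞ lineBundle K (-1))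

/-- The rational map `φ` between `K`-schemes is the Atiyah flop with flopping curve `c`. Here `c`
is a smooth rational curve with normal bundle `𝒪(-1) ⊕ 𝒪(-1)` in the regular locus of `Y`. The flop
is the blow-up `a : W ⟶ Y` of `c`, followed by the contraction `b : W ⟶ Y'` of the exceptional
divisor `E` along its other ruling: `b` is the blow-up of a curve `c'` of the same kind in `Y'` with
the same exceptional divisor, `E` is the product of `c` and `c'` via `a` and `b`, and `φ` is given
by an isomorphism from `Y ∖ c` to `Y' ∖ c'` that is compatible with `a` and `b`. -/
def IsAtiyahFlop {Y Y' : Scheme.{u}} (s : Y ⟶ Spec (.of K)) (s' : Y' ⟶ Spec (.of K))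
    (φ : Y ⤏ Y') (c : Closeds Y) : Prop :=
  HasNormalBundleNegOneNegOne s c ∧
  (∀ y ∈ c, IsRegularLocalRing (Y.presheaf.stalk y)) ∧
  ∃ c' : Closeds Y',
    HasNormalBundleNegOneNegOne s' c' ∧
    (∀ y ∈ c', IsRegularLocalRing (Y'.presheaf.stalk y)) ∧
    ∃ (W : Scheme.{u}) (a : W ⟶ Y) (b : W ⟶ Y'),
      IsBlowup a (Scheme.IdealSheafData.vanishingIdeal c) ∧
      IsBlowup b (Scheme.IdealSheafData.vanishingIdeal c') ∧
      (Scheme.IdealSheafData.vanishingIdeal c).comap a =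
        (Scheme.IdealSheafData.vanishingIdeal c').comap b ∧
      (∃ (e : ((Scheme.IdealSheafData.vanishingIdeal c).comap a).subscheme ⟶ reducedSubscheme c)
          (e' : ((Scheme.IdealSheafData.vanishingIdeal c).comap a).subscheme ⟶
            reducedSubscheme c'),
        e ≫ reducedι c = ((Scheme.IdealSheafData.vanishingIdeal c).comap a).subschemeι ≫ a ∧
        e' ≫ reducedι c' = ((Scheme.IdealSheafData.vanishingIdeal c).comap a).subschemeι ≫ b ∧
        IsPullback e e' (reducedι c ≫ s) (reducedι c' ≫ s')) ∧
      ∃ f : Y.PartialIso Y', f.toRationalMap = φ ∧ f.source = c.compl ∧ f.target = c'.compl ∧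
        (a ∣_ f.source) ≫ f.iso.hom ≫ f.target.ι = (a ⁻¹ᵁ f.source).ι ≫ b

end Flop

end AtiyahFlop

end

noncomputable section

namespace AtiyahFlop

section CartierCalculus

/-! ### Pulling back ideal sheaves -/

theorem mem_vanishingIdeal_iff {X : Scheme.{u}} (Z : Closeds X) (U : X.affineOpens)
    (f : Γ(X, U)) :
    f ∈ (Scheme.IdealSheafData.vanishingIdeal Z).ideal U ↔ ∀ x ∈ Z, x ∉ X.basicOpen f := by
  rw [Scheme.IdealSheafData.vanishingIdeal_ideal, PrimeSpectrum.mem_vanishingIdeal]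
  constructor
  · intro h x hx hxf
    have hxU : x ∈ U.1 := X.basicOpen_le f hxf
    obtain ⟨q, rfl⟩ : x ∈ Set.range U.2.fromSpec := by rw [U.2.range_fromSpec]; exact hxU
    have h1 := h q hx
    have : q ∈ U.2.fromSpec ⁻¹ᵁ X.basicOpen f := hxf
    rw [U.2.fromSpec_preimage_basicOpen] at this
    exact this h1
  · intro h q hq
    by_contra hf
    refine h _ hq ?_
    change q ∈ U.2.fromSpec ⁻¹ᵁ X.basicOpen f
    rw [U.2.fromSpec_preimage_basicOpen]
    exact hf

theorem appIso_inv_appLE {X Y : Scheme.{u}} (f : X ⟶ Y) [IsOpenImmersion f] (U : X.Opens) :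
    (f.appIso U).inv ≫ f.appLE (f ''ᵁ U) U (f.preimage_image_eq U).ge = 𝟙 _ := by
  rw [Scheme.Hom.appLE, Scheme.Hom.appIso_inv_app_assoc, ← Functor.map_comp]
  exact X.presheaf.map_id _

theorem vanishingIdeal_comap {X Y : Scheme.{u}} (Z : Closeds Y) (f : X ⟶ Y) [IsOpenImmersion f] :
    (Scheme.IdealSheafData.vanishingIdeal Z).comap f =
      Scheme.IdealSheafData.vanishingIdeal (Z.preimage f.continuous) := by
  ext U s
  rw [Scheme.IdealSheafData.ideal_comap_of_isOpenImmersion, Ideal.mem_comap,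
    mem_vanishingIdeal_iff, mem_vanishingIdeal_iff]
  have key : X.basicOpen s = f ⁻¹ᵁ Y.basicOpen ((f.appIso U.1).inv.hom s) := by
    have h := congrArg (fun φ ↦ φ.hom s) (appIso_inv_appLE f U.1)
    change f.appLE (f ''ᵁ U.1) U.1 _ ((f.appIso U.1).inv s) = s at h
    conv_lhs => rw [← h]
    rw [Scheme.basicOpen_appLE, inf_eq_right]
    refine (f.preimage_mono (Y.basicOpen_le _)).trans ?_
    rw [f.preimage_image_eq]
  rw [key]
  constructor
  · intro h x hx hx'
    exact h (f x) hx hx'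
  · intro h y hy hy'
    obtain ⟨x, hxU, rfl⟩ := Y.basicOpen_le _ hy'
    exact h x hy hy'

/-- The top open subset of an affine scheme. -/
def topAffine (X : Scheme.{u}) [IsAffine X] : X.affineOpens := ⟨⊤, isAffineOpen_top X⟩

theorem comap_specMap_ideal {R S : CommRingCat.{u}} (φ : R ⟶ S) (I : (Spec R).IdealSheafData) :
    (I.comap (Spec.map φ)).ideal (topAffine _) =
      (I.ideal (topAffine _)).map ((Spec.map φ).app ⊤).hom := by
  let J : (Spec S).IdealSheafData := Scheme.IdealSheafData.ofIdealTop
    ((I.ideal (topAffine _)).map ((Spec.map φ).app ⊤).hom)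
  have hJ : J.ideal (topAffine _) =
      (I.ideal (topAffine _)).map ((Spec.map φ).app ⊤).hom :=
    (Scheme.IdealSheafData.equivOfIsAffine (X := Spec S)).apply_symm_apply _
  apply le_antisymm
  · rw [← hJ]
    refine (?_ : I.comap (Spec.map φ) ≤ J) (topAffine _)
    rw [← Scheme.IdealSheafData.le_map_iff_comap_le]
    refine Scheme.IdealSheafData.le_of_isAffine ?_
    rw [Scheme.IdealSheafData.ideal_map_of_isAffineHom, ← Ideal.map_le_iff_le_comap]
    exact hJ.ge
  · refine Ideal.map_le_iff_le_comap.2 ?_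
    have := Scheme.IdealSheafData.le_map_comap I (Spec.map φ) (topAffine _)
    rw [Scheme.IdealSheafData.ideal_map_of_isAffineHom] at this
    exact this

theorem ideal_comap_ge {X Y : Scheme.{u}} (I : Y.IdealSheafData) (f : X ⟶ Y) (U : Y.affineOpens)
    (V : X.affineOpens) (e : V.1 ≤ f ⁻¹ᵁ U.1) :
    (I.ideal U).map (f.appLE U V e).hom ≤ (I.comap f).ideal V := by
  rw [Ideal.map_le_iff_le_comap]
  intro r hr
  rw [Ideal.mem_comap]
  have h := (I.le_map_comap f U).trans (Scheme.Hom.ideal_ker_le _ U) hr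
  rw [RingHom.mem_ker, Scheme.Hom.comp_app] at h
  rw [← Scheme.IdealSheafData.ker_subschemeι_app, RingHom.mem_ker]
  have h2 : f.appLE U V e ≫ (I.comap f).subschemeι.app V =
      f.app U ≫ (I.comap f).subschemeι.app (f ⁻¹ᵁ U) ≫
        (I.comap f).subscheme.presheaf.map ((Opens.map _).map (homOfLE e)).op := by
    rw [Scheme.Hom.appLE, Category.assoc, Scheme.Hom.naturality]
    rfl
  have h3 := congrArg (fun φ ↦ φ.hom r) h2
  refine h3.trans ?_
  change ((I.comap f).subscheme.presheaf.map _).hom (((I.comap f).subschemeι.app (f ⁻¹ᵁ U)).hom ((f.app U).hom r)) = 0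
  have h4 : ((I.comap f).subschemeι.app (f ⁻¹ᵁ U)).hom ((f.app U).hom r) = 0 := h
  rw [h4, map_zero]

theorem ideal_comap_of_openImmersion {X Y : Scheme.{u}} (I : Y.IdealSheafData) (f : X ⟶ Y)
    [IsOpenImmersion f] (U : Y.affineOpens) (V : X.affineOpens) (e : V.1 ≤ f ⁻¹ᵁ U.1) :
    (I.comap f).ideal V = (I.ideal U).map (f.appLE U V e).hom := by
  rw [Scheme.IdealSheafData.ideal_comap_of_isOpenImmersion]
  have hW : (⟨f ''ᵁ V, V.2.image_of_isOpenImmersion f⟩ : Y.affineOpens) ≤ U :=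
    (f.image_mono e).trans (f.image_preimage_le _)
  rw [← I.map_ideal hW]
  have h1 : f.appLE U V e = Y.presheaf.map (homOfLE hW).op ≫ (f.appIso V.1).hom := by
    rw [Scheme.Hom.appIso_hom', Scheme.Hom.map_appLE]
  rw [h1, CommRingCat.hom_comp, ← Ideal.map_map]
  exact (Ideal.map_comap_of_equiv (f.appIso V.1).commRingCatIsoToRingEquiv).symm

/-- The pullback of an ideal sheaf is generated by the pullbacks of its sections. -/
theorem ideal_comap_appLE {X Y : Scheme.{u}} (I : Y.IdealSheafData) (f : X ⟶ Y)
    (U : Y.affineOpens) (V : X.affineOpens) (e : V.1 ≤ f ⁻¹ᵁ U.1) :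
    (I.comap f).ideal V = (I.ideal U).map (f.appLE U V e).hom := by
  apply le_antisymm _ (ideal_comap_ge I f U V e)
  have hU : IsAffineOpen U.1 := U.2
  have hV : IsAffineOpen V.1 := V.2
  have hsq : Spec.map (f.appLE U V e) ≫ hU.fromSpec = hV.fromSpec ≫ f :=
    IsAffineOpen.SpecMap_appLE_fromSpec f hU hV e
  have h1 : (I.comap f).comap hV.fromSpec =
      (I.comap hU.fromSpec).comap (Spec.map (f.appLE U V e)) := by
    rw [← Scheme.IdealSheafData.comap_comp, ← Scheme.IdealSheafData.comap_comp, hsq]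
  have h2 := congrArg (fun J ↦ Scheme.IdealSheafData.ideal J (topAffine _)) h1
  have eV : (topAffine (Spec Γ(X, V))).1 ≤ hV.fromSpec ⁻¹ᵁ V.1 := by
    rw [hV.fromSpec_preimage_self]; exact le_rfl
  have eU : (topAffine (Spec Γ(Y, U))).1 ≤ hU.fromSpec ⁻¹ᵁ U.1 := by
    rw [hU.fromSpec_preimage_self]; exact le_rfl
  have h2' := (ideal_comap_of_openImmersion (I.comap f) hV.fromSpec V _ eV).symm.trans
    ((h2.trans (comap_specMap_ideal _ _)).trans
      (congrArg (Ideal.map _) (ideal_comap_of_openImmersion I hU.fromSpec U _ eU)))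
  have h3 : hU.fromSpec.appLE U.1 (topAffine _).1 eU ≫ (Spec.map (f.appLE U V e)).app ⊤ =
      f.appLE U V e ≫ hV.fromSpec.appLE V.1 (topAffine _).1 eV := by
    have : ∀ (g : Spec Γ(X, V) ⟶ Y) (hg : g = hV.fromSpec ≫ f)
        (h : (topAffine (Spec Γ(X, V))).1 ≤ g ⁻¹ᵁ U.1),
        g.appLE U.1 (topAffine _).1 h =
          f.appLE U V e ≫ hV.fromSpec.appLE V.1 (topAffine _).1 eV := by
      rintro g rfl h
      exact (Scheme.Hom.appLE_comp_appLE _ _ _ _ _ _ _).symm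
    refine Eq.trans ?_ (this _ hsq fun a _ ↦ eU trivial)
    rw [Scheme.Hom.app_eq_appLE]
    exact Scheme.Hom.appLE_comp_appLE _ _ _ _ _ _ _
  have h4 := congrArg (fun φ ↦ (I.ideal U).map φ.hom) h3
  have hiso : IsIso (hV.fromSpec.appLE V.1 (topAffine _).1 eV) := by
    have : IsIso (hV.fromSpec.app V.1) := by
      refine Scheme.Hom.isIso_app _ _ ?_
      rw [hV.opensRange_fromSpec]
    have h5 : (topAffine (Spec Γ(X, V))).1 = hV.fromSpec ⁻¹ᵁ V.1 :=
      (hV.fromSpec_preimage_self).symm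
    have : IsIso ((Spec Γ(X, V)).presheaf.map (homOfLE eV).op) := by
      have : homOfLE eV = eqToHom h5 := rfl
      rw [this]; infer_instance
    rw [Scheme.Hom.appLE]
    infer_instance
  have hbij := (ConcreteCategory.isIso_iff_bijective
    (hV.fromSpec.appLE V.1 (topAffine _).1 eV)).1 hiso
  have h7 : ((I.comap f).ideal V).map (hV.fromSpec.appLE V.1 (topAffine _).1 eV).hom =
      ((I.ideal U).map (f.appLE U V e).hom).map (hV.fromSpec.appLE V.1 (topAffine _).1 eV).hom :=
    h2'.trans ((Ideal.map_map _ _).trans (h4.trans (Ideal.map_map _ _).symm))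
  have h8 := Ideal.comap_map_of_bijective
    (hV.fromSpec.appLE V.1 (topAffine _).1 eV).hom hbij (I := (I.ideal U).map (f.appLE U V e).hom)
  exact (Ideal.map_le_iff_le_comap.1 h7.le).trans h8.le

theorem exists_affine_pair {X Y : Scheme.{u}} (f : X ⟶ Y) (x : X) (W : X.Opens) (hx : x ∈ W)
    (W' : Y.Opens) (hx' : f x ∈ W') :
    ∃ (U : Y.affineOpens) (V : X.affineOpens), x ∈ V.1 ∧ f x ∈ U.1 ∧ V.1 ≤ W ∧ U.1 ≤ W' ∧
      V.1 ≤ f ⁻¹ᵁ U.1 := by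
  obtain ⟨U, hU, hxU, hUW⟩ := Y.isBasis_affineOpens.exists_subset_of_mem_open hx' W'.2
  obtain ⟨V, hV, hxV, hVW⟩ := X.isBasis_affineOpens.exists_subset_of_mem_open
    (show x ∈ W ⊓ f ⁻¹ᵁ ⟨U, by obtain ⟨U, _, rfl⟩ := hU; exact U.2⟩ from ⟨hx, hxU⟩) (Opens.isOpen _)
  obtain ⟨U, hU, rfl⟩ := hU
  obtain ⟨V, hV, rfl⟩ := hV
  exact ⟨⟨U, hU⟩, ⟨V, hV⟩, hxV, hxU, fun a ha ↦ (hVW ha).1, hUW, fun a ha ↦ (hVW ha).2⟩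

/-- Ideal sheaves that agree near every point are equal. -/
theorem ideal_ext_of_forall {X : Scheme.{u}} {I J : X.IdealSheafData}
    (h : ∀ x : X, ∃ V : X.affineOpens, x ∈ V.1 ∧ I.ideal V = J.ideal V) : I = J := by
  choose V hxV hV using h
  refine Scheme.IdealSheafData.ext_of_iSup_eq_top V (top_le_iff.1 fun x _ ↦ ?_) hV
  exact Opens.mem_iSup.2 ⟨x, hxV x⟩

theorem comap_mul {X Y : Scheme.{u}} (I J : Y.IdealSheafData) (f : X ⟶ Y) :
    (I * J).comap f = I.comap f * J.comap f := by
  refine ideal_ext_of_forall fun x ↦ ?_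
  obtain ⟨U, V, hxV, -, -, -, e⟩ := exists_affine_pair f x ⊤ trivial ⊤ trivial
  refine ⟨V, hxV, ?_⟩
  rw [ideal_comap_appLE _ f U V e, Scheme.IdealSheafData.ideal_mul,
    Scheme.IdealSheafData.ideal_mul, Pi.mul_apply, Pi.mul_apply, ideal_comap_appLE _ f U V e,
    ideal_comap_appLE _ f U V e, Ideal.map_mul]

/-! ### Effective Cartier divisors -/

theorem mem_nonZeroDivisors_basicOpen {X : Scheme.{u}} (U : X.affineOpens) (f : Γ(X, U))
    (hf : f ∈ nonZeroDivisors Γ(X, U)) (g : Γ(X, U)) :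
    X.presheaf.map (homOfLE (X.basicOpen_le g)).op f ∈ nonZeroDivisors Γ(X, X.basicOpen g) := by
  have := U.2.isLocalization_basicOpen g
  have h := IsLocalization.map_nonZeroDivisors_le (Submonoid.powers g) Γ(X, X.basicOpen g)
  exact h (Submonoid.mem_map_of_mem _ hf)

theorem ideal_eq_span_of_le {X : Scheme.{u}} (I : X.IdealSheafData) {U V : X.affineOpens}
    (h : V ≤ U) {s : Set Γ(X, U)} (hs : I.ideal U = Ideal.span s) :
    I.ideal V = Ideal.span (X.presheaf.map (homOfLE h).op '' s) := by
  rw [← I.map_ideal h, hs, Ideal.map_span]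

theorem ideal_eq_span_singleton_of_le {X : Scheme.{u}} (I : X.IdealSheafData) {U V : X.affineOpens}
    (h : V ≤ U) {s : Γ(X, U)} (hs : I.ideal U = Ideal.span {s}) :
    I.ideal V = Ideal.span {X.presheaf.map (homOfLE h).op s} := by
  rw [ideal_eq_span_of_le I h hs, Set.image_singleton]

/-- The ideal sheaf is generated by one nonzerodivisor near a point. -/
def IsCartierAt {X : Scheme.{u}} (I : X.IdealSheafData) (x : X) : Prop :=
  ∃ U : X.affineOpens, x ∈ U.1 ∧ ∃ f ∈ nonZeroDivisors Γ(X, U), I.ideal U = Ideal.span {f}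

theorem IsCartierAt.exists_le {X : Scheme.{u}} {I : X.IdealSheafData} {x : X}
    (hI : IsCartierAt I x) (W : X.Opens) (hx : x ∈ W) :
    ∃ V : X.affineOpens, x ∈ V.1 ∧ V.1 ≤ W ∧ ∃ f ∈ nonZeroDivisors Γ(X, V),
      I.ideal V = Ideal.span {f} := by
  obtain ⟨U, hxU, f, hf, hfU⟩ := hI
  obtain ⟨g, hg, hxg⟩ := U.2.exists_basicOpen_le ⟨x, hx⟩ hxU
  exact ⟨X.affineBasicOpen g, hxg, hg, _, mem_nonZeroDivisors_basicOpen U f hf g,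
    ideal_eq_span_singleton_of_le I (X.affineBasicOpen_le g) hfU⟩

theorem IsEffectiveCartier.exists_le {X : Scheme.{u}} {I : X.IdealSheafData}
    (hI : IsEffectiveCartier I) (x : X) (W : X.Opens) (hx : x ∈ W) :
    ∃ V : X.affineOpens, x ∈ V.1 ∧ V.1 ≤ W ∧ ∃ f ∈ nonZeroDivisors Γ(X, V),
      I.ideal V = Ideal.span {f} :=
  IsCartierAt.exists_le (hI x) W hx

theorem mem_nonZeroDivisors_of_locally {X : Scheme.{u}} (V : X.Opens) (a : Γ(X, V))
    (h : ∀ x ∈ V, ∃ (W : X.Opens) (hW : W ≤ V), x ∈ W ∧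
      X.presheaf.map (homOfLE hW).op a ∈ nonZeroDivisors Γ(X, W)) :
    a ∈ nonZeroDivisors Γ(X, V) := by
  rw [mem_nonZeroDivisors_iff_right]
  intro c hc
  choose W hWV hxW hW using fun x : V ↦ h x.1 x.2
  refine X.sheaf.eq_of_locally_eq' W V (fun x ↦ homOfLE (hWV x))
    (fun x hx ↦ Opens.mem_iSup.2 ⟨⟨x, hx⟩, hxW ⟨x, hx⟩⟩) c 0 fun x ↦ ?_
  refine Eq.trans ?_ (map_zero _).symm
  refine (mem_nonZeroDivisors_iff_right.1 (hW x)) _ ?_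
  have := congrArg (X.presheaf.map (homOfLE (hWV x)).op) hc
  rw [map_mul, map_zero] at this
  exact this

theorem mem_nonZeroDivisors_of_span_eq {R : Type*} [CommRing R] {a b : R}
    (hb : b ∈ nonZeroDivisors R) (h : Ideal.span {a} = Ideal.span {b}) :
    a ∈ nonZeroDivisors R := by
  have hab : a ∣ b := by
    rw [← Ideal.mem_span_singleton, h]; exact Ideal.mem_span_singleton_self b
  obtain ⟨c, rfl⟩ := hab
  exact (mul_mem_nonZeroDivisors.1 hb).1

theorem mem_nonZeroDivisors_of_isCartierAt {X : Scheme.{u}} {I : X.IdealSheafData}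
    {V : X.affineOpens} (hI : ∀ x ∈ V.1, IsCartierAt I x) {a : Γ(X, V)}
    (ha : I.ideal V = Ideal.span {a}) : a ∈ nonZeroDivisors Γ(X, V) := by
  refine mem_nonZeroDivisors_of_locally V.1 a fun x hx ↦ ?_
  obtain ⟨W, hxW, hWV, f, hf, hfW⟩ := (hI x hx).exists_le V.1 hx
  refine ⟨W.1, hWV, hxW, mem_nonZeroDivisors_of_span_eq hf ?_⟩
  exact (ideal_eq_span_singleton_of_le I hWV ha).symm.trans hfW

theorem IsEffectiveCartier.mem_nonZeroDivisors {X : Scheme.{u}} {I : X.IdealSheafData}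
    (hI : IsEffectiveCartier I) {V : X.affineOpens} {a : Γ(X, V)}
    (ha : I.ideal V = Ideal.span {a}) : a ∈ nonZeroDivisors Γ(X, V) :=
  mem_nonZeroDivisors_of_isCartierAt (fun x _ ↦ hI x) ha

theorem IsEffectiveCartier.mul {X : Scheme.{u}} {I J : X.IdealSheafData}
    (hI : IsEffectiveCartier I) (hJ : IsEffectiveCartier J) : IsEffectiveCartier (I * J) := by
  intro x
  obtain ⟨U, hxU, f, hf, hfU⟩ := hI x
  obtain ⟨V, hxV, hVU, g, hg, hgV⟩ := hJ.exists_le x U.1 hxU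
  have h := ideal_eq_span_singleton_of_le I (show V ≤ U from hVU) hfU
  refine ⟨V, hxV, _, mul_mem (hI.mem_nonZeroDivisors h) hg, ?_⟩
  rw [Scheme.IdealSheafData.ideal_mul, Pi.mul_apply, h, hgV, Ideal.span_singleton_mul_span_singleton]

theorem exists_factor_of_mul_eq_span {R : Type*} [CommRing R] {I J : Ideal R} {f : R}
    (hf : f ∈ nonZeroDivisors R) (h : I * J = Ideal.span {f}) (q : Ideal R) (hq : q ≠ ⊤) :
    ∃ a ∈ I, ∃ b ∈ J, ∃ c, c ∉ q ∧ a * b = c * f := by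
  by_contra! hcon
  have hle : I * J ≤ q * Ideal.span {f} := by
    rw [Ideal.mul_le]
    intro a ha b hb
    have hab : a * b ∈ Ideal.span {f} := h ▸ Ideal.mul_mem_mul ha hb
    obtain ⟨c, hc⟩ := Ideal.mem_span_singleton'.1 hab
    rw [← hc]
    refine Ideal.mul_mem_mul ?_ (Ideal.mem_span_singleton_self f)
    by_contra hcq
    exact hcon a ha b hb c hcq hc.symm
  have hfm : f ∈ q * Ideal.span {f} := hle (h ▸ Ideal.mem_span_singleton_self f)
  obtain ⟨c, hc, hcf⟩ := Ideal.mem_mul_span_singleton.1 hfm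
  have : c = 1 := (mul_cancel_right_mem_nonZeroDivisors hf).1 (by rw [hcf, one_mul])
  exact hq ((Ideal.eq_top_iff_one q).2 (this ▸ hc))

theorem IsEffectiveCartier.of_mul_left {X : Scheme.{u}} {I J : X.IdealSheafData}
    (h : IsEffectiveCartier (I * J)) : IsEffectiveCartier I := by
  intro x
  obtain ⟨U, hxU, f, hf, hfU⟩ := h x
  rw [Scheme.IdealSheafData.ideal_mul, Pi.mul_apply] at hfU
  obtain ⟨a, ha, b, hb, c, hc, hab⟩ := exists_factor_of_mul_eq_span hf hfU
    (U.2.primeIdealOf ⟨x, hxU⟩).asIdeal (U.2.primeIdealOf ⟨x, hxU⟩).2.ne_top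
  have hxc : x ∈ X.basicOpen c := by
    have h1 : U.2.primeIdealOf ⟨x, hxU⟩ ∈ U.2.fromSpec ⁻¹ᵁ X.basicOpen c := by
      rw [U.2.fromSpec_preimage_basicOpen]; exact hc
    have h2 : U.2.fromSpec (U.2.primeIdealOf ⟨x, hxU⟩) = x := U.2.fromSpec_primeIdealOf ⟨x, hxU⟩
    rw [← h2]; exact h1
  let V := X.affineBasicOpen c
  let r : Γ(X, U) →+* Γ(X, X.basicOpen c) := (X.presheaf.map (homOfLE (X.basicOpen_le c)).op).hom
  have hcu : IsUnit (r c) := RingedSpace.isUnit_res_basicOpen _ c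
  have hab' : r a * r b = r c * r f := by rw [← map_mul, hab, map_mul]
  have hrf : r f ∈ nonZeroDivisors Γ(X, X.basicOpen c) := mem_nonZeroDivisors_basicOpen U f hf c
  have hra : r a * r b ∈ nonZeroDivisors Γ(X, X.basicOpen c) := by
    rw [hab']; exact mul_mem hcu.mem_nonZeroDivisors hrf
  refine ⟨V, hxc, r a, (mul_mem_nonZeroDivisors.1 hra).1, ?_⟩
  rw [← I.map_ideal (X.affineBasicOpen_le c)]
  apply le_antisymm
  · rw [Ideal.map_le_iff_le_comap]
    intro i hi
    have hib : i * b ∈ Ideal.span {f} := hfU ▸ Ideal.mul_mem_mul hi hb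
    obtain ⟨d, hd⟩ := Ideal.mem_span_singleton'.1 hib
    refine Ideal.mem_span_singleton.2 ?_
    change r a ∣ r i
    rw [← hcu.dvd_mul_right]
    refine ⟨r d, ?_⟩
    have h1 : (r i * r c) * r f = (r a * r d) * r f := by
      rw [mul_assoc, ← hab', mul_left_comm, ← map_mul r i b, ← hd, map_mul, mul_assoc]
    exact (mul_cancel_right_mem_nonZeroDivisors hrf).1 h1
  · exact (Ideal.span_singleton_le_iff_mem _).2 (Ideal.mem_map_of_mem _ ha)

theorem IsEffectiveCartier.of_mul_right {X : Scheme.{u}} {I J : X.IdealSheafData}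
    (h : IsEffectiveCartier (I * J)) : IsEffectiveCartier J :=
  IsEffectiveCartier.of_mul_left (J := I) (mul_comm I J ▸ h)

theorem map_mem_nonZeroDivisors_of_bijective {R S : Type*} [CommRing R] [CommRing S] (f : R →+* S)
    (hf : Function.Bijective f) {a : R} (ha : a ∈ nonZeroDivisors R) : f a ∈ nonZeroDivisors S := by
  rw [mem_nonZeroDivisors_iff_right] at ha ⊢
  intro s hs
  obtain ⟨r, rfl⟩ := hf.2 s
  rw [ha r (hf.1 (by rw [map_mul, hs, map_zero])), map_zero]

theorem IsEffectiveCartier.comap_of_isOpenImmersion {X Y : Scheme.{u}} {I : Y.IdealSheafData}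
    (hI : IsEffectiveCartier I) (f : X ⟶ Y) [IsOpenImmersion f] :
    IsEffectiveCartier (I.comap f) := by
  intro x
  obtain ⟨V, hxV, hVW, a, ha, haV⟩ := hI.exists_le (f x) f.opensRange ⟨x, rfl⟩
  have hV : IsAffineOpen (f ⁻¹ᵁ V.1) := V.2.preimage_of_isOpenImmersion f hVW
  refine ⟨⟨f ⁻¹ᵁ V.1, hV⟩, hxV, f.app V.1 a, ?_, ?_⟩
  · have : IsIso (f.app V.1) := Scheme.Hom.isIso_app _ _ hVW
    have hb := (ConcreteCategory.isIso_iff_bijective (f.app V.1)).1 this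
    exact map_mem_nonZeroDivisors_of_bijective (f.app V.1).hom hb ha
  · rw [ideal_comap_appLE I f V ⟨f ⁻¹ᵁ V.1, hV⟩ le_rfl, haV, Ideal.map_span, Set.image_singleton,
      ← Scheme.Hom.app_eq_appLE]

theorem isCartierAt_of_comap {X T : Scheme.{u}} {I : X.IdealSheafData} (j : T ⟶ X)
    [IsOpenImmersion j] (hT : IsEffectiveCartier (I.comap j)) (t : T) : IsCartierAt I (j t) := by
  obtain ⟨V, htV, a, ha, haV⟩ := hT t
  refine ⟨⟨j ''ᵁ V.1, V.2.image_of_isOpenImmersion j⟩, ⟨t, htV, rfl⟩, (j.appIso V.1).inv a, ?_, ?_⟩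
  · have hb := (ConcreteCategory.isIso_iff_bijective (j.appIso V.1).inv).1 inferInstance
    exact map_mem_nonZeroDivisors_of_bijective (j.appIso V.1).inv.hom hb ha
  · have hV : (⟨j ''ᵁ V.1, V.2.image_of_isOpenImmersion j⟩ : X.affineOpens).1 ≤ j ''ᵁ V.1 := le_rfl
    have h1 := ideal_comap_of_openImmersion I j ⟨j ''ᵁ V.1, V.2.image_of_isOpenImmersion j⟩ V
      (j.preimage_image_eq V.1).ge
    rw [haV, ← Scheme.Hom.appIso_hom'] at h1
    have h2 := congrArg (Ideal.map (j.appIso V.1).inv.hom) h1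
    rw [Ideal.map_map, ← CommRingCat.hom_comp, Iso.hom_inv_id, CommRingCat.hom_id, Ideal.map_id,
      Ideal.map_span, Set.image_singleton] at h2
    exact h2.symm

/-- Being an effective Cartier divisor is local. -/
theorem IsEffectiveCartier.of_openCover {X : Scheme.{u}} {I : X.IdealSheafData}
    (h : ∀ x : X, ∃ (T : Scheme.{u}) (j : T ⟶ X) (_ : IsOpenImmersion j), x ∈ Set.range j ∧
      IsEffectiveCartier (I.comap j)) : IsEffectiveCartier I := by
  intro x
  obtain ⟨T, j, hj, ⟨t, rfl⟩, hT⟩ := h x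
  exact isCartierAt_of_comap j hT t

/-- An effective Cartier divisor cancels in products of ideal sheaves. -/
theorem IsEffectiveCartier.mul_left_cancel {X : Scheme.{u}} {L I J : X.IdealSheafData}
    (hL : IsEffectiveCartier L) (h : L * I = L * J) : I = J := by
  refine ideal_ext_of_forall fun x ↦ ?_
  obtain ⟨U, hxU, f, hf, hfU⟩ := hL x
  refine ⟨U, hxU, ?_⟩
  have h1 := congrArg (fun K ↦ Scheme.IdealSheafData.ideal K U) h
  simp only [Scheme.IdealSheafData.ideal_mul, Pi.mul_apply, hfU] at h1
  ext a
  have key (K : Ideal Γ(X, U)) : a ∈ K ↔ f * a ∈ Ideal.span {f} * K := by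
    rw [Ideal.mem_span_singleton_mul]
    constructor
    · exact fun h ↦ ⟨a, h, rfl⟩
    · rintro ⟨b, hb, e⟩
      rwa [← (mul_cancel_left_mem_nonZeroDivisors hf).1 e]
  rw [key, key (J.ideal U), h1]

end CartierCalculus

section Locus

theorem mem_basicOpen_of_notMem_primeIdealOf {X : Scheme.{u}} {U : X.Opens} (hU : IsAffineOpen U)
    (x : U) (c : Γ(X, U)) (hc : c ∉ (hU.primeIdealOf x).asIdeal) : x.1 ∈ X.basicOpen c := by
  have h1 : hU.primeIdealOf x ∈ hU.fromSpec ⁻¹ᵁ X.basicOpen c := by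
    rw [hU.fromSpec_preimage_basicOpen]; exact hc
  have h2 : hU.fromSpec (hU.primeIdealOf x) = x := hU.fromSpec_primeIdealOf x
  rw [← h2]; exact h1

/-- Among generators of a principal ideal generated by a nonzerodivisor, one generates locally. -/
theorem exists_mem_associated {R : Type*} [CommRing R] {s : Set R} {f : R}
    (hf : f ∈ nonZeroDivisors R) (h : Ideal.span s = Ideal.span {f}) (q : Ideal R) (hq : q ≠ ⊤) :
    ∃ a ∈ s, ∃ c, c ∉ q ∧ a = c * f := by
  by_contra! hcon
  have hle : Ideal.span s ≤ q * Ideal.span {f} := by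
    rw [Ideal.span_le]
    intro a ha
    obtain ⟨c, hc⟩ := Ideal.mem_span_singleton'.1 (h ▸ Ideal.subset_span ha : a ∈ Ideal.span {f})
    rw [← hc]
    refine Ideal.mul_mem_mul ?_ (Ideal.mem_span_singleton_self f)
    by_contra hcq
    exact hcon a ha c hcq hc.symm
  obtain ⟨c, hc, hcf⟩ := Ideal.mem_mul_span_singleton.1
    (hle (h ▸ Ideal.mem_span_singleton_self f))
  have : c = 1 := (mul_cancel_right_mem_nonZeroDivisors hf).1 (by rw [hcf, one_mul])
  exact hq ((Ideal.eq_top_iff_one q).2 (this ▸ hc))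

theorem IsEffectiveCartier.dense_compl_support {X : Scheme.{u}} {I : X.IdealSheafData}
    (hI : IsEffectiveCartier I) : Dense ((I.support : Set X)ᶜ) := by
  rw [dense_iff_inter_open]
  rintro W hW ⟨x, hx⟩
  obtain ⟨V, hxV, hVW, f, hf, hfV⟩ := hI.exists_le x ⟨W, hW⟩ hx
  by_contra hcon
  have h1 : ∀ y ∈ V.1, y ∈ I.support := fun y hy ↦ by
    by_contra h
    exact hcon ⟨y, hVW hy, h⟩
  have h2 : X.basicOpen f = ⊥ := by
    refine bot_unique fun y hy ↦ ?_
    have hyV := X.basicOpen_le _ hy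
    have h3 := (Scheme.IdealSheafData.mem_support_iff_of_mem hyV).1 (h1 y hyV)
    rw [hfV, Scheme.mem_zeroLocus_iff] at h3
    exact h3 f (Ideal.mem_span_singleton_self f) hy
  have h3 : IsNilpotent f :=
    (Scheme.isNilpotent_iff_basicOpen_eq_bot_of_isCompact V.2.isCompact f).2 h2
  obtain ⟨n, hn⟩ := h3
  have h4 : (0 : Γ(X, V)) ∈ nonZeroDivisors Γ(X, V) := hn ▸ pow_mem hf n
  have h5 : Subsingleton Γ(X, V) := by
    have h6 := mem_nonZeroDivisors_iff_right.1 h4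
    exact ⟨fun a b ↦ sub_eq_zero.1 (h6 (a - b) (mul_zero _))⟩
  have : Nontrivial Γ(X, V) := by
    have : Nonempty V.1 := ⟨⟨x, hxV⟩⟩
    infer_instance
  exact not_subsingleton _ h5

/-- The open subset of `Y` over `U` on which the section `a` generates the pullback of `I`. -/
def chartLocus {X Y : Scheme.{u}} (π : Y ⟶ X) (I : X.IdealSheafData) (U : X.affineOpens)
    (a : Γ(X, U)) : Y.Opens :=
  sSup {V | ∃ (hV : IsAffineOpen V) (e : V ≤ π ⁻¹ᵁ U.1),
    (I.comap π).ideal ⟨V, hV⟩ = Ideal.span {π.appLE U V e a}}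

theorem mem_chartLocus {X Y : Scheme.{u}} {π : Y ⟶ X} {I : X.IdealSheafData} {U : X.affineOpens}
    {a : Γ(X, U)} {y : Y} : y ∈ chartLocus π I U a ↔ ∃ (V : Y.affineOpens) (e : V.1 ≤ π ⁻¹ᵁ U.1),
      y ∈ V.1 ∧ (I.comap π).ideal V = Ideal.span {π.appLE U V e a} := by
  rw [chartLocus, Opens.mem_sSup]
  constructor
  · rintro ⟨V, ⟨hV, e, h⟩, hy⟩
    exact ⟨⟨V, hV⟩, e, hy, h⟩
  · rintro ⟨V, e, hy, h⟩
    exact ⟨V.1, ⟨V.2, e, h⟩, hy⟩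

theorem chartLocus_le {X Y : Scheme.{u}} (π : Y ⟶ X) (I : X.IdealSheafData) (U : X.affineOpens)
    (a : Γ(X, U)) : chartLocus π I U a ≤ π ⁻¹ᵁ U.1 := by
  intro y hy
  obtain ⟨V, e, hyV, -⟩ := mem_chartLocus.1 hy
  exact e hyV

theorem map_appLE_apply {X Y : Scheme.{u}} (π : Y ⟶ X) {U : X.Opens} {V V' : Y.Opens}
    (e : V ≤ π ⁻¹ᵁ U) (h : V' ≤ V) (a : Γ(X, U)) :
    Y.presheaf.map (homOfLE h).op (π.appLE U V e a) = π.appLE U V' (h.trans e) a := by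
  rw [← CommRingCat.comp_apply, Scheme.Hom.appLE_map]

theorem appLE_appLE_apply {X Y T : Scheme.{u}} (h : T ⟶ Y) (π : Y ⟶ X) {U : X.Opens} {V : Y.Opens}
    {W : T.Opens} (e : V ≤ π ⁻¹ᵁ U) (e' : W ≤ h ⁻¹ᵁ V) (a : Γ(X, U)) :
    h.appLE V W e' (π.appLE U V e a) =
      (h ≫ π).appLE U W (e'.trans (h.preimage_mono e)) a := by
  rw [← CommRingCat.comp_apply, Scheme.Hom.appLE_comp_appLE]

theorem chartLocus_exists_le {X Y : Scheme.{u}} {π : Y ⟶ X} {I : X.IdealSheafData}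
    {U : X.affineOpens} {a : Γ(X, U)} {y : Y} (hy : y ∈ chartLocus π I U a) (W : Y.Opens)
    (hyW : y ∈ W) : ∃ (V : Y.affineOpens) (e : V.1 ≤ π ⁻¹ᵁ U.1), V.1 ≤ W ∧ y ∈ V.1 ∧
      (I.comap π).ideal V = Ideal.span {π.appLE U V e a} := by
  obtain ⟨V, e, hyV, h⟩ := mem_chartLocus.1 hy
  have hV : IsAffineOpen V.1 := V.2
  obtain ⟨g, hg, hyg⟩ := hV.exists_basicOpen_le ⟨y, hyW⟩ hyV
  refine ⟨Y.affineBasicOpen g, (Y.basicOpen_le g).trans e, hg, hyg, ?_⟩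
  rw [ideal_eq_span_singleton_of_le _ (Y.affineBasicOpen_le g) h]
  exact congrArg (fun x ↦ Ideal.span {x}) (map_appLE_apply π e _ a)

theorem ideal_comap_comap_eq_span {X Y T : Scheme.{u}} (h : T ⟶ Y) (π : Y ⟶ X)
    (I : X.IdealSheafData) (V : Y.affineOpens) (W : T.affineOpens)
    (e' : W.1 ≤ h ⁻¹ᵁ V.1) {b : Γ(Y, V)} (hb : (I.comap π).ideal V = Ideal.span {b}) :
    (I.comap (h ≫ π)).ideal W = Ideal.span {h.appLE V W e' b} := by
  rw [Scheme.IdealSheafData.comap_comp, ideal_comap_appLE _ h V W e', hb, Ideal.map_span,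
    Set.image_singleton]

/-- Chart loci of effective Cartier divisors are compatible with pullback. -/
theorem preimage_chartLocus {X Y T : Scheme.{u}} (h : T ⟶ Y) (π : Y ⟶ X) (I : X.IdealSheafData)
    (hY : IsEffectiveCartier (I.comap π)) (hT : IsEffectiveCartier (I.comap (h ≫ π)))
    (U : X.affineOpens) (a : Γ(X, U)) (ha : a ∈ I.ideal U) :
    h ⁻¹ᵁ chartLocus π I U a = chartLocus (h ≫ π) I U a := by
  ext t
  constructor
  · intro ht
    obtain ⟨V, e, htV, hV⟩ := mem_chartLocus.1 (show h t ∈ chartLocus π I U a from ht)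
    obtain ⟨W, hW, htW, hWV⟩ := T.isBasis_affineOpens.exists_subset_of_mem_open
      (show t ∈ h ⁻¹ᵁ V.1 from htV) (Opens.isOpen _)
    obtain ⟨W, hW, rfl⟩ := hW
    have e' : W ≤ h ⁻¹ᵁ V.1 := hWV
    refine mem_chartLocus.2 ⟨⟨W, hW⟩, e'.trans (h.preimage_mono e), htW, ?_⟩
    refine (ideal_comap_comap_eq_span h π I V ⟨W, hW⟩ e' hV).trans ?_
    rw [appLE_appLE_apply]
  · intro ht
    change h t ∈ chartLocus π I U a
    have htU : t ∈ (h ≫ π) ⁻¹ᵁ U.1 := chartLocus_le _ _ _ _ ht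
    obtain ⟨V, htV, hVU, b, hb, hbV⟩ := hY.exists_le (h t) (π ⁻¹ᵁ U.1) htU
    obtain ⟨W, e, hWV, htW, hW⟩ := chartLocus_exists_le ht (h ⁻¹ᵁ V.1) htV
    have ha' : π.appLE U V hVU a ∈ (I.comap π).ideal V := by
      rw [ideal_comap_appLE I π U V hVU]
      exact Ideal.mem_map_of_mem _ ha
    rw [hbV] at ha'
    obtain ⟨d, hd⟩ := Ideal.mem_span_singleton'.1 ha'
    have hW2 := ideal_comap_comap_eq_span h π I V W hWV hbV
    have hbW := hT.mem_nonZeroDivisors hW2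
    have h1 : h.appLE V W hWV d * h.appLE V W hWV b = (h ≫ π).appLE U W e a := by
      rw [← map_mul, hd, appLE_appLE_apply]
    have h2 : h.appLE V W hWV b ∈ Ideal.span {(h ≫ π).appLE U W e a} := by
      rw [← hW, hW2]; exact Ideal.mem_span_singleton_self _
    obtain ⟨c, hc⟩ := Ideal.mem_span_singleton'.1 h2
    have h3 : c * h.appLE V W hWV d = 1 := by
      refine (mul_cancel_right_mem_nonZeroDivisors hbW).1 ?_
      rw [mul_assoc, h1, hc, one_mul]
    have h4 : IsUnit (h.appLE V W hWV d) := .of_mul_eq_one_right _ h3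
    have h5 : t ∈ T.basicOpen (h.appLE V W hWV d) := by
      rw [Scheme.basicOpen_of_isUnit _ h4]; exact htW
    rw [Scheme.basicOpen_appLE] at h5
    have h6 : h t ∈ Y.basicOpen d := h5.2
    refine mem_chartLocus.2 ⟨Y.affineBasicOpen d, (Y.basicOpen_le d).trans hVU, h6, ?_⟩
    rw [ideal_eq_span_singleton_of_le _ (Y.affineBasicOpen_le d) hbV]
    have h7 := congrArg (Y.presheaf.map (homOfLE (Y.basicOpen_le d)).op) hd
    rw [map_mul, map_appLE_apply] at h7
    refine Eq.trans ?_ (congrArg (fun x ↦ Ideal.span {x}) h7)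
    refine (Ideal.span_singleton_mul_left_unit ?_ _).symm
    exact RingedSpace.isUnit_res_basicOpen _ d

theorem exists_mem_chartLocus {X T : Scheme.{u}} (g : T ⟶ X) (I : X.IdealSheafData)
    (hT : IsEffectiveCartier (I.comap g)) (t : T) (U : X.affineOpens) (htU : g t ∈ U.1)
    (s : Set Γ(X, U)) (hs : I.ideal U = Ideal.span s) :
    ∃ a ∈ s, t ∈ chartLocus g I U a := by
  obtain ⟨V, htV, hVU, b, hb, hbV⟩ := hT.exists_le t (g ⁻¹ᵁ U.1) htU
  have h1 : Ideal.span (g.appLE U V hVU '' s) = Ideal.span {b} := by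
    rw [← hbV, ideal_comap_appLE I g U V hVU, hs, Ideal.map_span]
  have hV : IsAffineOpen V.1 := V.2
  obtain ⟨_, ⟨a, has, rfl⟩, c, hc, hcb⟩ := exists_mem_associated hb h1
    (hV.primeIdealOf ⟨t, htV⟩).asIdeal (hV.primeIdealOf ⟨t, htV⟩).2.ne_top
  refine ⟨a, has, mem_chartLocus.2 ⟨T.affineBasicOpen c, (T.basicOpen_le c).trans hVU,
    mem_basicOpen_of_notMem_primeIdealOf hV ⟨t, htV⟩ c hc, ?_⟩⟩
  rw [ideal_eq_span_singleton_of_le _ (T.affineBasicOpen_le c) hbV]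
  have h7 := congrArg (T.presheaf.map (homOfLE (T.basicOpen_le c)).op) hcb
  rw [map_mul] at h7
  refine Eq.trans ?_ (congrArg (fun x ↦ Ideal.span {x}) (h7.symm.trans (map_appLE_apply g hVU _ a)))
  refine (Ideal.span_singleton_mul_left_unit ?_ _).symm
  exact RingedSpace.isUnit_res_basicOpen _ c

end Locus

section Charts

/-- `φ : A →+* R` is the chart of the blow-up of the ideal `I` on which `a ∈ I` generates. -/
structure IsBlowupChart {A R : Type u} [CommRing A] [CommRing R] (φ : A →+* R) (I : Ideal A)
    (a : A) : Prop where
  mem : a ∈ I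
  mem_nonZeroDivisors : φ a ∈ nonZeroDivisors R
  map_eq : I.map φ = Ideal.span {φ a}
  existsUnique_lift : ∀ {S : Type u} [CommRing S] (ψ : A →+* S), ψ a ∈ nonZeroDivisors S →
    I.map ψ = Ideal.span {ψ a} → ∃! χ : R →+* S, χ.comp φ = ψ

theorem dvd_of_locally {X : Scheme.{u}} (V : X.Opens) (a b : Γ(X, V))
    (ha : ∀ (W : X.Opens) (h : W ≤ V), X.presheaf.map (homOfLE h).op a ∈ nonZeroDivisors Γ(X, W))
    (hab : ∀ x ∈ V, ∃ (W : X.Opens) (h : W ≤ V), x ∈ W ∧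
      X.presheaf.map (homOfLE h).op a ∣ X.presheaf.map (homOfLE h).op b) : a ∣ b := by
  choose W hWV hxW c hc using fun x : V ↦ hab x.1 x.2
  have hr (V₁ V₂ V₃ : X.Opens) (h : V₂ ≤ V₁) (h' : V₃ ≤ V₂) (r : Γ(X, V₁)) :
      X.presheaf.map (homOfLE h').op (X.presheaf.map (homOfLE h).op r) =
        X.presheaf.map (homOfLE (h'.trans h)).op r := by
    rw [← CommRingCat.comp_apply, ← Functor.map_comp]; rfl
  obtain ⟨g, hg, -⟩ := X.sheaf.existsUnique_gluing' W V (fun x ↦ homOfLE (hWV x))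
    (fun x hx ↦ Opens.mem_iSup.2 ⟨⟨x, hx⟩, hxW ⟨x, hx⟩⟩) c (by
      intro x y
      refine (mul_cancel_left_mem_nonZeroDivisors
        (ha (W x ⊓ W y) (inf_le_left.trans (hWV x)))).1 ?_
      have h1 := congrArg (X.presheaf.map (homOfLE (inf_le_left : W x ⊓ W y ≤ W x)).op) (hc x)
      have h2 := congrArg (X.presheaf.map (homOfLE (inf_le_right : W x ⊓ W y ≤ W y)).op) (hc y)
      rw [map_mul, hr, hr] at h1 h2
      exact h1.symm.trans h2)
  refine ⟨(show Γ(X, V) from g), X.sheaf.eq_of_locally_eq' W V (fun x ↦ homOfLE (hWV x))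
    (fun x hx ↦ Opens.mem_iSup.2 ⟨⟨x, hx⟩, hxW ⟨x, hx⟩⟩) b (a * (show Γ(X, V) from g)) fun x ↦ ?_⟩
  refine (hc x).trans ?_
  refine Eq.trans ?_ (map_mul _ _ _).symm
  exact congrArg (_ * ·) (hg x).symm

theorem appLE_mem_nonZeroDivisors {X T : Scheme.{u}} {g : T ⟶ X} {I : X.IdealSheafData}
    (hT : IsEffectiveCartier (I.comap g)) {U : X.affineOpens} {a : Γ(X, U)} (W : T.Opens)
    (hW : W ≤ chartLocus g I U a) (e : W ≤ g ⁻¹ᵁ U.1) :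
    g.appLE U W e a ∈ nonZeroDivisors Γ(T, W) := by
  refine mem_nonZeroDivisors_of_locally W _ fun x hx ↦ ?_
  obtain ⟨V, e', hVW, hxV, hV⟩ := chartLocus_exists_le (hW hx) W hx
  refine ⟨V.1, hVW, hxV, ?_⟩
  rw [map_appLE_apply]
  exact hT.mem_nonZeroDivisors hV

theorem map_appLE_eq_span {X T : Scheme.{u}} {g : T ⟶ X} {I : X.IdealSheafData}
    (hT : IsEffectiveCartier (I.comap g)) {U : X.affineOpens} {a : Γ(X, U)} (ha : a ∈ I.ideal U)
    (W : T.Opens) (hW : W ≤ chartLocus g I U a) (e : W ≤ g ⁻¹ᵁ U.1) :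
    (I.ideal U).map (g.appLE U W e).hom = Ideal.span {g.appLE U W e a} := by
  apply le_antisymm
  · rw [Ideal.map_le_iff_le_comap]
    intro i hi
    rw [Ideal.mem_comap, Ideal.mem_span_singleton]
    refine dvd_of_locally W _ _ (fun V hV ↦ ?_) fun x hx ↦ ?_
    · rw [map_appLE_apply]
      exact appLE_mem_nonZeroDivisors hT V (hV.trans hW) (hV.trans e)
    · obtain ⟨V, e', hVW, hxV, hV⟩ := chartLocus_exists_le (hW hx) W hx
      refine ⟨V.1, hVW, hxV, ?_⟩
      change _ ∣ T.presheaf.map (homOfLE hVW).op (g.appLE U W e i)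
      rw [map_appLE_apply, map_appLE_apply, ← Ideal.mem_span_singleton, ← hV,
        ideal_comap_appLE I g U V e']
      exact Ideal.mem_map_of_mem _ hi
  · exact (Ideal.span_singleton_le_iff_mem _).2 (Ideal.mem_map_of_mem _ ha)

theorem toSpecΓ_cancel {T : Scheme.{u}} {R : CommRingCat.{u}} {α β : R ⟶ Γ(T, ⊤)}
    (h : T.toSpecΓ ≫ Spec.map α = T.toSpecΓ ≫ Spec.map β) : α = β := by
  have := congrArg Scheme.Hom.appTop h
  rw [Scheme.Hom.comp_appTop, Scheme.Hom.comp_appTop, Scheme.toSpecΓ_appTop,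
    Scheme.ΓSpecIso_naturality, Scheme.ΓSpecIso_naturality, cancel_epi] at this
  exact this

theorem eq_toSpecΓ_SpecMap {T : Scheme.{u}} {R : CommRingCat.{u}} (h : T ⟶ Spec R) :
    h = T.toSpecΓ ≫ Spec.map ((Scheme.ΓSpecIso R).inv ≫ h.appTop) := by
  rw [Spec.map_comp, ← Scheme.toSpecΓ_naturality_assoc]
  have : (Spec R).toSpecΓ = Spec.map (Scheme.ΓSpecIso R).hom := (SpecMap_ΓSpecIso_hom R).symm
  rw [this, ← Spec.map_comp, Iso.inv_hom_id, Spec.map_id, Category.comp_id]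

/-- The morphism to `X` from the spectrum of an algebra over the sections on an affine open. -/
def chartMap {X : Scheme.{u}} (U : X.affineOpens) {R : CommRingCat.{u}} (φ : Γ(X, U) ⟶ R) :
    Spec R ⟶ X :=
  Spec.map φ ≫ IsAffineOpen.fromSpec (show IsAffineOpen U.1 from U.2)

theorem chartMap_preimage {X : Scheme.{u}} (U : X.affineOpens) {R : CommRingCat.{u}}
    (φ : Γ(X, U) ⟶ R) : chartMap U φ ⁻¹ᵁ U.1 = ⊤ := by
  have hU : IsAffineOpen U.1 := U.2
  refine top_unique fun x _ ↦ ?_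
  have : hU.fromSpec (Spec.map φ x) ∈ U.1 := by
    have h := hU.range_fromSpec
    exact h.le ⟨_, rfl⟩
  exact this

theorem eq_chartMap_iff {X T : Scheme.{u}} (g : T ⟶ X) (U : X.affineOpens) (e : ⊤ ≤ g ⁻¹ᵁ U.1)
    {R : CommRingCat.{u}} (φ : Γ(X, U) ⟶ R) (χ : R ⟶ Γ(T, ⊤)) :
    T.toSpecΓ ≫ Spec.map χ ≫ chartMap U φ = g ↔ φ ≫ χ = g.appLE U ⊤ e := by
  have hU : IsAffineOpen U.1 := U.2
  have hg : T.toSpecΓ ≫ Spec.map (g.appLE U ⊤ e) ≫ hU.fromSpec = g := by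
    have : IsIso (⊤ : T.Opens).ι := inferInstanceAs (IsIso T.topIso.hom)
    rw [← cancel_epi (⊤ : T.Opens).ι, ← Scheme.Hom.resLE_comp_ι (e := e), ← hU.toSpecΓ_fromSpec,
      ← Scheme.Opens.toSpecΓ_SpecMap_appLE_assoc, Scheme.Opens.toSpecΓ_top, Category.assoc]
  have : T.toSpecΓ ≫ Spec.map χ ≫ chartMap U φ =
      (T.toSpecΓ ≫ Spec.map (φ ≫ χ)) ≫ hU.fromSpec := by
    simp only [chartMap, Spec.map_comp, Category.assoc]
  rw [this]
  constructor
  · intro h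
    rw [← hg, ← Category.assoc, cancel_mono] at h
    exact toSpecΓ_cancel h
  · intro h
    rw [h, Category.assoc, hg]

/-- A scheme over `X` with the universal property of a chart of a blow-up. -/
structure IsChart {X Z : Scheme.{u}} (g : Z ⟶ X) (I : X.IdealSheafData) (U : X.affineOpens)
    (a : Γ(X, U)) : Prop where
  isEffectiveCartier : IsEffectiveCartier (I.comap g)
  chartLocus_eq_top : chartLocus g I U a = ⊤
  existsUnique_lift : ∀ {T : Scheme.{u}} (h : T ⟶ X), IsEffectiveCartier (I.comap h) →
    chartLocus h I U a = ⊤ → ∃! l : T ⟶ Z, l ≫ g = h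

theorem IsBlowupChart.isChart {X : Scheme.{u}} (I : X.IdealSheafData) (U : X.affineOpens)
    {a : Γ(X, U)} {R : CommRingCat.{u}} (φ : Γ(X, U) ⟶ R)
    (h : IsBlowupChart φ.hom (I.ideal U) a) : IsChart (chartMap U φ) I U a := by
  have hap : (chartMap U φ).appLE U ⊤ (chartMap_preimage U φ).ge =
      φ ≫ (Scheme.ΓSpecIso R).inv := by
    symm
    rw [← eq_chartMap_iff]
    have : (Spec R).toSpecΓ = Spec.map (Scheme.ΓSpecIso R).hom :=
      (SpecMap_ΓSpecIso_hom R).symm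
    rw [this, ← Spec.map_comp_assoc, Iso.inv_hom_id, Spec.map_id, Category.id_comp]
  have hideal : (I.comap (chartMap U φ)).ideal (topAffine _) = Ideal.span
      {(chartMap U φ).appLE U (topAffine (Spec R)).1 (chartMap_preimage U φ).ge a} := by
    rw [ideal_comap_appLE I _ U _ (chartMap_preimage U φ).ge]
    change Ideal.map ((chartMap U φ).appLE U ⊤ (chartMap_preimage U φ).ge).hom _ =
      Ideal.span {(chartMap U φ).appLE U ⊤ (chartMap_preimage U φ).ge a}
    rw [hap, CommRingCat.hom_comp, ← Ideal.map_map, h.map_eq, Ideal.map_span, Set.image_singleton]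
    rfl
  have hnzd : (chartMap U φ).appLE U ⊤ (chartMap_preimage U φ).ge a ∈
      nonZeroDivisors Γ(Spec R, ⊤) := by
    rw [hap]
    exact map_mem_nonZeroDivisors_of_bijective (Scheme.ΓSpecIso R).inv.hom
      ((ConcreteCategory.isIso_iff_bijective (Scheme.ΓSpecIso R).inv).1 inferInstance)
      h.mem_nonZeroDivisors
  refine ⟨fun x ↦ ⟨topAffine _, trivial, _, hnzd, hideal⟩,
    top_unique fun x _ ↦ mem_chartLocus.2 ⟨topAffine _, _, trivial, hideal⟩, ?_⟩
  intro T g hT hg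
  have e : ⊤ ≤ g ⁻¹ᵁ U.1 := hg.ge.trans (chartLocus_le _ _ _ _)
  obtain ⟨χ, hχ, huniq⟩ := h.existsUnique_lift (g.appLE U ⊤ e).hom
    (appLE_mem_nonZeroDivisors hT ⊤ hg.ge e) (map_appLE_eq_span hT h.mem ⊤ hg.ge e)
  refine ⟨T.toSpecΓ ≫ Spec.map (CommRingCat.ofHom χ), ?_, fun l hl ↦ ?_⟩
  · change (_ ≫ _) ≫ _ = _
    rw [Category.assoc, eq_chartMap_iff g U e]
    exact CommRingCat.hom_ext hχ
  · change l ≫ _ = _ at hl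
    rw [eq_toSpecΓ_SpecMap l, Category.assoc, eq_chartMap_iff g U e] at hl
    rw [eq_toSpecΓ_SpecMap l]
    congr 2
    refine CommRingCat.hom_ext ?_
    exact huniq _ (congrArg CommRingCat.Hom.hom hl)

theorem IsEffectiveCartier.comap_comp {X Y T : Scheme.{u}} {I : X.IdealSheafData} {π : Y ⟶ X}
    (hI : IsEffectiveCartier (I.comap π)) (j : T ⟶ Y) [IsOpenImmersion j] :
    IsEffectiveCartier (I.comap (j ≫ π)) := by
  rw [Scheme.IdealSheafData.comap_comp]
  exact hI.comap_of_isOpenImmersion j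

/-- Over a chart, the blow-up is the chart. -/
theorem IsBlowup.exists_chart {X Y Z : Scheme.{u}} {π : Y ⟶ X} {I : X.IdealSheafData}
    (hπ : IsBlowup π I) {g : Z ⟶ X} {U : X.affineOpens} {a : Γ(X, U)} (ha : a ∈ I.ideal U)
    (hg : IsChart g I U a) :
    ∃ (c : Z ⟶ Y) (_ : IsOpenImmersion c), c ≫ π = g ∧ c.opensRange = chartLocus π I U a := by
  obtain ⟨c, hc, -⟩ := hπ.existsUnique_lift g hg.isEffectiveCartier
  let L := chartLocus π I U a
  have hcL : c ⁻¹ᵁ L = ⊤ := by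
    rw [preimage_chartLocus c π I hπ.isEffectiveCartier (by rw [hc]; exact hg.isEffectiveCartier)
      U a ha, hc, hg.chartLocus_eq_top]
  have hrange : Set.range c ⊆ Set.range L.ι := by
    rw [Scheme.Opens.range_ι]
    rintro _ ⟨z, rfl⟩
    exact (show z ∈ c ⁻¹ᵁ L by rw [hcL]; trivial)
  let c' := IsOpenImmersion.lift L.ι c hrange
  have hc' : c' ≫ L.ι = c := IsOpenImmersion.lift_fac _ _ _
  have hLC := hπ.isEffectiveCartier.comap_comp L.ι
  obtain ⟨d, hd, -⟩ := hg.existsUnique_lift (L.ι ≫ π) hLC (by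
    rw [← preimage_chartLocus L.ι π I hπ.isEffectiveCartier hLC U a ha]
    exact Scheme.Opens.ι_preimage_self L)
  have h1 : d ≫ c' = 𝟙 _ := by
    rw [← cancel_mono L.ι, Category.assoc, hc', Category.id_comp]
    refine (hπ.existsUnique_lift (L.ι ≫ π) hLC).unique ?_ rfl
    rw [Category.assoc, hc, hd]
  have h2 : c' ≫ d = 𝟙 _ := by
    refine (hg.existsUnique_lift g hg.isEffectiveCartier hg.chartLocus_eq_top).unique ?_
      (Category.id_comp g)
    rw [Category.assoc, hd, ← Category.assoc, hc', hc]
  have : IsIso c' := ⟨d, h2, h1⟩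
  have : IsOpenImmersion c := by rw [← hc']; infer_instance
  refine ⟨c, this, hc, ?_⟩
  have h3 : (c' ≫ L.ι).opensRange = L := by
    rw [Scheme.Hom.opensRange_comp_of_isIso, Scheme.Opens.opensRange_ι]
  refine Eq.trans ?_ h3
  congr 1
  exact hc'.symm

end Charts

section Existence

theorem exists_lift_of_locally {X Y Z : Scheme.{u}} (g : X ⟶ Z) (π : Y ⟶ Z)
    (uniq : ∀ {T : Scheme.{u}} (j : T ⟶ X) [IsOpenImmersion j] (h h' : T ⟶ Y),
      h ≫ π = j ≫ g → h' ≫ π = j ≫ g → h = h')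
    (loc : ∀ x : X, ∃ (U : X.Opens) (h : U.toScheme ⟶ Y), x ∈ U ∧ h ≫ π = U.ι ≫ g) :
    ∃ h : X ⟶ Y, h ≫ π = g := by
  choose U h hx hh using loc
  let 𝒰 : X.OpenCover := Scheme.openCoverOfIsOpenCover X U
    (top_unique fun x _ ↦ Opens.mem_iSup.2 ⟨x, hx x⟩)
  have hf (x y : X) : pullback.fst (U x).ι (U y).ι ≫ h x = pullback.snd (U x).ι (U y).ι ≫ h y := by
    refine uniq (pullback.fst (U x).ι (U y).ι ≫ (U x).ι) _ _ ?_ ?_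
    · rw [Category.assoc, hh, Category.assoc]
    · rw [Category.assoc, hh, pullback.condition, Category.assoc]
  refine ⟨𝒰.glueMorphisms h hf, ?_⟩
  · refine 𝒰.hom_ext _ _ fun x ↦ ?_
    exact ((Category.assoc _ _ _).symm.trans
      (congrArg (· ≫ π) (𝒰.ι_glueMorphisms h hf x))).trans (hh x)

theorem eq_of_locally {X Y : Scheme.{u}} (f g : X ⟶ Y)
    (h : ∀ x : X, ∃ (T : Scheme.{u}) (j : T ⟶ X) (_ : IsOpenImmersion j), x ∈ Set.range j ∧
      j ≫ f = j ≫ g) : f = g := by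
  refine Scheme.hom_ext_of_forall f g fun x ↦ ?_
  obtain ⟨T, j, hj, hx, he⟩ := h x
  refine ⟨j.opensRange, hx, ?_⟩
  have h1 : j.isoOpensRange.inv ≫ j = j.opensRange.ι := Scheme.Hom.isoOpensRange_inv_comp j
  rw [← h1, Category.assoc, he, Category.assoc]

variable {X : Scheme.{u}} (I : X.IdealSheafData)

/-- A family of charts. -/
structure ChartFamily where
  J : Type u
  Z : J → Scheme.{u}
  g : ∀ i, Z i ⟶ X
  U : J → X.affineOpens
  a : ∀ i, Γ(X, U i)
  mem : ∀ i, a i ∈ I.ideal (U i)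
  isChart : ∀ i, IsChart (g i) I (U i) (a i)

namespace ChartFamily
variable {I} (F : ChartFamily I)

/-- The overlap of two charts. -/
def V (i j : F.J) : (F.Z i).Opens := chartLocus (F.g i) I (F.U j) (F.a j)

variable {F}

theorem hom_unique {i : F.J} {T : Scheme.{u}} {h h' : T ⟶ F.Z i} (e : h ≫ F.g i = h' ≫ F.g i)
    (hT : IsEffectiveCartier (I.comap (h ≫ F.g i))) : h = h' := by
  refine ((F.isChart i).existsUnique_lift (h ≫ F.g i) hT ?_).unique rfl e.symm
  rw [← preimage_chartLocus h (F.g i) I (F.isChart i).isEffectiveCartier hT _ _ (F.mem i),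
    (F.isChart i).chartLocus_eq_top]
  rfl

theorem chartLocus_preimage (i j : F.J) {T : Scheme.{u}} (h : T ⟶ F.Z i)
    (hT : IsEffectiveCartier (I.comap (h ≫ F.g i))) :
    h ⁻¹ᵁ F.V i j = chartLocus (h ≫ F.g i) I (F.U j) (F.a j) :=
  preimage_chartLocus h (F.g i) I (F.isChart i).isEffectiveCartier hT _ _ (F.mem j)

variable (F)

theorem cartier_V (i j : F.J) : IsEffectiveCartier (I.comap ((F.V i j).ι ≫ F.g i)) :=
  (F.isChart i).isEffectiveCartier.comap_comp _

theorem exists_tAux (i j : F.J) : ∃ t : (F.V i j).toScheme ⟶ (F.V j i).toScheme,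
    t ≫ (F.V j i).ι ≫ F.g j = (F.V i j).ι ≫ F.g i := by
  obtain ⟨l, hl, -⟩ := (F.isChart j).existsUnique_lift ((F.V i j).ι ≫ F.g i) (F.cartier_V i j) (by
    rw [← chartLocus_preimage i j _ (F.cartier_V i j)]
    exact Scheme.Opens.ι_preimage_self _)
  have h1 : l ⁻¹ᵁ F.V j i = ⊤ := by
    rw [chartLocus_preimage j i l (by rw [hl]; exact F.cartier_V i j), hl,
      ← chartLocus_preimage i i _ (F.cartier_V i j)]
    have : F.V i i = ⊤ := (F.isChart i).chartLocus_eq_top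
    rw [this]; rfl
  have h2 : Set.range l ⊆ Set.range (F.V j i).ι := by
    rw [Scheme.Opens.range_ι]
    rintro _ ⟨z, rfl⟩
    exact (show z ∈ l ⁻¹ᵁ F.V j i by rw [h1]; trivial)
  exact ⟨IsOpenImmersion.lift (F.V j i).ι l h2, by rw [IsOpenImmersion.lift_fac_assoc, hl]⟩

/-- The transition isomorphism. -/
def t (i j : F.J) : (F.V i j).toScheme ⟶ (F.V j i).toScheme := (F.exists_tAux i j).choose

theorem t_comp (i j : F.J) : F.t i j ≫ (F.V j i).ι ≫ F.g j = (F.V i j).ι ≫ F.g i :=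
  (F.exists_tAux i j).choose_spec

theorem exists_t' (i j k : F.J) :
    ∃ t' : pullback (F.V i j).ι (F.V i k).ι ⟶ pullback (F.V j k).ι (F.V j i).ι,
      t' ≫ pullback.snd _ _ = pullback.fst _ _ ≫ F.t i j := by
  have hl : (pullback.fst (F.V i j).ι (F.V i k).ι ≫ F.t i j ≫ (F.V j i).ι) ≫ F.g j =
      (pullback.fst (F.V i j).ι (F.V i k).ι ≫ (F.V i j).ι) ≫ F.g i := by
    simp only [Category.assoc, t_comp]
  have hC : IsEffectiveCartier (I.comap
      ((pullback.fst (F.V i j).ι (F.V i k).ι ≫ (F.V i j).ι) ≫ F.g i)) :=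
    (F.isChart i).isEffectiveCartier.comap_comp _
  have h1 : (pullback.fst (F.V i j).ι (F.V i k).ι ≫ F.t i j ≫ (F.V j i).ι) ⁻¹ᵁ F.V j k = ⊤ := by
    rw [chartLocus_preimage j k _ (by rw [hl]; exact hC), hl, ← chartLocus_preimage i k _ hC,
      pullback.condition]
    refine top_unique fun x _ ↦ ?_
    change (F.V i k).ι (pullback.snd (F.V i j).ι (F.V i k).ι x) ∈ F.V i k
    exact Subtype.prop (pullback.snd (F.V i j).ι (F.V i k).ι x)
  have h2 : Set.range (pullback.fst (F.V i j).ι (F.V i k).ι ≫ F.t i j ≫ (F.V j i).ι) ⊆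
      Set.range (F.V j k).ι := by
    rw [Scheme.Opens.range_ι]
    rintro _ ⟨z, rfl⟩
    have : z ∈ (pullback.fst (F.V i j).ι (F.V i k).ι ≫ F.t i j ≫ (F.V j i).ι) ⁻¹ᵁ F.V j k := by
      rw [h1]; trivial
    exact this
  refine ⟨pullback.lift (IsOpenImmersion.lift (F.V j k).ι _ h2)
    (pullback.fst (F.V i j).ι (F.V i k).ι ≫ F.t i j) ?_, pullback.lift_snd _ _ _⟩
  rw [IsOpenImmersion.lift_fac, Category.assoc]

/-- The transition isomorphism on triple overlaps. -/
def t' (i j k : F.J) : pullback (F.V i j).ι (F.V i k).ι ⟶ pullback (F.V j k).ι (F.V j i).ι :=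
  (F.exists_t' i j k).choose

theorem t'_snd (i j k : F.J) : F.t' i j k ≫ pullback.snd _ _ = pullback.fst _ _ ≫ F.t i j :=
  (F.exists_t' i j k).choose_spec

theorem t'_comp (i j k : F.J) : F.t' i j k ≫ pullback.fst _ _ ≫ (F.V j k).ι ≫ F.g j =
    pullback.fst _ _ ≫ (F.V i j).ι ≫ F.g i := by
  rw [pullback.condition_assoc, ← Category.assoc (F.t' i j k), t'_snd, Category.assoc, t_comp]

/-- The gluing data of a family of charts. -/
def glueData : Scheme.GlueData.{u} where
  J := F.J
  U := F.Z
  V p := (F.V p.1 p.2).toScheme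
  f i j := (F.V i j).ι
  f_mono _ _ := inferInstance
  f_hasPullback _ _ _ := inferInstance
  f_id i := by
    have : F.V i i = ⊤ := (F.isChart i).chartLocus_eq_top
    rw [this]
    exact inferInstanceAs (IsIso (F.Z i).topIso.hom)
  t := F.t
  t_id i := by
    rw [← cancel_mono (F.V i i).ι]
    refine hom_unique ?_ ?_
    · rw [Category.assoc, t_comp, Category.id_comp]
    · rw [Category.assoc, t_comp]
      exact F.cartier_V i i
  t' := F.t'
  t_fac := F.t'_snd
  cocycle i j k := by
    have h : ((F.t' i j k ≫ F.t' j k i ≫ F.t' k i j) ≫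
        pullback.fst (F.V i j).ι (F.V i k).ι ≫ (F.V i j).ι) ≫ F.g i =
        (pullback.fst (F.V i j).ι (F.V i k).ι ≫ (F.V i j).ι) ≫ F.g i := by
      simp only [Category.assoc, t'_comp]
    rw [← cancel_mono (pullback.fst (F.V i j).ι (F.V i k).ι ≫ (F.V i j).ι)]
    refine hom_unique ?_ ?_
    · rw [Category.id_comp, h]
    · rw [h]
      exact (F.isChart i).isEffectiveCartier.comap_comp _
  f_open _ _ := inferInstance

theorem exists_glued : ∃ (Y : Scheme.{u}) (π : Y ⟶ X) (ι : ∀ i, F.Z i ⟶ Y),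
    (∀ i, IsOpenImmersion (ι i)) ∧ (∀ i, ι i ≫ π = F.g i) ∧ (∀ y : Y, ∃ i z, ι i z = y) ∧
    (∀ i j, F.t i j ≫ (F.V j i).ι ≫ ι j = (F.V i j).ι ≫ ι i) := by
  refine ⟨F.glueData.glued, Multicoequalizer.desc _ _ F.g ?_, F.glueData.ι,
    fun i ↦ Scheme.GlueData.ι_isOpenImmersion F.glueData i,
    fun i ↦ ?_, F.glueData.ι_jointly_surjective, F.glueData.glue_condition⟩
  · rintro ⟨i, j⟩
    change (F.V i j).ι ≫ F.g i = (F.t i j ≫ (F.V j i).ι) ≫ F.g j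
    exact (F.t_comp i j).symm.trans (Category.assoc _ _ _).symm
  · exact Multicoequalizer.π_desc _ _ _ _ _

/-- A family of charts that covers every effective Cartier inverse image glues to the blow-up. -/
theorem exists_isBlowup (hF : ∀ {T : Scheme.{u}} (g : T ⟶ X), IsEffectiveCartier (I.comap g) →
    ∀ t : T, ∃ i, t ∈ chartLocus g I (F.U i) (F.a i)) :
    ∃ (Y : Scheme.{u}) (π : Y ⟶ X), IsBlowup π I := by
  obtain ⟨Y, π, ι, hι, hπ, hsurj, hglue⟩ := F.exists_glued
  have hC : IsEffectiveCartier (I.comap π) := by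
    refine IsEffectiveCartier.of_openCover fun y ↦ ?_
    obtain ⟨i, z, rfl⟩ := hsurj y
    refine ⟨_, ι i, hι i, ⟨z, rfl⟩, ?_⟩
    rw [← Scheme.IdealSheafData.comap_comp, hπ]
    exact (F.isChart i).isEffectiveCartier
  have hr (i : F.J) (y : Y) (hy : y ∈ chartLocus π I (F.U i) (F.a i)) : y ∈ Set.range (ι i) := by
    obtain ⟨j, z, rfl⟩ := hsurj y
    have : z ∈ F.V j i := by
      have h := preimage_chartLocus (ι j) π I hC
        (by rw [hπ]; exact (F.isChart j).isEffectiveCartier) _ _ (F.mem i)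
      rw [hπ] at h
      exact h.le hy
    refine ⟨(F.t j i ≫ (F.V i j).ι) ⟨z, this⟩, ?_⟩
    exact congrArg (fun f : (F.V j i).toScheme ⟶ Y ↦ f ⟨z, this⟩) (hglue j i)
  have huniq {T : Scheme.{u}} (h h' : T ⟶ Y) (e : h ≫ π = h' ≫ π)
      (hT : IsEffectiveCartier (I.comap (h ≫ π))) : h = h' := by
    refine eq_of_locally h h' fun t ↦ ?_
    obtain ⟨i, hi⟩ := hF (h ≫ π) hT t
    let W := chartLocus (h ≫ π) I (F.U i) (F.a i)
    have key (l : T ⟶ Y) (hl : l ≫ π = h ≫ π) : ∃ l' : W.toScheme ⟶ F.Z i, l' ≫ ι i = W.ι ≫ l := by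
      refine ⟨IsOpenImmersion.lift (ι i) (W.ι ≫ l) ?_, IsOpenImmersion.lift_fac _ _ _⟩
      rintro _ ⟨w, rfl⟩
      refine hr i _ ?_
      have h1 := preimage_chartLocus l π I hC (by rw [hl]; exact hT) _ _ (F.mem i)
      rw [hl] at h1
      exact h1.ge w.2
    obtain ⟨l, hl⟩ := key h rfl
    obtain ⟨l', hl'⟩ := key h' e.symm
    refine ⟨_, W.ι, inferInstance, ?_, ?_⟩
    · rw [Scheme.Opens.range_ι]; exact hi
    have h2 : l ≫ F.g i = W.ι ≫ h ≫ π := by rw [← hπ, ← Category.assoc, hl, Category.assoc]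
    have h3 : l' ≫ F.g i = W.ι ≫ h' ≫ π := by rw [← hπ, ← Category.assoc, hl', Category.assoc]
    rw [← hl, ← hl']
    congr 1
    refine hom_unique ?_ ?_
    · rw [h2, h3, e]
    · rw [h2]; exact hT.comap_comp _
  refine ⟨Y, π, hC, fun {T} g hg ↦ ?_⟩
  obtain ⟨h, hh⟩ := exists_lift_of_locally g π (fun j _ h h' e e' ↦
    huniq h h' (e.trans e'.symm) (by rw [e]; exact hg.comap_comp j)) fun t ↦ by
      obtain ⟨i, hi⟩ := hF g hg t
      obtain ⟨l, hl, -⟩ := (F.isChart i).existsUnique_lift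
        ((chartLocus g I (F.U i) (F.a i)).ι ≫ g) (hg.comap_comp _) (by
          rw [← preimage_chartLocus _ g I hg (hg.comap_comp _) _ _ (F.mem i)]
          exact Scheme.Opens.ι_preimage_self _)
      exact ⟨_, l ≫ ι i, hi, by rw [Category.assoc, hπ, hl]⟩
  exact ⟨h, hh, fun h' e ↦ huniq _ _ (e.trans hh.symm) (by rw [e]; exact hg)⟩

end ChartFamily

/-- The universal criterion for charts: fractions with denominator a power of `a`. -/
theorem IsBlowupChart.of_exists_lift {A R : Type u} [CommRing A] [CommRing R] {φ : A →+* R}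
    {I : Ideal A} {a : A} (mem : a ∈ I) (nzd : φ a ∈ nonZeroDivisors R)
    (map_eq : I.map φ = Ideal.span {φ a}) (frac : ∀ r : R, ∃ n b, φ a ^ n * r = φ b)
    (lift : ∀ {S : Type u} [CommRing S] (ψ : A →+* S), ψ a ∈ nonZeroDivisors S →
      I.map ψ = Ideal.span {ψ a} → ∃ χ : R →+* S, χ.comp φ = ψ) : IsBlowupChart φ I a := by
  refine ⟨mem, nzd, map_eq, fun ψ h1 h2 ↦ ?_⟩
  obtain ⟨χ, hχ⟩ := lift ψ h1 h2
  refine ⟨χ, hχ, fun χ' hχ' ↦ RingHom.ext fun r ↦ ?_⟩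
  obtain ⟨n, b, hb⟩ := frac r
  have h (c : A) : χ (φ c) = ψ c := by rw [← hχ]; rfl
  have h' (c : A) : χ' (φ c) = ψ c := by rw [← (show χ'.comp φ = ψ from hχ')]; rfl
  refine (mul_cancel_left_mem_nonZeroDivisors (pow_mem h1 n)).1 ?_
  have e := congrArg χ hb
  have e' := congrArg χ' hb
  rw [map_mul, map_pow, h, h] at e
  rw [map_mul, map_pow, h', h'] at e'
  rw [e, e']

/-- The chart of the blow-up of `I` on which `a` generates exists. -/
theorem exists_isBlowupChart {A : Type u} [CommRing A] (I : Ideal A) {a : A} (ha : a ∈ I) :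
    ∃ (R : Type u) (_ : CommRing R) (φ : A →+* R), IsBlowupChart φ I a := by
  let L := Localization.Away a
  let u : L := IsLocalization.Away.invSelf a
  have hu : algebraMap A L a * u = 1 := IsLocalization.Away.mul_invSelf a
  have hunit : IsUnit (algebraMap A L a) := .of_mul_eq_one _ hu
  let R : Subalgebra A L := Algebra.adjoin A {x | ∃ i ∈ I, x = algebraMap A L i * u}
  have hval (c : A) : ((algebraMap A R c : R) : L) = algebraMap A L c := rfl
  refine ⟨R, inferInstance, algebraMap A R, .of_exists_lift ha ?_ ?_ ?_ ?_⟩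
  · rw [mem_nonZeroDivisors_iff_right]
    intro r hr
    apply Subtype.ext
    have h1 := congrArg Subtype.val hr
    exact (hunit.mul_left_eq_zero).1 h1
  · apply le_antisymm
    · rw [Ideal.map_le_iff_le_comap]
      intro i hi
      rw [Ideal.mem_comap, Ideal.mem_span_singleton]
      refine ⟨⟨algebraMap A L i * u, Algebra.subset_adjoin ⟨i, hi, rfl⟩⟩, Subtype.ext ?_⟩
      change algebraMap A L i = algebraMap A L a * (algebraMap A L i * u)
      rw [mul_left_comm, hu, mul_one]
    · exact (Ideal.span_singleton_le_iff_mem _).2 (Ideal.mem_map_of_mem _ ha)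
  · rintro ⟨r, -⟩
    obtain ⟨⟨b, ⟨_, n, rfl⟩⟩, hb⟩ := IsLocalization.surj (Submonoid.powers a) r
    refine ⟨n, b, Subtype.ext ?_⟩
    change algebraMap A L a ^ n * r = algebraMap A L b
    rw [← hb, map_pow, mul_comm]
  · intro S _ ψ h1 h2
    let N := Localization.Away (ψ a)
    have hinj : Function.Injective (algebraMap S N) :=
      IsLocalization.injective N (Submonoid.powers_le.2 h1)
    let f : L →+* N := IsLocalization.Away.lift a (g := (algebraMap S N).comp ψ)
      (IsLocalization.Away.algebraMap_isUnit (ψ a))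
    have hf (c : A) : f (algebraMap A L c) = algebraMap S N (ψ c) :=
      IsLocalization.Away.lift_eq a _ c
    have hR (r : R) : f r ∈ (algebraMap S N).range := by
      obtain ⟨r, hr⟩ := r
      induction hr using Algebra.adjoin_induction with
      | mem x hx =>
        obtain ⟨i, hi, rfl⟩ := hx
        obtain ⟨c, hc⟩ := Ideal.mem_span_singleton'.1
          (h2 ▸ Ideal.mem_map_of_mem ψ hi : ψ i ∈ Ideal.span {ψ a})
        refine ⟨c, ?_⟩
        have e : f (algebraMap A L a) * f u = 1 := by rw [← map_mul, hu, map_one]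
        change _ = f (algebraMap A L i * u)
        rw [map_mul, hf, ← hc, map_mul, mul_assoc, ← hf, e, mul_one]
      | algebraMap c => exact ⟨ψ c, (hf c).symm⟩
      | add x y hx hy h h' => 
        change f (x + y) ∈ _
        rw [map_add]; exact add_mem h h'
      | mul x y hx hy h h' => 
        change f (x * y) ∈ _
        rw [map_mul]; exact mul_mem h h'
    let e : S ≃+* (algebraMap S N).range := RingEquiv.ofBijective (algebraMap S N).rangeRestrict
      ⟨fun x y hxy ↦ hinj (congrArg Subtype.val hxy), (algebraMap S N).rangeRestrict_surjective⟩
    let χ : R →+* S := e.symm.toRingHom.comp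
      ((f.comp R.val.toRingHom).codRestrict (algebraMap S N).range hR)
    refine ⟨χ, RingHom.ext fun c ↦ ?_⟩
    apply e.injective
    change e (e.symm _) = _
    rw [RingEquiv.apply_symm_apply]
    exact Subtype.ext (hf c)

/-- Blow-ups exist. -/
theorem exists_isBlowup (I : X.IdealSheafData) :
    ∃ (Y : Scheme.{u}) (π : Y ⟶ X), IsBlowup π I := by
  choose R hR φ hφ using fun i : Σ U : X.affineOpens, I.ideal U ↦
    exists_isBlowupChart (I.ideal i.1) i.2.2
  let F : ChartFamily I :=
    { J := Σ U : X.affineOpens, I.ideal U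
      Z := fun i ↦ Spec (.of (R i))
      g := fun i ↦ chartMap i.1 (CommRingCat.ofHom (φ i))
      U := fun i ↦ i.1
      a := fun i ↦ i.2.1
      mem := fun i ↦ i.2.2
      isChart := fun i ↦ IsBlowupChart.isChart I i.1 _ (hφ i) }
  refine F.exists_isBlowup fun {T} g hg t ↦ ?_
  obtain ⟨U, hU, hxU, -⟩ := X.isBasis_affineOpens.exists_subset_of_mem_open
    (show g t ∈ (⊤ : X.Opens) from trivial) (Opens.isOpen _)
  obtain ⟨U, hU, rfl⟩ := hU
  obtain ⟨a, ha, hta⟩ := exists_mem_chartLocus g I hg t ⟨U, hU⟩ hxU (I.ideal ⟨U, hU⟩)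
    (Ideal.span_eq _).symm
  exact ⟨⟨⟨U, hU⟩, a, ha⟩, hta⟩

theorem nonempty_iteratedBlowup (B C : Closeds X) : Nonempty (IteratedBlowup B C) := by
  obtain ⟨X₁, π₁, h₁⟩ := exists_isBlowup (Scheme.IdealSheafData.vanishingIdeal B)
  obtain ⟨X₂, π₂, h₂⟩ := exists_isBlowup
    (Scheme.IdealSheafData.vanishingIdeal (strictTransform π₁ B C))
  exact ⟨⟨X₁, X₂, π₁, π₂, h₁, h₂⟩⟩

end Existence

section Transitivity

theorem isEffectiveCartier_top {X : Scheme.{u}} : IsEffectiveCartier (⊤ : X.IdealSheafData) := by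
  intro x
  obtain ⟨U, hU, hxU, -⟩ := X.isBasis_affineOpens.exists_subset_of_mem_open
    (show x ∈ (⊤ : X.Opens) from trivial) (Opens.isOpen _)
  obtain ⟨U, hU, rfl⟩ := hU
  refine ⟨⟨U, hU⟩, hxU, 1, one_mem _, ?_⟩
  rw [Ideal.span_singleton_one]
  rfl

theorem IsBlowup.hom_ext {X Y T : Scheme.{u}} {π : Y ⟶ X} {I : X.IdealSheafData}
    (hπ : IsBlowup π I) {f g : T ⟶ Y} (h : f ≫ π = g ≫ π)
    (hT : IsEffectiveCartier (I.comap (f ≫ π))) : f = g :=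
  (hπ.existsUnique_lift _ hT).unique rfl h.symm

/-- Blowing up does nothing where the center is an effective Cartier divisor. -/
theorem IsBlowup.exists_section {X Y T : Scheme.{u}} {π : Y ⟶ X} {I : X.IdealSheafData}
    (hπ : IsBlowup π I) (j : T ⟶ X) [IsOpenImmersion j] (hT : IsEffectiveCartier (I.comap j)) :
    ∃ (s : T ⟶ Y) (_ : IsOpenImmersion s), s ≫ π = j ∧ s.opensRange = π ⁻¹ᵁ j.opensRange := by
  obtain ⟨s, hs, -⟩ := hπ.existsUnique_lift j hT
  let L := π ⁻¹ᵁ j.opensRange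
  have hrange : Set.range s ⊆ Set.range L.ι := by
    rw [Scheme.Opens.range_ι]
    rintro _ ⟨z, rfl⟩
    exact ⟨z, congrArg (fun f : T ⟶ X ↦ f z) hs.symm⟩
  let s' := IsOpenImmersion.lift L.ι s hrange
  have hs' : s' ≫ L.ι = s := IsOpenImmersion.lift_fac _ _ _
  have hrange' : Set.range (L.ι ≫ π) ⊆ Set.range j := by
    rintro _ ⟨z, rfl⟩
    exact z.2
  let d : L.toScheme ⟶ T := IsOpenImmersion.lift j (L.ι ≫ π) hrange'
  have hd : d ≫ j = L.ι ≫ π := IsOpenImmersion.lift_fac _ _ _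
  have h1 : d ≫ s' = 𝟙 _ := by
    rw [← cancel_mono L.ι, Category.assoc, hs', Category.id_comp]
    refine hπ.hom_ext ?_ ?_
    · rw [Category.assoc, hs, hd]
    · rw [Category.assoc, hs, hd]
      exact hπ.isEffectiveCartier.comap_comp L.ι
  have h2 : s' ≫ d = 𝟙 _ := by
    rw [← cancel_mono j, Category.assoc, hd, ← Category.assoc, hs', hs, Category.id_comp]
  have : IsIso s' := ⟨d, h2, h1⟩
  have : IsOpenImmersion s := by rw [← hs']; infer_instance
  refine ⟨s, this, hs, ?_⟩
  have h3 : (s' ≫ L.ι).opensRange = L := by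
    rw [Scheme.Hom.opensRange_comp_of_isIso, Scheme.Opens.opensRange_ι]
  refine Eq.trans ?_ h3
  congr 1
  exact hs'.symm

/-- The complement of the support of an ideal sheaf. -/
def supportCompl {X : Scheme.{u}} (I : X.IdealSheafData) : X.Opens := I.support.compl

theorem eq_top_of_support_eq_bot {X : Scheme.{u}} {I : X.IdealSheafData}
    (h : ∀ x : X, x ∉ I.support) : I = ⊤ := by
  rw [← Scheme.IdealSheafData.support_eq_bot_iff]
  ext x
  simpa using h x

theorem comap_eq_top_of_le {X T : Scheme.{u}} (I : X.IdealSheafData) (j : T ⟶ X)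
    (h : ∀ t : T, j t ∉ I.support) : I.comap j = ⊤ := by
  refine eq_top_of_support_eq_bot fun t ht ↦ h t ?_
  rw [Scheme.IdealSheafData.support_comap] at ht
  exact ht

/-- Effective Cartier divisors pull back to effective Cartier divisors under blow-ups. -/
theorem IsBlowup.comap_isEffectiveCartier {X Y : Scheme.{u}} {π : Y ⟶ X} {I L : X.IdealSheafData}
    (hπ : IsBlowup π I) (hL : IsEffectiveCartier L) : IsEffectiveCartier (L.comap π) := by
  obtain ⟨s, hs, hsπ, hsr⟩ := hπ.exists_section (supportCompl I).ι (by
    rw [comap_eq_top_of_le I (supportCompl I).ι fun t ↦ t.2]; exact isEffectiveCartier_top)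
  have hLs : IsEffectiveCartier ((L.comap π).comap s) := by
    rw [← Scheme.IdealSheafData.comap_comp, hsπ]
    exact hL.comap_of_isOpenImmersion _
  intro y
  obtain ⟨U, hyU, l, hl, hlU⟩ := hL (π y)
  obtain ⟨V, hyV, hVU, e, he, heV⟩ := hπ.isEffectiveCartier.exists_le y (π ⁻¹ᵁ U.1) hyU
  have hLV : (L.comap π).ideal V = Ideal.span {π.appLE U V hVU l} := by
    rw [ideal_comap_appLE L π U V hVU, hlU, Ideal.map_span, Set.image_singleton]
  refine ⟨V, hyV, _, ?_, hLV⟩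
  have hDs : Y.basicOpen e ≤ s.opensRange := by
    intro z hz
    rw [hsr, Scheme.Opens.opensRange_ι]
    change π z ∉ I.support
    intro hzI
    have h1 : z ∈ (I.comap π).support := by
      rw [Scheme.IdealSheafData.support_comap]; exact hzI
    have hzV := Y.basicOpen_le _ hz
    have h3 := (Scheme.IdealSheafData.mem_support_iff_of_mem hzV).1 h1
    rw [heV, Scheme.mem_zeroLocus_iff] at h3
    exact h3 e (Ideal.mem_span_singleton_self e) hz
  have hnzd := mem_nonZeroDivisors_of_isCartierAt (I := L.comap π) (V := Y.affineBasicOpen e)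
    (fun z hz ↦ by
      obtain ⟨t, rfl⟩ := hDs hz
      exact isCartierAt_of_comap s hLs t)
    (ideal_eq_span_singleton_of_le _ (Y.affineBasicOpen_le e) hLV)
  have hV : IsAffineOpen V.1 := V.2
  have := hV.isLocalization_basicOpen e
  rw [mem_nonZeroDivisors_iff_right]
  intro c hc
  have h0 : algebraMap Γ(Y, V) Γ(Y, Y.basicOpen e) c = 0 := by
    refine mem_nonZeroDivisors_iff_right.1 hnzd _ ?_
    have := congrArg (Y.presheaf.map (homOfLE (Y.basicOpen_le e)).op) hc
    rw [map_mul, map_zero] at this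
    exact this
  obtain ⟨⟨_, n, rfl⟩, hm⟩ := (IsLocalization.map_eq_zero_iff (Submonoid.powers e)
    Γ(Y, Y.basicOpen e) c).1 h0
  exact (mul_left_mem_nonZeroDivisors_eq_zero_iff (pow_mem he n)).1 hm

/-- Iterated blow-ups are blow-ups of products. -/
theorem IsBlowup.comp {X X₁ X₂ : Scheme.{u}} {π₁ : X₁ ⟶ X} {π₂ : X₂ ⟶ X₁} {I L : X.IdealSheafData}
    {I' M : X₁.IdealSheafData} (h₁ : IsBlowup π₁ I) (h₂ : IsBlowup π₂ I')
    (hM : IsEffectiveCartier M) (h : I' * M = L.comap π₁) : IsBlowup (π₂ ≫ π₁) (I * L) := by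
  refine ⟨?_, fun {T} g hg ↦ ?_⟩
  · rw [comap_mul, Scheme.IdealSheafData.comap_comp, Scheme.IdealSheafData.comap_comp, ← h, comap_mul]
    exact (h₂.comap_isEffectiveCartier h₁.isEffectiveCartier).mul
      (h₂.isEffectiveCartier.mul (h₂.comap_isEffectiveCartier hM))
  · rw [comap_mul] at hg
    obtain ⟨g₁, hg₁, hu₁⟩ := h₁.existsUnique_lift g hg.of_mul_left
    have h3 : IsEffectiveCartier (I'.comap g₁) := by
      have := hg.of_mul_right
      rw [← hg₁, Scheme.IdealSheafData.comap_comp, ← h, comap_mul] at this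
      exact this.of_mul_left
    obtain ⟨g₂, hg₂, hu₂⟩ := h₂.existsUnique_lift g₁ h3
    refine ⟨g₂, ?_, fun k hk ↦ ?_⟩
    · change g₂ ≫ π₂ ≫ π₁ = g
      rw [← Category.assoc, hg₂, hg₁]
    · change k ≫ π₂ ≫ π₁ = g at hk
      exact hu₂ _ (hu₁ _ ((Category.assoc _ _ _).trans hk))

theorem IsBlowup.congr {X Y : Scheme.{u}} {π : Y ⟶ X} {I I' : X.IdealSheafData}
    (hπ : IsBlowup π I) (h : ∀ {T : Scheme.{u}} (g : T ⟶ X),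
      IsEffectiveCartier (I.comap g) ↔ IsEffectiveCartier (I'.comap g)) : IsBlowup π I' :=
  ⟨(h π).1 hπ.isEffectiveCartier, fun g hg ↦ hπ.existsUnique_lift g ((h g).2 hg)⟩

theorem isEffectiveCartier_mul_iff {X : Scheme.{u}} {I J : X.IdealSheafData} :
    IsEffectiveCartier (I * J) ↔ IsEffectiveCartier I ∧ IsEffectiveCartier J :=
  ⟨fun h ↦ ⟨h.of_mul_left, h.of_mul_right⟩, fun h ↦ h.1.mul h.2⟩

/-- Blow-ups are unique up to unique isomorphism. -/
theorem IsBlowup.exists_iso {X Y Y' : Scheme.{u}} {π : Y ⟶ X} {π' : Y' ⟶ X}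
    {I : X.IdealSheafData} (h : IsBlowup π I) (h' : IsBlowup π' I) :
    ∃ e : Y ≅ Y', e.hom ≫ π' = π := by
  obtain ⟨f, hf, -⟩ := h'.existsUnique_lift π h.isEffectiveCartier
  obtain ⟨g, hg, -⟩ := h.existsUnique_lift π' h'.isEffectiveCartier
  refine ⟨⟨f, g, h.hom_ext ?_ ?_, h'.hom_ext ?_ ?_⟩, hf⟩
  · rw [Category.assoc, hg, hf, Category.id_comp]
  · rw [Category.assoc, hg, hf]; exact h.isEffectiveCartier
  · rw [Category.assoc, hf, hg, Category.id_comp]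
  · rw [Category.assoc, hf, hg]; exact h'.isEffectiveCartier

theorem IsBlowup.iso_comp {X Y Y' : Scheme.{u}} {π : Y ⟶ X} {I : X.IdealSheafData}
    (h : IsBlowup π I) (e : Y' ≅ Y) : IsBlowup (e.hom ≫ π) I := by
  refine ⟨h.isEffectiveCartier.comap_comp e.hom, fun {T} g hg ↦ ?_⟩
  obtain ⟨l, hl, hu⟩ := h.existsUnique_lift g hg
  refine ⟨l ≫ e.inv, ?_, fun k hk ↦ ?_⟩
  · change (l ≫ e.inv) ≫ e.hom ≫ π = g
    rw [Category.assoc, Iso.inv_hom_id_assoc, hl]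
  · have hk' : (k ≫ e.hom) ≫ π = g := (Category.assoc _ _ _).trans hk
    rw [← hu (k ≫ e.hom) hk', Category.assoc, Iso.hom_inv_id, Category.comp_id]

end Transitivity

section SpecIdeal

/-- A ring is the ring of global functions on its spectrum. -/
def specIso (R : CommRingCat.{u}) : R ≅ Γ(Spec R, (topAffine (Spec R)).1) :=
  (Scheme.ΓSpecIso R).symm

/-- The ideal of a ring that corresponds to an ideal sheaf on its spectrum. -/
def specIdeal {R : CommRingCat.{u}} (I : (Spec R).IdealSheafData) : Ideal R :=
  (I.ideal (topAffine _)).comap (specIso R).hom.hom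

theorem specIdeal_eq_map {R : CommRingCat.{u}} (I : (Spec R).IdealSheafData) :
    specIdeal I = (I.ideal (topAffine _)).map (specIso R).inv.hom :=
  Ideal.comap_symm (I := I.ideal (topAffine _)) (specIso R).symm.commRingCatIsoToRingEquiv

theorem map_specIdeal {R : CommRingCat.{u}} (I : (Spec R).IdealSheafData) :
    (specIdeal I).map (specIso R).hom.hom = I.ideal (topAffine _) := by
  rw [specIdeal_eq_map, Ideal.map_map, ← CommRingCat.hom_comp, Iso.inv_hom_id, CommRingCat.hom_id,
    Ideal.map_id]

theorem specIdeal_injective {R : CommRingCat.{u}} {I J : (Spec R).IdealSheafData}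
    (h : specIdeal I = specIdeal J) : I = J := by
  refine ideal_ext_of_forall fun x ↦ ⟨topAffine _, trivial, ?_⟩
  rw [← map_specIdeal, h, map_specIdeal]

theorem specIdeal_mul {R : CommRingCat.{u}} (I J : (Spec R).IdealSheafData) :
    specIdeal (I * J) = specIdeal I * specIdeal J := by
  rw [specIdeal_eq_map, specIdeal_eq_map, specIdeal_eq_map, Scheme.IdealSheafData.ideal_mul,
    Pi.mul_apply, Ideal.map_mul]

theorem specIdeal_top {R : CommRingCat.{u}} : specIdeal (⊤ : (Spec R).IdealSheafData) = ⊤ := by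
  rw [specIdeal]; rfl

theorem chartMap_appLE {X : Scheme.{u}} (U : X.affineOpens) {R : CommRingCat.{u}}
    (φ : Γ(X, U) ⟶ R) : (chartMap U φ).appLE U (topAffine _).1 (chartMap_preimage U φ).ge =
      φ ≫ (specIso R).hom := by
  symm
  refine (eq_chartMap_iff _ U (chartMap_preimage U φ).ge φ (Scheme.ΓSpecIso R).inv).1 ?_
  have : (Spec R).toSpecΓ = Spec.map (Scheme.ΓSpecIso R).hom := (SpecMap_ΓSpecIso_hom R).symm
  rw [this, ← Spec.map_comp_assoc, Iso.inv_hom_id, Spec.map_id, Category.id_comp]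

theorem specIdeal_comap_chartMap {X : Scheme.{u}} (I : X.IdealSheafData) (U : X.affineOpens)
    {R : CommRingCat.{u}} (φ : Γ(X, U) ⟶ R) :
    specIdeal (I.comap (chartMap U φ)) = (I.ideal U).map φ.hom := by
  rw [specIdeal_eq_map, ideal_comap_appLE I _ U _ (chartMap_preimage U φ).ge]
  rw [chartMap_appLE, Ideal.map_map, ← CommRingCat.hom_comp, Category.assoc, Iso.hom_inv_id,
    Category.comp_id]

theorem mem_basicOpen_specIso {R : CommRingCat.{u}} (q : Spec R) (f : R) :
    q ∈ (Spec R).basicOpen ((specIso R).hom.hom f) ↔ f ∉ PrimeSpectrum.asIdeal (R := R) q := by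
  have h : (Spec R).basicOpen ((specIso R).hom.hom f) = PrimeSpectrum.basicOpen f :=
    basicOpen_eq_of_affine f
  rw [h]
  exact Iff.rfl

theorem mem_support_iff_specIdeal {R : CommRingCat.{u}} (I : (Spec R).IdealSheafData)
    (q : Spec R) : q ∈ I.support ↔ specIdeal I ≤ PrimeSpectrum.asIdeal (R := R) q := by
  rw [Scheme.IdealSheafData.mem_support_iff_of_mem (U := topAffine (Spec R)) (trivial : q ∈ ⊤),
    Scheme.mem_zeroLocus_iff]
  constructor
  · intro h f hf
    have := h _ hf
    rw [mem_basicOpen_specIso, not_not] at this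
    exact this
  · intro h f hf
    obtain ⟨r, rfl⟩ : ∃ r, (specIso R).hom.hom r = f :=
      ((ConcreteCategory.isIso_iff_bijective (specIso R).hom).1 inferInstance).2 f
    rw [mem_basicOpen_specIso, not_not]
    exact h hf

theorem mem_specIdeal_vanishingIdeal {R : CommRingCat.{u}} (Z : Closeds (Spec R)) (f : R) :
    f ∈ specIdeal (Scheme.IdealSheafData.vanishingIdeal Z) ↔
      ∀ q ∈ Z, f ∈ PrimeSpectrum.asIdeal (R := R) q := by
  rw [specIdeal, Ideal.mem_comap, mem_vanishingIdeal_iff]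
  refine forall₂_congr fun q _ ↦ ?_
  rw [mem_basicOpen_specIso, not_not]

/-- A prime ideal is the ideal of its zero locus. -/
theorem specIdeal_vanishingIdeal_of_isPrime {R : CommRingCat.{u}} (Z : Closeds (Spec R))
    (P : Ideal R) [hP : P.IsPrime]
    (hZ : ∀ q : Spec R, q ∈ Z ↔ P ≤ PrimeSpectrum.asIdeal (R := R) q) :
    specIdeal (Scheme.IdealSheafData.vanishingIdeal Z) = P := by
  ext f
  rw [mem_specIdeal_vanishingIdeal]
  exact ⟨fun h ↦ h (⟨P, hP⟩ : PrimeSpectrum R) ((hZ _).2 le_rfl), fun h q hq ↦ (hZ q).1 hq h⟩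

end SpecIdeal

section FormalFlop

/-- The formal input of the flop: `π` blows up `IB * J`, and the ideal of the flopping curve is the
quotient of `IB * IC` by the divisor `J`. -/
structure IsSmallResolution {X Y : Scheme.{u}} (IB IC J : X.IdealSheafData) (π : Y ⟶ X)
    (Ib : Y.IdealSheafData) : Prop where
  isBlowup : IsBlowup π (IB * J)
  mul_eq : J.comap π * Ib = (IB * IC).comap π

variable {X Y Y' : Scheme.{u}} {IB IC J : X.IdealSheafData} {π : Y ⟶ X} {π' : Y' ⟶ X}
  {Ib : Y.IdealSheafData} {Ic : Y'.IdealSheafData}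

theorem idealSheaf_mul_top (I : X.IdealSheafData) : I * ⊤ = I := by
  ext1
  rw [Scheme.IdealSheafData.ideal_mul]
  ext1 U
  exact Ideal.mul_top _

theorem IsSmallResolution.isEffectiveCartier_mid (h : IsSmallResolution IB IC J π Ib) :
    IsEffectiveCartier (J.comap π) := by
  have := h.isBlowup.isEffectiveCartier
  rw [comap_mul] at this
  exact this.of_mul_right

theorem IsSmallResolution.comap_mul_eq (h : IsSmallResolution IB IC J π Ib) {T : Scheme.{u}}
    (g : T ⟶ Y) : J.comap (g ≫ π) * Ib.comap g = (IB * IC).comap (g ≫ π) := by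
  rw [Scheme.IdealSheafData.comap_comp, Scheme.IdealSheafData.comap_comp, ← h.mul_eq, comap_mul]

/-- A second center that becomes invertible on the small resolution off the flopping curve. -/
theorem IsSmallResolution.cartier_of_comap_eq_top (h : IsSmallResolution IB IC J π Ib)
    {T : Scheme.{u}} (g : T ⟶ Y) (hJ : IsEffectiveCartier (J.comap (g ≫ π)))
    (hg : Ib.comap g = ⊤) : IsEffectiveCartier ((IC * J).comap (g ≫ π)) := by
  have h1 := h.comap_mul_eq g
  rw [hg, idealSheaf_mul_top, comap_mul] at h1
  rw [comap_mul]
  exact (IsEffectiveCartier.of_mul_right (h1 ▸ hJ)).mul hJ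

theorem IsSmallResolution.exists_hom (h : IsSmallResolution IB IC J π Ib)
    (h' : IsSmallResolution IC IB J π' Ic) :
    ∃ l : (supportCompl Ib).toScheme ⟶ (supportCompl Ic).toScheme,
      l ≫ (supportCompl Ic).ι ≫ π' = (supportCompl Ib).ι ≫ π := by
  have htop : Ib.comap (supportCompl Ib).ι = ⊤ := comap_eq_top_of_le Ib (supportCompl Ib).ι fun t ↦ t.2
  have hJ := h.isEffectiveCartier_mid.comap_comp (supportCompl Ib).ι
  obtain ⟨l, hl, -⟩ := h'.isBlowup.existsUnique_lift _ (h.cartier_of_comap_eq_top _ hJ htop)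
  have h1 := h'.comap_mul_eq l
  rw [hl, mul_comm IC IB, ← h.comap_mul_eq (supportCompl Ib).ι, htop] at h1
  have h2 := hJ.mul_left_cancel h1
  have h3 : Set.range l ⊆ Set.range (supportCompl Ic).ι := by
    rw [Scheme.Opens.range_ι]
    rintro _ ⟨z, rfl⟩ hz
    have h4 : z ∈ (Ic.comap l).support := by
      rw [Scheme.IdealSheafData.support_comap]; exact hz
    rw [h2, Scheme.IdealSheafData.support_top] at h4
    exact h4
  exact ⟨IsOpenImmersion.lift _ l h3, by rw [IsOpenImmersion.lift_fac_assoc, hl]⟩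

theorem IsSmallResolution.hom_ext_compl (h : IsSmallResolution IB IC J π Ib)
    {T : Scheme.{u}} (j : T ⟶ (supportCompl Ib).toScheme) [IsOpenImmersion j]
    (h' : IsSmallResolution IC IB J π' Ic) {f g : T ⟶ Y'}
    (hf : f ≫ π' = j ≫ (supportCompl Ib).ι ≫ π) (hg : g ≫ π' = j ≫ (supportCompl Ib).ι ≫ π) :
    f = g := by
  refine h'.isBlowup.hom_ext (hf.trans hg.symm) ?_
  have htop : Ib.comap (supportCompl Ib).ι = ⊤ :=
    comap_eq_top_of_le Ib (supportCompl Ib).ι fun t ↦ t.2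
  rw [hf]
  exact (h.cartier_of_comap_eq_top _ (h.isEffectiveCartier_mid.comap_comp (supportCompl Ib).ι)
    htop).comap_comp j

/-- The small resolutions are isomorphic off the flopping curves. -/
theorem IsSmallResolution.exists_iso (h : IsSmallResolution IB IC J π Ib)
    (h' : IsSmallResolution IC IB J π' Ic) :
    ∃ e : (supportCompl Ib).toScheme ≅ (supportCompl Ic).toScheme,
      e.hom ≫ (supportCompl Ic).ι ≫ π' = (supportCompl Ib).ι ≫ π := by
  obtain ⟨l, hl⟩ := h.exists_hom h'
  obtain ⟨k, hk⟩ := h'.exists_hom h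
  refine ⟨⟨l, k, ?_, ?_⟩, hl⟩
  · rw [← cancel_mono (supportCompl Ib).ι]
    refine h.isBlowup.hom_ext ?_ ?_
    · simp only [Category.assoc, hk, hl, Category.id_comp]
    · simp only [Category.assoc, hk, hl]
      exact h.isBlowup.isEffectiveCartier.comap_comp _
  · rw [← cancel_mono (supportCompl Ic).ι]
    refine h'.isBlowup.hom_ext ?_ ?_
    · simp only [Category.assoc, hk, hl, Category.id_comp]
    · simp only [Category.assoc, hk, hl]
      exact h'.isBlowup.isEffectiveCartier.comap_comp _

theorem IsSmallResolution.dense_compl (h : IsSmallResolution IB IC J π Ib) (hJ : J ≤ IC) :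
    Dense (supportCompl Ib : Set Y) := by
  refine (h.isBlowup.isEffectiveCartier).dense_compl_support.mono fun y hy ↦ ?_
  let V : Y.Opens := supportCompl ((IB * J).comap π)
  have htop : ((IB * J).comap π).comap V.ι = ⊤ := comap_eq_top_of_le _ V.ι fun t ↦ t.2
  have hle (I I' : V.toScheme.IdealSheafData) (e : I * I' = ⊤) : I' = ⊤ := by
    refine top_unique fun U ↦ ?_
    have := congrArg (fun K ↦ Scheme.IdealSheafData.ideal K U) e
    simp only [Scheme.IdealSheafData.ideal_mul, Pi.mul_apply] at this
    exact this.ge.trans Ideal.mul_le_right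
  rw [← Scheme.IdealSheafData.comap_comp, comap_mul] at htop
  have hJt := hle _ _ htop
  have hBt := hle _ _ (mul_comm (IB.comap (V.ι ≫ π)) _ ▸ htop)
  have hCt : IC.comap (V.ι ≫ π) = ⊤ := by
    refine top_unique ?_
    rw [← hJt]
    exact Scheme.IdealSheafData.comap_mono _ hJ
  have h1 := h.comap_mul_eq V.ι
  rw [comap_mul, hJt, hBt, hCt, mul_comm, idealSheaf_mul_top, idealSheaf_mul_top] at h1
  change y ∉ Ib.support
  intro hyI
  have h4 : (⟨y, hy⟩ : V) ∈ (Ib.comap V.ι).support := by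
    rw [Scheme.IdealSheafData.support_comap]; exact hyI
  rw [h1, Scheme.IdealSheafData.support_top] at h4
  exact h4

/-- The blow-up of the flopping curve is the common blow-up of all the centers. -/
theorem IsSmallResolution.comp_blowup (h : IsSmallResolution IB IC J π Ib) {W : Scheme.{u}}
    {a : W ⟶ Y} (ha : IsBlowup a Ib) : IsBlowup (a ≫ π) ((IB * IC) * J) := by
  have h1 := h.isBlowup.comp ha h.isEffectiveCartier_mid (L := IB * IC)
    (by rw [mul_comm, h.mul_eq])
  refine h1.congr fun g ↦ ?_
  simp only [comap_mul, isEffectiveCartier_mul_iff]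
  tauto

theorem IsSmallResolution.exists_common_blowup (h : IsSmallResolution IB IC J π Ib)
    (h' : IsSmallResolution IC IB J π' Ic) :
    ∃ (W : Scheme.{u}) (a : W ⟶ Y) (b : W ⟶ Y'), IsBlowup a Ib ∧ IsBlowup b Ic ∧
      Ib.comap a = Ic.comap b ∧ a ≫ π = b ≫ π' := by
  obtain ⟨W, a, ha⟩ := exists_isBlowup Ib
  obtain ⟨W', b, hb⟩ := exists_isBlowup Ic
  have hW := h.comp_blowup ha
  have hW' := h'.comp_blowup hb
  rw [mul_comm IC IB] at hW'
  obtain ⟨e, he⟩ := hW.exists_iso hW'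
  refine ⟨W, a, e.hom ≫ b, ha, hb.iso_comp e, ?_, by rw [Category.assoc, he]⟩
  have h1 := h.comap_mul_eq a
  have h2 := h'.comap_mul_eq (e.hom ≫ b)
  rw [Category.assoc, he, mul_comm IC IB, ← h1] at h2
  have hJ : IsEffectiveCartier (J.comap (a ≫ π)) := by
    have := hW.isEffectiveCartier
    rw [comap_mul] at this
    exact this.of_mul_right
  exact hJ.mul_left_cancel h2.symm

theorem compHom_eq_toRationalMap_iff {X Y Z : Scheme.{u}} (f : X.PartialMap Y) (g : Y ⟶ Z)
    (k : X ⟶ Z) : f.toRationalMap.compHom g = k.toRationalMap ↔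
      ∃ (V : X.Opens) (_ : Dense (V : Set X)) (hV : V ≤ f.domain),
        X.homOfLE hV ≫ f.hom ≫ g = V.ι ≫ k := by
  rw [← Scheme.RationalMap.compHom_toRationalMap, Scheme.PartialMap.toRationalMap_eq_iff]
  have key (V : X.Opens) (hV : V ≤ ⊤) : X.homOfLE hV ≫ X.topIso.hom ≫ k = V.ι ≫ k := by
    rw [← Category.assoc]
    congr 1
    exact X.homOfLE_ι hV
  constructor
  · rintro ⟨V, hV, h1, h2, e⟩
    exact ⟨V, hV, h1, Eq.trans e (key V h2)⟩
  · rintro ⟨V, hV, h1, e⟩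
    exact ⟨V, hV, h1, le_top, Eq.trans e (key V le_top).symm⟩

theorem IsSmallResolution.exists_flop (h : IsSmallResolution IB IC J π Ib)
    (h' : IsSmallResolution IC IB J π' Ic) (hJB : J ≤ IB) (hJC : J ≤ IC) :
    ∃ φ : Y ⤏ Y', (φ.compHom π' = π.toRationalMap ∧
        ∀ ψ : Y ⤏ Y', ψ.compHom π' = π.toRationalMap → ψ = φ) ∧
      ∃ (W : Scheme.{u}) (a : W ⟶ Y) (b : W ⟶ Y'), IsBlowup a Ib ∧ IsBlowup b Ic ∧
        Ib.comap a = Ic.comap b ∧ a ≫ π = b ≫ π' ∧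
        ∃ f : Y.PartialIso Y', f.toRationalMap = φ ∧ f.source = supportCompl Ib ∧
          f.target = supportCompl Ic ∧
          (a ∣_ f.source) ≫ f.iso.hom ≫ f.target.ι = (a ⁻¹ᵁ f.source).ι ≫ b := by
  obtain ⟨e, he⟩ := h.exists_iso h'
  obtain ⟨W, a, b, ha, hb, hab, hπ⟩ := h.exists_common_blowup h'
  let f : Y.PartialIso Y' := ⟨_, h.dense_compl hJC, _, h'.dense_compl hJB, e⟩
  refine ⟨f.toRationalMap, ⟨?_, fun ψ hψ ↦ ?_⟩, W, a, b, ha, hb, hab, hπ, f, rfl, rfl, rfl, ?_⟩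
  · refine (compHom_eq_toRationalMap_iff _ _ _).2
      ⟨supportCompl Ib, h.dense_compl hJC, le_rfl, ?_⟩
    change Y.homOfLE _ ≫ (e.hom ≫ (supportCompl Ic).ι) ≫ π' = _
    rw [Scheme.homOfLE_rfl, Category.id_comp, Category.assoc, he]
  · obtain ⟨g, rfl⟩ := ψ.exists_rep
    obtain ⟨V, hV, hVg, hVe⟩ := (compHom_eq_toRationalMap_iff _ _ _).1 hψ
    have hVU : V ⊓ supportCompl Ib ≤ supportCompl Ib := inf_le_right
    refine Scheme.PartialMap.toRationalMap_eq_iff.2 ⟨V ⊓ supportCompl Ib,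
      hV.inter_of_isOpen_left (h.dense_compl hJC) V.2, inf_le_left.trans hVg, hVU, ?_⟩
    refine h.hom_ext_compl (Y.homOfLE hVU) h' ?_ ?_
    · change (Y.homOfLE (inf_le_left.trans hVg) ≫ g.hom) ≫ π' = _
      rw [Category.assoc, ← Y.homOfLE_homOfLE inf_le_left hVg, Category.assoc, hVe,
        Y.homOfLE_ι_assoc, Y.homOfLE_ι_assoc]
    · change (Y.homOfLE hVU ≫ e.hom ≫ (supportCompl Ic).ι) ≫ π' = _
      simp only [Category.assoc, he]
  · have hW := (h'.comp_blowup hb).isEffectiveCartier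
    have h1 : ((a ∣_ f.source) ≫ f.iso.hom ≫ f.target.ι) ≫ π' = ((a ⁻¹ᵁ f.source).ι ≫ b) ≫ π' := by
      change ((a ∣_ supportCompl Ib) ≫ e.hom ≫ (supportCompl Ic).ι) ≫ π' = _
      rw [Category.assoc, Category.assoc, Category.assoc, he, morphismRestrict_ι_assoc, hπ]
    refine h'.isBlowup.hom_ext h1 ?_
    rw [h1, Category.assoc]
    refine IsEffectiveCartier.comap_comp ?_ _
    rw [comap_mul, comap_mul, isEffectiveCartier_mul_iff, isEffectiveCartier_mul_iff] at hW
    rw [comap_mul]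
    exact hW.1.1.mul hW.2

end FormalFlop

section RingCharts
open Polynomial

/-- The ring `A[T] / (a - b T)`. -/
def BlowupRing (A : Type u) [CommRing A] (a b : A) : Type u :=
  AdjoinRoot (C a - C b * X : A[X])

instance (A : Type u) [CommRing A] (a b : A) : CommRing (BlowupRing A a b) :=
  inferInstanceAs (CommRing (AdjoinRoot (C a - C b * X : A[X])))

namespace BlowupRing

variable {A : Type u} [CommRing A] {a b : A}

/-- The quotient map from the polynomial ring. -/
def mk : A[X] →+* BlowupRing A a b := AdjoinRoot.mk (C a - C b * X)

/-- The fraction `a / b`. -/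
def frac : BlowupRing A a b := mk X

/-- The structure map. -/
def of : A →+* BlowupRing A a b := mk.comp C

theorem mk_eq_zero {p : A[X]} : (mk p : BlowupRing A a b) = 0 ↔ (C a - C b * X) ∣ p :=
  AdjoinRoot.mk_eq_zero

theorem mk_eq_eval₂ (p : A[X]) : (mk p : BlowupRing A a b) = p.eval₂ of frac := by
  conv_lhs => rw [← eval₂_C_X (p := p), hom_eval₂]
  rfl

theorem of_eq : (of a : BlowupRing A a b) = of b * frac := by
  have h : (mk (C a - C b * X) : BlowupRing A a b) = 0 := mk_eq_zero.2 dvd_rfl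
  rw [map_sub, map_mul] at h
  exact sub_eq_zero.1 h

/-- Ring homomorphisms out of `A[T] / (a - b T)`. -/
def lift {S : Type*} [CommRing S] (φ : A →+* S) (s : S) (h : φ a = φ b * s) :
    BlowupRing A a b →+* S :=
  AdjoinRoot.lift φ s (by simp [h])

theorem lift_mk {S : Type*} [CommRing S] (φ : A →+* S) (s : S) (h : φ a = φ b * s) (p : A[X]) :
    lift φ s h (mk p) = p.eval₂ φ s := AdjoinRoot.lift_mk _ p

@[simp] theorem lift_of {S : Type*} [CommRing S] (φ : A →+* S) (s : S) (h : φ a = φ b * s) (c : A) :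
    lift φ s h (of c) = φ c := (lift_mk φ s h (C c)).trans (eval₂_C _ _)

@[simp] theorem lift_frac {S : Type*} [CommRing S] (φ : A →+* S) (s : S) (h : φ a = φ b * s) :
    lift φ s h frac = s := (lift_mk φ s h X).trans (eval₂_X _ _)

theorem mk_surjective' (r : BlowupRing A a b) : ∃ p : A[X], mk p = r :=
  AdjoinRoot.mk_surjective r

instance [IsNoetherianRing A] : IsNoetherianRing (BlowupRing A a b) :=
  isNoetherianRing_of_surjective _ _ mk mk_surjective'

theorem mk_surjective (r : BlowupRing A a b) :
    ∃ p : A[X], (p.eval₂ of frac : BlowupRing A a b) = r := by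
  obtain ⟨p, rfl⟩ := mk_surjective' r
  exact ⟨p, (mk_eq_eval₂ p).symm⟩

theorem induction_on {P : BlowupRing A a b → Prop} (r : BlowupRing A a b)
    (h1 : ∀ c, P (of c)) (h2 : ∀ r s, P r → P s → P (r + s)) (h3 : ∀ r, P r → P (r * frac)) :
    P r := by
  obtain ⟨p, rfl⟩ := mk_surjective r
  induction p using Polynomial.induction_on with
  | C c => simpa using h1 c
  | add p q hp hq => rw [eval₂_add]; exact h2 _ _ hp hq
  | monomial n c h =>
    have : (C c * X ^ (n + 1) : A[X]) = C c * X ^ n * X := by ring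
    rw [this, eval₂_mul_X]; exact h3 _ h

/-- Every element is a fraction with denominator a power of `b`. -/
theorem exists_pow_mul_eq (r : BlowupRing A a b) : ∃ n c, of b ^ n * r = of c := by
  refine induction_on (P := fun r ↦ ∃ n c, of b ^ n * r = of c) r (fun c ↦ ⟨0, c, by simp⟩) ?_ ?_
  · rintro r s ⟨n, c, hc⟩ ⟨m, d, hd⟩
    refine ⟨n + m, b ^ m * c + b ^ n * d, ?_⟩
    rw [map_add, map_mul, map_mul, ← hc, ← hd, map_pow, map_pow]
    ring
  · rintro r ⟨n, c, hc⟩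
    refine ⟨n + 1, c * a, ?_⟩
    rw [map_mul, ← hc, of_eq]
    ring

theorem mem_span_of_eval_eq_zero (hab : ∀ c d, a * c = b * d → b ∣ c) {F : Type*} [CommRing F] {φ : A →+* F}
    (hφ : Function.Injective φ) {x : F} (hx : φ a = φ b * x) (p : A[X])
    (hp : p.eval₂ φ x = 0) : p ∈ Ideal.span {(C a - C b * X : A[X])} := by
  induction hn : p.natDegree using Nat.strong_induction_on generalizing p with
  | _ n ih =>
  obtain hn0 | hn0 := Nat.eq_zero_or_pos n
  · obtain ⟨c, rfl⟩ := natDegree_eq_zero.1 (hn.trans hn0)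
    rw [eval₂_C] at hp
    rw [hφ (hp.trans (map_zero φ).symm), C_0]; exact zero_mem _
  have key : b ∣ p.coeff n := by
    have h1 : ∃ d, p.coeff n * a ^ n = b * d := by
      have h2 : φ b ^ n * p.eval₂ φ x = 0 := by rw [hp, mul_zero]
      rw [eval₂_eq_sum_range, hn, Finset.sum_range_succ, mul_add, Finset.mul_sum] at h2
      have h3 : φ b ^ n * (φ (p.coeff n) * x ^ n) = φ (p.coeff n * a ^ n) := by
        rw [map_mul, map_pow, hx]; ring
      have h4 : ∑ i ∈ Finset.range n, φ b ^ n * (φ (p.coeff i) * x ^ i) =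
          φ (b * ∑ i ∈ Finset.range n, p.coeff i * a ^ i * b ^ (n - 1 - i)) := by
        rw [Finset.mul_sum, map_sum]
        refine Finset.sum_congr rfl fun i hi ↦ ?_
        have hi' := Finset.mem_range.1 hi
        have : n = i + 1 + (n - 1 - i) := by omega
        rw [map_mul, map_mul, map_mul, map_pow, map_pow, hx]
        conv_lhs => rw [this]
        ring
      rw [h3, h4, ← map_add] at h2
      have h5 := hφ (h2.trans (map_zero φ).symm)
      refine ⟨-∑ i ∈ Finset.range n, p.coeff i * a ^ i * b ^ (n - 1 - i), ?_⟩
      linear_combination h5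
    have h6 : ∀ m c, (∃ d, c * a ^ m = b * d) → b ∣ c := by
      intro m
      induction m with
      | zero => rintro c ⟨d, hd⟩; exact ⟨d, by simpa using hd⟩
      | succ m ihm =>
        rintro c ⟨d, hd⟩
        obtain ⟨e, he⟩ := hab (c * a ^ m) d (by rw [← hd]; ring)
        exact ihm c ⟨e, he⟩
    exact h6 n _ h1
  obtain ⟨q, hq⟩ := key
  have hp' : p + C q * X ^ (n - 1) * (C a - C b * X) ∈ Ideal.span {(C a - C b * X : A[X])} := by
    have heval : (p + C q * X ^ (n - 1) * (C a - C b * X)).eval₂ φ x = 0 := by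
      rw [eval₂_add, hp, eval₂_mul, eval₂_sub, eval₂_mul_X, eval₂_C, eval₂_C, hx]
      simp
    by_cases h0 : p + C q * X ^ (n - 1) * (C a - C b * X) = 0
    · rw [h0]; exact zero_mem _
    refine ih _ ?_ _ heval rfl
    have hXn : (X : A[X]) ^ (n - 1) * X = X ^ n := by
      rw [← pow_succ]; congr 1; omega
    have e1 : p + C q * X ^ (n - 1) * (C a - C b * X) =
        p.erase n + C (q * a) * X ^ (n - 1) := by
      have := monomial_add_erase p n
      rw [← C_mul_X_pow_eq_monomial, hq] at this
      conv_lhs => rw [← this]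
      rw [← hXn, C_mul, C_mul]
      ring
    rw [e1] at h0 ⊢
    have hd : (p.erase n + C (q * a) * X ^ (n - 1) : A[X]).degree < (n : WithBot ℕ) := by
      refine (degree_add_le _ _).trans_lt (max_lt ?_ ?_)
      · have hp0 : p ≠ 0 := by rintro rfl; simp at hn; omega
        have := degree_erase_lt hp0
        rw [hn, degree_eq_natDegree hp0, hn] at this
        exact this
      · refine (degree_C_mul_X_pow_le _ _).trans_lt ?_
        exact_mod_cast (by omega : n - 1 < n)
    exact (natDegree_lt_iff_degree_lt h0).2 hd
  have h7 := sub_mem hp' (Ideal.mul_mem_left _ (C q * X ^ (n - 1)) (Ideal.mem_span_singleton_self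
    (C a - C b * X : A[X])))
  simpa using h7

/-- The embedding into the field of fractions. -/
theorem exists_injective [IsDomain A] (hb : b ≠ 0) (hab : ∀ c d, a * c = b * d → b ∣ c) :
    ∃ f : BlowupRing A a b →+* FractionRing A,
    Function.Injective f ∧ ∀ c, f (of c) = algebraMap A (FractionRing A) c := by
  have hb' : algebraMap A (FractionRing A) b ≠ 0 := by simpa using hb
  refine ⟨lift (algebraMap A _) (algebraMap A (FractionRing A) a / algebraMap A (FractionRing A) b)
    (mul_div_cancel₀ _ hb').symm, ?_, fun c ↦ lift_of _ _ _ c⟩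
  rw [injective_iff_map_eq_zero]
  intro r hr
  obtain ⟨p, rfl⟩ := mk_surjective' r
  rw [mk_eq_zero, ← Ideal.mem_span_singleton]
  refine mem_span_of_eval_eq_zero hab (FaithfulSMul.algebraMap_injective A (FractionRing A))
    (mul_div_cancel₀ _ hb').symm p ?_
  exact (lift_mk _ _ _ p).symm.trans hr

theorem isDomain [IsDomain A] (hb : b ≠ 0) (hab : ∀ c d, a * c = b * d → b ∣ c) :
    IsDomain (BlowupRing A a b) := by
  obtain ⟨f, hf, -⟩ := exists_injective hb hab
  exact hf.isDomain f

theorem of_injective [IsDomain A] (hb : b ≠ 0) (hab : ∀ c d, a * c = b * d → b ∣ c) :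
    Function.Injective (of : A →+* BlowupRing A a b) := by
  obtain ⟨f, -, hf⟩ := exists_injective hb hab
  intro c d h
  have := congrArg f h
  rw [hf, hf] at this
  exact FaithfulSMul.algebraMap_injective A (FractionRing A) this

theorem isBlowupChart [IsDomain A] (hb : b ≠ 0) (hab : ∀ c d, a * c = b * d → b ∣ c) :
    IsBlowupChart (of : A →+* BlowupRing A a b) (Ideal.span {a, b}) b := by
  have := isDomain hb hab
  refine .of_exists_lift (Ideal.subset_span (by simp)) ?_ ?_ exists_pow_mul_eq ?_
  · rw [mem_nonZeroDivisors_iff_ne_zero]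
    exact fun h ↦ hb (of_injective hb hab (h.trans (map_zero _).symm))
  · rw [Ideal.map_span, Set.image_pair]
    refine le_antisymm (Ideal.span_le.2 ?_) (Ideal.span_mono (by simp))
    rintro _ (rfl | rfl)
    · rw [of_eq]; exact Ideal.mul_mem_right _ _ (Ideal.mem_span_singleton_self _)
    · exact Ideal.mem_span_singleton_self _
  · intro S _ ψ _ h
    have : ψ a ∈ Ideal.span {ψ b} := h ▸ Ideal.mem_map_of_mem ψ (Ideal.subset_span (by simp))
    obtain ⟨s, hs⟩ := Ideal.mem_span_singleton'.1 this
    have hs' : ψ a = ψ b * s := by rw [← hs, mul_comm]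
    exact ⟨lift ψ s hs', RingHom.ext fun c ↦ lift_of ψ s hs' c⟩

/-- If all coefficients lie in an ideal, then so does the value. -/
theorem eval_mem {S : Type*} [CommRing S] (φ : A →+* S) (s : S) (I : Ideal S) (p : A[X])
    (h : ∀ n, φ (p.coeff n) ∈ I) : p.eval₂ φ s ∈ I := by
  rw [eval₂_eq_sum_range]
  exact sum_mem fun i _ ↦ Ideal.mul_mem_right _ _ (h i)

/-- Reduction modulo the denominator: the fraction becomes a free variable. -/
theorem ker_lift_polynomial {D : Type*} [CommRing D] (σ : A →+* D)
    (hσ : RingHom.ker σ = Ideal.span {a, b}) (h : (C.comp σ) a = (C.comp σ) b * (X : D[X])) :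
    RingHom.ker (lift (a := a) (b := b) (C.comp σ) (X : D[X]) h) = Ideal.span {of b} := by
  apply le_antisymm
  · intro r hr
    obtain ⟨p, rfl⟩ := mk_surjective r
    rw [RingHom.mem_ker, hom_eval₂, lift_frac] at hr
    have hr' : p.map σ = 0 := by
      rw [← hr, ← eval₂_C_X (p := p.map σ), eval₂_map]
      congr 1
      ext c
      simp
    refine eval_mem _ _ _ _ fun n ↦ ?_
    have hn : p.coeff n ∈ RingHom.ker σ := by
      rw [RingHom.mem_ker, ← coeff_map, hr', coeff_zero]
    rw [hσ] at hn
    obtain ⟨u, v, huv⟩ := Ideal.mem_span_pair.1 hn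
    rw [← huv, map_add, map_mul, map_mul, of_eq, Ideal.mem_span_singleton]
    exact ⟨of u * frac + of v, by ring⟩
  · rw [Ideal.span_singleton_le_iff_mem, RingHom.mem_ker, lift_of]
    have : σ b = 0 := by
      rw [← RingHom.mem_ker, hσ]; exact Ideal.subset_span (by simp)
    simp [this]

/-- Fraction rings commute with quotients by principal ideals. -/
theorem ker_map {A' : Type u} [CommRing A'] (σ : A →+* A') (hs : Function.Surjective σ) {c : A}
    (hσ : RingHom.ker σ = Ideal.span {c})
    (h : (of.comp σ) a = (of.comp σ) b * (frac : BlowupRing A' (σ a) (σ b))) :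
    RingHom.ker (lift (a := a) (b := b) (of.comp σ) (frac : BlowupRing A' (σ a) (σ b)) h) =
      Ideal.span {of c} := by
  apply le_antisymm
  · intro r hr
    obtain ⟨p, rfl⟩ := mk_surjective r
    rw [RingHom.mem_ker, hom_eval₂, lift_frac] at hr
    have h1 : (mk (p.map σ) : BlowupRing A' (σ a) (σ b)) = 0 := by
      rw [← hr, mk_eq_eval₂, eval₂_map]
      congr 1
      ext c
      simp
    rw [mk_eq_zero] at h1
    obtain ⟨q', hq'⟩ := h1
    obtain ⟨q, rfl⟩ := Polynomial.map_surjective σ hs q'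
    have h2 : (p - (C a - C b * X) * q).map σ = 0 := by
      rw [Polynomial.map_sub, hq']; simp
    have h3 : p.eval₂ of frac = (p - (C a - C b * X) * q).eval₂ (of : A →+* BlowupRing A a b)
        frac := by
      rw [eval₂_sub, eval₂_mul, eval₂_sub, eval₂_mul, eval₂_C, eval₂_C, eval₂_X, of_eq]
      simp
    rw [h3]
    refine eval_mem _ _ _ _ fun n ↦ ?_
    have hn : (p - (C a - C b * X) * q).coeff n ∈ RingHom.ker σ := by
      rw [RingHom.mem_ker, ← coeff_map, h2, coeff_zero]
    rw [hσ] at hn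
    obtain ⟨u, hu⟩ := Ideal.mem_span_singleton'.1 hn
    rw [← hu, map_mul]
    exact Ideal.mul_mem_left _ _ (Ideal.mem_span_singleton_self _)
  · rw [Ideal.span_singleton_le_iff_mem, RingHom.mem_ker, lift_of]
    have : σ c = 0 := by
      rw [← RingHom.mem_ker, hσ]; exact Ideal.mem_span_singleton_self _
    simp [this]

end BlowupRing

end RingCharts

section LineCharts
open Polynomial

/-- Local equations `x, y` of `B` and `x, z` of `C` near the intersection point with maximal ideal
`(x, y, z)` and residue field `K`. -/
structure FlopCoords {K A : Type u} [Field K] [CommRing A] (κ : K →+* A) (x y z : A) : Prop where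
  isDomain : IsDomain A
  isNoetherianRing : IsNoetherianRing A
  x_ne_zero : x ≠ 0
  isPrime_xy : (Ideal.span {x, y}).IsPrime
  isPrime_xz : (Ideal.span {x, z}).IsPrime
  z_notMem : z ∉ Ideal.span {x, y}
  y_notMem : y ∉ Ideal.span {x, z}
  y_regular : ∀ c d, y * c = x * d → x ∣ c
  z_regular : ∀ c d, z * c = x * d → x ∣ c
  exists_residue : ∃ ρ : A →+* K, ρ.comp κ = RingHom.id K ∧ RingHom.ker ρ = Ideal.span {x, y, z}

theorem FlopCoords.symm {K A : Type u} [Field K] [CommRing A] {κ : K →+* A} {x y z : A}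
    (h : FlopCoords κ x y z) : FlopCoords κ x z y where
  isDomain := h.isDomain
  isNoetherianRing := h.isNoetherianRing
  x_ne_zero := h.x_ne_zero
  isPrime_xy := h.isPrime_xz
  isPrime_xz := h.isPrime_xy
  z_notMem := h.y_notMem
  y_notMem := h.z_notMem
  y_regular := h.z_regular
  z_regular := h.y_regular
  exists_residue := by
    obtain ⟨ρ, h1, h2⟩ := h.exists_residue
    exact ⟨ρ, h1, by rw [h2, Set.pair_comm y z]⟩

/-- The spectrum of `R` contains an affine line with coordinate `τ`, cut out by the regular
sequence `f, g`. -/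
structure LineChart {K R : Type u} [Field K] [CommRing R] (κ : K →+* R) (f g τ : R) : Prop where
  isDomain : IsDomain R
  isNoetherianRing : IsNoetherianRing R
  f_ne_zero : f ≠ 0
  isPrime : (Ideal.span {f}).IsPrime
  g_notMem : g ∉ Ideal.span {f}
  exists_ev : ∃ ev : R →+* K[X], ev.comp κ = C ∧ ev τ = X ∧ RingHom.ker ev = Ideal.span {f, g}

theorem isPrime_span_of_ker {R S : Type*} [CommRing R] [CommRing S] [IsDomain S] {f : R}
    (φ : R →+* S) (h : RingHom.ker φ = Ideal.span {f}) : (Ideal.span {f}).IsPrime :=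
  h ▸ RingHom.ker_isPrime φ

theorem mem_span_pair_of_mem_triple {R S : Type*} [CommRing R] [CommRing S] {x y z : R}
    (φ : R →+* S) {I : Ideal S} (hx : φ x ∈ I) (hy : φ y ∈ I) (hz : φ z ∈ I) {c : R}
    (hc : c ∈ Ideal.span {x, y, z}) : φ c ∈ I := by
  have : Ideal.span {x, y, z} ≤ I.comap φ := by
    rw [Ideal.span_le]
    rintro _ (rfl | rfl | rfl)
    exacts [hx, hy, hz]
  exact this hc

/-- The quotient of the first chart by `y` is a polynomial ring. -/
theorem ker_pre {A : Type u} [CommRing A] {x y : A} : ∃ σ : BlowupRing A x y →+* (A ⧸ Ideal.span {x, y})[X],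
    Function.Surjective σ ∧ RingHom.ker σ = Ideal.span {BlowupRing.of y} ∧
    (∀ c, σ (BlowupRing.of c) = C (Ideal.Quotient.mk _ c)) ∧ σ BlowupRing.frac = X := by
  let σ := Ideal.Quotient.mk (Ideal.span {x, y})
  have hσx : σ x = 0 := Ideal.Quotient.eq_zero_iff_mem.2 (Ideal.subset_span (by simp))
  have hσy : σ y = 0 := Ideal.Quotient.eq_zero_iff_mem.2 (Ideal.subset_span (by simp))
  have hrel : (C.comp σ) x = (C.comp σ) y * (X : (A ⧸ Ideal.span {x, y})[X]) := by
    simp [hσx, hσy]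
  refine ⟨BlowupRing.lift (C.comp σ) X hrel, fun p ↦ ?_,
    BlowupRing.ker_lift_polynomial σ (Ideal.mk_ker) hrel, fun c ↦ BlowupRing.lift_of _ _ _ c,
    BlowupRing.lift_frac _ _ _⟩
  induction p using Polynomial.induction_on with
  | C c =>
    obtain ⟨c, rfl⟩ := Ideal.Quotient.mk_surjective c
    exact ⟨BlowupRing.of c, BlowupRing.lift_of _ _ _ c⟩
  | add p q hp hq =>
    obtain ⟨r, rfl⟩ := hp
    obtain ⟨s, rfl⟩ := hq
    exact ⟨r + s, map_add _ _ _⟩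
  | monomial n c hc =>
    obtain ⟨r, hr⟩ := hc
    exact ⟨r * BlowupRing.frac, by rw [map_mul, hr, BlowupRing.lift_frac]; ring⟩

theorem LineChart.of_fraction {K A D : Type u} [Field K] [CommRing A] [IsDomain A]
    [IsNoetherianRing A] [CommRing D]
    [IsDomain D] {κ : K →+* A} {z t y : A} (ht : t ≠ 0) (hzt : ∀ c d, z * c = t * d → t ∣ c)
    (hy : y ≠ 0) (σ : A →+* D[X]) (hs : Function.Surjective σ)
    (hσ : RingHom.ker σ = Ideal.span {y}) {δ : D} (hδ : δ ≠ 0) (hσz : σ z = C δ) (hσt : σ t = X)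
    (ev : A →+* K[X]) (hev : ev.comp κ = C) (hevt : ev t = X)
    (hker : RingHom.ker ev = Ideal.span {y, z}) :
    LineChart (BlowupRing.of.comp κ : K →+* BlowupRing A z t) (BlowupRing.of y) BlowupRing.frac
      (BlowupRing.of t) := by
  have hb : σ t ≠ 0 := by rw [hσt]; exact X_ne_zero
  have hab : ∀ c d, σ z * c = σ t * d → σ t ∣ c := by
    intro c d e
    rw [hσt, hσz] at e
    rw [hσt, X_dvd_iff]
    have h1 := congrArg (fun p ↦ coeff p 0) e
    simp only [mul_coeff_zero, coeff_C_zero, coeff_X_zero, zero_mul] at h1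
    exact (mul_eq_zero.1 h1).resolve_left hδ
  have hdom := BlowupRing.isDomain hb hab
  have hrel : (BlowupRing.of.comp σ) z =
      (BlowupRing.of.comp σ) t * (BlowupRing.frac : BlowupRing D[X] (σ z) (σ t)) := by
    rw [RingHom.comp_apply, RingHom.comp_apply, BlowupRing.of_eq]
  have hker' := BlowupRing.ker_map σ hs hσ hrel
  have hinj := BlowupRing.of_injective ht hzt
  refine ⟨BlowupRing.isDomain ht hzt, inferInstance, ?_, isPrime_span_of_ker _ hker', ?_, ?_⟩
  · rwa [map_ne_zero_iff _ hinj]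
  · rw [← hker', RingHom.mem_ker, BlowupRing.lift_frac]
    intro e
    have h1 := BlowupRing.of_eq (a := σ z) (b := σ t)
    rw [e, mul_zero, hσz] at h1
    rw [hσz] at hab
    have h2 := BlowupRing.of_injective hb hab (h1.trans (map_zero _).symm)
    exact hδ (C_injective (h2.trans C_0.symm))
  · have hevz : ev z = 0 := by
      rw [← RingHom.mem_ker, hker]; exact Ideal.subset_span (by simp)
    have hevy : ev y = 0 := by
      rw [← RingHom.mem_ker, hker]; exact Ideal.subset_span (by simp)
    have hrel' : ev z = ev t * 0 := by rw [hevz, mul_zero]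
    refine ⟨BlowupRing.lift ev 0 hrel', ?_, (BlowupRing.lift_of _ _ _ _).trans hevt,
      le_antisymm ?_ ?_⟩
    · ext1 c
      rw [RingHom.comp_apply, RingHom.comp_apply, BlowupRing.lift_of, ← hev, RingHom.comp_apply]
    · intro r hr
      obtain ⟨p, rfl⟩ := BlowupRing.mk_surjective r
      have h0 : p.eval₂ BlowupRing.of (BlowupRing.frac : BlowupRing A z t) =
          p.divX.eval₂ BlowupRing.of BlowupRing.frac * BlowupRing.frac +
            BlowupRing.of (p.coeff 0) := by
        have h1 : p.eval₂ BlowupRing.of (BlowupRing.frac : BlowupRing A z t) =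
          (p.divX * X + C (p.coeff 0)).eval₂ BlowupRing.of BlowupRing.frac := by
            rw [divX_mul_X_add]
        rw [h1, eval₂_add, eval₂_mul_X, eval₂_C]
      rw [RingHom.mem_ker, h0, map_add, map_mul, BlowupRing.lift_frac, mul_zero, zero_add,
        BlowupRing.lift_of, ← RingHom.mem_ker, hker] at hr
      rw [h0]
      refine add_mem (Ideal.mul_mem_left _ _ (Ideal.subset_span (by simp))) ?_
      obtain ⟨u, v, huv⟩ := Ideal.mem_span_pair.1 hr
      rw [← huv, map_add, map_mul, map_mul, BlowupRing.of_eq (a := z)]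
      exact add_mem (Ideal.mul_mem_left _ _ (Ideal.subset_span (by simp)))
        (Ideal.mul_mem_left _ _ (Ideal.mul_mem_left _ _ (Ideal.subset_span (by simp))))
    · rw [Ideal.span_le]
      rintro _ (rfl | rfl)
      · rw [SetLike.mem_coe, RingHom.mem_ker, BlowupRing.lift_of, hevy]
      · rw [SetLike.mem_coe, RingHom.mem_ker, BlowupRing.lift_frac]

theorem IsBlowupChart.of_fraction {A A₁ : Type u} [CommRing A] [CommRing A₁] [IsDomain A₁]
    {φ₁ : A →+* A₁} (hφ₁ : Function.Injective φ₁) {x y z : A} {t : A₁} (ht : t ≠ 0)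
    (hzt : ∀ c d, φ₁ z * c = t * d → t ∣ c) (hx : x ≠ 0) (hy : y ≠ 0) (hxt : φ₁ x = φ₁ y * t)
    (hfrac : ∀ r, ∃ n c, φ₁ y ^ n * r = φ₁ c)
    (hlift : ∀ {S : Type u} [CommRing S] (ψ : A →+* S) (s : S), ψ x = ψ y * s →
      ∃ χ : A₁ →+* S, χ.comp φ₁ = ψ ∧ χ t = s) :
    IsBlowupChart ((BlowupRing.of : A₁ →+* BlowupRing A₁ (φ₁ z) t).comp φ₁)
      (Ideal.span {x, y} * Ideal.span {x, y * z}) (x * y) := by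
  have := BlowupRing.isDomain ht hzt
  have hinj : Function.Injective ((BlowupRing.of : A₁ →+* BlowupRing A₁ (φ₁ z) t).comp φ₁) :=
    (BlowupRing.of_injective ht hzt).comp hφ₁
  have hφ (c) : ((BlowupRing.of : A₁ →+* BlowupRing A₁ (φ₁ z) t).comp φ₁) c =
    BlowupRing.of (φ₁ c) := rfl
  have hw : BlowupRing.of (φ₁ z) = BlowupRing.of t * (BlowupRing.frac : BlowupRing A₁ (φ₁ z) t) :=
    BlowupRing.of_eq
  have hlift' {S : Type u} [CommRing S] (ψ : A →+* S) (s v : S) (h1 : ψ x = ψ y * s)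
      (h2 : ψ z = s * v) : ∃ χ : BlowupRing A₁ (φ₁ z) t →+* S,
        χ.comp ((BlowupRing.of : A₁ →+* BlowupRing A₁ (φ₁ z) t).comp φ₁) = ψ := by
    obtain ⟨χ, hχ, hχt⟩ := hlift ψ s h1
    have hχ' (c) : χ (φ₁ c) = ψ c := by rw [← hχ]; rfl
    have hv'' : χ (φ₁ z) = χ t * v := by rw [hχ', hχt, h2]
    exact ⟨BlowupRing.lift χ v hv'', RingHom.ext fun c ↦
      (BlowupRing.lift_of χ v hv'' _).trans (hχ' c)⟩
  have hfr := BlowupRing.exists_pow_mul_eq (a := φ₁ z) (b := t)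
  generalize (BlowupRing.frac : BlowupRing A₁ (φ₁ z) t) = w at hw
  generalize ((BlowupRing.of : A₁ →+* BlowupRing A₁ (φ₁ z) t).comp φ₁) = φ at *
  generalize (BlowupRing.of : A₁ →+* BlowupRing A₁ (φ₁ z) t) = ι at *
  have hx' : φ x ≠ 0 := (map_ne_zero_iff _ hinj).2 hx
  have hy' : φ y ≠ 0 := (map_ne_zero_iff _ hinj).2 hy
  have ht' : φ x = φ y * ι t := by
    rw [hφ, hφ, hxt, map_mul]
  refine .of_exists_lift ?_ ?_ ?_ ?_ ?_
  · rw [mul_comm x y]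
    exact Ideal.mul_mem_mul (Ideal.subset_span (by simp)) (Ideal.subset_span (by simp))
  · rw [map_mul]; exact mem_nonZeroDivisors_of_ne_zero (mul_ne_zero hx' hy')
  · have h1 : (Ideal.span {x, y}).map φ = Ideal.span {φ y} := by
      rw [Ideal.map_span, Set.image_pair]
      refine le_antisymm (Ideal.span_le.2 ?_) (Ideal.span_mono (by simp))
      rintro _ (rfl | rfl)
      · rw [ht']; exact Ideal.mul_mem_right _ _ (Ideal.mem_span_singleton_self _)
      · exact Ideal.mem_span_singleton_self _
    have h2 : (Ideal.span {x, y * z}).map φ = Ideal.span {φ x} := by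
      rw [Ideal.map_span, Set.image_pair]
      refine le_antisymm (Ideal.span_le.2 ?_) (Ideal.span_mono (by simp))
      rintro _ (rfl | rfl)
      · exact Ideal.mem_span_singleton_self _
      · rw [map_mul, hφ z, hw, ← mul_assoc, ← ht']
        exact Ideal.mul_mem_right _ _ (Ideal.mem_span_singleton_self _)
    rw [Ideal.map_mul, h1, h2, Ideal.span_singleton_mul_span_singleton, map_mul, mul_comm (φ x)]
  · intro r
    obtain ⟨n, c, hc⟩ := hfr r
    obtain ⟨m, d, hd⟩ := hfrac c
    refine ⟨n + m, x ^ m * y ^ n * (y ^ n * d), ?_⟩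
    have h1 : φ d = φ y ^ m * (ι t ^ n * r) := by
      rw [hφ, hφ, ← hd, map_mul, hc, map_pow]
    simp only [map_mul, map_pow]
    rw [h1, ht']
    ring
  · intro S _ ψ h1 h2
    have hm (u v : A) (hu : u ∈ Ideal.span {x, y}) (hv : v ∈ Ideal.span {x, y * z}) :
        ∃ s, s * ψ (x * y) = ψ (u * v) := by
      rw [← Ideal.mem_span_singleton', ← h2]
      exact Ideal.mem_map_of_mem ψ (Ideal.mul_mem_mul hu hv)
    obtain ⟨s, hs⟩ := hm x x (Ideal.subset_span (by simp)) (Ideal.subset_span (by simp))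
    obtain ⟨v, hv⟩ := hm y (y * z) (Ideal.subset_span (by simp)) (Ideal.subset_span (by simp))
    rw [map_mul] at h1
    obtain ⟨hx1, hy1⟩ := mul_mem_nonZeroDivisors.1 h1
    simp only [map_mul] at hs hv
    have hs' : ψ x = ψ y * s := by
      refine (mul_cancel_left_mem_nonZeroDivisors hx1).1 ?_
      rw [← hs]; ring
    have hv' : ψ z = s * v := by
      refine (mul_cancel_left_mem_nonZeroDivisors (mul_mem hy1 hy1)).1 ?_
      rw [mul_assoc, ← hv, hs']; ring
    exact hlift' ψ s v hs' hv'

namespace FlopCoords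

variable {K A : Type u} [Field K] [CommRing A] {κ : K →+* A} {x y z : A}

theorem y_ne_zero (h : FlopCoords κ x y z) : y ≠ 0 := fun e ↦ h.y_notMem (e ▸ zero_mem _)

theorem x_regular (h : FlopCoords κ x y z) (c d : A) (e : x * c = y * d) : y ∣ c := by
  have := h.isDomain
  obtain ⟨d', rfl⟩ := h.y_regular d c e.symm
  exact ⟨d', mul_left_cancel₀ h.x_ne_zero (by rw [e]; ring)⟩

theorem isDomain_two (h : FlopCoords κ x y z) : IsDomain (BlowupRing A y x) :=
  have := h.isDomain
  BlowupRing.isDomain h.x_ne_zero h.y_regular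

theorem of_two_injective (h : FlopCoords κ x y z) : Function.Injective (BlowupRing.of : A →+* BlowupRing A y x) :=
  have := h.isDomain
  BlowupRing.of_injective h.x_ne_zero h.y_regular

theorem isDomain_pre (h : FlopCoords κ x y z) : IsDomain (BlowupRing A x y) :=
  have := h.isDomain
  BlowupRing.isDomain h.y_ne_zero h.x_regular

theorem of_pre_injective (h : FlopCoords κ x y z) : Function.Injective (BlowupRing.of : A →+* BlowupRing A x y) :=
  have := h.isDomain
  BlowupRing.of_injective h.y_ne_zero h.x_regular

theorem lineChart_two (h : FlopCoords κ x y z) : LineChart (BlowupRing.of.comp κ : K →+* BlowupRing A y x)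
    (BlowupRing.of x) (BlowupRing.of z) BlowupRing.frac := by
  have := h.isDomain
  have hD := h.isPrime_xy
  let σ := Ideal.Quotient.mk (Ideal.span {x, y})
  have hσ : RingHom.ker σ = Ideal.span {y, x} := by rw [Ideal.mk_ker, Set.pair_comm]
  have hσx : σ x = 0 := Ideal.Quotient.eq_zero_iff_mem.2 (Ideal.subset_span (by simp))
  have hσy : σ y = 0 := Ideal.Quotient.eq_zero_iff_mem.2 (Ideal.subset_span (by simp))
  have hrel : (C.comp σ) y = (C.comp σ) x * (X : (A ⧸ Ideal.span {x, y})[X]) := by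
    simp [hσx, hσy]
  have hker := BlowupRing.ker_lift_polynomial σ hσ hrel
  have := h.isNoetherianRing
  refine ⟨h.isDomain_two, inferInstance, ?_, isPrime_span_of_ker _ hker, ?_, ?_⟩
  · rw [map_ne_zero_iff _ h.of_two_injective]; exact h.x_ne_zero
  · rw [← hker, RingHom.mem_ker, BlowupRing.lift_of]
    intro hz
    refine h.z_notMem (Ideal.Quotient.eq_zero_iff_mem.1 ?_)
    exact C_injective (hz.trans C_0.symm)
  · obtain ⟨ρ, hρκ, hρ⟩ := h.exists_residue
    have hx : ρ x = 0 := by rw [← RingHom.mem_ker, hρ]; exact Ideal.subset_span (by simp)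
    have hy : ρ y = 0 := by rw [← RingHom.mem_ker, hρ]; exact Ideal.subset_span (by simp)
    have hz : ρ z = 0 := by rw [← RingHom.mem_ker, hρ]; exact Ideal.subset_span (by simp)
    have hrel : (C.comp ρ) y = (C.comp ρ) x * (X : K[X]) := by simp [hx, hy]
    refine ⟨BlowupRing.lift (C.comp ρ) X hrel, ?_, BlowupRing.lift_frac _ _ _, le_antisymm ?_ ?_⟩
    · ext c
      rw [RingHom.comp_apply, RingHom.comp_apply, BlowupRing.lift_of, RingHom.comp_apply,
        ← RingHom.comp_apply ρ κ, hρκ, RingHom.id_apply]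
    · intro r hr
      obtain ⟨p, rfl⟩ := BlowupRing.mk_surjective r
      rw [RingHom.mem_ker, hom_eval₂, BlowupRing.lift_frac] at hr
      have hr' : p.map ρ = 0 := by
        rw [← hr, ← eval₂_C_X (p := p.map ρ), eval₂_map]
        congr 1
        ext c
        simp
      refine BlowupRing.eval_mem _ _ _ _ fun n ↦ ?_
      have hn : p.coeff n ∈ RingHom.ker ρ := by
        rw [RingHom.mem_ker, ← coeff_map, hr', coeff_zero]
      rw [hρ] at hn
      refine mem_span_pair_of_mem_triple _ (Ideal.subset_span (by simp)) ?_
        (Ideal.subset_span (by simp)) hn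
      rw [BlowupRing.of_eq]
      exact Ideal.mul_mem_right _ _ (Ideal.subset_span (by simp))
    · rw [Ideal.span_le]
      rintro _ (rfl | rfl) <;> simp [RingHom.mem_ker, hx, hz]

theorem isBlowupChart_two (h : FlopCoords κ x y z) : IsBlowupChart (BlowupRing.of : A →+* BlowupRing A y x)
    (Ideal.span {x, y} * Ideal.span {x, y * z}) (x * x) := by
  have := h.isDomain
  have := h.isDomain_two
  have hx : (BlowupRing.of x : BlowupRing A y x) ≠ 0 :=
    (map_ne_zero_iff _ h.of_two_injective).2 h.x_ne_zero
  refine .of_exists_lift (Ideal.mul_mem_mul (Ideal.subset_span (by simp))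
    (Ideal.subset_span (by simp))) ?_ ?_ ?_ ?_
  · rw [map_mul]; exact mem_nonZeroDivisors_of_ne_zero (mul_ne_zero hx hx)
  · have h1 : (Ideal.span {x, y}).map (BlowupRing.of : A →+* BlowupRing A y x) =
        Ideal.span {BlowupRing.of x} := by
      rw [Ideal.map_span, Set.image_pair]
      refine le_antisymm (Ideal.span_le.2 ?_) (Ideal.span_mono (by simp))
      rintro _ (rfl | rfl)
      · exact Ideal.mem_span_singleton_self _
      · rw [BlowupRing.of_eq]; exact Ideal.mul_mem_right _ _ (Ideal.mem_span_singleton_self _)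
    have h2 : (Ideal.span {x, y * z}).map (BlowupRing.of : A →+* BlowupRing A y x) =
        Ideal.span {BlowupRing.of x} := by
      rw [Ideal.map_span, Set.image_pair]
      refine le_antisymm (Ideal.span_le.2 ?_) (Ideal.span_mono (by simp))
      rintro _ (rfl | rfl)
      · exact Ideal.mem_span_singleton_self _
      · rw [map_mul, BlowupRing.of_eq, mul_assoc]
        exact Ideal.mul_mem_right _ _ (Ideal.mem_span_singleton_self _)
    rw [Ideal.map_mul, h1, h2, Ideal.span_singleton_mul_span_singleton, map_mul]
  · intro r
    obtain ⟨n, c, hc⟩ := BlowupRing.exists_pow_mul_eq r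
    exact ⟨n, x ^ n * c, by rw [map_mul, map_mul, ← hc, map_pow]; ring⟩
  · intro S _ ψ h1 h2
    have : ψ (x * y) ∈ Ideal.span {ψ (x * x)} := by
      rw [← h2, mul_comm x y]
      exact Ideal.mem_map_of_mem ψ (Ideal.mul_mem_mul (Ideal.subset_span (by simp))
        (Ideal.subset_span (by simp)))
    obtain ⟨s, hs⟩ := Ideal.mem_span_singleton'.1 this
    rw [map_mul] at h1
    have hs' : ψ y = ψ x * s := by
      refine (mul_cancel_left_mem_nonZeroDivisors (mul_mem_nonZeroDivisors.1 h1).1).1 ?_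
      rw [← map_mul, ← hs, map_mul]; ring
    exact ⟨BlowupRing.lift ψ s hs', RingHom.ext fun c ↦ BlowupRing.lift_of ψ s hs' c⟩

theorem z_regular_pre (h : FlopCoords κ x y z) (c d : BlowupRing A x y)
    (e : BlowupRing.of z * c = BlowupRing.frac * d) : BlowupRing.frac ∣ c := by
  have hx : Ideal.Quotient.mk (Ideal.span {x}) x = 0 :=
    Ideal.Quotient.eq_zero_iff_mem.2 (Ideal.mem_span_singleton_self _)
  have hrel : Ideal.Quotient.mk (Ideal.span {x}) x = Ideal.Quotient.mk (Ideal.span {x}) y * 0 := by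
    rw [hx, mul_zero]
  let σ : BlowupRing A x y →+* A ⧸ Ideal.span {x} := BlowupRing.lift _ 0 hrel
  have hker (r : BlowupRing A x y) : ∃ c : A, BlowupRing.frac ∣ r - BlowupRing.of c := by
    obtain ⟨p, rfl⟩ := BlowupRing.mk_surjective r
    refine ⟨p.coeff 0, (p.divX).eval₂ BlowupRing.of BlowupRing.frac, ?_⟩
    have h1 : p.eval₂ BlowupRing.of BlowupRing.frac = (p.divX * X + C (p.coeff 0)).eval₂
      (BlowupRing.of : A →+* BlowupRing A x y) BlowupRing.frac := by rw [divX_mul_X_add]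
    rw [h1, eval₂_add, eval₂_mul_X, eval₂_C]
    ring
  obtain ⟨c', u, hu⟩ := hker c
  have h1 := congrArg σ e
  have h2 : σ BlowupRing.frac = 0 := BlowupRing.lift_frac _ _ _
  have h3 : ∀ a, σ (BlowupRing.of a) = Ideal.Quotient.mk _ a := fun a ↦ BlowupRing.lift_of _ _ _ a
  have h4 : c = BlowupRing.of c' + BlowupRing.frac * u := by rw [← hu]; ring
  rw [map_mul, map_mul, h2, zero_mul, h4, map_add, map_mul, h2, zero_mul, add_zero, h3, h3, ← map_mul,
    Ideal.Quotient.eq_zero_iff_mem, Ideal.mem_span_singleton] at h1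
  obtain ⟨v, hv⟩ := h1
  obtain ⟨w, hw⟩ := h.z_regular c' v hv
  rw [h4, hw, map_mul, BlowupRing.of_eq]
  exact ⟨BlowupRing.of y * BlowupRing.of w + u, by ring⟩

theorem frac_ne_zero (h : FlopCoords κ x y z) : (BlowupRing.frac : BlowupRing A x y) ≠ 0 := by
  intro e
  have h1 := BlowupRing.of_eq (a := x) (b := y)
  rw [e, mul_zero] at h1
  exact h.x_ne_zero (h.of_pre_injective (h1.trans (map_zero _).symm))

theorem exists_ev_pre (h : FlopCoords κ x y z) : ∃ ev : BlowupRing A x y →+* K[X],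
    ev.comp (BlowupRing.of.comp κ) = C ∧ ev BlowupRing.frac = X ∧
    RingHom.ker ev = Ideal.span {BlowupRing.of y, BlowupRing.of z} := by
  obtain ⟨ρ, hρκ, hρ⟩ := h.exists_residue
  have hx : ρ x = 0 := by rw [← RingHom.mem_ker, hρ]; exact Ideal.subset_span (by simp)
  have hy : ρ y = 0 := by rw [← RingHom.mem_ker, hρ]; exact Ideal.subset_span (by simp)
  have hz : ρ z = 0 := by rw [← RingHom.mem_ker, hρ]; exact Ideal.subset_span (by simp)
  have hrel : (C.comp ρ) x = (C.comp ρ) y * (X : K[X]) := by simp [hx, hy]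
  refine ⟨BlowupRing.lift (C.comp ρ) X hrel, ?_, BlowupRing.lift_frac _ _ _, le_antisymm ?_ ?_⟩
  · ext c
    rw [RingHom.comp_apply, RingHom.comp_apply, BlowupRing.lift_of, RingHom.comp_apply,
      ← RingHom.comp_apply ρ κ, hρκ, RingHom.id_apply]
  · intro r hr
    obtain ⟨p, rfl⟩ := BlowupRing.mk_surjective r
    rw [RingHom.mem_ker, hom_eval₂, BlowupRing.lift_frac] at hr
    have hr' : p.map ρ = 0 := by
      rw [← hr, ← eval₂_C_X (p := p.map ρ), eval₂_map]
      congr 1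
      ext c
      simp
    refine BlowupRing.eval_mem _ _ _ _ fun n ↦ ?_
    have hn : p.coeff n ∈ RingHom.ker ρ := by
      rw [RingHom.mem_ker, ← coeff_map, hr', coeff_zero]
    rw [hρ] at hn
    refine mem_span_pair_of_mem_triple _ ?_ (Ideal.subset_span (by simp))
      (Ideal.subset_span (by simp)) hn
    rw [BlowupRing.of_eq]
    exact Ideal.mul_mem_right _ _ (Ideal.subset_span (by simp))
  · rw [Ideal.span_le]
    rintro _ (rfl | rfl) <;> simp [RingHom.mem_ker, hy, hz]

theorem lineChart_one (h : FlopCoords κ x y z) :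
    LineChart (BlowupRing.of.comp (BlowupRing.of.comp κ) :
      K →+* BlowupRing (BlowupRing A x y) (BlowupRing.of z) BlowupRing.frac)
    (BlowupRing.of (BlowupRing.of y)) BlowupRing.frac (BlowupRing.of BlowupRing.frac) := by
  have := h.isDomain_pre
  have := h.isNoetherianRing
  have hD := h.isPrime_xy
  obtain ⟨σ, hs, hσ, hσc, hσf⟩ := ker_pre (x := x) (y := y)
  obtain ⟨ev, h1, h2, h3⟩ := h.exists_ev_pre
  refine LineChart.of_fraction h.frac_ne_zero h.z_regular_pre ?_ σ hs hσ ?_ (hσc z) hσf ev h1 h2 h3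
  · rw [map_ne_zero_iff _ h.of_pre_injective]
    exact h.y_ne_zero
  · exact fun e ↦ h.z_notMem (Ideal.Quotient.eq_zero_iff_mem.1 e)

theorem isBlowupChart_one (h : FlopCoords κ x y z) :
    IsBlowupChart ((BlowupRing.of : BlowupRing A x y →+* BlowupRing (BlowupRing A x y)
      (BlowupRing.of z) BlowupRing.frac).comp BlowupRing.of)
    (Ideal.span {x, y} * Ideal.span {x, y * z}) (x * y) := by
  have := h.isDomain_pre
  exact IsBlowupChart.of_fraction h.of_pre_injective h.frac_ne_zero h.z_regular_pre h.x_ne_zero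
    h.y_ne_zero BlowupRing.of_eq BlowupRing.exists_pow_mul_eq fun ψ s hs ↦
      ⟨BlowupRing.lift ψ s hs, RingHom.ext fun c ↦ BlowupRing.lift_of ψ s hs c,
        BlowupRing.lift_frac ψ s hs⟩

end FlopCoords

end LineCharts

section LocalIdentities

theorem comap_injective_of_bijective {R S : Type*} [CommRing R] [CommRing S] {φ : R →+* S}
    (hφ : Function.Bijective φ) {I J : Ideal S} (h : I.comap φ = J.comap φ) : I = J := by
  rw [← Ideal.map_comap_of_surjective φ hφ.2 I, h, Ideal.map_comap_of_surjective φ hφ.2 J]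

/-- Equality of ideal sheaves can be checked on an open cover. -/
theorem idealSheaf_ext_of_openCover {X : Scheme.{u}} {I J : X.IdealSheafData}
    (h : ∀ x : X, ∃ (T : Scheme.{u}) (j : T ⟶ X) (_ : IsOpenImmersion j), x ∈ Set.range j ∧
      I.comap j = J.comap j) : I = J := by
  refine ideal_ext_of_forall fun x ↦ ?_
  obtain ⟨T, j, hj, ⟨t, rfl⟩, hIJ⟩ := h x
  obtain ⟨V, hV, htV, -⟩ := T.isBasis_affineOpens.exists_subset_of_mem_open
    (show t ∈ (⊤ : T.Opens) from trivial) (Opens.isOpen _)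
  obtain ⟨V, hV, rfl⟩ := hV
  refine ⟨⟨j ''ᵁ V, hV.image_of_isOpenImmersion j⟩, ⟨t, htV, rfl⟩, ?_⟩
  have h1 := congrArg (fun K ↦ Scheme.IdealSheafData.ideal K ⟨V, hV⟩) hIJ
  simp only [Scheme.IdealSheafData.ideal_comap_of_isOpenImmersion] at h1
  exact comap_injective_of_bijective
    ((ConcreteCategory.isIso_iff_bijective (j.appIso V).inv).1 inferInstance) h1

theorem mem_closure_iff_le {R : CommRingCat.{u}} {S : Set (Spec R)} {P : Ideal R} [hP : P.IsPrime]
    (h1 : ∀ q ∈ S, P ≤ PrimeSpectrum.asIdeal (R := R) q)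
    (h2 : (show Spec R from (⟨P, hP⟩ : PrimeSpectrum R)) ∈ S) (q : Spec R) :
    q ∈ closure S ↔ P ≤ PrimeSpectrum.asIdeal (R := R) q := by
  constructor
  · intro hq
    have hcl : IsClosed {q : Spec R | P ≤ PrimeSpectrum.asIdeal (R := R) q} :=
      PrimeSpectrum.isClosed_zeroLocus (R := R) (P : Set R)
    exact closure_minimal (fun q hq ↦ h1 q hq) hcl hq
  · intro hq
    have hs : (⟨P, hP⟩ : PrimeSpectrum R) ⤳ q := (PrimeSpectrum.le_iff_specializes _ _).1 hq
    exact hs.mem_closed isClosed_closure (subset_closure h2)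

theorem mem_support_vanishingIdeal {X : Scheme.{u}} (Z : Closeds X) (x : X) :
    x ∈ (Scheme.IdealSheafData.vanishingIdeal Z).support ↔ x ∈ Z := by
  have := Scheme.IdealSheafData.coe_support_vanishingIdeal Z
  rw [← SetLike.mem_coe, this]; rfl

theorem mem_iff_specIdeal_le {X Y : Scheme.{u}} (Z : Closeds X) (π : Y ⟶ X) {R : CommRingCat.{u}}
    (c : Spec R ⟶ Y) (q : Spec R) : π (c q) ∈ Z ↔
      specIdeal ((Scheme.IdealSheafData.vanishingIdeal Z).comap (c ≫ π)) ≤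
        PrimeSpectrum.asIdeal (R := R) q := by
  rw [← mem_support_iff_specIdeal, Scheme.IdealSheafData.support_comap, ← mem_support_vanishingIdeal]
  rfl

/-- The structure map of the ring of sections of a scheme over a field. -/
def structureHom {K : Type u} [Field K] {X : Scheme.{u}} (s : X ⟶ Spec (.of K)) (U : X.Opens) :
    K →+* Γ(X, U) :=
  ((Scheme.ΓSpecIso (.of K)).inv ≫ s.appLE ⊤ U le_top).hom

/-- Local equations of two curves near their intersection point. -/
structure HasFlopCoords {K : Type u} [Field K] {X : Scheme.{u}} (s : X ⟶ Spec (.of K))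
    (B C : Closeds X) (p : X) (U : X.affineOpens) (x y z : Γ(X, U)) : Prop where
  inter_eq : (B : Set X) ∩ C = {p}
  mem : p ∈ U.1
  coords : FlopCoords (structureHom s U.1) x y z
  ideal_left : (Scheme.IdealSheafData.vanishingIdeal B).ideal U = Ideal.span {x, y}
  ideal_right : (Scheme.IdealSheafData.vanishingIdeal C).ideal U = Ideal.span {x, z}

theorem HasFlopCoords.symm {K : Type u} [Field K] {X : Scheme.{u}} {s : X ⟶ Spec (.of K)}
    {B C : Closeds X} {p : X} {U : X.affineOpens} {x y z : Γ(X, U)}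
    (h : HasFlopCoords s B C p U x y z) : HasFlopCoords s C B p U x z y where
  inter_eq := by rw [Set.inter_comm, h.inter_eq]
  mem := h.mem
  coords := h.coords.symm
  ideal_left := h.ideal_right
  ideal_right := h.ideal_left

/-- The ideal sheaf of the union of two curves. -/
abbrev unionIdeal {X : Scheme.{u}} (B C : Closeds X) : X.IdealSheafData :=
  Scheme.IdealSheafData.vanishingIdeal (B ⊔ C)

theorem span_pair_mul_right {A : Type*} [CommRing A] (a b : A) :
    Ideal.span {a, a * b} = Ideal.span {a} := by
  refine le_antisymm (Ideal.span_le.2 ?_) (Ideal.span_mono (by simp))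
  rintro _ (rfl | rfl)
  · exact Ideal.mem_span_singleton_self _
  · exact Ideal.mul_mem_right _ _ (Ideal.mem_span_singleton_self _)

theorem span_singleton_mul_span_pair {A : Type*} [CommRing A] (a b c : A) :
    Ideal.span {a} * Ideal.span {b, c} = Ideal.span {a * b, a * c} := by
  rw [Ideal.span_mul_span', Set.singleton_mul, Set.image_pair]

theorem span_pair_inf {A : Type*} [CommRing A] {x y z : A} (hP : (Ideal.span {x, z}).IsPrime)
    (hy : y ∉ Ideal.span {x, z}) :
    Ideal.span {x, y} ⊓ Ideal.span {x, z} = Ideal.span {x, y * z} := by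
  apply le_antisymm
  · rintro f ⟨h1, h2⟩
    obtain ⟨u, v, rfl⟩ := Ideal.mem_span_pair.1 h1
    have h3 : v * y ∈ Ideal.span {x, z} := by
      have := sub_mem h2 (Ideal.mul_mem_left _ u
        (show x ∈ Ideal.span {x, z} from Ideal.subset_span (by simp)))
      simpa using this
    obtain ⟨a, b, hab⟩ := Ideal.mem_span_pair.1 ((hP.mem_or_mem h3).resolve_right hy)
    rw [← hab]
    exact Ideal.mem_span_pair.2 ⟨u + a * y, b, by ring⟩
  · rw [Ideal.span_le]
    rintro _ (rfl | rfl)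
    · exact ⟨Ideal.subset_span (by simp), Ideal.subset_span (by simp)⟩
    · exact ⟨Ideal.mul_mem_right _ _ (Ideal.subset_span (by simp)),
        Ideal.mul_mem_left _ _ (Ideal.subset_span (by simp))⟩

/-- The ideal of the strict transform of `C` in a chart of the blow-up of `B`. -/
theorem FlopCoords.isPrime_strict {K A : Type u} [Field K] [CommRing A] {κ : K →+* A} {x y z : A}
    (h : FlopCoords κ x y z) :
    (Ideal.span {BlowupRing.frac, BlowupRing.of z} : Ideal (BlowupRing A x y)).IsPrime ∧
      BlowupRing.of y ∉ (Ideal.span {BlowupRing.frac, BlowupRing.of z} :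
        Ideal (BlowupRing A x y)) := by
  have hP := h.isPrime_xz
  have hx : Ideal.Quotient.mk (Ideal.span {x, z}) x = 0 :=
    Ideal.Quotient.eq_zero_iff_mem.2 (Ideal.subset_span (by simp))
  have hz : Ideal.Quotient.mk (Ideal.span {x, z}) z = 0 :=
    Ideal.Quotient.eq_zero_iff_mem.2 (Ideal.subset_span (by simp))
  have hrel : Ideal.Quotient.mk (Ideal.span {x, z}) x =
    Ideal.Quotient.mk (Ideal.span {x, z}) y * 0 := by rw [hx, mul_zero]
  let σ : BlowupRing A x y →+* A ⧸ Ideal.span {x, z} := BlowupRing.lift _ 0 hrel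
  have h2 : σ BlowupRing.frac = 0 := BlowupRing.lift_frac _ _ _
  have h3 : ∀ a, σ (BlowupRing.of a) = Ideal.Quotient.mk _ a := fun a ↦ BlowupRing.lift_of _ _ _ a
  have hker : RingHom.ker σ = Ideal.span {BlowupRing.frac, BlowupRing.of z} := by
    apply le_antisymm
    · intro r hr
      obtain ⟨p, rfl⟩ := BlowupRing.mk_surjective r
      have h0 : p.eval₂ BlowupRing.of (BlowupRing.frac : BlowupRing A x y) =
          p.divX.eval₂ BlowupRing.of BlowupRing.frac * BlowupRing.frac +
            BlowupRing.of (p.coeff 0) := by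
        have h1 : p.eval₂ BlowupRing.of (BlowupRing.frac : BlowupRing A x y) =
          (p.divX * Polynomial.X + Polynomial.C (p.coeff 0)).eval₂ BlowupRing.of
            BlowupRing.frac := by rw [Polynomial.divX_mul_X_add]
        rw [h1, Polynomial.eval₂_add, Polynomial.eval₂_mul_X, Polynomial.eval₂_C]
      rw [RingHom.mem_ker, h0, map_add, map_mul, h2, mul_zero, zero_add, h3,
        Ideal.Quotient.eq_zero_iff_mem] at hr
      rw [h0]
      refine add_mem (Ideal.mul_mem_left _ _ (Ideal.subset_span (by simp))) ?_
      obtain ⟨u, v, huv⟩ := Ideal.mem_span_pair.1 hr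
      rw [← huv, map_add, map_mul, map_mul, BlowupRing.of_eq]
      exact add_mem (Ideal.mul_mem_left _ _ (Ideal.mul_mem_left _ _ (Ideal.subset_span (by simp))))
        (Ideal.mul_mem_left _ _ (Ideal.subset_span (by simp)))
    · rw [Ideal.span_le]
      rintro _ (rfl | rfl)
      · exact h2
      · exact (h3 z).trans hz
  rw [← hker]
  refine ⟨RingHom.ker_isPrime σ, fun e ↦ h.y_notMem ?_⟩
  rw [RingHom.mem_ker, h3] at e
  exact Ideal.Quotient.eq_zero_iff_mem.1 e

theorem comap_eq_of_preimage_eq {X T : Scheme.{u}} {Z Z' : Closeds X} (V : X.Opens)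
    (h : ∀ x ∈ V, x ∈ Z ↔ x ∈ Z') (j : T ⟶ X) (hj : ∀ t, j t ∈ V) :
    (Scheme.IdealSheafData.vanishingIdeal Z).comap j =
      (Scheme.IdealSheafData.vanishingIdeal Z').comap j := by
  have hr : Set.range j ⊆ Set.range V.ι := by
    rw [Scheme.Opens.range_ι]
    rintro _ ⟨t, rfl⟩
    exact hj t
  have hV : (Scheme.IdealSheafData.vanishingIdeal Z).comap V.ι =
      (Scheme.IdealSheafData.vanishingIdeal Z').comap V.ι := by
    rw [vanishingIdeal_comap, vanishingIdeal_comap]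
    congr 1
    ext v
    exact h v.1 v.2
  rw [← IsOpenImmersion.lift_fac V.ι j hr, Scheme.IdealSheafData.comap_comp,
    Scheme.IdealSheafData.comap_comp, hV]

theorem comap_vanishingIdeal_eq_top {X T : Scheme.{u}} {Z : Closeds X} (j : T ⟶ X)
    (h : ∀ t, j t ∉ Z) : (Scheme.IdealSheafData.vanishingIdeal Z).comap j = ⊤ :=
  comap_eq_top_of_le _ j fun t ht ↦ h t ((mem_support_vanishingIdeal Z _).1 ht)

theorem comap_strictTransform {X Y T : Scheme.{u}} (π : Y ⟶ X) (Z V : Set X) (c : T ⟶ Y)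
    [IsOpenImmersion c] :
    (Scheme.IdealSheafData.vanishingIdeal (strictTransform π Z V)).comap c =
      Scheme.IdealSheafData.vanishingIdeal (strictTransform (c ≫ π) Z V) := by
  rw [vanishingIdeal_comap]
  congr 1
  ext t
  have h := c.isOpenEmbedding.isOpenMap.preimage_closure_eq_closure_preimage c.continuous
    (π ⁻¹' (V \ Z))
  exact Set.ext_iff.1 h t

namespace HasFlopCoords

variable {K : Type u} [Field K] {X : Scheme.{u}} {s : X ⟶ Spec (.of K)}
    {B C : Closeds X} {p : X} {U : X.affineOpens} {x y z : Γ(X, U)}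

theorem ideal_union (h : HasFlopCoords s B C p U x y z) :
    (unionIdeal B C).ideal U = Ideal.span {x, y * z} := by
  rw [← span_pair_inf h.coords.isPrime_xz h.coords.y_notMem, ← h.ideal_left, ← h.ideal_right]
  ext f
  rw [Ideal.mem_inf, mem_vanishingIdeal_iff, mem_vanishingIdeal_iff, mem_vanishingIdeal_iff]
  constructor
  · exact fun h ↦ ⟨fun x hx ↦ h x (Or.inl hx), fun x hx ↦ h x (Or.inr hx)⟩
  · rintro ⟨h1, h2⟩ x (hx | hx)
    exacts [h1 x hx, h2 x hx]

theorem p_mem_left (h : HasFlopCoords s B C p U x y z) : p ∈ B :=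
  (h.inter_eq.ge rfl).1

theorem p_mem_right (h : HasFlopCoords s B C p U x y z) : p ∈ C :=
  (h.inter_eq.ge rfl).2

theorem eq_of_mem (h : HasFlopCoords s B C p U x y z) {a : X} (hB : a ∈ B) (hC : a ∈ C) : a = p :=
  h.inter_eq.le ⟨hB, hC⟩

theorem chartMap_mem_left_iff (h : HasFlopCoords s B C p U x y z) {R : CommRingCat.{u}}
    (φ : Γ(X, U) ⟶ R) (q : Spec R) : chartMap U φ q ∈ B ↔
      φ.hom x ∈ PrimeSpectrum.asIdeal (R := R) q ∧ φ.hom y ∈ PrimeSpectrum.asIdeal (R := R) q := by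
  have h1 := mem_iff_specIdeal_le B (chartMap U φ) (𝟙 _) q
  rw [Category.id_comp, specIdeal_comap_chartMap, h.ideal_left, Ideal.map_le_iff_le_comap,
    Ideal.span_le] at h1
  refine h1.trans ⟨fun h ↦ ⟨h (by simp), h (by simp)⟩, ?_⟩
  rintro ⟨h1, h2⟩ _ (rfl | rfl)
  exacts [h1, h2]

theorem chartMap_mem_right_iff (h : HasFlopCoords s B C p U x y z) {R : CommRingCat.{u}}
    (φ : Γ(X, U) ⟶ R) (q : Spec R) : chartMap U φ q ∈ C ↔
      φ.hom x ∈ PrimeSpectrum.asIdeal (R := R) q ∧ φ.hom z ∈ PrimeSpectrum.asIdeal (R := R) q :=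
  h.symm.chartMap_mem_left_iff φ q

theorem chartMap_eq_iff (h : HasFlopCoords s B C p U x y z) {R : CommRingCat.{u}}
    (φ : Γ(X, U) ⟶ R) (q : Spec R) : chartMap U φ q = p ↔
      φ.hom x ∈ PrimeSpectrum.asIdeal (R := R) q ∧ φ.hom y ∈ PrimeSpectrum.asIdeal (R := R) q ∧
        φ.hom z ∈ PrimeSpectrum.asIdeal (R := R) q := by
  have h1 : chartMap U φ q = p ↔ chartMap U φ q ∈ B ∧ chartMap U φ q ∈ C :=
    ⟨fun e ↦ e ▸ ⟨h.p_mem_left, h.p_mem_right⟩, fun e ↦ h.eq_of_mem e.1 e.2⟩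
  rw [h1, h.chartMap_mem_left_iff, h.chartMap_mem_right_iff]
  tauto

theorem comap_chart_left (h : HasFlopCoords s B C p U x y z) {R : CommRingCat.{u}}
    (φ : Γ(X, U) ⟶ R) {t : R} (ht : φ.hom y = φ.hom x * t) :
    specIdeal ((Scheme.IdealSheafData.vanishingIdeal B).comap (chartMap U φ)) =
      Ideal.span {φ.hom x} := by
  rw [specIdeal_comap_chartMap, h.ideal_left, Ideal.map_span, Set.image_pair, ht]
  exact span_pair_mul_right _ _

theorem comap_chart_union (h : HasFlopCoords s B C p U x y z) {R : CommRingCat.{u}}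
    (φ : Γ(X, U) ⟶ R) {t : R} (ht : φ.hom (y * z) = φ.hom x * t) :
    specIdeal ((unionIdeal B C).comap (chartMap U φ)) = Ideal.span {φ.hom x} := by
  rw [specIdeal_comap_chartMap, h.ideal_union, Ideal.map_span, Set.image_pair, ht]
  exact span_pair_mul_right _ _

theorem comap_chart_left' (h : HasFlopCoords s B C p U x y z) {R : CommRingCat.{u}}
    (φ : Γ(X, U) ⟶ R) {t : R} (ht : φ.hom x = φ.hom y * t) :
    specIdeal ((Scheme.IdealSheafData.vanishingIdeal B).comap (chartMap U φ)) =
      Ideal.span {φ.hom y} := by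
  rw [specIdeal_comap_chartMap, h.ideal_left, Ideal.map_span, Set.image_pair, ht, Set.pair_comm]
  exact span_pair_mul_right _ _

theorem comap_chart_union' (h : HasFlopCoords s B C p U x y z) {R : CommRingCat.{u}}
    (φ : Γ(X, U) ⟶ R) {t : R} (ht : φ.hom x = φ.hom (y * z) * t) :
    specIdeal ((unionIdeal B C).comap (chartMap U φ)) = Ideal.span {φ.hom (y * z)} := by
  rw [specIdeal_comap_chartMap, h.ideal_union, Ideal.map_span, Set.image_pair, ht, Set.pair_comm]
  exact span_pair_mul_right _ _

/-- The strict transform of `C` does not meet the chart where `x` generates the ideal of `B`. -/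
theorem strictTransform_comap_eq_top (h : HasFlopCoords s B C p U x y z) {X₁ : Scheme.{u}}
    {π : X₁ ⟶ X} {R : CommRingCat.{u}} (φ : Γ(X, U) ⟶ R) (c : Spec R ⟶ X₁) [IsOpenImmersion c]
    (hc : c ≫ π = chartMap U φ) {t : R} (ht : φ.hom y = φ.hom x * t) :
    (Scheme.IdealSheafData.vanishingIdeal (strictTransform π B C)).comap c = ⊤ := by
  rw [comap_strictTransform, hc]
  have : strictTransform (chartMap U φ) B C = ⊥ := by
    ext q
    have h1 : chartMap U φ ⁻¹' ((C : Set X) \ B) = ∅ := by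
      ext q
      refine iff_of_false ?_ id
      rintro ⟨h1, h2⟩
      have h3 := (h.chartMap_mem_right_iff _ q).1 h1
      exact h2 ((h.chartMap_mem_left_iff _ q).2 ⟨h3.1, ht ▸ Ideal.mul_mem_right _ _ h3.1⟩)
    change q ∈ closure _ ↔ _
    rw [h1, closure_empty]
    rfl
  rw [this]
  exact Scheme.IdealSheafData.vanishingIdeal_bot

theorem specIdeal_strictTransform (h : HasFlopCoords s B C p U x y z) {X₁ : Scheme.{u}}
    {π : X₁ ⟶ X} {R : CommRingCat.{u}} (φ : Γ(X, U) ⟶ R) (c : Spec R ⟶ X₁) [IsOpenImmersion c]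
    (hc : c ≫ π = chartMap U φ) {t : R} (ht : φ.hom x = φ.hom y * t)
    (hP : (Ideal.span {t, φ.hom z}).IsPrime) (hy : φ.hom y ∉ Ideal.span {t, φ.hom z}) :
    specIdeal ((Scheme.IdealSheafData.vanishingIdeal (strictTransform π B C)).comap c) =
      Ideal.span {t, φ.hom z} := by
  rw [comap_strictTransform, hc]
  refine specIdeal_vanishingIdeal_of_isPrime _ _ (mem_closure_iff_le ?_ ?_)
  · rintro q ⟨h1, h2⟩
    have h3 := (h.chartMap_mem_right_iff _ q).1 h1
    have h4 := mt (h.chartMap_mem_left_iff _ q).2 h2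
    have h5 := h3.1
    rw [ht] at h5
    rw [Ideal.span_le]
    rintro _ (rfl | rfl)
    · exact ((PrimeSpectrum.isPrime (R := R) q).mem_or_mem h5).resolve_left fun h6 ↦ h4 ⟨h3.1, h6⟩
    · exact h3.2
  · have hx : φ.hom x ∈ Ideal.span {t, φ.hom z} := by
      rw [ht]; exact Ideal.mul_mem_left _ _ (Ideal.subset_span (by simp))
    exact ⟨(h.chartMap_mem_right_iff _ _).2 ⟨hx, Ideal.subset_span (by simp)⟩,
      fun h1 ↦ hy ((h.chartMap_mem_left_iff _ _).1 h1).2⟩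

theorem mul_strictTransform_chart_left (h : HasFlopCoords s B C p U x y z) {X₁ : Scheme.{u}}
    {π : X₁ ⟶ X} {R : CommRingCat.{u}} (φ : Γ(X, U) ⟶ R) (c : Spec R ⟶ X₁) [IsOpenImmersion c]
    (hc : c ≫ π = chartMap U φ) {t : R} (ht : φ.hom y = φ.hom x * t) :
    (Scheme.IdealSheafData.vanishingIdeal (strictTransform π B C) *
      (Scheme.IdealSheafData.vanishingIdeal B).comap π).comap c =
      ((unionIdeal B C).comap π).comap c := by
  apply specIdeal_injective
  rw [comap_mul, h.strictTransform_comap_eq_top φ c hc ht, mul_comm, idealSheaf_mul_top,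
    ← Scheme.IdealSheafData.comap_comp, ← Scheme.IdealSheafData.comap_comp, hc,
    h.comap_chart_left φ ht, h.comap_chart_union φ (t := t * φ.hom z) (by rw [map_mul, ht]; ring)]

theorem mul_strictTransform_chart_right (h : HasFlopCoords s B C p U x y z) {X₁ : Scheme.{u}}
    {π : X₁ ⟶ X} {R : CommRingCat.{u}} (φ : Γ(X, U) ⟶ R) (c : Spec R ⟶ X₁) [IsOpenImmersion c]
    (hc : c ≫ π = chartMap U φ) {t : R} (ht : φ.hom x = φ.hom y * t)
    (hP : (Ideal.span {t, φ.hom z}).IsPrime) (hy : φ.hom y ∉ Ideal.span {t, φ.hom z}) :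
    (Scheme.IdealSheafData.vanishingIdeal (strictTransform π B C) *
      (Scheme.IdealSheafData.vanishingIdeal B).comap π).comap c =
      ((unionIdeal B C).comap π).comap c := by
  apply specIdeal_injective
  rw [comap_mul, specIdeal_mul, h.specIdeal_strictTransform φ c hc ht hP hy,
    ← Scheme.IdealSheafData.comap_comp, ← Scheme.IdealSheafData.comap_comp, hc,
    h.comap_chart_left' φ ht, specIdeal_comap_chartMap, h.ideal_union, Ideal.map_span,
    Set.image_pair, ht, map_mul, mul_comm, span_singleton_mul_span_pair]

theorem mul_strictTransform_of_notMem_left {X₁ : Scheme.{u}} {π : X₁ ⟶ X}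
    (hπ : IsBlowup π (Scheme.IdealSheafData.vanishingIdeal B)) {a : X₁} (ha : π a ∉ B) :
    ∃ (T : Scheme.{u}) (j : T ⟶ X₁) (_ : IsOpenImmersion j), a ∈ Set.range j ∧
    (Scheme.IdealSheafData.vanishingIdeal (strictTransform π B C) *
      (Scheme.IdealSheafData.vanishingIdeal B).comap π).comap j =
      ((unionIdeal B C).comap π).comap j := by
  let V : X.Opens := B.compl
  have hBV : (Scheme.IdealSheafData.vanishingIdeal B).comap V.ι = ⊤ :=
    comap_vanishingIdeal_eq_top V.ι fun t ↦ t.2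
  obtain ⟨σ, hσ, hσπ, hσr⟩ := hπ.exists_section V.ι (by rw [hBV]; exact isEffectiveCartier_top)
  have har : a ∈ σ.opensRange := by
    rw [hσr, Scheme.Opens.opensRange_ι]; exact ha
  refine ⟨_, σ, hσ, har, ?_⟩
  rw [comap_mul, ← Scheme.IdealSheafData.comap_comp, ← Scheme.IdealSheafData.comap_comp, hσπ, hBV,
    idealSheaf_mul_top, comap_strictTransform, hσπ, vanishingIdeal_comap]
  congr 1
  ext t
  have h1 : V.ι ⁻¹' ((C : Set X) \ B) = V.ι ⁻¹' (C : Set X) := by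
    ext t
    exact ⟨fun h ↦ h.1, fun h ↦ ⟨h, t.2⟩⟩
  change t ∈ closure (V.ι ⁻¹' ((C : Set X) \ B)) ↔ V.ι t ∈ B ⊔ C
  rw [h1, (C.isClosed.preimage V.ι.continuous).closure_eq]
  exact ⟨fun h ↦ Or.inr h, fun h ↦ h.resolve_left t.2⟩

theorem strictTransform_subset {X₁ : Scheme.{u}} {π : X₁ ⟶ X} :
    (strictTransform π (B : Set X) C : Set X₁) ⊆ π ⁻¹' C :=
  closure_minimal (Set.preimage_mono Set.sdiff_subset) (C.isClosed.preimage π.continuous)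

theorem mul_strictTransform_of_notMem_right {X₁ : Scheme.{u}} {π : X₁ ⟶ X} {a : X₁}
    (ha : π a ∉ C) : ∃ (T : Scheme.{u}) (j : T ⟶ X₁) (_ : IsOpenImmersion j), a ∈ Set.range j ∧
    (Scheme.IdealSheafData.vanishingIdeal (strictTransform π B C) *
      (Scheme.IdealSheafData.vanishingIdeal B).comap π).comap j =
      ((unionIdeal B C).comap π).comap j := by
  let V : X.Opens := C.compl
  refine ⟨_, (π ⁻¹ᵁ V).ι, inferInstance, by rw [Scheme.Opens.range_ι]; exact ha, ?_⟩
  have h1 : (Scheme.IdealSheafData.vanishingIdeal (strictTransform π B C)).comap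
      (π ⁻¹ᵁ V).ι = ⊤ :=
    comap_vanishingIdeal_eq_top (π ⁻¹ᵁ V).ι fun t ht ↦ t.2 (strictTransform_subset ht)
  rw [comap_mul, h1, mul_comm, idealSheaf_mul_top, ← Scheme.IdealSheafData.comap_comp,
    ← Scheme.IdealSheafData.comap_comp]
  refine comap_eq_of_preimage_eq V (fun t ht ↦ ?_) _ fun t ↦ t.2
  exact ⟨fun h ↦ Or.inl h, fun h ↦ h.resolve_right ht⟩

theorem isBlowupChart_left (h : HasFlopCoords s B C p U x y z) :
    IsBlowupChart (CommRingCat.ofHom (BlowupRing.of : Γ(X, U) →+* BlowupRing Γ(X, U) y x)).hom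
      ((Scheme.IdealSheafData.vanishingIdeal B).ideal U) x := by
  have := h.coords.isDomain
  rw [h.ideal_left, Set.pair_comm]
  exact BlowupRing.isBlowupChart h.coords.x_ne_zero h.coords.y_regular

theorem isBlowupChart_right (h : HasFlopCoords s B C p U x y z) :
    IsBlowupChart (CommRingCat.ofHom (BlowupRing.of : Γ(X, U) →+* BlowupRing Γ(X, U) x y)).hom
      ((Scheme.IdealSheafData.vanishingIdeal B).ideal U) y := by
  have := h.coords.isDomain
  rw [h.ideal_left]
  exact BlowupRing.isBlowupChart h.coords.y_ne_zero h.coords.x_regular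

theorem x_mem (h : HasFlopCoords s B C p U x y z) :
    x ∈ (Scheme.IdealSheafData.vanishingIdeal B).ideal U := by
  rw [h.ideal_left]; exact Ideal.subset_span (by simp)

theorem y_mem (h : HasFlopCoords s B C p U x y z) :
    y ∈ (Scheme.IdealSheafData.vanishingIdeal B).ideal U := by
  rw [h.ideal_left]; exact Ideal.subset_span (by simp)

/-- The inverse image of both curves in the blow-up of one of them. -/
theorem mul_strictTransform (h : HasFlopCoords s B C p U x y z) {X₁ : Scheme.{u}} {π : X₁ ⟶ X}
    (hπ : IsBlowup π (Scheme.IdealSheafData.vanishingIdeal B)) :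
    Scheme.IdealSheafData.vanishingIdeal (strictTransform π B C) *
      (Scheme.IdealSheafData.vanishingIdeal B).comap π = (unionIdeal B C).comap π := by
  refine idealSheaf_ext_of_openCover fun a ↦ ?_
  by_cases haB : π a ∈ B
  swap
  · exact mul_strictTransform_of_notMem_left hπ haB
  by_cases haC : π a ∈ C
  swap
  · exact mul_strictTransform_of_notMem_right haC
  have hap := h.eq_of_mem haB haC
  obtain ⟨a', ha', ha⟩ := exists_mem_chartLocus π _ hπ.isEffectiveCartier a U
    (by rw [hap]; exact h.mem) _ h.ideal_left
  obtain e | e : a' = x ∨ a' = y := ha'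
  · rw [e] at ha
    obtain ⟨c, hc, hcπ, hcr⟩ := hπ.exists_chart h.x_mem h.isBlowupChart_left.isChart
    exact ⟨_, c, hc, hcr.ge ha, h.mul_strictTransform_chart_left _ c hcπ BlowupRing.of_eq⟩
  · rw [e] at ha
    obtain ⟨c, hc, hcπ, hcr⟩ := hπ.exists_chart h.y_mem h.isBlowupChart_right.isChart
    obtain ⟨hP, hyP⟩ := h.coords.isPrime_strict
    exact ⟨_, c, hc, hcr.ge ha, h.mul_strictTransform_chart_right _ c hcπ BlowupRing.of_eq hP hyP⟩

end HasFlopCoords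

end LocalIdentities

section SmallResolution

theorem span_singleton_mul_left_cancel {A : Type*} [CommRing A] {a : A} (ha : a ∈ nonZeroDivisors A)
    {I J : Ideal A} (h : I * Ideal.span {a} = J * Ideal.span {a}) : I = J := by
  have key (I J : Ideal A) (h : I * Ideal.span {a} = J * Ideal.span {a}) : I ≤ J := by
    intro i hi
    have h1 : i * a ∈ J * Ideal.span {a} := h ▸ Ideal.mul_mem_mul hi (Ideal.mem_span_singleton_self a)
    obtain ⟨j, hj, e⟩ := Ideal.mem_mul_span_singleton.1 h1
    rwa [← (mul_cancel_right_mem_nonZeroDivisors ha).1 e]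
  exact le_antisymm (key I J h) (key J I h.symm)

theorem LineChart.isPrime_pair {K R : Type u} [Field K] [CommRing R] {κ : K →+* R} {f g τ : R}
    (h : LineChart κ f g τ) : (Ideal.span {f, g}).IsPrime := by
  obtain ⟨ev, -, -, hev⟩ := h.exists_ev
  exact hev ▸ RingHom.ker_isPrime ev

theorem LineChart.notMem {K R : Type u} [Field K] [CommRing R] {κ : K →+* R} {f g τ : R}
    (h : LineChart κ f g τ) : τ ∉ Ideal.span {f, g} := by
  obtain ⟨ev, -, h1, hev⟩ := h.exists_ev
  rw [← hev, RingHom.mem_ker, h1]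
  exact Polynomial.X_ne_zero

/-- The chart of the iterated blow-up where the ideal of the centers is generated by `x * y`. -/
structure IsChartOne {K A R : Type u} [Field K] [CommRing A] [CommRing R] (κ : K →+* A) (x y z : A)
    (φ : A →+* R) (t w : R) : Prop where
  eq_x : φ x = φ y * t
  eq_z : φ z = t * w
  lineChart : LineChart (φ.comp κ) (φ y) w t
  isBlowupChart : IsBlowupChart φ (Ideal.span {x, y} * Ideal.span {x, y * z}) (x * y)

/-- The chart of the iterated blow-up where the ideal of the centers is generated by `x * x`. -/
structure IsChartTwo {K A R : Type u} [Field K] [CommRing A] [CommRing R] (κ : K →+* A) (x y z : A)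
    (φ : A →+* R) (t : R) : Prop where
  eq_y : φ y = φ x * t
  lineChart : LineChart (φ.comp κ) (φ x) (φ z) t
  isBlowupChart : IsBlowupChart φ (Ideal.span {x, y} * Ideal.span {x, y * z}) (x * x)

theorem exists_isChartOne_of_comp {K A A₁ R : Type u} [Field K] [CommRing A] [CommRing A₁]
    [CommRing R] {κ : K →+* A} {x y z : A} {φ : A →+* A₁} {ι : A₁ →+* R} {t : A₁} {w : R}
    (hx : φ x = φ y * t) (hz : ι (φ z) = ι t * w)
    (h : LineChart (ι.comp (φ.comp κ)) (ι (φ y)) w (ι t))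
    (h' : IsBlowupChart (ι.comp φ) (Ideal.span {x, y} * Ideal.span {x, y * z}) (x * y)) :
    ∃ (R : Type u) (_ : CommRing R) (φ : A →+* R) (t w : R), IsChartOne κ x y z φ t w :=
  ⟨R, inferInstance, ι.comp φ, ι t, w, by rw [RingHom.comp_apply, hx, map_mul]; rfl, hz, h, h'⟩

theorem FlopCoords.exists_isChartOne {K A : Type u} [Field K] [CommRing A] {κ : K →+* A}
    {x y z : A} (h : FlopCoords κ x y z) :
    ∃ (R : Type u) (_ : CommRing R) (φ : A →+* R) (t w : R), IsChartOne κ x y z φ t w :=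
  exists_isChartOne_of_comp BlowupRing.of_eq BlowupRing.of_eq h.lineChart_one h.isBlowupChart_one

theorem FlopCoords.exists_isChartTwo {K A : Type u} [Field K] [CommRing A] {κ : K →+* A}
    {x y z : A} (h : FlopCoords κ x y z) :
    ∃ (R : Type u) (_ : CommRing R) (φ : A →+* R) (t : R), IsChartTwo κ x y z φ t :=
  ⟨BlowupRing A y x, inferInstance, BlowupRing.of, BlowupRing.frac, BlowupRing.of_eq,
    h.lineChart_two, h.isBlowupChart_two⟩

theorem span_pair_mul_span_pair_eq {A : Type*} [CommRing A] (x y z : A) :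
    Ideal.span {x, y} * Ideal.span {x, y * z} = Ideal.span {x * x, x * y, y * (y * z)} := by
  rw [Ideal.span_pair_mul_span_pair]
  apply le_antisymm <;> rw [Ideal.span_le]
  · rintro _ (rfl | rfl | rfl | rfl)
    · exact Ideal.subset_span (by simp)
    · rw [show x * (y * z) = x * y * z by ring]
      exact Ideal.mul_mem_right _ _ (Ideal.subset_span (by simp))
    · rw [mul_comm y x]
      exact Ideal.subset_span (by simp)
    · exact Ideal.subset_span (by simp)
  · rintro _ (rfl | rfl | rfl)
    · exact Ideal.subset_span (by simp)
    · rw [mul_comm x y]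
      exact Ideal.subset_span (by simp)
    · exact Ideal.subset_span (by simp)

/-- On the third chart the inverse images of all centers are principal. -/
theorem IsBlowupChart.exists_third {A R : Type u} [CommRing A] [CommRing R] {x y z : A}
    {φ : A →+* R} (h : IsBlowupChart φ (Ideal.span {x, y} * Ideal.span {x, y * z}) (y * (y * z))) :
    φ y ∈ nonZeroDivisors R ∧ φ z ∈ nonZeroDivisors R ∧ ∃ w, φ x = φ (y * z) * w := by
  have h1 := h.mem_nonZeroDivisors
  rw [map_mul, map_mul, mul_mem_nonZeroDivisors, mul_mem_nonZeroDivisors] at h1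
  refine ⟨h1.1, h1.2.2, ?_⟩
  have h2 : φ (y * x) ∈ Ideal.span {φ (y * (y * z))} := by
    rw [← h.map_eq]
    exact Ideal.mem_map_of_mem φ (Ideal.mul_mem_mul (Ideal.subset_span (by simp))
      (Ideal.subset_span (by simp)))
  obtain ⟨w, hw⟩ := Ideal.mem_span_singleton'.1 h2
  refine ⟨w, (mul_cancel_left_mem_nonZeroDivisors h1.1).1 ?_⟩
  rw [← map_mul, ← hw, map_mul φ y (y * z)]
  ring

namespace HasFlopCoords

variable {K : Type u} [Field K] {X : Scheme.{u}} {s : X ⟶ Spec (.of K)}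
    {B C : Closeds X} {p : X} {U : X.affineOpens} {x y z : Γ(X, U)}

theorem isBlowup_toBase (h : HasFlopCoords s B C p U x y z) (Y : IteratedBlowup B C) :
    IsBlowup Y.toBase (Scheme.IdealSheafData.vanishingIdeal B * unionIdeal B C) :=
  Y.isBlowup₁.comp Y.isBlowup₂ Y.isBlowup₁.isEffectiveCartier (h.mul_strictTransform Y.isBlowup₁)

theorem ideal_mul (h : HasFlopCoords s B C p U x y z) :
    (Scheme.IdealSheafData.vanishingIdeal B * unionIdeal B C).ideal U =
      Ideal.span {x, y} * Ideal.span {x, y * z} := by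
  rw [Scheme.IdealSheafData.ideal_mul, Pi.mul_apply, h.ideal_left, h.ideal_union]

/-- The ideal of the center of the second blow-up on a chart of the iterated blow-up. -/
theorem specIdeal_strict_mul (h : HasFlopCoords s B C p U x y z) (Y : IteratedBlowup B C)
    {R : CommRingCat.{u}} (φ : Γ(X, U) ⟶ R) (c : Spec R ⟶ Y.X₂)
    (hc : c ≫ Y.toBase = chartMap U φ) :
    specIdeal ((Scheme.IdealSheafData.vanishingIdeal (strictTransform Y.π₁ B C)).comap (c ≫ Y.π₂)) *
      specIdeal ((Scheme.IdealSheafData.vanishingIdeal B).comap (chartMap U φ)) =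
      specIdeal ((unionIdeal B C).comap (chartMap U φ)) := by
  have h1 := congrArg (fun I ↦ specIdeal (Scheme.IdealSheafData.comap I (c ≫ Y.π₂)))
    (h.mul_strictTransform Y.isBlowup₁)
  simp only [comap_mul, specIdeal_mul] at h1
  rw [← Scheme.IdealSheafData.comap_comp _ (c ≫ Y.π₂) Y.π₁,
    ← Scheme.IdealSheafData.comap_comp _ (c ≫ Y.π₂) Y.π₁] at h1
  have h2 : (c ≫ Y.π₂) ≫ Y.π₁ = chartMap U φ := by rw [← hc, Category.assoc]; rfl
  rw [h2] at h1
  exact h1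

theorem comap_fiberCurve (Y : IteratedBlowup B C) {R : CommRingCat.{u}} (c : Spec R ⟶ Y.X₂)
    [IsOpenImmersion c] : (Scheme.IdealSheafData.vanishingIdeal (Y.fiberCurve p)).comap c =
      Scheme.IdealSheafData.vanishingIdeal (Closeds.closure {q : Spec R | (c ≫ Y.toBase) q = p ∧
        (c ≫ Y.π₂) q ∉ strictTransform Y.π₁ B C}) :=
  comap_strictTransform Y.π₂ _ _ c

theorem specIdeal_fiberCurve (h : HasFlopCoords s B C p U x y z) (Y : IteratedBlowup B C)
    {R : CommRingCat.{u}} (φ : Γ(X, U) ⟶ R) (c : Spec R ⟶ Y.X₂) [IsOpenImmersion c]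
    (hc : c ≫ Y.toBase = chartMap U φ) {S P : Ideal R} (hP : P.IsPrime)
    (hS : specIdeal ((Scheme.IdealSheafData.vanishingIdeal (strictTransform Y.π₁ B C)).comap
      (c ≫ Y.π₂)) = S)
    (h1 : ∀ q : Ideal R, q.IsPrime → φ.hom x ∈ q → φ.hom y ∈ q → φ.hom z ∈ q → ¬ S ≤ q → P ≤ q)
    (hx : φ.hom x ∈ P) (hy : φ.hom y ∈ P) (hz : φ.hom z ∈ P) (hSP : ¬ S ≤ P) :
    specIdeal ((Scheme.IdealSheafData.vanishingIdeal (Y.fiberCurve p)).comap c) = P := by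
  rw [comap_fiberCurve]
  have hmem (q : Spec R) : (c ≫ Y.π₂) q ∈ strictTransform Y.π₁ B C ↔
      S ≤ PrimeSpectrum.asIdeal (R := R) q := by
    rw [← hS, ← mem_iff_specIdeal_le]; rfl
  refine specIdeal_vanishingIdeal_of_isPrime _ _ (mem_closure_iff_le ?_ ?_)
  · rintro q ⟨h2, h3⟩
    rw [hc, h.chartMap_eq_iff] at h2
    exact h1 _ (PrimeSpectrum.isPrime (R := R) q) h2.1 h2.2.1 h2.2.2 (mt (hmem q).2 h3)
  · refine ⟨?_, fun h2 ↦ hSP ((hmem _).1 h2)⟩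
    rw [hc]
    exact (h.chartMap_eq_iff _ _).2 ⟨hx, hy, hz⟩

theorem fiberCurve_eq_top (h : HasFlopCoords s B C p U x y z) (Y : IteratedBlowup B C)
    {R : CommRingCat.{u}} (φ : Γ(X, U) ⟶ R) (c : Spec R ⟶ Y.X₂) [IsOpenImmersion c]
    (hc : c ≫ Y.toBase = chartMap U φ)
    (hS : specIdeal ((Scheme.IdealSheafData.vanishingIdeal (strictTransform Y.π₁ B C)).comap
      (c ≫ Y.π₂)) = Ideal.span {φ.hom z}) :
    (Scheme.IdealSheafData.vanishingIdeal (Y.fiberCurve p)).comap c = ⊤ := by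
  rw [comap_fiberCurve]
  have : {q : Spec R | (c ≫ Y.toBase) q = p ∧ (c ≫ Y.π₂) q ∉ strictTransform Y.π₁ B C} = ∅ := by
    ext q
    refine iff_of_false ?_ id
    rintro ⟨h2, h3⟩
    rw [hc, h.chartMap_eq_iff] at h2
    refine h3 ((mem_iff_specIdeal_le _ Y.π₂ c q).2 ?_)
    rw [hS, Ideal.span_le, Set.singleton_subset_iff]
    exact h2.2.2
  rw [this]
  refine Eq.trans ?_ Scheme.IdealSheafData.vanishingIdeal_bot
  congr 1
  exact Closeds.ext closure_empty

theorem fiberCurve_subset (hp : IsClosed {p}) (Y : IteratedBlowup B C) {a : Y.X₂}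
    (ha : a ∈ Y.fiberCurve p) : Y.toBase a = p := by
  have h : (Y.fiberCurve p : Set Y.X₂) ⊆ Y.toBase ⁻¹' {p} := by
    refine closure_minimal ?_ (hp.preimage Y.toBase.continuous)
    rintro a ⟨h1, -⟩
    exact h1
  exact h ha

theorem specIdeal_right (h : HasFlopCoords s B C p U x y z) {R : CommRingCat.{u}}
    (φ : Γ(X, U) ⟶ R) : specIdeal ((Scheme.IdealSheafData.vanishingIdeal C).comap (chartMap U φ)) =
      Ideal.span {φ.hom x, φ.hom z} := by
  rw [specIdeal_comap_chartMap, h.ideal_right, Ideal.map_span, Set.image_pair]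

section Charts

variable {R : CommRingCat.{u}} {φ : Γ(X, U) ⟶ R} {t w : R}

theorem specIdeal_fiberCurve_one (h : HasFlopCoords s B C p U x y z) (Y : IteratedBlowup B C)
    (hφ : IsChartOne (structureHom s U.1) x y z φ.hom t w) (c : Spec R ⟶ Y.X₂) [IsOpenImmersion c]
    (hc : c ≫ Y.toBase = chartMap U φ) :
    specIdeal ((Scheme.IdealSheafData.vanishingIdeal (Y.fiberCurve p)).comap c) =
      Ideal.span {φ.hom y, w} := by
  have := hφ.lineChart.isDomain
  have h1 := h.specIdeal_strict_mul Y φ c hc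
  rw [h.comap_chart_left' φ hφ.eq_x, specIdeal_comap_chartMap, h.ideal_union, Ideal.map_span,
    Set.image_pair, map_mul, hφ.eq_z, hφ.eq_x, ← span_singleton_mul_span_pair, span_pair_mul_right,
    mul_comm (Ideal.span {φ.hom y})] at h1
  have h2 := span_singleton_mul_left_cancel
    (mem_nonZeroDivisors_of_ne_zero hφ.lineChart.f_ne_zero) h1
  have hy : φ.hom y ∈ Ideal.span {φ.hom y, w} := Ideal.subset_span (by simp)
  have hw : w ∈ Ideal.span {φ.hom y, w} := Ideal.subset_span (by simp)
  refine h.specIdeal_fiberCurve Y φ c hc hφ.lineChart.isPrime_pair h2 ?_ ?_ hy ?_ ?_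
  · intro q hq hxq hyq hzq htq
    rw [Ideal.span_le]
    rintro _ (rfl | rfl)
    · exact hyq
    · rw [hφ.eq_z] at hzq
      refine (hq.mem_or_mem hzq).resolve_left fun e ↦ htq ?_
      rwa [Ideal.span_le, Set.singleton_subset_iff]
  · rw [hφ.eq_x]; exact Ideal.mul_mem_right _ _ hy
  · rw [hφ.eq_z]; exact Ideal.mul_mem_left _ _ hw
  · rw [Ideal.span_le, Set.singleton_subset_iff]
    exact hφ.lineChart.notMem

theorem mul_eq_one (h : HasFlopCoords s B C p U x y z) (Y : IteratedBlowup B C)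
    (hφ : IsChartOne (structureHom s U.1) x y z φ.hom t w) (c : Spec R ⟶ Y.X₂) [IsOpenImmersion c]
    (hc : c ≫ Y.toBase = chartMap U φ) :
    ((unionIdeal B C).comap Y.toBase * Scheme.IdealSheafData.vanishingIdeal (Y.fiberCurve p)).comap c =
      ((Scheme.IdealSheafData.vanishingIdeal B * Scheme.IdealSheafData.vanishingIdeal C).comap
        Y.toBase).comap c := by
  apply specIdeal_injective
  rw [comap_mul, ← Scheme.IdealSheafData.comap_comp, ← Scheme.IdealSheafData.comap_comp, comap_mul,
    hc, specIdeal_mul, specIdeal_mul, h.comap_chart_left' φ hφ.eq_x,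
    h.comap_chart_union φ (t := w) (by rw [map_mul, hφ.eq_z, hφ.eq_x]; ring),
    h.specIdeal_right, h.specIdeal_fiberCurve_one Y hφ c hc, span_singleton_mul_span_pair,
    span_singleton_mul_span_pair, hφ.eq_z, hφ.eq_x]
  congr 2
  · ring
  · rw [Set.singleton_eq_singleton_iff]; ring

theorem specIdeal_fiberCurve_two (h : HasFlopCoords s B C p U x y z) (Y : IteratedBlowup B C)
    (hφ : IsChartTwo (structureHom s U.1) x y z φ.hom t) (c : Spec R ⟶ Y.X₂) [IsOpenImmersion c]
    (hc : c ≫ Y.toBase = chartMap U φ) :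
    specIdeal ((Scheme.IdealSheafData.vanishingIdeal (Y.fiberCurve p)).comap c) =
      Ideal.span {φ.hom x, φ.hom z} := by
  have := hφ.lineChart.isDomain
  have h1 := h.specIdeal_strict_mul Y φ c hc
  rw [h.comap_chart_left φ hφ.eq_y, h.comap_chart_union φ (t := t * φ.hom z)
    (by rw [map_mul, hφ.eq_y, mul_assoc])] at h1
  have h2 := span_singleton_mul_left_cancel (J := ⊤)
    (mem_nonZeroDivisors_of_ne_zero hφ.lineChart.f_ne_zero) (h1.trans (by rw [Ideal.top_mul]))
  have hx : φ.hom x ∈ Ideal.span {φ.hom x, φ.hom z} := Ideal.subset_span (by simp)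
  refine h.specIdeal_fiberCurve Y φ c hc hφ.lineChart.isPrime_pair h2 ?_ hx ?_ ?_ ?_
  · intro q hq hxq hyq hzq htq
    rw [Ideal.span_le]
    rintro _ (rfl | rfl)
    exacts [hxq, hzq]
  · rw [hφ.eq_y]; exact Ideal.mul_mem_right _ _ hx
  · exact Ideal.subset_span (by simp)
  · exact fun e ↦ hφ.lineChart.notMem (e trivial)

theorem mul_eq_two (h : HasFlopCoords s B C p U x y z) (Y : IteratedBlowup B C)
    (hφ : IsChartTwo (structureHom s U.1) x y z φ.hom t) (c : Spec R ⟶ Y.X₂) [IsOpenImmersion c]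
    (hc : c ≫ Y.toBase = chartMap U φ) :
    ((unionIdeal B C).comap Y.toBase * Scheme.IdealSheafData.vanishingIdeal (Y.fiberCurve p)).comap c =
      ((Scheme.IdealSheafData.vanishingIdeal B * Scheme.IdealSheafData.vanishingIdeal C).comap
        Y.toBase).comap c := by
  apply specIdeal_injective
  rw [comap_mul, ← Scheme.IdealSheafData.comap_comp, ← Scheme.IdealSheafData.comap_comp, comap_mul,
    hc, specIdeal_mul, specIdeal_mul, h.comap_chart_left φ hφ.eq_y,
    h.comap_chart_union φ (t := t * φ.hom z) (by rw [map_mul, hφ.eq_y, mul_assoc]),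
    h.specIdeal_right, h.specIdeal_fiberCurve_two Y hφ c hc]

theorem fiberCurve_third (h : HasFlopCoords s B C p U x y z) (Y : IteratedBlowup B C)
    (hy : φ.hom y ∈ nonZeroDivisors R) (hw : φ.hom x = φ.hom (y * z) * w) (c : Spec R ⟶ Y.X₂)
    [IsOpenImmersion c] (hc : c ≫ Y.toBase = chartMap U φ) :
    (Scheme.IdealSheafData.vanishingIdeal (Y.fiberCurve p)).comap c = ⊤ := by
  refine h.fiberCurve_eq_top Y φ c hc ?_
  have h1 := h.specIdeal_strict_mul Y φ c hc
  rw [h.comap_chart_left' φ (t := φ.hom z * w) (by rw [hw, map_mul, mul_assoc]),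
    h.comap_chart_union' φ hw, map_mul, mul_comm (φ.hom y),
    ← Ideal.span_singleton_mul_span_singleton] at h1
  exact span_singleton_mul_left_cancel hy h1

theorem mul_eq_third (h : HasFlopCoords s B C p U x y z) (Y : IteratedBlowup B C)
    (hy : φ.hom y ∈ nonZeroDivisors R) (hw : φ.hom x = φ.hom (y * z) * w) (c : Spec R ⟶ Y.X₂)
    [IsOpenImmersion c] (hc : c ≫ Y.toBase = chartMap U φ) :
    ((unionIdeal B C).comap Y.toBase * Scheme.IdealSheafData.vanishingIdeal (Y.fiberCurve p)).comap c =
      ((Scheme.IdealSheafData.vanishingIdeal B * Scheme.IdealSheafData.vanishingIdeal C).comap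
        Y.toBase).comap c := by
  apply specIdeal_injective
  rw [comap_mul, h.fiberCurve_third Y hy hw c hc, idealSheaf_mul_top,
    ← Scheme.IdealSheafData.comap_comp, ← Scheme.IdealSheafData.comap_comp, comap_mul,
    hc, specIdeal_mul, h.comap_chart_left' φ (t := φ.hom z * w) (by rw [hw, map_mul, mul_assoc]),
    h.comap_chart_union' φ hw, h.specIdeal_right, hw, map_mul, Set.pair_comm,
    mul_comm (φ.hom y) (φ.hom z), mul_assoc, span_pair_mul_right,
    Ideal.span_singleton_mul_span_singleton, mul_comm (φ.hom y)]

end Charts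

/-- Every point over `p` lies on one of the three charts. -/
theorem exists_charts (h : HasFlopCoords s B C p U x y z) (Y : IteratedBlowup B C) {R₁ R₂ : Type u}
    [CommRing R₁] [CommRing R₂] {φ₁ : Γ(X, U) →+* R₁} {t₁ w₁ : R₁} {φ₂ : Γ(X, U) →+* R₂} {t₂ : R₂}
    (h₁ : IsChartOne (structureHom s U.1) x y z φ₁ t₁ w₁)
    (h₂ : IsChartTwo (structureHom s U.1) x y z φ₂ t₂) :
    ∃ (c₁ : Spec (.of R₁) ⟶ Y.X₂) (c₂ : Spec (.of R₂) ⟶ Y.X₂) (R₃ : CommRingCat.{u})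
      (φ₃ : Γ(X, U) ⟶ R₃) (w : R₃) (c₃ : Spec R₃ ⟶ Y.X₂) (_ : IsOpenImmersion c₁)
      (_ : IsOpenImmersion c₂) (_ : IsOpenImmersion c₃),
      c₁ ≫ Y.toBase = chartMap U (CommRingCat.ofHom φ₁) ∧
      c₂ ≫ Y.toBase = chartMap U (CommRingCat.ofHom φ₂) ∧ c₃ ≫ Y.toBase = chartMap U φ₃ ∧
      φ₃.hom y ∈ nonZeroDivisors R₃ ∧ φ₃.hom x = φ₃.hom (y * z) * w ∧
      c₁.opensRange = chartLocus Y.toBase (Scheme.IdealSheafData.vanishingIdeal B * unionIdeal B C)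
        U (x * y) ∧
      c₂.opensRange = chartLocus Y.toBase (Scheme.IdealSheafData.vanishingIdeal B * unionIdeal B C)
        U (x * x) ∧
      ∀ a, Y.toBase a = p → a ∈ Set.range c₁ ∨ a ∈ Set.range c₂ ∨ a ∈ Set.range c₃ := by
  have hI := h.ideal_mul
  have hI' := hI.trans (span_pair_mul_span_pair_eq x y z)
  have hmem (a) (ha : a ∈ ({x * x, x * y, y * (y * z)} : Set Γ(X, U))) :
      a ∈ (Scheme.IdealSheafData.vanishingIdeal B * unionIdeal B C).ideal U := by
    rw [hI']; exact Ideal.subset_span ha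
  obtain ⟨R₃, _, φ₃, h₃⟩ := exists_isBlowupChart _ (hmem (y * (y * z)) (by simp))
  have hb := h.isBlowup_toBase Y
  have h₁' := h₁.isBlowupChart
  have h₂' := h₂.isBlowupChart
  rw [← hI] at h₁' h₂'
  obtain ⟨c₁, hc₁, hc₁b, hc₁r⟩ := hb.exists_chart (hmem (x * y) (by simp))
    (h₁'.isChart _ _ (CommRingCat.ofHom φ₁))
  obtain ⟨c₂, hc₂, hc₂b, hc₂r⟩ := hb.exists_chart (hmem (x * x) (by simp))
    (h₂'.isChart _ _ (CommRingCat.ofHom φ₂))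
  obtain ⟨c₃, hc₃, hc₃b, hc₃r⟩ := hb.exists_chart (hmem (y * (y * z)) (by simp))
    (IsBlowupChart.isChart _ _ (CommRingCat.ofHom φ₃) h₃)
  rw [hI] at h₃
  obtain ⟨hy, -, w, hw⟩ := h₃.exists_third
  refine ⟨c₁, c₂, .of R₃, CommRingCat.ofHom φ₃, w, c₃, hc₁, hc₂, hc₃, hc₁b, hc₂b, hc₃b, hy, hw,
    hc₁r, hc₂r, fun a ha ↦ ?_⟩
  obtain ⟨b, hb, hab⟩ := exists_mem_chartLocus Y.toBase _ hb.isEffectiveCartier a U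
    (by rw [ha]; exact h.mem) _ hI'
  obtain e | e | e : b = x * x ∨ b = x * y ∨ b = y * (y * z) := hb
  · rw [e] at hab
    exact Or.inr (Or.inl (hc₂r.ge hab))
  · rw [e] at hab
    exact Or.inl (hc₁r.ge hab)
  · rw [e] at hab
    exact Or.inr (Or.inr (hc₃r.ge hab))

theorem mul_eq_of_notMem_left (hp : IsClosed {p}) (Y : IteratedBlowup B C) (hpB : p ∈ B)
    {a : Y.X₂} (ha : Y.toBase a ∉ B) :
    ∃ (T : Scheme.{u}) (j : T ⟶ Y.X₂) (_ : IsOpenImmersion j), a ∈ Set.range j ∧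
    ((unionIdeal B C).comap Y.toBase *
      Scheme.IdealSheafData.vanishingIdeal (Y.fiberCurve p)).comap j =
      ((Scheme.IdealSheafData.vanishingIdeal B * Scheme.IdealSheafData.vanishingIdeal C).comap
        Y.toBase).comap j := by
  let V : X.Opens := B.compl
  refine ⟨_, (Y.toBase ⁻¹ᵁ V).ι, inferInstance, by rw [Scheme.Opens.range_ι]; exact ha, ?_⟩
  have h1 : (Scheme.IdealSheafData.vanishingIdeal (Y.fiberCurve p)).comap
      (Y.toBase ⁻¹ᵁ V).ι = ⊤ :=
    comap_vanishingIdeal_eq_top _ fun t ht ↦ t.2 (by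
      have h2 := fiberCurve_subset hp Y ht
      change Y.toBase ((Y.toBase ⁻¹ᵁ V).ι t) ∈ B
      rw [h2]; exact hpB)
  have h2 : (Scheme.IdealSheafData.vanishingIdeal B).comap ((Y.toBase ⁻¹ᵁ V).ι ≫ Y.toBase) = ⊤ :=
    comap_vanishingIdeal_eq_top _ fun t ↦ t.2
  rw [comap_mul, h1, idealSheaf_mul_top, ← Scheme.IdealSheafData.comap_comp,
    ← Scheme.IdealSheafData.comap_comp, comap_mul, h2, mul_comm, idealSheaf_mul_top]
  refine comap_eq_of_preimage_eq V (fun t ht ↦ ?_) _ fun t ↦ t.2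
  exact ⟨fun h ↦ h.resolve_left ht, fun h ↦ Or.inr h⟩

theorem mul_eq_of_notMem_right (hp : IsClosed {p}) (Y : IteratedBlowup B C) (hpC : p ∈ C)
    {a : Y.X₂} (ha : Y.toBase a ∉ C) :
    ∃ (T : Scheme.{u}) (j : T ⟶ Y.X₂) (_ : IsOpenImmersion j), a ∈ Set.range j ∧
    ((unionIdeal B C).comap Y.toBase *
      Scheme.IdealSheafData.vanishingIdeal (Y.fiberCurve p)).comap j =
      ((Scheme.IdealSheafData.vanishingIdeal B * Scheme.IdealSheafData.vanishingIdeal C).comap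
        Y.toBase).comap j := by
  let V : X.Opens := C.compl
  refine ⟨_, (Y.toBase ⁻¹ᵁ V).ι, inferInstance, by rw [Scheme.Opens.range_ι]; exact ha, ?_⟩
  have h1 : (Scheme.IdealSheafData.vanishingIdeal (Y.fiberCurve p)).comap
      (Y.toBase ⁻¹ᵁ V).ι = ⊤ :=
    comap_vanishingIdeal_eq_top _ fun t ht ↦ t.2 (by
      have h2 := fiberCurve_subset hp Y ht
      change Y.toBase ((Y.toBase ⁻¹ᵁ V).ι t) ∈ C
      rw [h2]; exact hpC)
  have h2 : (Scheme.IdealSheafData.vanishingIdeal C).comap ((Y.toBase ⁻¹ᵁ V).ι ≫ Y.toBase) = ⊤ :=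
    comap_vanishingIdeal_eq_top _ fun t ↦ t.2
  rw [comap_mul, h1, idealSheaf_mul_top, ← Scheme.IdealSheafData.comap_comp,
    ← Scheme.IdealSheafData.comap_comp, comap_mul, h2, idealSheaf_mul_top]
  refine comap_eq_of_preimage_eq V (fun t ht ↦ ?_) _ fun t ↦ t.2
  exact ⟨fun h ↦ h.resolve_right ht, fun h ↦ Or.inl h⟩

theorem isSmallResolution (h : HasFlopCoords s B C p U x y z) (hp : IsClosed {p})
    (Y : IteratedBlowup B C) :
    IsSmallResolution (Scheme.IdealSheafData.vanishingIdeal B)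
      (Scheme.IdealSheafData.vanishingIdeal C) (unionIdeal B C) Y.toBase
      (Scheme.IdealSheafData.vanishingIdeal (Y.fiberCurve p)) := by
  refine ⟨h.isBlowup_toBase Y, idealSheaf_ext_of_openCover fun a ↦ ?_⟩
  by_cases haB : Y.toBase a ∈ B
  swap
  · exact mul_eq_of_notMem_left hp Y h.p_mem_left haB
  by_cases haC : Y.toBase a ∈ C
  swap
  · exact mul_eq_of_notMem_right hp Y h.p_mem_right haC
  obtain ⟨R₁, _, φ₁, t₁, w₁, h₁⟩ := h.coords.exists_isChartOne
  obtain ⟨R₂, _, φ₂, t₂, h₂⟩ := h.coords.exists_isChartTwo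
  obtain ⟨c₁, c₂, R₃, φ₃, w, c₃, _, _, _, e₁, e₂, e₃, hy, hw, -, -, hcov⟩ := h.exists_charts Y h₁ h₂
  obtain e | e | e := hcov a (h.eq_of_mem haB haC)
  · exact ⟨_, c₁, inferInstance, e, h.mul_eq_one Y h₁ c₁ e₁⟩
  · exact ⟨_, c₂, inferInstance, e, h.mul_eq_two Y h₂ c₂ e₂⟩
  · exact ⟨_, c₃, inferInstance, e, h.mul_eq_third Y hy hw c₃ e₃⟩

end HasFlopCoords

end SmallResolution

section Charts
open Polynomial

/-- A morphism is an isomorphism if it is one over the members of an open cover. -/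
theorem isIso_of_charts {Z P : Scheme.{u}} (f : Z ⟶ P)
    (h : ∀ x : P, ∃ (V E : Scheme.{u}) (i : V ⟶ P) (j : E ⟶ Z) (g : E ⟶ V)
      (_ : IsOpenImmersion i) (_ : IsOpenImmersion j) (_ : IsIso g),
      x ∈ Set.range i ∧ j ≫ f = g ≫ i ∧ f ⁻¹' Set.range i ⊆ Set.range j) : IsIso f := by
  choose V E i j g hi hj hg hx hf hr using h
  let 𝒰 : P.OpenCover := Scheme.Cover.mkOfCovers P V i (fun x ↦ ⟨x, hx x⟩) hi
  refine (IsZariskiLocalAtTarget.iff_of_openCover (P := MorphismProperty.isomorphisms Scheme.{u})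
    𝒰).2 fun x ↦ ?_
  have := hi x
  have := hj x
  have := hg x
  change IsIso (pullback.snd f (i x))
  have h1 : IsOpenImmersion (pullback.lift (j x) (g x) (hf x) ≫ pullback.fst f (i x)) := by
    rw [pullback.lift_fst]; infer_instance
  have h2 : IsOpenImmersion (pullback.lift (j x) (g x) (hf x)) :=
    IsOpenImmersion.of_comp _ (pullback.fst f (i x))
  have h3 : Function.Surjective (pullback.lift (j x) (g x) (hf x)) := by
    intro a
    have h4 : pullback.fst f (i x) a ∈ f ⁻¹' Set.range (i x) :=
      (Scheme.Pullback.range_fst (f := f) (g := i x)).le ⟨a, rfl⟩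
    obtain ⟨e, he⟩ := hr x h4
    refine ⟨e, (pullback.fst f (i x)).isOpenEmbedding.injective ?_⟩
    rw [← he, ← Scheme.Hom.comp_apply, pullback.lift_fst]
  have h5 : IsIso (pullback.lift (j x) (g x) (hf x)) := by
    have : Epi (pullback.lift (j x) (g x) (hf x)).base := (TopCat.epi_iff_surjective _).2 h3
    exact IsOpenImmersion.isIso _
  have h6 := pullback.lift_snd (f := f) (g := i x) (j x) (g x) (hf x)
  have h7 : IsIso (pullback.lift (j x) (g x) (hf x) ≫ pullback.snd f (i x)) := by
    rw [h6]; infer_instance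
  exact IsIso.of_isIso_comp_left (pullback.lift (j x) (g x) (hf x)) _

/-- The homomorphism on global sections that corresponds to a morphism to a spectrum. -/
def sectionsHom {T : Scheme.{u}} {R : CommRingCat.{u}} (j : T ⟶ Spec R) : R ⟶ Γ(T, ⊤) :=
  (Scheme.ΓSpecIso R).inv ≫ j.appTop

theorem toSpecΓ_sectionsHom {T : Scheme.{u}} {R : CommRingCat.{u}} (j : T ⟶ Spec R) :
    T.toSpecΓ ≫ Spec.map (sectionsHom j) = j := by
  rw [sectionsHom, Spec.map_comp, ← Scheme.toSpecΓ_naturality_assoc]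
  have : (Spec R).toSpecΓ = Spec.map (Scheme.ΓSpecIso R).hom := (SpecMap_ΓSpecIso_hom R).symm
  rw [this, ← Spec.map_comp, Iso.inv_hom_id, Spec.map_id, Category.comp_id]

theorem sectionsHom_comp_SpecMap {T : Scheme.{u}} {R S : CommRingCat.{u}} (j : T ⟶ Spec S)
    (φ : R ⟶ S) : sectionsHom (j ≫ Spec.map φ) = φ ≫ sectionsHom j := by
  rw [sectionsHom, sectionsHom, Scheme.Hom.comp_appTop, Scheme.ΓSpecIso_inv_naturality_assoc]

theorem sectionsHom_comp {T T' : Scheme.{u}} {R : CommRingCat.{u}} (k : T' ⟶ T) (j : T ⟶ Spec R) :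
    sectionsHom (k ≫ j) = sectionsHom j ≫ k.appTop := by
  rw [sectionsHom, sectionsHom, Scheme.Hom.comp_appTop, Category.assoc]

theorem specIdeal_ker {R D : CommRingCat.{u}} (ev : R ⟶ D) :
    specIdeal (Spec.map ev).ker = RingHom.ker ev.hom := by
  have h := Scheme.Hom.ker_apply (Spec.map ev) (topAffine _)
  rw [specIdeal, h]
  have e : (specIso R).hom ≫ (Spec.map ev).app (topAffine (Spec R)).1 = ev ≫ (specIso D).hom :=
    (Scheme.ΓSpecIso_inv_naturality ev).symm
  have h2 : (RingHom.ker ((Spec.map ev).app (topAffine (Spec R)).1).hom).comap (specIso R).hom.hom =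
      RingHom.ker ((specIso R).hom ≫ (Spec.map ev).app (topAffine (Spec R)).1).hom := rfl
  refine h2.trans ?_
  refine (congrArg (fun φ ↦ RingHom.ker (CommRingCat.Hom.hom φ)) e).trans ?_
  exact RingHom.ker_comp_of_injective ev.hom (f := (specIso D).hom.hom)
    ((ConcreteCategory.isIso_iff_bijective (specIso D).hom).1 inferInstance).1

theorem exists_subscheme_chart {Y : Scheme.{u}} (I : Y.IdealSheafData) {R D : CommRingCat.{u}}
    (c : Spec R ⟶ Y) [IsOpenImmersion c] (ev : R ⟶ D) (hev : Function.Surjective ev.hom)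
    (hker : RingHom.ker ev.hom = specIdeal (I.comap c)) :
    ∃ (j : Spec D ⟶ I.subscheme) (_ : IsOpenImmersion j), j ≫ I.subschemeι = Spec.map ev ≫ c ∧
      Set.range j = I.subschemeι ⁻¹' Set.range c := by
  have : IsClosedImmersion (Spec.map ev) := IsClosedImmersion.spec_of_surjective ev hev
  have hk : (Spec.map ev).ker = (pullback.fst c I.subschemeι).ker := by
    apply specIdeal_injective
    rw [specIdeal_ker, hker]; rfl
  have := IsClosedImmersion.isIso_lift (pullback.fst c I.subschemeι) (Spec.map ev) hk.symm
  have hl := IsClosedImmersion.lift_fac (pullback.fst c I.subschemeι) (Spec.map ev) hk.symm.le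
  refine ⟨IsClosedImmersion.lift (pullback.fst c I.subschemeι) (Spec.map ev) hk.symm.le ≫
    pullback.snd _ _, inferInstance, ?_, ?_⟩
  · rw [Category.assoc, ← pullback.condition, reassoc_of% hl]
  · rw [← Scheme.Pullback.range_snd]
    exact congrArg Opens.carrier (Scheme.Hom.opensRange_comp_of_isIso _ (pullback.snd c I.subschemeι))

/-- A chart `Spec R` of the `K`-scheme `Y` in which the curve `Z` is an affine line with coordinate
`τ` that is cut out by the regular sequence `f, g`. -/
structure CurveChart {K : Type u} [Field K] {Y : Scheme.{u}} (s : Y ⟶ Spec (.of K)) (Z : Closeds Y)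
    where
  R : CommRingCat.{u}
  κ : K →+* R
  f : R
  g : R
  τ : R
  c : Spec R ⟶ Y
  isOpenImmersion : IsOpenImmersion c
  lineChart : LineChart κ f g τ
  comp_eq : c ≫ s = Spec.map (CommRingCat.ofHom κ)
  specIdeal_eq : specIdeal ((Scheme.IdealSheafData.vanishingIdeal Z).comap c) = Ideal.span {f, g}

attribute [instance] CurveChart.isOpenImmersion

/-- Two charts that cover the curve `Z` and are glued like the two affine lines in the projective
line, where the equations `f, g` are sections of `𝒪(1)`. -/
structure CurveAtlas {K : Type u} [Field K] {Y : Scheme.{u}} (s : Y ⟶ Spec (.of K)) (Z : Closeds Y)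
    where
  chart : Fin 2 → CurveChart s Z
  exists_mem_range : ∀ y ∈ Z, ∃ k, y ∈ Set.range (chart k).c
  mem_range_one : ∀ q : Spec (chart 0).R, (chart 0).τ ∉ PrimeSpectrum.asIdeal (R := (chart 0).R) q →
    (chart 0).c q ∈ Set.range (chart 1).c
  mem_range_zero : ∀ q : Spec (chart 1).R, (chart 1).τ ∉ PrimeSpectrum.asIdeal (R := (chart 1).R) q →
    (chart 1).c q ∈ Set.range (chart 0).c
  f_eq : ∀ {T : Scheme.{u}} (j₀ : T ⟶ Spec (chart 0).R) (j₁ : T ⟶ Spec (chart 1).R),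
    j₀ ≫ (chart 0).c = j₁ ≫ (chart 1).c →
    (sectionsHom j₀).hom (chart 0).f = (sectionsHom j₁).hom ((chart 1).τ * (chart 1).f)
  g_eq : ∀ {T : Scheme.{u}} (j₀ : T ⟶ Spec (chart 0).R) (j₁ : T ⟶ Spec (chart 1).R),
    j₀ ≫ (chart 0).c = j₁ ≫ (chart 1).c →
    (sectionsHom j₀).hom (chart 0).g = (sectionsHom j₁).hom ((chart 1).τ * (chart 1).g)
  τ_mul : ∀ {T : Scheme.{u}} (j₀ : T ⟶ Spec (chart 0).R) (j₁ : T ⟶ Spec (chart 1).R)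
    [IsOpenImmersion j₁], j₀ ≫ (chart 0).c = j₁ ≫ (chart 1).c →
    (sectionsHom j₀).hom (chart 0).τ * (sectionsHom j₁).hom (chart 1).τ = 1

theorem sectionsHom_isOpenImmersion_injective {T : Scheme.{u}} {R : CommRingCat.{u}} [IsDomain R]
    [Nonempty T] (j : T ⟶ Spec R) [IsOpenImmersion j] : IsDomain Γ(T, ⊤) ∧
      Function.Injective (sectionsHom j).hom := by
  have : IsIntegral T := isIntegral_of_isOpenImmersion j
  refine ⟨inferInstance, ?_⟩
  have : Nonempty (j ''ᵁ ⊤) := ⟨⟨j (Classical.arbitrary T), ⟨_, trivial, rfl⟩⟩⟩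
  have h1 := map_injective_of_isIntegral (Spec R) (homOfLE (le_top : j ''ᵁ ⊤ ≤ ⊤))
  have h2 := j.app_appIso_inv ⊤
  have h3 : Function.Injective j.appTop.hom := by
    intro a b hab
    refine h1 ?_
    have h4 := congrArg (fun φ ↦ CommRingCat.Hom.hom φ a) h2
    have h5 := congrArg (fun φ ↦ CommRingCat.Hom.hom φ b) h2
    exact h4.symm.trans ((congrArg (j.appIso ⊤).inv.hom hab).trans h5)
  exact h3.comp ((ConcreteCategory.isIso_iff_bijective (Scheme.ΓSpecIso R).inv).1 inferInstance).1

/-- On a chart, a section generates the ideal where its quotient by a generator is invertible. -/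
theorem mem_chartLocus_chartMap {X : Scheme.{u}} (M : X.IdealSheafData) (U : X.affineOpens)
    {R : CommRingCat.{u}} (φ : Γ(X, U) ⟶ R) {r u : R} (h : (M.ideal U).map φ.hom = Ideal.span {r})
    {a : Γ(X, U)} (ha : φ.hom a = u * r) (q : Spec R)
    (hq : u ∉ PrimeSpectrum.asIdeal (R := R) q) : q ∈ chartLocus (chartMap U φ) M U a := by
  have h1 : (M.comap (chartMap U φ)).ideal (topAffine _) = Ideal.span {(specIso R).hom.hom r} := by
    rw [← map_specIdeal, specIdeal_comap_chartMap, h, Ideal.map_span, Set.image_singleton]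
  have h2 : (chartMap U φ).appLE U (topAffine _).1 (chartMap_preimage U φ).ge a =
      (specIso R).hom.hom u * (specIso R).hom.hom r := by
    rw [chartMap_appLE, ← map_mul, ← ha]; rfl
  let c := (specIso R).hom.hom u
  refine mem_chartLocus.2 ⟨(Spec R).affineBasicOpen c, ((Spec R).basicOpen_le c).trans
    (chartMap_preimage U φ).ge, (mem_basicOpen_specIso q u).2 hq, ?_⟩
  rw [ideal_eq_span_singleton_of_le _ ((Spec R).affineBasicOpen_le c) h1]
  have h7 := congrArg ((Spec R).presheaf.map (homOfLE ((Spec R).basicOpen_le c)).op) h2.symm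
  rw [map_mul] at h7
  refine Eq.trans ?_ (congrArg (fun x ↦ Ideal.span {x})
    (h7.trans (map_appLE_apply (chartMap U φ) (chartMap_preimage U φ).ge
      ((Spec R).basicOpen_le c) a)))
  refine (Ideal.span_singleton_mul_left_unit ?_ _).symm
  exact RingedSpace.isUnit_res_basicOpen _ c

section FlopCharts
variable {K : Type u} [Field K] {X : Scheme.{u}} {s : X ⟶ Spec (.of K)}
    {B C : Closeds X} {p : X} {U : X.affineOpens} {x y z : Γ(X, U)}

theorem chartMap_comp_structure (s : X ⟶ Spec (.of K)) (U : X.affineOpens) {R : CommRingCat.{u}}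
    (φ : Γ(X, U) ⟶ R) :
    chartMap U φ ≫ s = Spec.map (CommRingCat.ofHom (φ.hom.comp (structureHom s U.1))) := by
  have hU : IsAffineOpen U.1 := U.2
  have h := (isAffineOpen_top (Spec (.of K))).SpecMap_appLE_fromSpec s hU (le_top : U.1 ≤ s ⁻¹ᵁ ⊤)
  have h1 : (isAffineOpen_top (Spec (.of K))).fromSpec =
      Spec.map (Scheme.ΓSpecIso (.of K)).inv := by
    rw [IsAffineOpen.fromSpec_top, Scheme.isoSpec_Spec_inv]
  rw [h1, ← Spec.map_comp] at h
  refine (Category.assoc _ _ _).trans ?_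
  refine (congrArg (Spec.map φ ≫ ·) h.symm).trans ?_
  rw [← Spec.map_comp]
  rfl

theorem comp_sectionsHom_eq {T : Scheme.{u}} {R R' : CommRingCat.{u}} (φ : Γ(X, U) ⟶ R)
    (φ' : Γ(X, U) ⟶ R') (j : T ⟶ Spec R) (j' : T ⟶ Spec R')
    (h : j ≫ chartMap U φ = j' ≫ chartMap U φ') : φ ≫ sectionsHom j = φ' ≫ sectionsHom j' := by
  have e : ⊤ ≤ (j ≫ chartMap U φ) ⁻¹ᵁ U.1 := by
    rw [Scheme.Hom.comp_preimage, chartMap_preimage]; rfl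
  rw [(eq_chartMap_iff (j ≫ chartMap U φ) U e φ (sectionsHom j)).1
    (by rw [← Category.assoc, toSpecΓ_sectionsHom]),
    (eq_chartMap_iff (j ≫ chartMap U φ) U e φ' (sectionsHom j')).1
    (by rw [← Category.assoc, toSpecΓ_sectionsHom, h])]

/-- The three charts of the iterated blow-up over a neighborhood of `p`. -/
structure FlopCharts (s : X ⟶ Spec (.of K)) (p : X) (U : X.affineOpens) (x y z : Γ(X, U))
    (Y : IteratedBlowup B C) where
  R₁ : CommRingCat.{u}
  R₂ : CommRingCat.{u}
  φ₁ : Γ(X, U) ⟶ R₁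
  φ₂ : Γ(X, U) ⟶ R₂
  t₁ : R₁
  w₁ : R₁
  t₂ : R₂
  c₁ : Spec R₁ ⟶ Y.X₂
  c₂ : Spec R₂ ⟶ Y.X₂
  isChartOne : IsChartOne (structureHom s U.1) x y z φ₁.hom t₁ w₁
  isChartTwo : IsChartTwo (structureHom s U.1) x y z φ₂.hom t₂
  isOpenImmersion₁ : IsOpenImmersion c₁
  isOpenImmersion₂ : IsOpenImmersion c₂
  c₁_comp : c₁ ≫ Y.toBase = chartMap U φ₁
  c₂_comp : c₂ ≫ Y.toBase = chartMap U φ₂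
  range₁ : c₁.opensRange = chartLocus Y.toBase
    (Scheme.IdealSheafData.vanishingIdeal B * unionIdeal B C) U (x * y)
  range₂ : c₂.opensRange = chartLocus Y.toBase
    (Scheme.IdealSheafData.vanishingIdeal B * unionIdeal B C) U (x * x)
  exists_mem_range : ∀ a ∈ Y.fiberCurve p, a ∈ Set.range c₁ ∨ a ∈ Set.range c₂

attribute [instance] FlopCharts.isOpenImmersion₁ FlopCharts.isOpenImmersion₂

theorem HasFlopCoords.nonempty_flopCharts (h : HasFlopCoords s B C p U x y z) (hp : IsClosed {p})
    (Y : IteratedBlowup B C) : Nonempty (FlopCharts s p U x y z Y) := by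
  obtain ⟨R₁, _, φ₁, t₁, w₁, h₁⟩ := h.coords.exists_isChartOne
  obtain ⟨R₂, _, φ₂, t₂, h₂⟩ := h.coords.exists_isChartTwo
  obtain ⟨c₁, c₂, R₃, φ₃, w, c₃, _, _, _, e₁, e₂, e₃, hy, hw, hr₁, hr₂, hcov⟩ :=
    h.exists_charts Y h₁ h₂
  refine ⟨⟨.of R₁, .of R₂, CommRingCat.ofHom φ₁, CommRingCat.ofHom φ₂, t₁, w₁, t₂, c₁, c₂, h₁, h₂,
    inferInstance, inferInstance, e₁, e₂, hr₁, hr₂, fun a ha ↦ ?_⟩⟩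
  obtain e | e | ⟨q, rfl⟩ := hcov a (HasFlopCoords.fiberCurve_subset hp Y ha)
  · exact Or.inl e
  · exact Or.inr e
  · have h3 := h.fiberCurve_third Y hy hw c₃ e₃
    have h4 := mem_iff_specIdeal_le (Y.fiberCurve p) c₃ (𝟙 _) q
    rw [Category.id_comp, h3, specIdeal_top] at h4
    exact absurd (top_unique (h4.1 ha)) (PrimeSpectrum.isPrime (R := R₃) q).ne_top

namespace FlopCharts

variable {Y : IteratedBlowup B C} (D : FlopCharts s p U x y z Y)

theorem sections_eq {T : Scheme.{u}} (j₀ : T ⟶ Spec D.R₂) (j₁ : T ⟶ Spec D.R₁)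
    (e : j₀ ≫ D.c₂ = j₁ ≫ D.c₁) (a : Γ(X, U)) :
    (sectionsHom j₀).hom (D.φ₂.hom a) = (sectionsHom j₁).hom (D.φ₁.hom a) := by
  refine congrArg (fun φ ↦ CommRingCat.Hom.hom φ a) (comp_sectionsHom_eq D.φ₂ D.φ₁ j₀ j₁ ?_)
  rw [← D.c₁_comp, ← D.c₂_comp]
  exact congrArg (· ≫ Y.toBase) e

theorem mem_range_one (h : HasFlopCoords s B C p U x y z) (q : Spec D.R₂)
    (hq : D.t₂ ∉ PrimeSpectrum.asIdeal (R := D.R₂) q) : D.c₂ q ∈ Set.range D.c₁ := by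
  have hb := h.isBlowup_toBase Y
  have hm := D.isChartTwo.isBlowupChart.map_eq
  rw [← h.ideal_mul] at hm
  have h1 := mem_chartLocus_chartMap _ U D.φ₂ hm (a := x * y) (u := D.t₂)
    (by rw [map_mul, map_mul, D.isChartTwo.eq_y]; ring) q hq
  have h2 := preimage_chartLocus D.c₂ Y.toBase _ hb.isEffectiveCartier
    (hb.isEffectiveCartier.comap_comp D.c₂) U (x * y)
    (by rw [h.ideal_mul, mul_comm x y]; exact Ideal.mul_mem_mul (Ideal.subset_span (by simp))
          (Ideal.subset_span (by simp)))
  rw [D.c₂_comp] at h2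
  have h3 : D.c₂ q ∈ D.c₁.opensRange := D.range₁.ge (h2.ge h1)
  exact h3

theorem mem_range_zero (h : HasFlopCoords s B C p U x y z) (q : Spec D.R₁)
    (hq : D.t₁ ∉ PrimeSpectrum.asIdeal (R := D.R₁) q) : D.c₁ q ∈ Set.range D.c₂ := by
  have hb := h.isBlowup_toBase Y
  have hm := D.isChartOne.isBlowupChart.map_eq
  rw [← h.ideal_mul] at hm
  have h1 := mem_chartLocus_chartMap _ U D.φ₁ hm (a := x * x) (u := D.t₁)
    (by rw [map_mul, map_mul, D.isChartOne.eq_x]; ring) q hq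
  have h2 := preimage_chartLocus D.c₁ Y.toBase _ hb.isEffectiveCartier
    (hb.isEffectiveCartier.comap_comp D.c₁) U (x * x)
    (by rw [h.ideal_mul]; exact Ideal.mul_mem_mul (Ideal.subset_span (by simp))
          (Ideal.subset_span (by simp)))
  rw [D.c₁_comp] at h2
  have h3 : D.c₁ q ∈ D.c₂.opensRange := D.range₂.ge (h2.ge h1)
  exact h3

theorem f_eq {T : Scheme.{u}} (j₀ : T ⟶ Spec D.R₂) (j₁ : T ⟶ Spec D.R₁)
    (e : j₀ ≫ D.c₂ = j₁ ≫ D.c₁) :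
    (sectionsHom j₀).hom (D.φ₂.hom x) = (sectionsHom j₁).hom (D.t₁ * D.φ₁.hom y) := by
  rw [mul_comm, ← D.isChartOne.eq_x, D.sections_eq j₀ j₁ e]

theorem g_eq {T : Scheme.{u}} (j₀ : T ⟶ Spec D.R₂) (j₁ : T ⟶ Spec D.R₁)
    (e : j₀ ≫ D.c₂ = j₁ ≫ D.c₁) :
    (sectionsHom j₀).hom (D.φ₂.hom z) = (sectionsHom j₁).hom (D.t₁ * D.w₁) := by
  rw [← D.isChartOne.eq_z, D.sections_eq j₀ j₁ e]

theorem τ_mul {T : Scheme.{u}} (j₀ : T ⟶ Spec D.R₂) (j₁ : T ⟶ Spec D.R₁)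
    [hj : IsOpenImmersion j₁] (e : j₀ ≫ D.c₂ = j₁ ≫ D.c₁) :
    (sectionsHom j₀).hom D.t₂ * (sectionsHom j₁).hom D.t₁ = 1 := by
  cases isEmpty_or_nonempty T
  · exact Subsingleton.elim _ _
  have : IsDomain D.R₁ := D.isChartOne.lineChart.isDomain
  obtain ⟨_, hi⟩ := sectionsHom_isOpenImmersion_injective j₁
  have h2 := D.sections_eq j₀ j₁ e y
  rw [D.isChartTwo.eq_y, map_mul, D.sections_eq j₀ j₁ e, D.isChartOne.eq_x, map_mul, mul_assoc] at h2
  have h3 := (map_ne_zero_iff _ hi).2 D.isChartOne.lineChart.f_ne_zero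
  rw [mul_comm]
  exact (mul_eq_left₀ h3).1 h2

end FlopCharts

/-- The charts of the iterated blow-up, as charts of the flopping curve. -/
def FlopCharts.atlas (h : HasFlopCoords s B C p U x y z) {Y : IteratedBlowup B C}
    (D : FlopCharts s p U x y z Y) : CurveAtlas (Y.toBase ≫ s) (Y.fiberCurve p) where
  chart := ![
    { R := D.R₂
      κ := D.φ₂.hom.comp (structureHom s U.1)
      f := D.φ₂.hom x
      g := D.φ₂.hom z
      τ := D.t₂
      c := D.c₂
      isOpenImmersion := inferInstance
      lineChart := D.isChartTwo.lineChart
      comp_eq := by rw [← Category.assoc, D.c₂_comp, chartMap_comp_structure]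
      specIdeal_eq := h.specIdeal_fiberCurve_two Y D.isChartTwo D.c₂ D.c₂_comp },
    { R := D.R₁
      κ := D.φ₁.hom.comp (structureHom s U.1)
      f := D.φ₁.hom y
      g := D.w₁
      τ := D.t₁
      c := D.c₁
      isOpenImmersion := inferInstance
      lineChart := D.isChartOne.lineChart
      comp_eq := by rw [← Category.assoc, D.c₁_comp, chartMap_comp_structure]
      specIdeal_eq := h.specIdeal_fiberCurve_one Y D.isChartOne D.c₁ D.c₁_comp }]
  exists_mem_range a ha := (D.exists_mem_range a ha).elim (fun h ↦ ⟨1, h⟩) (fun h ↦ ⟨0, h⟩)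
  mem_range_one q hq := D.mem_range_one h q hq
  mem_range_zero q hq := D.mem_range_zero h q hq
  f_eq j₀ j₁ e := D.f_eq j₀ j₁ e
  g_eq j₀ j₁ e := D.g_eq j₀ j₁ e
  τ_mul j₀ j₁ hj e := D.τ_mul (hj := hj) j₀ j₁ e

end FlopCharts

end Charts

section Regular
open Polynomial

theorem isRegularLocalRing_localization {R : Type*} [CommRing R] [IsNoetherianRing R] (q : Ideal R)
    [hq : q.IsPrime] (s : Set R) (hs : s.Finite) (hqs : q = Ideal.span s) (h : s.ncard ≤ q.height) :
    IsRegularLocalRing (Localization.AtPrime q) := by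
  apply IsRegularLocalRing.of_spanFinrank_maximalIdeal_le
  rw [IsLocalization.AtPrime.ringKrullDim_eq_height q, ← Localization.AtPrime.map_eq_maximalIdeal]
  have h1 : q.map (algebraMap R (Localization.AtPrime q)) =
      Ideal.span (algebraMap R (Localization.AtPrime q) '' s) := by
    rw [← Ideal.map_span, ← hqs]
  rw [h1]
  have h2 : (Ideal.span (algebraMap R (Localization.AtPrime q) '' s)).spanFinrank ≤ s.ncard :=
    (Submodule.spanFinrank_span_le_ncard_of_finite (hs.image _)).trans (Set.ncard_image_le hs)
  have h3 : ((Ideal.span (algebraMap R (Localization.AtPrime q) '' s)).spanFinrank : ℕ∞) ≤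
    q.height := (Nat.cast_le.2 h2).trans h
  exact_mod_cast h3

theorem surjective_of_comp_eq_C {K R : Type u} [Field K] [CommRing R] {κ : K →+* R} {τ : R}
    {ev : R →+* K[X]} (h : ev.comp κ = C) (h' : ev τ = X) : Function.Surjective ev := by
  intro p
  refine ⟨p.eval₂ κ τ, ?_⟩
  rw [hom_eval₂, h, h', eval₂_C_X]

theorem LineChart.isRegularLocalRing {K R : Type u} [Field K] [CommRing R] {κ : K →+* R} {f g τ : R}
    (h : LineChart κ f g τ) (q : Ideal R) [hq : q.IsPrime] (hfg : Ideal.span {f, g} ≤ q) :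
    IsRegularLocalRing (Localization.AtPrime q) := by
  have := h.isDomain
  have := h.isNoetherianRing
  have hP1 := h.isPrime
  have hP2 := h.isPrime_pair
  have hb : (⊥ : Ideal R).IsPrime := Ideal.isPrime_bot
  have h1 : (⊥ : Ideal R) < Ideal.span {f} :=
    bot_lt_iff_ne_bot.2 fun e ↦ h.f_ne_zero (Ideal.span_singleton_eq_bot.1 e)
  have h2 : Ideal.span {f} < Ideal.span {f, g} :=
    lt_of_le_of_ne (Ideal.span_mono (by simp)) fun e ↦
      h.g_notMem (e ▸ Ideal.subset_span (by simp))
  have h3 := Ideal.height_add_one_le_of_lt_of_isPrime h1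
  have h4 := Ideal.height_add_one_le_of_lt_of_isPrime h2
  have h5 : 2 ≤ (Ideal.span {f, g}).height := by
    refine le_trans ?_ h4
    have : (1 : ℕ∞) ≤ (Ideal.span {f}).height := le_trans le_add_self h3
    calc (2 : ℕ∞) = 1 + 1 := by norm_num
      _ ≤ _ := by gcongr
  rcases eq_or_lt_of_le hfg with e | hlt
  · refine isRegularLocalRing_localization q {f, g} (by simp) e.symm ?_
    rw [← e]
    exact (Nat.cast_le.2 ((Set.ncard_insert_le f {g}).trans (by simp))).trans h5
  · obtain ⟨ev, h6, h6', h7⟩ := h.exists_ev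
    have hs := surjective_of_comp_eq_C h6 h6'
    obtain ⟨r, hr⟩ : ∃ r, q = Ideal.span {f, g, r} := by
      obtain ⟨c, hc⟩ := (IsPrincipalIdealRing.principal (q.map ev)).principal
      obtain ⟨r, rfl⟩ := hs c
      have hker : RingHom.ker ev ≤ q := h7 ▸ hfg
      have hq' := Ideal.comap_map_of_surjective ev hs q
      rw [← RingHom.ker_eq_comap_bot, sup_eq_left.2 hker] at hq'
      refine ⟨r, le_antisymm (fun a ha ↦ ?_) ?_⟩
      · have h8 : ev a ∈ Ideal.span {ev r} := by
          rw [← Ideal.submodule_span_eq, ← hc]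
          exact Ideal.mem_map_of_mem ev ha
        obtain ⟨b, hb⟩ := Ideal.mem_span_singleton'.1 h8
        obtain ⟨b, rfl⟩ := hs b
        have h9 : a - b * r ∈ Ideal.span {f, g} := by
          rw [← h7, RingHom.mem_ker, map_sub, map_mul, hb, sub_self]
        have h10 : Ideal.span {f, g} ≤ Ideal.span {f, g, r} := Ideal.span_mono (by
          rintro _ (rfl | rfl) <;> simp)
        rw [← sub_add_cancel a (b * r)]
        exact add_mem (h10 h9) (Ideal.mul_mem_left _ _ (Ideal.subset_span (by simp)))
      · rw [Ideal.span_le]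
        rintro _ (rfl | rfl | rfl)
        · exact hfg (Ideal.subset_span (by simp))
        · exact hfg (Ideal.subset_span (by simp))
        · rw [SetLike.mem_coe, ← hq', Ideal.mem_comap, hc]
          exact Submodule.mem_span_singleton_self _
    have h9 : ({f, g, r} : Set R).ncard ≤ 3 := by
      have h10 := Set.ncard_insert_le f {g, r}
      have h11 := Set.ncard_insert_le g {r}
      rw [Set.ncard_singleton] at h11
      omega
    refine isRegularLocalRing_localization q {f, g, r} (by simp) hr ?_
    have h8 := Ideal.height_add_one_le_of_lt_of_isPrime hlt
    refine (Nat.cast_le.2 h9).trans ?_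
    refine le_trans ?_ h8
    calc ((3 : ℕ) : ℕ∞) = 2 + 1 := by norm_num
      _ ≤ (Ideal.span {f, g}).height + 1 := add_le_add_left h5 1

theorem CurveChart.isRegularLocalRing {K : Type u} [Field K] {Y : Scheme.{u}}
    {s : Y ⟶ Spec (.of K)} {Z : Closeds Y} (D : CurveChart s Z) (q : Spec D.R) (hq : D.c q ∈ Z) :
    IsRegularLocalRing (Y.presheaf.stalk (D.c q)) := by
  have h1 := mem_iff_specIdeal_le Z D.c (𝟙 _) q
  rw [Category.id_comp, D.specIdeal_eq] at h1
  have hqp : (PrimeSpectrum.asIdeal (R := D.R) q).IsPrime := PrimeSpectrum.isPrime (R := D.R) q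
  have h2 := D.lineChart.isRegularLocalRing _ (h1.1 hq)
  have e : (Spec D.R).presheaf.stalk q ≅ Y.presheaf.stalk (D.c q) := (asIso (D.c.stalkMap q)).symm
  have h3 : IsRegularLocalRing ((Spec D.R).presheaf.stalk q) :=
    .of_ringEquiv (R := Localization.AtPrime (PrimeSpectrum.asIdeal (R := D.R) q))
      (Spec.stalkIso D.R q).symm.commRingCatIsoToRingEquiv
  exact .of_ringEquiv e.commRingCatIsoToRingEquiv

theorem CurveAtlas.isRegularLocalRing {K : Type u} [Field K] {Y : Scheme.{u}}
    {s : Y ⟶ Spec (.of K)} {Z : Closeds Y} (D : CurveAtlas s Z) (y : Y) (hy : y ∈ Z) :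
    IsRegularLocalRing (Y.presheaf.stalk y) := by
  obtain ⟨k, q, rfl⟩ := D.exists_mem_range y hy
  exact (D.chart k).isRegularLocalRing q hy

end Regular

section ProjectiveLine
open Polynomial HomogeneousLocalization

attribute [local instance] MvPolynomial.gradedAlgebra

variable (K : Type u) [Field K]

/-- The grading of the homogeneous coordinate ring of the projective line. -/
abbrev lineGrading : ℕ → Submodule K (MvPolynomial (Fin 2) K) :=
  MvPolynomial.homogeneousSubmodule (Fin 2) K

theorem X_mem_lineGrading (i : Fin 2) : (MvPolynomial.X i : MvPolynomial (Fin 2) K) ∈ lineGrading K 1 :=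
  (MvPolynomial.mem_homogeneousSubmodule 1 _).2 (MvPolynomial.isHomogeneous_X K i)

/-- The coordinate ring of the affine chart where `X i` is invertible. -/
abbrev LineAway (i : Fin 2) : Type u := Away (lineGrading K) (MvPolynomial.X i)

/-- The substitution that sets the `i`-th coordinate to `1`. -/
def dehomogenize (i : Fin 2) : MvPolynomial (Fin 2) K →+* K[X] :=
  MvPolynomial.eval₂Hom C fun j ↦ if j = i then 1 else X

theorem eval₂_mul_of_isHomogeneous {R S : Type*} [CommRing R] [CommRing S] (φ : R →+* S)
    {n : ℕ} {p : MvPolynomial (Fin 2) R} (hp : p.IsHomogeneous n) (c : S) (v : Fin 2 → S) :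
    MvPolynomial.eval₂ φ (fun i : Fin 2 ↦ c * v i) p = c ^ n * MvPolynomial.eval₂ φ v p := by
  rw [MvPolynomial.eval₂_eq', MvPolynomial.eval₂_eq', Finset.mul_sum]
  refine Finset.sum_congr rfl fun d hd ↦ ?_
  have h : d.degree = n := by
    by_contra hne
    exact MvPolynomial.mem_support_iff.1 hd (hp.coeff_eq_zero hne)
  have h2 : c ^ n = ∏ i, c ^ d i := by
    rw [Finset.prod_pow_eq_pow_sum, ← h, Finsupp.degree_eq_sum]
  simp only [mul_pow, Finset.prod_mul_distrib, h2]
  ring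

/-- The isomorphism from the chart where `X i` is invertible to the affine line. -/
def fromLineAway (i : Fin 2) : LineAway K i →+* K[X] :=
  (IsLocalization.Away.lift (S := Localization.Away (MvPolynomial.X (R := K) i)) (MvPolynomial.X i)
    (g := dehomogenize K i) (by simp [dehomogenize])).comp
  (algebraMap (LineAway K i) (Localization.Away (MvPolynomial.X (R := K) i)))

/-- The coordinate `X j / X i`. -/
def lineCoord (i j : Fin 2) : LineAway K i :=
  Away.mk _ (X_mem_lineGrading K i) 1 (MvPolynomial.X j) (X_mem_lineGrading K j)

theorem fromLineAway_mk (i : Fin 2) (n : ℕ) (a : MvPolynomial (Fin 2) K)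
    (ha : a ∈ lineGrading K (n • 1)) :
    fromLineAway K i (Away.mk _ (X_mem_lineGrading K i) n a ha) = dehomogenize K i a := by
  rw [fromLineAway, RingHom.comp_apply, HomogeneousLocalization.algebraMap_apply, Away.val_mk,
    Localization.mk_eq_mk', IsLocalization.Away.lift, IsLocalization.lift_mk'_spec]
  simp [dehomogenize]

theorem fromLineAway_lineCoord {i j : Fin 2} (h : i ≠ j) : fromLineAway K i (lineCoord K i j) = X := by
  rw [lineCoord, fromLineAway_mk]
  simp [dehomogenize, h.symm]

/-- The constants. -/
def lineConst (i : Fin 2) : K →+* LineAway K i :=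
  (fromZeroRingHom (lineGrading K) _).comp (algebraMap K (lineGrading K 0))

theorem C_mem_lineGrading (c : K) : MvPolynomial.C c ∈ lineGrading K (0 • 1) := by
  rw [zero_smul]
  exact SetLike.algebraMap_mem_graded (lineGrading K) c

theorem lineConst_eq (i : Fin 2) (c : K) :
    lineConst K i c = Away.mk _ (X_mem_lineGrading K i) 0 (MvPolynomial.C c)
      (C_mem_lineGrading K c) := by
  refine HomogeneousLocalization.val_injective _ (Eq.trans ?_ (Away.val_mk ..).symm)
  refine (HomogeneousLocalization.val_mk _).trans ?_
  simp only [pow_zero]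
  rfl

theorem val_lineConst (i : Fin 2) (c : K) :
    (lineConst K i c).val = algebraMap K (Localization.Away (MvPolynomial.X (R := K) i)) c := by
  rw [lineConst_eq, Away.val_mk, Localization.mk_eq_mk', IsScalarTower.algebraMap_apply K
    (MvPolynomial (Fin 2) K), IsLocalization.mk'_eq_iff_eq_mul]
  simp [MvPolynomial.algebraMap_eq]

theorem fromLineAway_lineConst (i : Fin 2) : (fromLineAway K i).comp (lineConst K i) = C := by
  ext1 c
  refine (congrArg _ (lineConst_eq K i c)).trans ((fromLineAway_mk K i _ _ _).trans ?_)
  simp [dehomogenize]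

theorem eval₂_lineCoord {i j : Fin 2} (h : i ≠ j) (r : LineAway K i) :
    (fromLineAway K i r).eval₂ (lineConst K i) (lineCoord K i j) = r := by
  obtain ⟨n, a, ha, rfl⟩ := Away.mk_surjective (lineGrading K) (X_mem_lineGrading K i) r
  rw [fromLineAway_mk]
  refine HomogeneousLocalization.val_injective _ ?_
  let L := Localization.Away (MvPolynomial.X i : MvPolynomial (Fin 2) K)
  let v : LineAway K i →+* L := algebraMap _ _
  have hv : ∀ k : Fin 2, algebraMap (MvPolynomial (Fin 2) K) L (MvPolynomial.X i) *
      (if k = i then 1 else (lineCoord K i j).val) = algebraMap (MvPolynomial (Fin 2) K) L (MvPolynomial.X k) := by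
    intro k
    split_ifs with hk
    · rw [hk, mul_one]
    · have : k = j := by omega
      rw [this, lineCoord, Away.val_mk]
      simp only [pow_one]
      rw [Localization.mk_eq_mk']
      exact IsLocalization.mk'_spec' (M := Submonoid.powers (MvPolynomial.X i)) L (MvPolynomial.X j)
        ⟨MvPolynomial.X i, 1, pow_one _⟩
  have hu : IsUnit (algebraMap (MvPolynomial (Fin 2) K) L (MvPolynomial.X i) ^ n) :=
    (IsLocalization.Away.algebraMap_isUnit (MvPolynomial.X i)).pow n
  refine hu.mul_left_cancel ?_
  rw [Away.val_mk, Localization.mk_eq_mk']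
  refine Eq.trans ?_ (((congrArg (· * _) (map_pow _ _ _)).symm.trans
    (IsLocalization.mk'_spec' L a _)).symm)
  change _ * v _ = _
  have h1 : v ((dehomogenize K i a).eval₂ (lineConst K i) (lineCoord K i j)) =
      MvPolynomial.eval₂ (algebraMap K L) (fun k ↦ if k = i then 1 else (lineCoord K i j).val) a := by
    have hc : v.comp (lineConst K i) = algebraMap K L := RingHom.ext (val_lineConst K i)
    rw [hom_eval₂, hc]
    change Polynomial.eval₂RingHom (algebraMap K L) (v (lineCoord K i j)) _ = _
    rw [dehomogenize, MvPolynomial.coe_eval₂Hom, MvPolynomial.hom_eval₂]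
    congr 1
    · ext c; simp
    · funext k
      by_cases hk : k = i
      · simp [hk]
      · simp only [hk, v, if_false, eval₂_X, coe_eval₂RingHom]
        rfl
  rw [h1, ← eval₂_mul_of_isHomogeneous _ (by simpa using (MvPolynomial.mem_homogeneousSubmodule _ _).1 ha)]
  simp only [hv]
  exact (MvPolynomial.aeval_algebraMap_apply L (MvPolynomial.X : Fin 2 → MvPolynomial (Fin 2) K) a).trans (by simp)

theorem fromLineAway_bijective (i : Fin 2) : Function.Bijective (fromLineAway K i) := by
  obtain ⟨j, h⟩ : ∃ j, i ≠ j := ⟨1 - i, by revert i; decide⟩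
  refine ⟨fun a b e ↦ ?_, fun p ↦ ⟨p.eval₂ (lineConst K i) (lineCoord K i j), ?_⟩⟩
  · rw [← eval₂_lineCoord K h a, e, eval₂_lineCoord K h b]
  · rw [hom_eval₂, fromLineAway_lineConst, fromLineAway_lineCoord K h, eval₂_C_X]

/-- The affine chart of the projective line where `X i` is invertible. -/
def lineChartι (i : Fin 2) : Spec (.of K[X]) ⟶ Proj (lineGrading K) :=
  Spec.map (CommRingCat.ofHom (fromLineAway K i)) ≫
    Proj.awayι (lineGrading K) _ (X_mem_lineGrading K i) zero_lt_one

instance (i : Fin 2) : IsIso (CommRingCat.ofHom (fromLineAway K i)) :=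
  (ConcreteCategory.isIso_iff_bijective _).2 (fromLineAway_bijective K i)

instance (i : Fin 2) : IsOpenImmersion (lineChartι K i) := by
  rw [lineChartι]; infer_instance

theorem opensRange_lineChartι (i : Fin 2) :
    (lineChartι K i).opensRange = Proj.basicOpen (lineGrading K) (MvPolynomial.X i) := by
  rw [← Proj.opensRange_awayι (lineGrading K) _ (X_mem_lineGrading K i) zero_lt_one]
  exact Scheme.Hom.opensRange_comp_of_isIso _ _

theorem mem_range_lineChartι {i : Fin 2} {x : Proj (lineGrading K)} :
    x ∈ Set.range (lineChartι K i) ↔ x ∈ Proj.basicOpen (lineGrading K) (MvPolynomial.X i) := by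
  rw [← opensRange_lineChartι]
  rfl

theorem exists_mem_range_lineChartι (x : Proj (lineGrading K)) :
    ∃ i, x ∈ Set.range (lineChartι K i) := by
  have h := Proj.iSup_basicOpen_eq_top' (lineGrading K) (MvPolynomial.X : Fin 2 → _)
    (fun i ↦ ⟨1, X_mem_lineGrading K i⟩) (by
      rw [eq_top_iff]
      intro p _
      induction p using MvPolynomial.induction_on with
      | C a =>
        exact (Algebra.adjoin (lineGrading K 0) (Set.range MvPolynomial.X)).algebraMap_mem
          ⟨_, SetLike.algebraMap_mem_graded (lineGrading K) a⟩
      | add p q hp hq => exact add_mem (hp trivial) (hq trivial)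
      | mul_X p i hp => exact mul_mem (hp trivial) (Algebra.subset_adjoin ⟨i, rfl⟩))
  obtain ⟨i, hi⟩ := Opens.mem_iSup.1 (h.ge (Opens.mem_top x))
  exact ⟨i, (mem_range_lineChartι K).2 hi⟩

/-- The structure morphism of the projective line. -/
def lineToSpec : Proj (lineGrading K) ⟶ Spec (.of K) := projectiveLineToSpec K

theorem lineChartι_comp (i : Fin 2) :
    lineChartι K i ≫ lineToSpec K = Spec.map (CommRingCat.ofHom C) := by
  have h := Proj.awayι_toSpecZero_assoc (lineGrading K) _ (X_mem_lineGrading K i) zero_lt_one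
    (Spec.map (CommRingCat.ofHom (algebraMap K (lineGrading K 0))))
  refine (Category.assoc _ _ _).trans
    ((congrArg (Spec.map (CommRingCat.ofHom (fromLineAway K i)) ≫ ·) h).trans ?_)
  rw [← fromLineAway_lineConst K i]
  refine (congrArg _ (Spec.map_comp _ _).symm).trans ((Spec.map_comp _ _).symm.trans ?_)
  rfl

theorem lineChartι_mem_range {i j : Fin 2} (h : i ≠ j) (q : Spec (.of K[X])) :
    lineChartι K i q ∈ Set.range (lineChartι K j) ↔ X ∉ PrimeSpectrum.asIdeal (R := K[X]) q := by
  rw [mem_range_lineChartι]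
  have h1 := Proj.awayι_preimage_basicOpen (lineGrading K) (X_mem_lineGrading K i) zero_lt_one
    (X_mem_lineGrading K j) zero_lt_one
  have h2 : lineChartι K i q ∈ Proj.basicOpen (lineGrading K) (MvPolynomial.X j) ↔
      Spec.map (CommRingCat.ofHom (fromLineAway K i)) q ∈
        Proj.awayι (lineGrading K) _ (X_mem_lineGrading K i) zero_lt_one ⁻¹ᵁ
          Proj.basicOpen (lineGrading K) (MvPolynomial.X j) := Iff.rfl
  rw [h2, h1]
  have h3 : fromLineAway K i (Away.isLocalizationElem (X_mem_lineGrading K i)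
      (X_mem_lineGrading K j)) = X := by
    refine (fromLineAway_mk K i _ _ _).trans ?_
    simp [dehomogenize, h.symm]
  rw [← h3]
  rfl

/-- Gluing of the two charts of the projective line. -/
theorem lineChartι_glue {T : Scheme.{u}} (j₀ j₁ : T ⟶ Spec (.of K[X]))
    (hX : (sectionsHom j₀).hom X * (sectionsHom j₁).hom X = 1)
    (hC : (sectionsHom j₀).hom.comp C = (sectionsHom j₁).hom.comp C) :
    j₀ ≫ lineChartι K 0 = j₁ ≫ lineChartι K 1 := by
  have hx : (MvPolynomial.X 0 * MvPolynomial.X 1 : MvPolynomial (Fin 2) K) =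
    MvPolynomial.X 0 * MvPolynomial.X 1 := rfl
  have hx' : (MvPolynomial.X 0 * MvPolynomial.X 1 : MvPolynomial (Fin 2) K) =
    MvPolynomial.X 1 * MvPolynomial.X 0 := mul_comm _ _
  let α₀ := awayMap (lineGrading K) (X_mem_lineGrading K 1) hx
  let α₁ := awayMap (lineGrading K) (X_mem_lineGrading K 0) hx'
  let θ₀ := (sectionsHom j₀).hom.comp (fromLineAway K 0)
  let θ₁ := (sectionsHom j₁).hom.comp (fromLineAway K 1)
  obtain ⟨χ, hχ⟩ : ∃ χ : Away (lineGrading K) (MvPolynomial.X 0 * MvPolynomial.X 1) →+* Γ(T, ⊤),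
      χ.comp α₀ = θ₀ := by
    let := α₀.toAlgebra
    have := Away.isLocalization_mul (X_mem_lineGrading K 0) (X_mem_lineGrading K 1) hx one_ne_zero
    have hu : IsUnit (θ₀ (Away.isLocalizationElem (X_mem_lineGrading K 0)
        (X_mem_lineGrading K 1))) := by
      have h3 : fromLineAway K 0 (Away.isLocalizationElem (X_mem_lineGrading K 0)
          (X_mem_lineGrading K 1)) = X := by
        refine (fromLineAway_mk K 0 _ _ _).trans ?_
        simp [dehomogenize]
      refine IsUnit.of_mul_eq_one ((sectionsHom j₁).hom X) (Eq.trans ?_ hX)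
      exact congrArg (fun r ↦ (sectionsHom j₀).hom r * _) h3
    exact ⟨IsLocalization.Away.lift _ hu, IsLocalization.Away.lift_comp _ hu⟩
  have hconst : α₀.comp (lineConst K 0) = α₁.comp (lineConst K 1) := by
    ext1 c
    refine HomogeneousLocalization.val_injective _ ?_
    rw [RingHom.comp_apply, RingHom.comp_apply, lineConst_eq, lineConst_eq]
    refine (val_awayMap_mk ..).trans (Eq.trans ?_ (val_awayMap_mk ..).symm)
    congr 1
  have hcoord : α₀ (lineCoord K 0 1) * α₁ (lineCoord K 1 0) = 1 := by
    refine HomogeneousLocalization.val_injective _ ?_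
    rw [HomogeneousLocalization.val_mul, HomogeneousLocalization.val_one]
    refine (congrArg₂ (· * ·) (val_awayMap_mk ..) (val_awayMap_mk ..)).trans ?_
    refine (Localization.mk_mul _ _ _ _).trans ?_
    rw [← Localization.mk_one, Localization.mk_eq_mk_iff, Localization.r_iff_exists]
    refine ⟨1, ?_⟩
    simp
    ring
  have h1 : χ.comp α₁ = θ₁ := by
    ext1 r
    rw [← eval₂_lineCoord K (show (1 : Fin 2) ≠ 0 by decide) r]
    rw [hom_eval₂, hom_eval₂]
    have e1 : (χ.comp α₁).comp (lineConst K 1) = θ₁.comp (lineConst K 1) := by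
      rw [RingHom.comp_assoc, ← hconst, ← RingHom.comp_assoc, hχ]
      rw [RingHom.comp_assoc, RingHom.comp_assoc, fromLineAway_lineConst, fromLineAway_lineConst, hC]
    have e2 : (χ.comp α₁) (lineCoord K 1 0) = θ₁ (lineCoord K 1 0) := by
      have a1 : θ₀ (lineCoord K 0 1) = (sectionsHom j₀).hom X :=
        congrArg (sectionsHom j₀).hom (fromLineAway_lineCoord K (by decide))
      have a2 : θ₁ (lineCoord K 1 0) = (sectionsHom j₁).hom X :=
        congrArg (sectionsHom j₁).hom (fromLineAway_lineCoord K (by decide))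
      have a3 : θ₀ (lineCoord K 0 1) * χ (α₁ (lineCoord K 1 0)) = 1 := by
        rw [← hχ, RingHom.comp_apply, ← map_mul, hcoord, map_one]
      rw [a2]
      rw [a1] at a3
      exact (left_inv_eq_right_inv ((mul_comm _ _).trans hX) a3).symm
    rw [e1, e2]
  have key (j : T ⟶ Spec (.of K[X])) (i : Fin 2) (α : LineAway K i →+* _)
      (h : χ.comp α = (sectionsHom j).hom.comp (fromLineAway K i)) :
      j ≫ Spec.map (CommRingCat.ofHom (fromLineAway K i)) =
        (T.toSpecΓ ≫ Spec.map (CommRingCat.ofHom χ)) ≫ Spec.map (CommRingCat.ofHom α) := by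
    refine (congrArg (· ≫ _) (toSpecΓ_sectionsHom j).symm).trans ?_
    rw [Category.assoc, Category.assoc, ← Spec.map_comp, ← Spec.map_comp]
    congr 2
    exact CommRingCat.hom_ext h.symm
  have w₀ := Proj.SpecMap_awayMap_awayι (lineGrading K) (X_mem_lineGrading K 0) zero_lt_one
    (X_mem_lineGrading K 1) hx
  have w₁ := Proj.SpecMap_awayMap_awayι (lineGrading K) (X_mem_lineGrading K 1) zero_lt_one
    (X_mem_lineGrading K 0) hx'
  refine (Category.assoc _ _ _).symm.trans ((congrArg (· ≫ _) (key j₀ 0 α₀ hχ)).trans ?_)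
  refine Eq.trans ?_ ((congrArg (· ≫ _) (key j₁ 1 α₁ h1)).symm.trans (Category.assoc _ _ _))
  refine (Category.assoc _ _ _).trans ((congrArg _ w₀).trans ?_)
  exact ((Category.assoc _ _ _).trans (congrArg _ w₁)).symm

end ProjectiveLine

section RationalCurve
open Polynomial

attribute [local instance] MvPolynomial.gradedAlgebra

theorem exists_glue_two {Z P : Scheme.{u}} {V : Fin 2 → Scheme.{u}} (b : ∀ k, V k ⟶ Z)
    [hb : ∀ k, IsOpenImmersion (b k)] (hcov : ∀ z, ∃ k, z ∈ Set.range (b k)) (f : ∀ k, V k ⟶ P)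
    (h : pullback.fst (b 0) (b 1) ≫ f 0 = pullback.snd (b 0) (b 1) ≫ f 1) :
    ∃ g : Z ⟶ P, ∀ k, b k ≫ g = f k := by
  let 𝒰 : Z.OpenCover := Scheme.Cover.mkOfCovers (Fin 2) V b hcov hb
  have h' : ∀ k l : Fin 2, pullback.fst (b k) (b l) ≫ f k = pullback.snd (b k) (b l) ≫ f l := by
    intro k l
    have hkk (k : Fin 2) : pullback.fst (b k) (b k) ≫ f k = pullback.snd (b k) (b k) ≫ f k := by
      rw [(cancel_mono (b k)).1 pullback.condition]
    fin_cases k <;> fin_cases l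
    · exact hkk 0
    · exact h
    · have e := congrArg ((pullbackSymmetry (b 1) (b 0)).hom ≫ ·) h
      rw [pullbackSymmetry_hom_comp_fst_assoc, pullbackSymmetry_hom_comp_snd_assoc] at e
      exact e.symm
    · exact hkk 1
  exact ⟨Scheme.Cover.glueMorphisms 𝒰 f h', Scheme.Cover.ι_glueMorphisms 𝒰 f h'⟩

variable {K : Type u} [Field K] {Y : Scheme.{u}} {s : Y ⟶ Spec (.of K)} {Z : Closeds Y}

theorem CurveChart.exists_affineLine (D : CurveChart s Z) :
    ∃ (ev : D.R →+* K[X]) (b : Spec (.of K[X]) ⟶ reducedSubscheme Z) (_ : IsOpenImmersion b),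
      ev.comp D.κ = C ∧ ev D.τ = X ∧ RingHom.ker ev = Ideal.span {D.f, D.g} ∧
      b ≫ reducedι Z = Spec.map (CommRingCat.ofHom ev) ≫ D.c ∧
      Set.range b = reducedι Z ⁻¹' Set.range D.c := by
  obtain ⟨ev, h1, h2, h3⟩ := D.lineChart.exists_ev
  obtain ⟨b, hb, h4, h5⟩ := exists_subscheme_chart _ D.c (CommRingCat.ofHom ev)
    (surjective_of_comp_eq_C h1 h2) (h3.trans D.specIdeal_eq.symm)
  exact ⟨ev, b, hb, h1, h2, h3, h4, h5⟩

namespace CurveAtlas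

variable (D : CurveAtlas s Z)

theorem τ_mul_of_comp {T : Scheme.{u}} (j₀ : T ⟶ Spec (D.chart 0).R) (j₁ : T ⟶ Spec (D.chart 1).R)
    (e : j₀ ≫ (D.chart 0).c = j₁ ≫ (D.chart 1).c) :
    (sectionsHom j₀).hom (D.chart 0).τ * (sectionsHom j₁).hom (D.chart 1).τ = 1 := by
  have h := D.τ_mul (pullback.fst (D.chart 0).c (D.chart 1).c) (pullback.snd _ _) pullback.condition
  rw [← pullback.lift_fst j₀ j₁ e, sectionsHom_comp]
  conv_lhs => enter [2]; rw [← pullback.lift_snd j₀ j₁ e, sectionsHom_comp]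
  have h2 := congrArg (pullback.lift j₀ j₁ e).appTop.hom h
  rw [map_mul, map_one] at h2
  exact h2

theorem exists_iso : ∃ (e : Proj (lineGrading K) ≅ reducedSubscheme Z)
    (ev : ∀ k, (D.chart k).R →+* K[X]),
    (∀ k, (ev k).comp (D.chart k).κ = C ∧ (ev k) (D.chart k).τ = X ∧
      RingHom.ker (ev k) = Ideal.span {(D.chart k).f, (D.chart k).g} ∧
      lineChartι K k ≫ e.hom ≫ reducedι Z = Spec.map (CommRingCat.ofHom (ev k)) ≫ (D.chart k).c ∧
      Set.range (lineChartι K k ≫ e.hom) = reducedι Z ⁻¹' Set.range (D.chart k).c) ∧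
    e.hom ≫ reducedι Z ≫ s = lineToSpec K := by
  choose ev b hb h1 h2 h3 h4 h5 using fun k ↦ (D.chart k).exists_affineLine
  have hcov : ∀ z, ∃ k, z ∈ Set.range (b k) := by
    intro z
    have hz : reducedι Z z ∈ Z := by
      exact (mem_support_vanishingIdeal _ _).1
        ((Scheme.IdealSheafData.range_subschemeι (.vanishingIdeal Z)).le ⟨z, rfl⟩)
    obtain ⟨k, hk⟩ := D.exists_mem_range _ hz
    exact ⟨k, (h5 k).ge hk⟩
  have hs (k) : b k ≫ reducedι Z ≫ s = Spec.map (CommRingCat.ofHom C) := by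
    rw [reassoc_of% h4 k, (D.chart k).comp_eq, ← Spec.map_comp, ← h1 k]
    rfl
  obtain ⟨g, hg⟩ := exists_glue_two b hcov (lineChartι K) (by
    apply lineChartι_glue
    · have e1 := D.τ_mul_of_comp
        (pullback.fst (b 0) (b 1) ≫ Spec.map (CommRingCat.ofHom (ev 0)))
        (pullback.snd (b 0) (b 1) ≫ Spec.map (CommRingCat.ofHom (ev 1))) (by
          rw [Category.assoc, Category.assoc, ← h4, ← h4, pullback.condition_assoc])
      rw [sectionsHom_comp_SpecMap, sectionsHom_comp_SpecMap] at e1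
      exact (congrArg₂ (fun u v ↦ (sectionsHom (pullback.fst (b 0) (b 1))).hom u *
        (sectionsHom (pullback.snd (b 0) (b 1))).hom v) (h2 0) (h2 1)).symm.trans e1
    · have e1 : pullback.fst (b 0) (b 1) ≫ Spec.map (CommRingCat.ofHom C) =
          pullback.snd (b 0) (b 1) ≫ Spec.map (CommRingCat.ofHom (C : K →+* K[X])) := by
        refine (congrArg (_ ≫ ·) (hs 0)).symm.trans (Eq.trans ?_ (congrArg (_ ≫ ·) (hs 1)))
        rw [pullback.condition_assoc]
      have e2 := congrArg sectionsHom e1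
      rw [sectionsHom_comp_SpecMap, sectionsHom_comp_SpecMap] at e2
      exact congrArg CommRingCat.Hom.hom e2)
  have hiso : IsIso g := by
    refine isIso_of_charts g fun x ↦ ?_
    obtain ⟨k, hk⟩ := exists_mem_range_lineChartι K x
    refine ⟨_, _, lineChartι K k, b k, 𝟙 _, inferInstance, hb k, inferInstance, hk,
      (hg k).trans (Category.id_comp _).symm, fun z hz ↦ ?_⟩
    obtain ⟨l, q, rfl⟩ := hcov z
    by_cases hkl : l = k
    · rw [← hkl]; exact ⟨q, rfl⟩
    have e1 : lineChartι K l q ∈ Set.range (lineChartι K k) := by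
      rw [← hg l]; exact hz
    have e2 := (lineChartι_mem_range K hkl q).1 e1
    rw [h5 k]
    have e3 : reducedι Z (b l q) = (D.chart l).c (Spec.map (CommRingCat.ofHom (ev l)) q) := by
      rw [← Scheme.Hom.comp_apply, h4, Scheme.Hom.comp_apply]
    rw [Set.mem_preimage, e3]
    have e4 : (D.chart l).τ ∉ PrimeSpectrum.asIdeal (R := (D.chart l).R)
        (Spec.map (CommRingCat.ofHom (ev l)) q) := by
      rw [← h2 l] at e2
      exact e2
    obtain ⟨rfl, rfl⟩ | ⟨rfl, rfl⟩ : (l = 0 ∧ k = 1) ∨ (l = 1 ∧ k = 0) := by omega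
    · exact D.mem_range_one _ e4
    · exact D.mem_range_zero _ e4
  have hb' (k) : lineChartι K k ≫ inv g = b k := by rw [← hg k, Category.assoc, IsIso.hom_inv_id,
    Category.comp_id]
  refine ⟨(asIso g).symm, ev, fun k ↦ ⟨h1 k, h2 k, h3 k, ?_, ?_⟩, ?_⟩
  · refine (Category.assoc _ _ _).symm.trans ((congrArg (· ≫ reducedι Z) (hb' k)).trans (h4 k))
  · rw [← h5 k, ← hb' k]; rfl
  · refine (Iso.inv_comp_eq (asIso g)).2 ?_
    let 𝒰 : (reducedSubscheme Z).OpenCover := Scheme.Cover.mkOfCovers (Fin 2) _ b hcov hb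
    refine Scheme.Cover.hom_ext 𝒰 _ _ fun k ↦ ?_
    refine (hs k).trans ((lineChartι_comp K k).symm.trans ?_)
    rw [← hg k, Category.assoc]
    rfl

end CurveAtlas

end RationalCurve

section Frames

theorem map_map_apply {X : Scheme.{u}} (M : X.Modules) {V W T : X.Opens} (h : W ≤ V) (h' : T ≤ W)
    (m : Γ(M, V)) : M.presheaf.map (homOfLE h').op (M.presheaf.map (homOfLE h).op m) =
      M.presheaf.map (homOfLE (h'.trans h)).op m := by
  rw [← AddCommGrpCat.comp_apply, ← Functor.map_comp]; rfl

theorem map_self_apply {X : Scheme.{u}} (M : X.Modules) {V : X.Opens} (h : V ≤ V)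
    (m : Γ(M, V)) : M.presheaf.map (homOfLE h).op m = m := by
  have : (homOfLE h).op = 𝟙 (op V) := rfl
  rw [this, CategoryTheory.Functor.map_id]; rfl

theorem Modules.eq_of_locally_eq {X : Scheme.{u}} (M : X.Modules) {ι : Type*} {V : X.Opens}
    (W : ι → X.Opens) (hW : ∀ i, W i ≤ V) (hV : V ≤ iSup W) (m m' : Γ(M, V))
    (h : ∀ i, M.presheaf.map (homOfLE (hW i)).op m = M.presheaf.map (homOfLE (hW i)).op m') :
    m = m' :=
  TopCat.Sheaf.eq_of_locally_eq' ⟨M.presheaf, M.isSheaf⟩ W V (fun i ↦ homOfLE (hW i)) hV m m' h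

theorem Modules.exists_gluing {X : Scheme.{u}} (M : X.Modules) {ι : Type*} {V : X.Opens}
    (W : ι → X.Opens) (hW : ∀ i, W i ≤ V) (hV : V ≤ iSup W) (m : ∀ i, Γ(M, W i))
    (h : ∀ i j, M.presheaf.map (homOfLE (inf_le_left : W i ⊓ W j ≤ _)).op (m i) =
      M.presheaf.map (homOfLE (inf_le_right : W i ⊓ W j ≤ _)).op (m j)) :
    ∃ n : Γ(M, V), ∀ i, M.presheaf.map (homOfLE (hW i)).op n = m i :=
  (TopCat.Sheaf.existsUnique_gluing' ⟨M.presheaf, M.isSheaf⟩ W V (fun i ↦ homOfLE (hW i)) hV m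
    h).exists

/-- A homomorphism of modules from its components. -/
def Modules.mkHom {X : Scheme.{u}} {M N : X.Modules} (f : ∀ V : X.Opens, Γ(M, V) →+ Γ(N, V))
    (hsmul : ∀ V (r : Γ(X, V)) m, f V (r • m) = r • f V m)
    (hmap : ∀ (V W : X.Opens) (h : W ≤ V) m, f W (M.presheaf.map (homOfLE h).op m) =
      N.presheaf.map (homOfLE h).op (f V m)) : M ⟶ N :=
  SheafOfModules.Hom.mk (PresheafOfModules.homMk (M₁ := M.val) (M₂ := N.val)
    { app := fun V ↦ AddCommGrpCat.ofHom (f V.unop)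
      naturality := fun V W i ↦ by
        ext m
        exact hmap V.unop W.unop i.unop.le m }
    (fun V r m ↦ hsmul V.unop r m))

variable {X : Scheme.{u}} (U : Fin 2 → X.Opens) (T : X.Opens → Type u)
  [∀ V, AddCommGroup (T V)] [∀ V, Module Γ(X, V) (T V)] (res : ∀ {V W : X.Opens}, W ≤ V → T V → T W)
  (t : ∀ V : X.Opens, V ≤ U 0 → V ≤ U 1 → T V → T V)

/-- Coordinates on a module over two open sets, with a prescribed coordinate change. -/
structure Frames (M : X.Modules) where
  coord : ∀ k V, V ≤ U k → Γ(M, V) → T V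
  map_add : ∀ k V h m n, coord k V h (m + n) = coord k V h m + coord k V h n
  map_smul : ∀ k V h (r : Γ(X, V)) m, coord k V h (r • m) = r • coord k V h m
  bijective : ∀ k V h, Function.Bijective (coord k V h)
  map_res : ∀ k V W (h : V ≤ U k) (hW : W ≤ V) m,
    coord k W (hW.trans h) (M.presheaf.map (homOfLE hW).op m) = res hW (coord k V h m)
  coord_zero : ∀ V h₀ h₁ m, coord 0 V h₀ m = t V h₀ h₁ (coord 1 V h₁ m)

namespace Frames

variable {U T res t} {M M' : X.Modules} (F : Frames U T res t M) (F' : Frames U T res t M')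

/-- Two sections have the same coordinates. -/
def Rel (V : X.Opens) (m : Γ(M, V)) (m' : Γ(M', V)) : Prop :=
  ∀ k, F.coord k (V ⊓ U k) inf_le_right (M.presheaf.map (homOfLE inf_le_left).op m) =
    F'.coord k (V ⊓ U k) inf_le_right (M'.presheaf.map (homOfLE inf_le_left).op m')

variable {F F'}

theorem Rel.symm {V : X.Opens} {m : Γ(M, V)} {m' : Γ(M', V)} (h : Rel F F' V m m') :
    Rel F' F V m' m := fun k ↦ (h k).symm

theorem Rel.add {V : X.Opens} {m n : Γ(M, V)} {m' n' : Γ(M', V)} (h : Rel F F' V m m')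
    (h' : Rel F F' V n n') : Rel F F' V (m + n) (m' + n') := fun k ↦ by
  simp only [_root_.map_add, F.map_add, F'.map_add, h k, h' k]

theorem Rel.smul {V : X.Opens} {m : Γ(M, V)} {m' : Γ(M', V)} (h : Rel F F' V m m')
    (r : Γ(X, V)) : Rel F F' V (r • m) (r • m') := fun k ↦ by
  rw [Scheme.Modules.map_smul, Scheme.Modules.map_smul, F.map_smul, F'.map_smul, h k]

theorem Rel.map {V W : X.Opens} (hW : W ≤ V) {m : Γ(M, V)} {m' : Γ(M', V)} (h : Rel F F' V m m') :
    Rel F F' W (M.presheaf.map (homOfLE hW).op m) (M'.presheaf.map (homOfLE hW).op m') := fun k ↦ by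
  have h1 : W ⊓ U k ≤ V ⊓ U k := inf_le_inf_right _ hW
  have h2 := congrArg (res h1) (h k)
  rw [← F.map_res, ← F'.map_res] at h2
  rw [map_map_apply] at h2 ⊢
  rw [map_map_apply] at h2 ⊢
  exact h2

theorem Rel.unique (hU : U 0 ⊔ U 1 = ⊤) {V : X.Opens} {m : Γ(M, V)} {m' n' : Γ(M', V)}
    (h : Rel F F' V m m') (h' : Rel F F' V m n') : m' = n' := by
  refine Modules.eq_of_locally_eq M' (fun k ↦ V ⊓ U k) (fun _ ↦ inf_le_left) ?_ _ _ fun k ↦ ?_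
  · rw [← inf_iSup_eq]
    refine le_inf le_rfl (le_top.trans (hU.ge.trans (sup_le (le_iSup U 0) (le_iSup U 1))))
  · exact (F'.bijective k _ _).1 ((h k).symm.trans (h' k))

theorem coord_eq_iff (V : X.Opens) (k l : Fin 2) (hk : V ≤ U k) (hl : V ≤ U l) (m : Γ(M, V))
    (m' : Γ(M', V)) : F.coord k V hk m = F'.coord k V hk m' ↔ F.coord l V hl m = F'.coord l V hl m' := by
  have key (h₀ : V ≤ U 0) (h₁ : V ≤ U 1) :
      F.coord 0 V h₀ m = F'.coord 0 V h₀ m' ↔ F.coord 1 V h₁ m = F'.coord 1 V h₁ m' := by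
    refine ⟨fun h ↦ ?_, fun h ↦ ?_⟩
    · obtain ⟨n, hn⟩ := (F.bijective 1 V h₁).2 (F'.coord 1 V h₁ m')
      have : F.coord 0 V h₀ n = F.coord 0 V h₀ m := by
        rw [F.coord_zero V h₀ h₁, hn, ← F'.coord_zero V h₀ h₁, h]
      rw [← (F.bijective 0 V h₀).1 this, hn]
    · rw [F.coord_zero V h₀ h₁, F'.coord_zero V h₀ h₁, h]
  fin_cases k <;> fin_cases l
  · rfl
  · exact key hk hl
  · exact (key hl hk).symm
  · rfl

theorem exists_rel (hU : U 0 ⊔ U 1 = ⊤) (V : X.Opens) (m : Γ(M, V)) : ∃ m', Rel F F' V m m' := by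
  choose n hn using fun k ↦ (F'.bijective k (V ⊓ U k) inf_le_right).2
    (F.coord k (V ⊓ U k) inf_le_right (M.presheaf.map (homOfLE inf_le_left).op m))
  obtain ⟨m', hm'⟩ := Modules.exists_gluing M' (fun k ↦ V ⊓ U k) (fun _ ↦ inf_le_left) (by
    rw [← inf_iSup_eq]
    exact le_inf le_rfl (le_top.trans (hU.ge.trans (sup_le (le_iSup U 0) (le_iSup U 1))))) n (by
    intro k l
    have hk : (V ⊓ U k) ⊓ (V ⊓ U l) ≤ U k := inf_le_left.trans inf_le_right
    have hl : (V ⊓ U k) ⊓ (V ⊓ U l) ≤ U l := inf_le_right.trans inf_le_right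
    refine (F'.bijective k _ hk).1 ?_
    have e1 := F'.map_res k _ _ inf_le_right (inf_le_left : (V ⊓ U k) ⊓ (V ⊓ U l) ≤ V ⊓ U k) (n k)
    have e2 := F'.map_res l _ _ inf_le_right (inf_le_right : (V ⊓ U k) ⊓ (V ⊓ U l) ≤ V ⊓ U l) (n l)
    rw [hn, ← F.map_res, map_map_apply] at e1 e2
    exact e1.trans ((coord_eq_iff (F := F) (F' := F') _ k l hk hl _ _).2 e2.symm))
  exact ⟨m', fun k ↦ by rw [hm', hn]⟩

variable (F F') in
/-- The homomorphism that respects coordinates. -/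
def hom (hU : U 0 ⊔ U 1 = ⊤) : M ⟶ M' :=
  Modules.mkHom (fun V ↦ AddMonoidHom.mk' (fun m ↦ (exists_rel (F := F) (F' := F') hU V m).choose)
      fun m n ↦ (exists_rel hU V _).choose_spec.unique hU
        ((exists_rel hU V m).choose_spec.add (exists_rel hU V n).choose_spec))
    (fun V r m ↦ (exists_rel hU V _).choose_spec.unique hU ((exists_rel hU V m).choose_spec.smul r))
    (fun V W h m ↦ (exists_rel hU W _).choose_spec.unique hU
      ((exists_rel hU V m).choose_spec.map h))

theorem rel_hom (hU : U 0 ⊔ U 1 = ⊤) (V : X.Opens) (m : Γ(M, V)) :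
    Rel F F' V m ((hom F F' hU).app V m) :=
  (exists_rel hU V m).choose_spec

theorem hom_comp_hom (hU : U 0 ⊔ U 1 = ⊤) : hom F F' hU ≫ hom F' F hU = 𝟙 M := by
  refine Scheme.Modules.hom_ext _ _ fun V ↦ ?_
  ext m
  exact (rel_hom hU V _).unique hU (rel_hom hU V m).symm

variable (F F') in
/-- Modules with the same coordinate changes are isomorphic. -/
def iso (hU : U 0 ⊔ U 1 = ⊤) : M ≅ M' := ⟨hom F F' hU, hom F' F hU, hom_comp_hom hU, hom_comp_hom hU⟩

end Frames
end Frames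

section DualSections
variable {Z Y : Scheme.{u}}

theorem map_map_section {X : Scheme.{u}} {V W T : X.Opens} (h : W ≤ V) (h' : T ≤ W)
    (m : Γ(X, V)) : X.presheaf.map (homOfLE h').op (X.presheaf.map (homOfLE h).op m) =
      X.presheaf.map (homOfLE (h'.trans h)).op m := by
  rw [← CommRingCat.comp_apply, ← Functor.map_comp]; rfl

/-- The sheaf of functions on the open subset `V`, as a module on the whole scheme. -/
def openUnit (V : Z.Opens) : Z.Modules :=
  (Scheme.Modules.pushforward V.ι).obj (SheafOfModules.unit V.toScheme.ringCatSheaf : V.toScheme.Modules)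

/-- The functions on `V ⊓ W`, as sections over `W`. -/
def openUnitEquiv (V W : Z.Opens) : Γ(openUnit V, W) ≃+ Γ(Z, V.ι ''ᵁ V.ι ⁻¹ᵁ W) where
  toFun m := m
  invFun m := m
  left_inv _ := rfl
  right_inv _ := rfl
  map_add' _ _ := rfl

theorem image_preimage_le (V W : Z.Opens) : V.ι ''ᵁ V.ι ⁻¹ᵁ W ≤ W := by
  rw [Scheme.Hom.image_preimage_eq_opensRange_inf]; exact inf_le_right

theorem le_image_preimage {V W W' : Z.Opens} (hV : W' ≤ V) (hW : W' ≤ W) :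
    W' ≤ V.ι ''ᵁ V.ι ⁻¹ᵁ W := by
  rw [Scheme.Hom.image_preimage_eq_opensRange_inf, Scheme.Opens.opensRange_ι]
  exact le_inf hV hW

theorem openUnitEquiv_smul (V W : Z.Opens) (r : Γ(Z, W)) (m : Γ(openUnit V, W)) :
    openUnitEquiv V W (r • m) =
      Z.presheaf.map (homOfLE (image_preimage_le V W)).op r * openUnitEquiv V W m := by
  have h : V.ι.app W r = Z.presheaf.map (homOfLE (image_preimage_le V W)).op r := by
    rw [Scheme.Opens.ι_app]; rfl
  rw [← h]
  rfl

theorem openUnitEquiv_map (V : Z.Opens) {W W' : Z.Opens} (h : W' ≤ W) (m : Γ(openUnit V, W)) :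
    openUnitEquiv V W' ((openUnit V).presheaf.map (homOfLE h).op m) =
      Z.presheaf.map (homOfLE (V.ι.image_mono (V.ι.preimage_mono h))).op (openUnitEquiv V W m) :=
  rfl

theorem dualSections_map {A : Z.Modules} {V : Z.Opens} (φ : dualSections A V) {W W' : Z.Opens}
    (hW : W ≤ V) (hW' : W' ≤ V) (h : W' ≤ W) (m : Γ(A, W)) :
    φ.1 ⟨W', hW'⟩ (A.presheaf.map (homOfLE h).op m) =
      Z.presheaf.map (homOfLE h).op (φ.1 ⟨W, hW⟩ m) :=
  φ.2 ⟨W, hW⟩ ⟨W', hW'⟩ h m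

/-- A section of the dual over `V`, as a homomorphism to the functions on `V`. -/
def homOfDualSection {A : Z.Modules} {V : Z.Opens} (φ : dualSections A V) : A ⟶ openUnit V :=
  Modules.mkHom (fun W ↦ AddMonoidHom.mk' (fun m ↦ (openUnitEquiv V W).symm
      (φ.1 ⟨V.ι ''ᵁ V.ι ⁻¹ᵁ W, V.ι_image_le _⟩
        (A.presheaf.map (homOfLE (image_preimage_le V W)).op m))) (fun m n ↦ by simp))
    (fun W r m ↦ by
      refine (openUnitEquiv V W).injective ?_
      rw [openUnitEquiv_smul]
      change φ.1 _ _ = _ * φ.1 _ _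
      rw [Scheme.Modules.map_smul, LinearMap.map_smul]
      rfl)
    (fun W W' h m ↦ by
      refine (openUnitEquiv V W').injective ?_
      rw [openUnitEquiv_map]
      refine Eq.trans ?_ (dualSections_map φ (V.ι_image_le _) (V.ι_image_le _)
        (V.ι.image_mono (V.ι.preimage_mono h)) _)
      change φ.1 _ _ = φ.1 _ _
      rw [map_map_apply, map_map_apply])

theorem homOfDualSection_injective {A : Z.Modules} {V : Z.Opens} {φ ψ : dualSections A V}
    (h : homOfDualSection φ = homOfDualSection ψ) : φ = ψ := by
  refine Subtype.ext (funext fun W ↦ LinearMap.ext fun m ↦ ?_)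
  have h1 := congrArg (fun f ↦ Scheme.Modules.Hom.app f W.1 m) h
  have h2 : φ.1 ⟨V.ι ''ᵁ V.ι ⁻¹ᵁ W.1, V.ι_image_le _⟩
        (A.presheaf.map (homOfLE (image_preimage_le V W.1)).op m) =
      ψ.1 ⟨V.ι ''ᵁ V.ι ⁻¹ᵁ W.1, V.ι_image_le _⟩
        (A.presheaf.map (homOfLE (image_preimage_le V W.1)).op m) := h1
  have hl := le_image_preimage W.2 le_rfl
  have h3 := congrArg (Z.presheaf.map (homOfLE hl).op) h2
  rw [← dualSections_map φ _ W.2 hl, ← dualSections_map ψ _ W.2 hl, map_map_apply,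
    map_self_apply] at h3
  exact h3

theorem exists_dualSection {A : Z.Modules} {V : Z.Opens} (h : A ⟶ openUnit V) :
    ∃ φ : dualSections A V, ∀ (W) (hW : W ≤ V) (m : Γ(A, W)), φ.1 ⟨W, hW⟩ m =
      Z.presheaf.map (homOfLE (le_image_preimage hW le_rfl)).op (openUnitEquiv V W (h.app W m)) := by
  refine ⟨⟨fun W ↦
    { toFun := fun m ↦ Z.presheaf.map (homOfLE (le_image_preimage W.2 le_rfl)).op
        (openUnitEquiv V W.1 (h.app W.1 m))
      map_add' := fun m n ↦ by simp
      map_smul' := fun r m ↦ by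
        rw [Scheme.Modules.Hom.app_smul, openUnitEquiv_smul, map_mul, map_map_section]
        congr 1
        have : (homOfLE ((le_image_preimage W.2 le_rfl).trans (image_preimage_le V W.1))).op =
          𝟙 (op W.1) := rfl
        rw [this, CategoryTheory.Functor.map_id]; rfl }, ?_⟩, fun _ _ _ ↦ rfl⟩
  intro W W' hW m
  change Z.presheaf.map _ (openUnitEquiv V W'.1 (h.app W'.1 (A.presheaf.map _ m))) =
    Z.presheaf.map _ (Z.presheaf.map _ (openUnitEquiv V W.1 (h.app W.1 m)))
  have h1 : h.app W'.1 (A.presheaf.map (homOfLE hW).op m) =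
      (openUnit V).presheaf.map (homOfLE hW).op (h.app W.1 m) :=
    congrArg (fun f ↦ AddCommGrpCat.Hom.hom f m) (h.mapPresheaf.naturality (homOfLE hW).op)
  rw [h1, openUnitEquiv_map, map_map_section, map_map_section]

variable (i : Z ⟶ Y) (I : Y.Modules)

/-- The pullback of sections. -/
def pullbackSection {W : Y.Opens} (m : Γ(I, W)) : Γ((Scheme.Modules.pullback i).obj I, i ⁻¹ᵁ W) :=
  ((Scheme.Modules.pullbackPushforwardAdjunction i).unit.app I).app W m

theorem pullbackSection_add {W : Y.Opens} (m n : Γ(I, W)) :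
    pullbackSection i I (m + n) = pullbackSection i I m + pullbackSection i I n :=
  map_add (((Scheme.Modules.pullbackPushforwardAdjunction i).unit.app I).app W).hom m n

theorem pullbackSection_smul {W : Y.Opens} (r : Γ(Y, W)) (m : Γ(I, W)) :
    pullbackSection i I (r • m) = i.app W r • pullbackSection i I m :=
  Scheme.Modules.Hom.app_smul ((Scheme.Modules.pullbackPushforwardAdjunction i).unit.app I) r m

theorem pullbackSection_map {W W' : Y.Opens} (h : W' ≤ W) (m : Γ(I, W)) :
    pullbackSection i I (I.presheaf.map (homOfLE h).op m) =
      ((Scheme.Modules.pullback i).obj I).presheaf.map (homOfLE (i.preimage_mono h)).op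
        (pullbackSection i I m) :=
  congrArg (fun f ↦ AddCommGrpCat.Hom.hom f m)
    (((Scheme.Modules.pullbackPushforwardAdjunction i).unit.app I).mapPresheaf.naturality (homOfLE h).op)

theorem dualSection_ext {V : Z.Opens} {φ ψ : dualSections ((Scheme.Modules.pullback i).obj I) V}
    (h : ∀ (W : Y.Opens) (m : Γ(I, W)) (W' : Z.Opens) (hV : W' ≤ V) (hW : W' ≤ i ⁻¹ᵁ W),
      φ.1 ⟨W', hV⟩ (Scheme.Modules.presheaf _ |>.map (homOfLE hW).op (pullbackSection i I m)) =
      ψ.1 ⟨W', hV⟩ (Scheme.Modules.presheaf _ |>.map (homOfLE hW).op (pullbackSection i I m))) :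
    φ = ψ := by
  refine homOfDualSection_injective
    (((Scheme.Modules.pullbackPushforwardAdjunction i).homEquiv _ _).injective ?_)
  rw [Adjunction.homEquiv_unit, Adjunction.homEquiv_unit]
  refine Scheme.Modules.hom_ext _ _ fun W ↦ ?_
  ext m
  exact congrArg (openUnitEquiv V _).symm (h W m _ (V.ι_image_le _) (image_preimage_le V _))

theorem exists_dualSection_pullback {V : Z.Opens}
    (θ : I ⟶ (Scheme.Modules.pushforward i).obj (openUnit V)) :
    ∃ φ : dualSections ((Scheme.Modules.pullback i).obj I) V,
      ∀ (W : Y.Opens) (m : Γ(I, W)) (W' : Z.Opens) (hV : W' ≤ V) (hW : W' ≤ i ⁻¹ᵁ W),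
        φ.1 ⟨W', hV⟩ (Scheme.Modules.presheaf _ |>.map (homOfLE hW).op (pullbackSection i I m)) =
          Z.presheaf.map (homOfLE (le_image_preimage hV hW)).op
            (openUnitEquiv V (i ⁻¹ᵁ W) (θ.app W m)) := by
  let adj := Scheme.Modules.pullbackPushforwardAdjunction i
  let h := (adj.homEquiv _ _).symm θ
  have hθ : θ = adj.unit.app I ≫ (Scheme.Modules.pushforward i).map h := by
    exact (Equiv.apply_symm_apply (adj.homEquiv _ _) θ).symm.trans (adj.homEquiv_unit _ _ _)
  obtain ⟨φ, hφ⟩ := exists_dualSection h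
  refine ⟨φ, fun W m W' hV hW ↦ ?_⟩
  have h1 : h.app W' (Scheme.Modules.presheaf _ |>.map (homOfLE hW).op (pullbackSection i I m)) =
      (openUnit V).presheaf.map (homOfLE hW).op (h.app (i ⁻¹ᵁ W) (pullbackSection i I m)) :=
    congrArg (fun f ↦ AddCommGrpCat.Hom.hom f (pullbackSection i I m))
      (h.mapPresheaf.naturality (homOfLE hW).op)
  have h2 : θ.app W m = h.app (i ⁻¹ᵁ W) (pullbackSection i I m) := by rw [hθ]; rfl
  rw [hφ, h1, openUnitEquiv_map, map_map_section, h2]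

end DualSections

section KernelSections
variable {X : Scheme.{u}} {M N : X.Modules} (φ : M ⟶ N)

theorem kernel_ι_app_injective (W : X.Opens) : Function.Injective ((kernel.ι φ).app W) := by
  have h : Mono ((Scheme.Modules.toPresheaf X).map (kernel.ι φ)) := inferInstance
  have h1 : Mono (((Scheme.Modules.toPresheaf X).map (kernel.ι φ)).app (op W)) := inferInstance
  exact (AddCommGrpCat.mono_iff_injective _).1 h1

theorem exists_kernel_ι_app_eq (W : X.Opens) (m : Γ(M, W)) (h : φ.app W m = 0) :
    ∃ n : Γ(kernel φ, W), (kernel.ι φ).app W n = m := by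
  let F := Scheme.Modules.toPresheaf X ⋙ (evaluation _ _).obj (op W)
  have h1 : PreservesLimits (Scheme.Modules.toPresheaf X) := inferInstance
  have h2 : PreservesLimits ((evaluation (Opens X)ᵒᵖ Ab.{u}).obj (op W)) := inferInstance
  have : PreservesLimits F := comp_preservesLimits _ _
  have : PreservesLimit (parallelPair φ 0) F := inferInstance
  have hF : F.PreservesZeroMorphisms := ⟨fun _ _ ↦ rfl⟩
  let hl := KernelFork.mapIsLimit _ (kernelIsKernel φ) F
  let f : Γ(M, W) ⟶ Γ(N, W) := F.map φ
  obtain ⟨l, hl'⟩ := KernelFork.IsLimit.lift' hl (AddCommGrpCat.ofHom f.hom.ker.subtype) (by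
    ext x
    exact x.2)
  exact ⟨l (⟨m, h⟩ : f.hom.ker), congrArg (fun g ↦ AddCommGrpCat.Hom.hom g (⟨m, h⟩ : f.hom.ker)) hl'⟩

end KernelSections

section NormalCoordinates
variable {Z Y : Scheme.{u}} (i : Z ⟶ Y)

/-- The structure sheaf as a module. -/
abbrev unitModule (X : Scheme.{u}) : X.Modules := SheafOfModules.unit X.ringCatSheaf

/-- The restriction of functions as a homomorphism of modules. -/
def restrictionHom : unitModule Y ⟶ (Scheme.Modules.pushforward i).obj (unitModule Z) :=
  structureMap i

/-- The ideal of a closed immersion as a module. -/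
abbrev idealModule : Y.Modules := kernel (restrictionHom i)

/-- The function on the ambient scheme given by a section of the ideal. -/
def idealVal (W : Y.Opens) : Γ(idealModule i, W) →+ Γ(Y, W) :=
  ((kernel.ι (restrictionHom i)).app W).hom

variable {i}

theorem idealVal_injective (W : Y.Opens) : Function.Injective (idealVal i W) :=
  kernel_ι_app_injective _ W

theorem idealVal_smul {W : Y.Opens} (r : Γ(Y, W)) (m) : idealVal i W (r • m) = r * idealVal i W m :=
  Scheme.Modules.Hom.app_smul (kernel.ι (restrictionHom i)) r m

theorem idealVal_map {W W' : Y.Opens} (h : W' ≤ W) (m) :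
    idealVal i W' ((idealModule i).presheaf.map (homOfLE h).op m) =
      Y.presheaf.map (homOfLE h).op (idealVal i W m) :=
  congrArg (fun f ↦ AddCommGrpCat.Hom.hom f m)
    ((kernel.ι (restrictionHom i)).mapPresheaf.naturality (homOfLE h).op)

theorem app_idealVal {W : Y.Opens} (m) : i.app W (idealVal i W m) = 0 :=
  congrArg (fun φ ↦ Scheme.Modules.Hom.app φ W m) (kernel.condition (restrictionHom i))

theorem exists_idealVal_eq {W : Y.Opens} (m : Γ(Y, W)) (h : i.app W m = 0) :
    ∃ n, idealVal i W n = m :=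
  exists_kernel_ι_app_eq (restrictionHom i) W m h

theorem app_map_apply {W W' : Y.Opens} (h : W' ≤ W) (r : Γ(Y, W)) :
    i.app W' (Y.presheaf.map (homOfLE h).op r) =
      Z.presheaf.map (homOfLE (i.preimage_mono h)).op (i.app W r) :=
  congrArg (fun φ ↦ CommRingCat.Hom.hom φ r) (i.naturality (homOfLE h).op)

variable (i) in
/-- The functions `f, g` on `Ω` form a regular sequence that generates the ideal of `Z`. -/
structure IsConormalFrame (Ω : Y.Opens) (f g : Γ(Y, Ω)) : Prop where
  app_left : i.app Ω f = 0
  app_right : i.app Ω g = 0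
  generate : ∀ (W : Y.Opens) (h : W ≤ Ω) (m : Γ(Y, W)), i.app W m = 0 → ∀ y ∈ W,
    ∃ (W' : Y.Opens) (h' : W' ≤ W), y ∈ W' ∧ ∃ u v : Γ(Y, W'), Y.presheaf.map (homOfLE h').op m =
      u * Y.presheaf.map (homOfLE (h'.trans h)).op f + v * Y.presheaf.map (homOfLE (h'.trans h)).op g
  syzygy : ∀ (W : Y.Opens) (h : W ≤ Ω) (u v : Γ(Y, W)),
    u * Y.presheaf.map (homOfLE h).op f + v * Y.presheaf.map (homOfLE h).op g = 0 →
      i.app W u = 0 ∧ i.app W v = 0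

section Combo
variable {V : Z.Opens} (a b : Γ(Z, V))

variable (i) in
/-- A linear combination of `a` and `b`. -/
def combo {N : Y.Opens} (u v : Γ(Y, N)) {W : Z.Opens} (hV : W ≤ V) (hN : W ≤ i ⁻¹ᵁ N) : Γ(Z, W) :=
  Z.presheaf.map (homOfLE hN).op (i.app N u) * Z.presheaf.map (homOfLE hV).op a +
    Z.presheaf.map (homOfLE hN).op (i.app N v) * Z.presheaf.map (homOfLE hV).op b

theorem combo_map {N : Y.Opens} (u v : Γ(Y, N)) {W W' : Z.Opens} (hV : W ≤ V) (hN : W ≤ i ⁻¹ᵁ N)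
    (h : W' ≤ W) : Z.presheaf.map (homOfLE h).op (combo i a b u v hV hN) =
      combo i a b u v (h.trans hV) (h.trans hN) := by
  rw [combo, combo, map_add, map_mul, map_mul]
  rw [map_map_section, map_map_section, map_map_section, map_map_section]

theorem combo_restrict {N N' : Y.Opens} (u v : Γ(Y, N)) {W : Z.Opens} (hV : W ≤ V) (h : N' ≤ N)
    (hN : W ≤ i ⁻¹ᵁ N') : combo i a b (Y.presheaf.map (homOfLE h).op u)
      (Y.presheaf.map (homOfLE h).op v) hV hN =
        combo i a b u v hV (hN.trans (i.preimage_mono h)) := by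
  rw [combo, combo, app_map_apply, app_map_apply, map_map_section, map_map_section]

theorem combo_add {N : Y.Opens} (u v u' v' : Γ(Y, N)) {W : Z.Opens} (hV : W ≤ V) (hN : W ≤ i ⁻¹ᵁ N) :
    combo i a b (u + u') (v + v') hV hN = combo i a b u v hV hN + combo i a b u' v' hV hN := by
  simp only [combo, map_add]; ring

theorem combo_mul {N : Y.Opens} (r u v : Γ(Y, N)) {W : Z.Opens} (hV : W ≤ V) (hN : W ≤ i ⁻¹ᵁ N) :
    combo i a b (r * u) (r * v) hV hN =
      Z.presheaf.map (homOfLE hN).op (i.app N r) * combo i a b u v hV hN := by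
  simp only [combo, map_mul]; ring

end Combo

namespace IsConormalFrame

variable {Ω : Y.Opens} {f g : Γ(Y, Ω)} (h : IsConormalFrame i Ω f g)

theorem combo_eq (h : IsConormalFrame i Ω f g) {V : Z.Opens} (a b : Γ(Z, V)) {N : Y.Opens} (hΩ : N ≤ Ω)
    {u v u' v' : Γ(Y, N)}
    (e : u * Y.presheaf.map (homOfLE hΩ).op f + v * Y.presheaf.map (homOfLE hΩ).op g =
      u' * Y.presheaf.map (homOfLE hΩ).op f + v' * Y.presheaf.map (homOfLE hΩ).op g)
    {W : Z.Opens} (hV : W ≤ V) (hN : W ≤ i ⁻¹ᵁ N) :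
    combo i a b u v hV hN = combo i a b u' v' hV hN := by
  obtain ⟨h1, h2⟩ := h.syzygy N hΩ (u - u') (v - v') (by linear_combination e)
  rw [map_sub, sub_eq_zero] at h1 h2
  rw [combo, combo, h1, h2]

variable (i f g) in
/-- The value at `m` of the homomorphism that maps `f` to `a` and `g` to `b`. -/
def IsValue {V : Z.Opens} (a b : Γ(Z, V)) (W : Y.Opens) (m : Γ(Y, W))
    (σ : Γ(Z, V.ι ''ᵁ V.ι ⁻¹ᵁ i ⁻¹ᵁ W)) : Prop :=
  ∀ z ∈ V, i z ∈ W → ∃ (N : Y.Opens) (hW : N ≤ W) (hΩ : N ≤ Ω) (u v : Γ(Y, N)), i z ∈ N ∧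
    Y.presheaf.map (homOfLE hW).op m =
      u * Y.presheaf.map (homOfLE hΩ).op f + v * Y.presheaf.map (homOfLE hΩ).op g ∧
    ∀ (W' : Z.Opens) (hV : W' ≤ V) (hN : W' ≤ i ⁻¹ᵁ N),
      Z.presheaf.map (homOfLE (le_image_preimage hV (hN.trans (i.preimage_mono hW)))).op σ =
        combo i a b u v hV hN

theorem mem_of_mem_image {V W : Z.Opens} {z : Z} (hz : z ∈ V.ι ''ᵁ V.ι ⁻¹ᵁ W) : z ∈ V ∧ z ∈ W :=
  ⟨V.ι_image_le _ hz, image_preimage_le V W hz⟩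

theorem res_eq {X : Scheme.{u}} {N W W' : X.Opens} (h : W ≤ N) (h' : W' ≤ W) {m : Γ(X, W)}
    {f g : Γ(X, N)} {u v : Γ(X, W)} (e : m = u * X.presheaf.map (homOfLE h).op f +
      v * X.presheaf.map (homOfLE h).op g) : X.presheaf.map (homOfLE h').op m =
    X.presheaf.map (homOfLE h').op u * X.presheaf.map (homOfLE (h'.trans h)).op f +
      X.presheaf.map (homOfLE h').op v * X.presheaf.map (homOfLE (h'.trans h)).op g := by
  rw [e, map_add, map_mul, map_mul, map_map_section, map_map_section]

variable {V : Z.Opens} {a b : Γ(Z, V)} {W : Y.Opens}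

theorem IsValue.unique (h : IsConormalFrame i Ω f g) {m : Γ(Y, W)} {σ σ'}
    (hσ : IsValue i f g a b W m σ) (hσ' : IsValue i f g a b W m σ') : σ = σ' := by
  have key (z : (V.ι ''ᵁ V.ι ⁻¹ᵁ i ⁻¹ᵁ W : Z.Opens)) : ∃ (W' : Z.Opens)
      (hW' : W' ≤ V.ι ''ᵁ V.ι ⁻¹ᵁ i ⁻¹ᵁ W), z.1 ∈ W' ∧
      Z.presheaf.map (homOfLE hW').op σ = Z.presheaf.map (homOfLE hW').op σ' := by
    obtain ⟨hz, hzW⟩ := mem_of_mem_image z.2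
    obtain ⟨N, hW, hΩ, u, v, hN, e, H⟩ := hσ z.1 hz hzW
    obtain ⟨N', hW', hΩ', u', v', hN', e', H'⟩ := hσ' z.1 hz hzW
    refine ⟨V ⊓ i ⁻¹ᵁ (N ⊓ N'), le_image_preimage inf_le_left (inf_le_right.trans
      (i.preimage_mono (inf_le_left.trans hW))), ⟨hz, hN, hN'⟩, ?_⟩
    rw [H _ inf_le_left (inf_le_right.trans (i.preimage_mono inf_le_left)),
      H' _ inf_le_left (inf_le_right.trans (i.preimage_mono inf_le_right)),
      ← combo_restrict a b u v inf_le_left inf_le_left inf_le_right,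
      ← combo_restrict a b u' v' inf_le_left inf_le_right inf_le_right]
    refine h.combo_eq a b (inf_le_left.trans hΩ) ?_ _ _
    rw [← res_eq hΩ inf_le_left e, ← res_eq hΩ' inf_le_right e', map_map_section, map_map_section]
  choose W' hW' hz e using key
  exact Z.sheaf.eq_of_locally_eq' W' _ (fun z ↦ homOfLE (hW' z))
    (fun z hz' ↦ Opens.mem_iSup.2 ⟨⟨z, hz'⟩, hz _⟩) _ _ e

theorem IsValue.add {m n : Γ(Y, W)} {σ τ} (hσ : IsValue i f g a b W m σ)
    (hτ : IsValue i f g a b W n τ) : IsValue i f g a b W (m + n) (σ + τ) := by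
  intro z hz hzW
  obtain ⟨N, hW, hΩ, u, v, hN, e, H⟩ := hσ z hz hzW
  obtain ⟨N', hW', hΩ', u', v', hN', e', H'⟩ := hτ z hz hzW
  refine ⟨N ⊓ N', inf_le_left.trans hW, inf_le_left.trans hΩ,
    Y.presheaf.map (homOfLE inf_le_left).op u + Y.presheaf.map (homOfLE inf_le_right).op u',
    Y.presheaf.map (homOfLE inf_le_left).op v + Y.presheaf.map (homOfLE inf_le_right).op v',
    ⟨hN, hN'⟩, ?_, fun W' hV hNN ↦ ?_⟩
  · have e1 := res_eq hΩ (inf_le_left : N ⊓ N' ≤ N) e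
    have e2 := res_eq hΩ' (inf_le_right : N ⊓ N' ≤ N') e'
    rw [map_map_section] at e1 e2
    rw [map_add, e1, e2]
    ring
  · rw [map_add, combo_add, combo_restrict, combo_restrict, ← H _ hV, ← H' _ hV]

theorem IsValue.smul {m : Γ(Y, W)} {σ} (hσ : IsValue i f g a b W m σ) (r : Γ(Y, W)) :
    IsValue i f g a b W (r * m)
      (Z.presheaf.map (homOfLE (image_preimage_le V (i ⁻¹ᵁ W))).op (i.app W r) * σ) := by
  intro z hz hzW
  obtain ⟨N, hW, hΩ, u, v, hN, e, H⟩ := hσ z hz hzW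
  refine ⟨N, hW, hΩ, Y.presheaf.map (homOfLE hW).op r * u, Y.presheaf.map (homOfLE hW).op r * v, hN,
    ?_, fun W' hV hN' ↦ ?_⟩
  · rw [map_mul, e]; ring
  · rw [map_mul, combo_mul, H _ hV hN', map_map_section, app_map_apply, map_map_section]

theorem IsValue.map {W₂ : Y.Opens} (h₂ : W₂ ≤ W) {m : Γ(Y, W)} {σ} (hσ : IsValue i f g a b W m σ) :
    IsValue i f g a b W₂ (Y.presheaf.map (homOfLE h₂).op m)
      (Z.presheaf.map (homOfLE (V.ι.image_mono (V.ι.preimage_mono (i.preimage_mono h₂)))).op σ) := by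
  intro z hz hzW
  obtain ⟨N, hW, hΩ, u, v, hN, e, H⟩ := hσ z hz (h₂ hzW)
  refine ⟨N ⊓ W₂, inf_le_right, inf_le_left.trans hΩ, Y.presheaf.map (homOfLE inf_le_left).op u,
    Y.presheaf.map (homOfLE inf_le_left).op v, ⟨hN, hzW⟩, ?_, fun W' hV hN' ↦ ?_⟩
  · rw [← res_eq hΩ inf_le_left e, map_map_section, map_map_section]
  · rw [combo_restrict, ← H _ hV, map_map_section]

theorem exists_isValue (h : IsConormalFrame i Ω f g) (hV : V ≤ i ⁻¹ᵁ Ω) (m : Γ(Y, W))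
    (hm : i.app W m = 0) : ∃ σ, IsValue i f g a b W m σ := by
  have key (z : (V.ι ''ᵁ V.ι ⁻¹ᵁ i ⁻¹ᵁ W : Z.Opens)) : ∃ (N : Y.Opens) (hW : N ≤ W) (hΩ : N ≤ Ω)
      (u v : Γ(Y, N)), i z.1 ∈ N ∧ Y.presheaf.map (homOfLE hW).op m =
        u * Y.presheaf.map (homOfLE hΩ).op f + v * Y.presheaf.map (homOfLE hΩ).op g := by
    obtain ⟨hz, hzW⟩ := mem_of_mem_image z.2
    obtain ⟨N, hN, hzN, u, v, e⟩ := h.generate (W ⊓ Ω) inf_le_right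
      (Y.presheaf.map (homOfLE inf_le_left).op m)
      (by rw [app_map_apply, hm, map_zero]) (i z.1) ⟨hzW, hV hz⟩
    rw [map_map_section] at e
    exact ⟨N, hN.trans inf_le_left, hN.trans inf_le_right, u, v, hzN, e⟩
  choose N hW hΩ u v hN e using key
  obtain ⟨σ, hσ, -⟩ := Z.sheaf.existsUnique_gluing' (fun z ↦ V ⊓ i ⁻¹ᵁ (N z))
    (V.ι ''ᵁ V.ι ⁻¹ᵁ i ⁻¹ᵁ W)
    (fun z ↦ homOfLE (le_image_preimage inf_le_left (inf_le_right.trans (i.preimage_mono (hW z)))))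
    (fun z hz ↦ Opens.mem_iSup.2 ⟨⟨z, hz⟩, (mem_of_mem_image hz).1, hN ⟨z, hz⟩⟩)
    (fun z ↦ combo i a b (u z) (v z) inf_le_left inf_le_right) (fun z z' ↦ by
      have h0 : (V ⊓ i ⁻¹ᵁ (N z)) ⊓ (V ⊓ i ⁻¹ᵁ (N z')) ≤ V := inf_le_left.trans inf_le_left
      have h1 : (V ⊓ i ⁻¹ᵁ (N z)) ⊓ (V ⊓ i ⁻¹ᵁ (N z')) ≤ i ⁻¹ᵁ (N z ⊓ N z') :=
        le_inf (inf_le_left.trans inf_le_right) (inf_le_right.trans inf_le_right)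
      refine (combo_map a b (u z) (v z) _ _ inf_le_left).trans
        (Eq.trans ?_ (combo_map a b (u z') (v z') _ _ inf_le_right).symm)
      rw [← combo_restrict a b (u z) (v z) h0 inf_le_left h1,
        ← combo_restrict a b (u z') (v z') h0 inf_le_right h1]
      refine h.combo_eq a b (inf_le_left.trans (hΩ z)) ?_ _ _
      rw [← res_eq (hΩ z) inf_le_left (e z), ← res_eq (hΩ z') inf_le_right (e z'),
        map_map_section, map_map_section])
  refine ⟨σ, fun z hz hzW ↦ ?_⟩
  have hz' : z ∈ V.ι ''ᵁ V.ι ⁻¹ᵁ i ⁻¹ᵁ W :=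
    le_image_preimage (W' := V ⊓ i ⁻¹ᵁ W) inf_le_left inf_le_right ⟨hz, hzW⟩
  refine ⟨N ⟨z, hz'⟩, hW _, hΩ _, u _, v _, hN ⟨z, hz'⟩, e _, fun W' hV' hN' ↦ ?_⟩
  have h1 := congrArg (Z.presheaf.map (homOfLE (le_inf hV' hN')).op) (hσ ⟨z, hz'⟩)
  exact ((map_map_section _ _ _).symm.trans h1).trans (combo_map a b _ _ _ _ _)

theorem isValue_left (hV : V ≤ i ⁻¹ᵁ Ω) : IsValue i f g a b Ω f
    (Z.presheaf.map (homOfLE (V.ι_image_le _)).op a) := fun z hz _ ↦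
  ⟨Ω, le_rfl, le_rfl, 1, 0, hV hz, by simp, fun W' hV' hN ↦ by simp [combo, map_map_section]⟩

theorem isValue_right (hV : V ≤ i ⁻¹ᵁ Ω) : IsValue i f g a b Ω g
    (Z.presheaf.map (homOfLE (V.ι_image_le _)).op b) := fun z hz _ ↦
  ⟨Ω, le_rfl, le_rfl, 0, 1, hV hz, by simp, fun W' hV' hN ↦ by simp [combo, map_map_section]⟩

/-- The homomorphism from the ideal that maps `f` to `a` and `g` to `b`. -/
theorem exists_hom (h : IsConormalFrame i Ω f g) (hV : V ≤ i ⁻¹ᵁ Ω) (a b : Γ(Z, V)) :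
    ∃ θ : idealModule i ⟶ (Scheme.Modules.pushforward i).obj (openUnit V),
      ∀ (W) (m : Γ(idealModule i, W)),
        IsValue i f g a b W (idealVal i W m) (openUnitEquiv V (i ⁻¹ᵁ W) (θ.app W m)) := by
  choose σ hσ using fun W (m : Γ(idealModule i, W)) ↦
    exists_isValue (a := a) (b := b) h hV (idealVal i W m) (app_idealVal m)
  refine ⟨Modules.mkHom (fun W ↦ AddMonoidHom.mk' (fun m ↦ (openUnitEquiv V (i ⁻¹ᵁ W)).symm (σ W m))
    fun m n ↦ ?_) (fun W r m ↦ ?_) (fun W W' hW m ↦ ?_), hσ⟩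
  · refine (openUnitEquiv V (i ⁻¹ᵁ W)).injective ?_
    have := (hσ W m).add (hσ W n)
    rw [← map_add] at this
    exact (hσ W _).unique h this
  · refine (openUnitEquiv V (i ⁻¹ᵁ W)).injective ?_
    have := (hσ W m).smul r
    rw [← idealVal_smul] at this
    exact ((hσ W _).unique h this).trans
      (openUnitEquiv_smul V (i ⁻¹ᵁ W) (i.app W r) ((openUnitEquiv V (i ⁻¹ᵁ W)).symm (σ W m))).symm
  · refine (openUnitEquiv V (i ⁻¹ᵁ W')).injective ?_
    have := (hσ W m).map hW
    rw [← idealVal_map] at this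
    exact (hσ W' _).unique h this

/-- A function in the ideal, as a section of the conormal sheaf. -/
def conormalSection {W : Y.Opens} (m : Γ(Y, W)) (hm : i.app W m = 0) : Γ(conormalSheaf i, i ⁻¹ᵁ W) :=
  pullbackSection i (idealModule i) (exists_idealVal_eq m hm).choose

theorem conormalSection_smul {W : Y.Opens} (r m : Γ(Y, W)) (hm : i.app W m = 0)
    (hrm : i.app W (r * m) = 0) :
    conormalSection (r * m) hrm = i.app W r • conormalSection m hm := by
  rw [conormalSection, conormalSection]
  refine Eq.trans ?_ (pullbackSection_smul i (idealModule i) r _)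
  congr 1
  refine idealVal_injective _ ?_
  rw [idealVal_smul, (exists_idealVal_eq _ hrm).choose_spec, (exists_idealVal_eq m hm).choose_spec]

theorem conormalSection_map {W W' : Y.Opens} (hW : W' ≤ W) (m : Γ(Y, W)) (hm : i.app W m = 0)
    (hm' : i.app W' (Y.presheaf.map (homOfLE hW).op m) = 0) :
    (conormalSheaf i).presheaf.map (homOfLE (i.preimage_mono hW)).op (conormalSection m hm) =
      conormalSection (Y.presheaf.map (homOfLE hW).op m) hm' := by
  rw [conormalSection, conormalSection]
  refine (pullbackSection_map i (idealModule i) hW _).symm.trans ?_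
  congr 1
  refine idealVal_injective _ ?_
  rw [idealVal_map, (exists_idealVal_eq _ hm).choose_spec, (exists_idealVal_eq _ hm').choose_spec]

/-- The value of a normal vector at a function in the ideal. -/
def normalValue {V : Z.Opens} {W : Y.Opens} (hV : V ≤ i ⁻¹ᵁ W) (m : Γ(Y, W)) (hm : i.app W m = 0)
    (φ : dualSections (conormalSheaf i) V) : Γ(Z, V) :=
  φ.1 ⟨V, le_rfl⟩ ((conormalSheaf i).presheaf.map (homOfLE hV).op (conormalSection m hm))

theorem exists_normalValue_eq (h : IsConormalFrame i Ω f g) (hV : V ≤ i ⁻¹ᵁ Ω) (a b : Γ(Z, V)) :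
    ∃ φ, normalValue hV f h.app_left φ = a ∧ normalValue hV g h.app_right φ = b := by
  obtain ⟨θ, hθ⟩ := h.exists_hom hV a b
  obtain ⟨φ, hφ⟩ := exists_dualSection_pullback i (idealModule i) θ
  have key (m : Γ(Y, Ω)) (hm : i.app Ω m = 0) (c : Γ(Z, V))
      (hc : IsValue i f g a b Ω m (Z.presheaf.map (homOfLE (V.ι_image_le _)).op c)) :
      normalValue hV m hm φ = c := by
    refine (hφ Ω _ V le_rfl hV).trans ?_
    have h1 := hθ Ω (exists_idealVal_eq m hm).choose
    rw [(exists_idealVal_eq m hm).choose_spec] at h1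
    rw [h1.unique h hc, map_map_section]
    have : (homOfLE ((le_image_preimage le_rfl hV).trans (V.ι_image_le (V.ι ⁻¹ᵁ i ⁻¹ᵁ Ω)))).op =
      𝟙 (op V) := rfl
    rw [this, CategoryTheory.Functor.map_id]; rfl
  exact ⟨φ, key f _ a (isValue_left hV), key g _ b (isValue_right hV)⟩

theorem normalValue_ext (h : IsConormalFrame i Ω f g) (hV : V ≤ i ⁻¹ᵁ Ω)
    {φ ψ : dualSections (conormalSheaf i) V}
    (hf : normalValue hV f h.app_left φ = normalValue hV f h.app_left ψ)
    (hg : normalValue hV g h.app_right φ = normalValue hV g h.app_right ψ) : φ = ψ := by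
  refine dualSection_ext i (idealModule i) fun W m W' hW' hW ↦ ?_
  have key (z : W') : ∃ (T : Z.Opens) (hT : T ≤ W'), z.1 ∈ T ∧
      Z.presheaf.map (homOfLE hT).op (φ.1 ⟨W', hW'⟩
        (Scheme.Modules.presheaf _ |>.map (homOfLE hW).op (pullbackSection i (idealModule i) m))) =
      Z.presheaf.map (homOfLE hT).op (ψ.1 ⟨W', hW'⟩
        (Scheme.Modules.presheaf _ |>.map (homOfLE hW).op (pullbackSection i (idealModule i) m))) := by
    obtain ⟨N, hN, hzN, u, v, e⟩ := h.generate (W ⊓ Ω) inf_le_right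
      (Y.presheaf.map (homOfLE inf_le_left).op (idealVal i W m))
      (by rw [app_map_apply, app_idealVal, map_zero]) (i z.1) ⟨hW z.2, hV (hW' z.2)⟩
    rw [map_map_section] at e
    let T := W' ⊓ i ⁻¹ᵁ N
    have hTW : T ≤ W' := inf_le_left
    have hTN : T ≤ i ⁻¹ᵁ N := inf_le_right
    let F := (exists_idealVal_eq f h.app_left).choose
    let G := (exists_idealVal_eq g h.app_right).choose
    have e' : (idealModule i).presheaf.map (homOfLE (hN.trans inf_le_left)).op m =
        u • (idealModule i).presheaf.map (homOfLE (hN.trans inf_le_right)).op F +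
          v • (idealModule i).presheaf.map (homOfLE (hN.trans inf_le_right)).op G := by
      refine idealVal_injective _ ?_
      rw [map_add, idealVal_smul, idealVal_smul, idealVal_map, idealVal_map, idealVal_map]
      rw [(exists_idealVal_eq f h.app_left).choose_spec, (exists_idealVal_eq g h.app_right).choose_spec]
      exact e
    have hm : (conormalSheaf i).presheaf.map (homOfLE (hTW.trans hW)).op (pullbackSection i (idealModule i) m) =
        Z.presheaf.map (homOfLE hTN).op (i.app N u) • (conormalSheaf i).presheaf.map
          (homOfLE ((hTW.trans hW').trans hV)).op (conormalSection f h.app_left) +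
        Z.presheaf.map (homOfLE hTN).op (i.app N v) • (conormalSheaf i).presheaf.map
          (homOfLE ((hTW.trans hW').trans hV)).op (conormalSection g h.app_right) := by
      have h1 := pullbackSection_map i (idealModule i) (hN.trans inf_le_left) m
      rw [e'] at h1
      have h2 := congrArg ((conormalSheaf i).presheaf.map (homOfLE hTN).op) h1
      refine ((map_map_apply _ _ _ _).symm.trans h2.symm).trans ?_
      rw [pullbackSection_add, pullbackSection_smul, pullbackSection_smul, pullbackSection_map,
        pullbackSection_map]
      refine (map_add ((conormalSheaf i).presheaf.map (homOfLE hTN).op).hom _ _).trans ?_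
      refine congrArg₂ (· + ·) ?_ ?_ <;>
      · refine (Scheme.Modules.map_smul _ _ _ _).trans (congrArg _ ?_)
        exact map_map_apply _ _ _ _
    have hval (χ : dualSections (conormalSheaf i) V) (c : Γ(Y, Ω)) (hc : i.app Ω c = 0) :
        χ.1 ⟨T, hTW.trans hW'⟩ ((conormalSheaf i).presheaf.map
          (homOfLE ((hTW.trans hW').trans hV)).op (conormalSection c hc)) =
        Z.presheaf.map (homOfLE (hTW.trans hW')).op (normalValue hV c hc χ) := by
      rw [normalValue, ← dualSections_map χ le_rfl, map_map_apply]
    have hres (χ : dualSections (conormalSheaf i) V) :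
        Z.presheaf.map (homOfLE hTW).op (χ.1 ⟨W', hW'⟩
          ((conormalSheaf i).presheaf.map (homOfLE hW).op (pullbackSection i (idealModule i) m))) =
        Z.presheaf.map (homOfLE hTN).op (i.app N u) *
          Z.presheaf.map (homOfLE (hTW.trans hW')).op (normalValue hV f h.app_left χ) +
        Z.presheaf.map (homOfLE hTN).op (i.app N v) *
          Z.presheaf.map (homOfLE (hTW.trans hW')).op (normalValue hV g h.app_right χ) := by
      rw [← dualSections_map χ hW' (hTW.trans hW')]
      refine (congrArg (χ.1 ⟨T, hTW.trans hW'⟩) ((map_map_apply _ _ _ _).trans hm)).trans ?_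
      rw [map_add, LinearMap.map_smul, LinearMap.map_smul, hval, hval]
      rfl
    refine ⟨T, hTW, ⟨z.2, hzN⟩, (hres φ).trans (Eq.trans ?_ (hres ψ).symm)⟩
    rw [hf, hg]
  choose T hT hz e using key
  exact Z.sheaf.eq_of_locally_eq' T _ (fun z ↦ homOfLE (hT z))
    (fun z hz' ↦ Opens.mem_iSup.2 ⟨⟨z, hz'⟩, hz _⟩) _ _ e

end IsConormalFrame

end NormalCoordinates

section TwistFrame

open ProjectiveSpectrum

variable {A : Type u} {σ : Type*} [CommRing A] [SetLike σ A] [AddSubgroupClass σ A]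
variable {𝒜 : ℕ → σ} [GradedRing 𝒜] {f g : A} (hf : f ∈ 𝒜 1) (hg : g ∈ 𝒜 1)

/-- The section `1 / f` of `𝒪(-1)`. -/
def invSection {V : Opens (ProjectiveSpectrum.top 𝒜)} (hf : f ∈ 𝒜 1)
    (h : ∀ x ∈ V, f ∉ x.asHomogeneousIdeal) : twistSections 𝒜 (-1) V :=
  ⟨fun x ↦ Localization.mk 1 ⟨f, h x.1 x.2⟩, fun x ↦ ⟨V, x.2, 𝟙 _, 0, 1, by norm_num,
    ⟨1, SetLike.one_mem_graded 𝒜⟩, ⟨f, hf⟩, fun y ↦ h y.1 y.2, fun _ ↦ rfl⟩⟩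

theorem invSection_smul_injective {V : Opens (ProjectiveSpectrum.top 𝒜)}
    (h : ∀ x ∈ V, f ∉ x.asHomogeneousIdeal) {a b : (Proj.structureSheaf 𝒜).1.obj (op V)}
    (e : a • invSection hf h = b • invSection hf h) : a = b := by
  refine Subtype.ext (funext fun x ↦ HomogeneousLocalization.val_injective _ ?_)
  have h1 : (a.1 x).val * Localization.mk 1 ⟨f, h x.1 x.2⟩ =
      (b.1 x).val * Localization.mk 1 ⟨f, h x.1 x.2⟩ := congrArg (fun s ↦ s.1 x) e
  have h2 := congrArg (· * algebraMap A (TwistFiber 𝒜 x.1) f) h1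
  have h3 : (Localization.mk 1 ⟨f, h x.1 x.2⟩ : TwistFiber 𝒜 x.1) * algebraMap A _ f = 1 := by
    rw [← Localization.mk_one_eq_algebraMap, Localization.mk_mul]
    exact (Localization.mk_eq_mk_iff.2 (Localization.r_iff_exists.2 ⟨1, by simp⟩)).trans
      Localization.mk_one
  dsimp only at h2
  rwa [mul_assoc, mul_assoc, h3, mul_one, mul_one] at h2

theorem exists_smul_invSection {V : Opens (ProjectiveSpectrum.top 𝒜)}
    (h : ∀ x ∈ V, f ∉ x.asHomogeneousIdeal) (s : twistSections 𝒜 (-1) V) :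
    ∃ a : (Proj.structureSheaf 𝒜).1.obj (op V), a • invSection hf h = s := by
  have key (x : V) : ∃ (W : Opens (ProjectiveSpectrum.top 𝒜)) (_ : x.1 ∈ W) (hW : W ≤ V) (j : ℕ)
      (r : 𝒜 j) (t : 𝒜 j) (ht : ∀ y : W, t.1 ∉ y.1.asHomogeneousIdeal),
      ∀ y : W, s.1 ⟨y.1, hW y.2⟩ =
        Localization.mk r.1 ⟨t.1, ht y⟩ * Localization.mk 1 ⟨f, h y.1 (hW y.2)⟩ := by
    obtain ⟨W, hx, i, m, n, hmn, r, t, ht, e⟩ := s.2 x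
    obtain rfl : n = m + 1 := by omega
    refine ⟨W, hx, i.le, m + 1, ⟨r.1 * f, SetLike.mul_mem_graded r.2 hf⟩, t, ht, fun y ↦ ?_⟩
    refine (e y).trans ?_
    rw [Localization.mk_mul]
    refine Localization.mk_eq_mk_iff.2 (Localization.r_iff_exists.2 ⟨1, ?_⟩)
    simp only [OneMemClass.coe_one, one_mul, mul_one]
    change t.1 * f * r.1 = _
    ring
  choose W hx hW j r t ht e using key
  have hc (x y : V) (hy : y.1 ∈ W x) :
      HomogeneousLocalization.mk (𝒜 := 𝒜) (x := y.1.asHomogeneousIdeal.toIdeal.primeCompl)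
        ⟨j x, r x, t x, ht x ⟨y.1, hy⟩⟩ =
      HomogeneousLocalization.mk ⟨j y, r y, t y, ht y ⟨y.1, hx y⟩⟩ := by
    refine HomogeneousLocalization.val_injective _ ?_
    rw [HomogeneousLocalization.val_mk, HomogeneousLocalization.val_mk]
    have h1 := (e x ⟨y.1, hy⟩).symm.trans (e y ⟨y.1, hx y⟩)
    have h2 := congrArg (· * algebraMap A (TwistFiber 𝒜 y.1) f) h1
    have h3 : (Localization.mk 1 ⟨f, h y.1 y.2⟩ : TwistFiber 𝒜 y.1) * algebraMap A _ f = 1 := by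
      rw [← Localization.mk_one_eq_algebraMap, Localization.mk_mul]
      exact (Localization.mk_eq_mk_iff.2 (Localization.r_iff_exists.2 ⟨1, by simp⟩)).trans
        Localization.mk_one
    dsimp only at h2
    rwa [mul_assoc, mul_assoc, h3, mul_one, mul_one] at h2
  refine ⟨⟨fun x ↦ HomogeneousLocalization.mk ⟨j x, r x, t x, ht x ⟨x.1, hx x⟩⟩, fun x ↦
    ⟨W x, hx x, homOfLE (hW x), j x, r x, t x, fun y ↦ ht x y, fun y ↦
      (hc x ⟨y.1, hW x y.2⟩ y.2).symm⟩⟩, ?_⟩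
  refine Subtype.ext (funext fun x ↦ ?_)
  exact (congrArg (· * _) (HomogeneousLocalization.val_mk _)).trans (e x ⟨x.1, hx x⟩).symm

variable (𝒜) in
/-- The function `g / f`. -/
def quotientFunction (hf : f ∈ 𝒜 1) (hg : g ∈ 𝒜 1) : Γ(Proj 𝒜, Proj.basicOpen 𝒜 f) :=
  (AlgebraicGeometry.Proj.awayToSection 𝒜 f).hom (HomogeneousLocalization.Away.mk 𝒜 hf 1 g (by simpa using hg))

theorem quotientFunction_smul (hf : f ∈ 𝒜 1) (hg : g ∈ 𝒜 1) {V : Opens (ProjectiveSpectrum.top 𝒜)}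
    (h : ∀ x ∈ V, f ∉ x.asHomogeneousIdeal) (h' : ∀ x ∈ V, g ∉ x.asHomogeneousIdeal) :
    (show (Proj.structureSheaf 𝒜).1.obj (op V) from
      (Proj 𝒜).presheaf.map (homOfLE (show V ≤ Proj.basicOpen 𝒜 f from h)).op
        (quotientFunction 𝒜 hf hg)) • invSection hg h' = invSection hf h := by
  refine Subtype.ext (funext fun x ↦ ?_)
  have h1 : ((ProjectiveSpectrum.Proj.awayToSection 𝒜 f).hom
      (HomogeneousLocalization.Away.mk 𝒜 hf 1 g (by simpa using hg)) |>.1 ⟨x.1, h x.1 x.2⟩).val =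
      Localization.mk g ⟨f, h x.1 x.2⟩ := by
    refine (ProjectiveSpectrum.Proj.awayToSection_apply 𝒜 f _ ⟨x.1, h x.1 x.2⟩).trans ?_
    rw [HomogeneousLocalization.Away.val_mk, Localization.mk_eq_mk', IsLocalization.map_mk',
      Localization.mk_eq_mk']
    simp only [RingHom.id_apply, pow_one]
  refine (congrArg (· * _) h1).trans ?_
  refine (Localization.mk_mul _ _ _ _).trans (Localization.mk_eq_mk_iff.2
    (Localization.r_iff_exists.2 ⟨1, ?_⟩))
  change (1 : A) * (f * (g * 1)) = 1 * (f * g * 1)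
  ring

/-- Multiplication by `1 / f`. -/
def invMul {V : Opens (ProjectiveSpectrum.top 𝒜)} (hf : f ∈ 𝒜 1)
    (h : ∀ x ∈ V, f ∉ x.asHomogeneousIdeal) (a : (Proj.structureSheaf 𝒜).1.obj (op V)) :
    twistSections 𝒜 (-1) V := a • invSection hf h

theorem invMul_add {V : Opens (ProjectiveSpectrum.top 𝒜)}
    (h : ∀ x ∈ V, f ∉ x.asHomogeneousIdeal) (a b : (Proj.structureSheaf 𝒜).1.obj (op V)) :
    invMul hf h (a + b) = invMul hf h a + invMul hf h b := add_smul _ _ _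

theorem invMul_mul {V : Opens (ProjectiveSpectrum.top 𝒜)}
    (h : ∀ x ∈ V, f ∉ x.asHomogeneousIdeal) (a b : (Proj.structureSheaf 𝒜).1.obj (op V)) :
    invMul hf h (a * b) = a • invMul hf h b := mul_smul _ _ _

theorem invMul_change {V : Opens (ProjectiveSpectrum.top 𝒜)}
    (h : ∀ x ∈ V, f ∉ x.asHomogeneousIdeal) (h' : ∀ x ∈ V, g ∉ x.asHomogeneousIdeal)
    (a ξ : (Proj.structureSheaf 𝒜).1.obj (op V)) (e : ξ • invSection hf h = invSection hg h') :
    invMul hg h' a = a • invMul hf h ξ := by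
  rw [invMul, invMul, e]

variable (𝒜) in
/-- The coordinate of a section of `𝒪(-1)` where `f` does not vanish. -/
def twistCoord (hf : f ∈ 𝒜 1) (V : (Proj 𝒜).Opens) (h : V ≤ Proj.basicOpen 𝒜 f) :
    Γ(twist 𝒜 (-1), V) ≃ Γ(Proj 𝒜, V) :=
  (Equiv.ofBijective (invMul hf h)
    ⟨fun _ _ e ↦ invSection_smul_injective hf h e, exists_smul_invSection hf h⟩).symm

theorem twistCoord_symm_add (V : (Proj 𝒜).Opens) (h : V ≤ Proj.basicOpen 𝒜 f) (a b : Γ(Proj 𝒜, V)) :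
    (twistCoord 𝒜 hf V h).symm (a + b) = (twistCoord 𝒜 hf V h).symm a + (twistCoord 𝒜 hf V h).symm b :=
  invMul_add hf h a b

theorem twistCoord_symm_mul (V : (Proj 𝒜).Opens) (h : V ≤ Proj.basicOpen 𝒜 f) (a b : Γ(Proj 𝒜, V)) :
    (twistCoord 𝒜 hf V h).symm (a * b) = a • (twistCoord 𝒜 hf V h).symm b :=
  invMul_mul hf h a b

theorem twistCoord_symm_map (V W : (Proj 𝒜).Opens) (h : V ≤ Proj.basicOpen 𝒜 f) (hW : W ≤ V)
    (a : Γ(Proj 𝒜, V)) :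
    (twist 𝒜 (-1)).presheaf.map (homOfLE hW).op ((twistCoord 𝒜 hf V h).symm a) =
      (twistCoord 𝒜 hf W (hW.trans h)).symm ((Proj 𝒜).presheaf.map (homOfLE hW).op a) := rfl

theorem twistCoord_symm_change (V : (Proj 𝒜).Opens) (h : V ≤ Proj.basicOpen 𝒜 f)
    (h' : V ≤ Proj.basicOpen 𝒜 g) (a : Γ(Proj 𝒜, V)) :
    (twistCoord 𝒜 hg V h').symm a = (twistCoord 𝒜 hf V h).symm
      (a * (Proj 𝒜).presheaf.map (homOfLE h').op (quotientFunction 𝒜 hg hf)) := by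
  rw [twistCoord_symm_mul]
  exact invMul_change hf hg h h' a _ (quotientFunction_smul hg hf h' h)

theorem twistCoord_add (V : (Proj 𝒜).Opens) (h : V ≤ Proj.basicOpen 𝒜 f) (s t : Γ(twist 𝒜 (-1), V)) :
    twistCoord 𝒜 hf V h (s + t) = twistCoord 𝒜 hf V h s + twistCoord 𝒜 hf V h t := by
  rw [← Equiv.eq_symm_apply, twistCoord_symm_add, Equiv.symm_apply_apply, Equiv.symm_apply_apply]

theorem twistCoord_smul (V : (Proj 𝒜).Opens) (h : V ≤ Proj.basicOpen 𝒜 f) (r : Γ(Proj 𝒜, V))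
    (s : Γ(twist 𝒜 (-1), V)) : twistCoord 𝒜 hf V h (r • s) = r * twistCoord 𝒜 hf V h s := by
  rw [← Equiv.eq_symm_apply, twistCoord_symm_mul, Equiv.symm_apply_apply]

theorem twistCoord_map (V W : (Proj 𝒜).Opens) (h : V ≤ Proj.basicOpen 𝒜 f) (hW : W ≤ V)
    (s : Γ(twist 𝒜 (-1), V)) :
    twistCoord 𝒜 hf W (hW.trans h) ((twist 𝒜 (-1)).presheaf.map (homOfLE hW).op s) =
      (Proj 𝒜).presheaf.map (homOfLE hW).op (twistCoord 𝒜 hf V h s) := by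
  rw [← Equiv.eq_symm_apply, ← twistCoord_symm_map hf V W h hW, Equiv.symm_apply_apply]

theorem twistCoord_change (V : (Proj 𝒜).Opens) (h : V ≤ Proj.basicOpen 𝒜 f)
    (h' : V ≤ Proj.basicOpen 𝒜 g) (s : Γ(twist 𝒜 (-1), V)) :
    twistCoord 𝒜 hf V h s =
      (Proj 𝒜).presheaf.map (homOfLE h').op (quotientFunction 𝒜 hg hf) * twistCoord 𝒜 hg V h' s := by
  rw [← Equiv.eq_symm_apply, mul_comm, ← twistCoord_symm_change, Equiv.symm_apply_apply]

end TwistFrame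

section ConormalFrame

theorem mem_map_of_syzygy {S L : Type*} [CommRing S] [IsDomain S] [CommRing L] [Algebra S L] (r : S)
    [IsLocalization.Away r L] {f g : S} (hf : (Ideal.span {f}).IsPrime) (hf0 : f ≠ 0)
    (hg : g ∉ Ideal.span {f}) {u v : L} (e : u * algebraMap S L f + v * algebraMap S L g = 0) :
    u ∈ (Ideal.span {f, g}).map (algebraMap S L) ∧ v ∈ (Ideal.span {f, g}).map (algebraMap S L) := by
  obtain ⟨⟨U, s⟩, hU⟩ := IsLocalization.surj (Submonoid.powers r) u
  obtain ⟨⟨V, t⟩, hV⟩ := IsLocalization.surj (Submonoid.powers r) v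
  dsimp only at hU hV
  have h1 : algebraMap S L (U * t * f + V * s * g) = algebraMap S L 0 := by
    rw [map_add, map_mul, map_mul, map_mul, map_mul, ← hU, ← hV, map_zero]
    linear_combination (algebraMap S L s * algebraMap S L t) * e
  obtain ⟨c, hc⟩ := (IsLocalization.eq_iff_exists (Submonoid.powers r) L).1 h1
  rw [mul_zero] at hc
  have h2 : (c * V * s) * g ∈ Ideal.span {f} := by
    rw [Ideal.mem_span_singleton']
    exact ⟨-(c * U * t), by linear_combination -hc⟩
  obtain ⟨w, hw⟩ := Ideal.mem_span_singleton'.1 ((hf.mem_or_mem h2).resolve_right hg)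
  have h3 : (c * U * t : S) = -w * g := by
    refine mul_right_cancel₀ hf0 ?_
    linear_combination hc + g * hw
  have hu (x : Submonoid.powers r) : IsUnit (algebraMap S L x) := IsLocalization.map_units L x
  have key (a : L) (x : S) (y z : Submonoid.powers r) (hx : x ∈ Ideal.span {f, g})
      (h : algebraMap S L x = algebraMap S L y * algebraMap S L z * a) :
      a ∈ (Ideal.span {f, g}).map (algebraMap S L) := by
    refine ((Ideal.map (algebraMap S L) _).unit_mul_mem_iff_mem ((hu y).mul (hu z))).1 ?_
    rw [← h]
    exact Ideal.mem_map_of_mem _ hx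
  constructor
  · refine key u (c * U * t) c (s * t) ?_ ?_
    · rw [h3]; exact Ideal.mul_mem_left _ _ (Ideal.subset_span (by simp))
    · rw [map_mul, map_mul, ← hU, Submonoid.coe_mul, map_mul]; ring
  · refine key v (c * V * s) c (s * t) ?_ ?_
    · rw [← hw]; exact Ideal.mul_mem_left _ _ (Ideal.subset_span (by simp))
    · rw [map_mul, map_mul, ← hV, Submonoid.coe_mul, map_mul]; ring

variable {Y : Scheme.{u}}

theorem isConormalFrame_of_isAffineOpen (I : Y.IdealSheafData) (Ω : Y.affineOpens) {f g : Γ(Y, Ω)}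
    (hd : IsDomain Γ(Y, Ω)) (hf : (Ideal.span {f}).IsPrime) (hf0 : f ≠ 0) (hg : g ∉ Ideal.span {f})
    (hI : I.ideal Ω = Ideal.span {f, g}) : IsConormalFrame I.subschemeι Ω.1 f g := by
  have hΩ : IsAffineOpen Ω.1 := Ω.2
  have h0 (U : Y.affineOpens) (m : Γ(Y, U)) : I.subschemeι.app U m = 0 ↔ m ∈ I.ideal U := by
    rw [← I.ker_subschemeι_app U]; rfl
  have hmap (r : Γ(Y, Ω)) : (I.ideal Ω).map (Y.presheaf.map (homOfLE (Y.basicOpen_le r)).op).hom =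
      I.ideal (Y.affineBasicOpen r) := I.map_ideal (Y.affineBasicOpen_le r)
  refine ⟨(h0 Ω f).2 (hI ▸ Ideal.subset_span (by simp)),
    (h0 Ω g).2 (hI ▸ Ideal.subset_span (by simp)), fun W hW m hm y hy ↦ ?_, fun W hW u v e ↦ ?_⟩
  · obtain ⟨r, hr, hyr⟩ := hΩ.exists_basicOpen_le ⟨y, hy⟩ (hW hy)
    refine ⟨Y.basicOpen r, hr, hyr, ?_⟩
    have h1 := (h0 (Y.affineBasicOpen r) (Y.presheaf.map (homOfLE hr).op m)).1
      ((app_map_apply hr m).trans ((congrArg _ hm).trans (map_zero _)))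
    have h3 : I.ideal (Y.affineBasicOpen r) = Ideal.span
        {Y.presheaf.map (homOfLE (Y.basicOpen_le r)).op f,
          Y.presheaf.map (homOfLE (Y.basicOpen_le r)).op g} := by
      rw [← hmap r, hI, Ideal.map_span, Set.image_pair]
    obtain ⟨u, v, h2⟩ := Ideal.mem_span_pair.1 (h3.le h1)
    exact ⟨u, v, h2.symm⟩
  · have key (z : (I.subschemeι ⁻¹ᵁ W : I.subscheme.Opens)) : ∃ (N : Y.Opens) (hN : N ≤ W),
        I.subschemeι z.1 ∈ N ∧ I.subschemeι.app N (Y.presheaf.map (homOfLE hN).op u) = 0 ∧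
          I.subschemeι.app N (Y.presheaf.map (homOfLE hN).op v) = 0 := by
      obtain ⟨r, hr, hyr⟩ := hΩ.exists_basicOpen_le ⟨I.subschemeι z.1, z.2⟩ (hW z.2)
      refine ⟨Y.basicOpen r, hr, hyr, ?_⟩
      have := hΩ.isLocalization_basicOpen r
      have h1 := congrArg (Y.presheaf.map (homOfLE hr).op) e
      rw [map_add, map_mul, map_mul, map_map_section, map_map_section, map_zero] at h1
      obtain ⟨h2, h3⟩ := mem_map_of_syzygy (L := Γ(Y, Y.basicOpen r)) r hf hf0 hg h1
      rw [← hI] at h2 h3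
      exact ⟨(h0 (Y.affineBasicOpen r) _).2 ((hmap r).le h2),
        (h0 (Y.affineBasicOpen r) _).2 ((hmap r).le h3)⟩
    choose N hN hz h1 h2 using key
    have hcov : I.subschemeι ⁻¹ᵁ W ≤ ⨆ z, I.subschemeι ⁻¹ᵁ (N z) :=
      fun z hz' ↦ Opens.mem_iSup.2 ⟨⟨z, hz'⟩, hz _⟩
    refine ⟨I.subscheme.sheaf.eq_of_locally_eq' (fun z ↦ I.subschemeι ⁻¹ᵁ (N z)) _
      (fun z ↦ homOfLE (I.subschemeι.preimage_mono (hN z))) hcov _ _ fun z ↦ ?_,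
      I.subscheme.sheaf.eq_of_locally_eq' (fun z ↦ I.subschemeι ⁻¹ᵁ (N z)) _
      (fun z ↦ homOfLE (I.subschemeι.preimage_mono (hN z))) hcov _ _ fun z ↦ ?_⟩
    · exact (app_map_apply (hN z) u).symm.trans ((h1 z).trans (map_zero _).symm)
    · exact (app_map_apply (hN z) v).symm.trans ((h2 z).trans (map_zero _).symm)

/-- The coordinate ring of an affine chart as a ring of sections. -/
def chartIso {R : CommRingCat.{u}} (c : Spec R ⟶ Y) [IsOpenImmersion c] : R ≅ Γ(Y, c ''ᵁ ⊤) :=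
  specIso R ≪≫ (c.appIso ⊤).symm

theorem comap_ideal_chartIso (I : Y.IdealSheafData) {R : CommRingCat.{u}} (c : Spec R ⟶ Y)
    [IsOpenImmersion c] :
    (I.ideal ⟨c ''ᵁ ⊤, (isAffineOpen_top _).image_of_isOpenImmersion c⟩).comap (chartIso c).hom.hom =
      specIdeal (I.comap c) := by
  rw [specIdeal, Scheme.IdealSheafData.ideal_comap_of_isOpenImmersion, Ideal.comap_comap]
  rfl

theorem isConormalFrame_of_ringEquiv (I : Y.IdealSheafData) (Ω : Y.affineOpens) {R : Type u}
    [CommRing R] [IsDomain R] (ρ : R ≃+* Γ(Y, Ω)) {f g : R} (hf : (Ideal.span {f}).IsPrime)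
    (hf0 : f ≠ 0) (hg : g ∉ Ideal.span {f}) (hI : (I.ideal Ω).comap ρ.toRingHom = Ideal.span {f, g}) :
    IsConormalFrame I.subschemeι Ω.1 (ρ f) (ρ g) := by
  have h1 : Ideal.span {ρ f} = (Ideal.span {f}).map ρ.toRingHom := by
    rw [Ideal.map_span, Set.image_singleton]; rfl
  have h2 : (Ideal.span {f}).map ρ.toRingHom = (Ideal.span {f}).comap ρ.symm :=
    Ideal.map_comap_of_equiv ρ
  refine isConormalFrame_of_isAffineOpen I Ω (ρ.symm.toMulEquiv.isDomain _) ?_ ?_ ?_ ?_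
  · rw [h1, h2]; exact Ideal.comap_isPrime _ _
  · exact (map_ne_zero_iff _ ρ.injective).2 hf0
  · rw [h1, h2, Ideal.mem_comap, RingEquiv.symm_apply_apply]; exact hg
  · have h3 := Ideal.map_comap_of_surjective ρ.toRingHom ρ.surjective (I.ideal Ω)
    rw [← h3, hI, Ideal.map_span, Set.image_pair]; rfl

end ConormalFrame

namespace CurveChart
variable {K : Type u} [Field K] {Y : Scheme.{u}} {s : Y ⟶ Spec (.of K)} {Z : Closeds Y}
  (D : CurveChart s Z)

/-- An element of the coordinate ring as a section. -/
def sec (r : D.R) : Γ(Y, D.c ''ᵁ ⊤) := (chartIso D.c).hom r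

theorem isConormalFrame : IsConormalFrame (reducedι Z) (D.c ''ᵁ ⊤) (D.sec D.f) (D.sec D.g) := by
  have := D.lineChart.isDomain
  exact isConormalFrame_of_ringEquiv _ ⟨D.c ''ᵁ ⊤, (isAffineOpen_top _).image_of_isOpenImmersion D.c⟩
    (chartIso D.c).commRingCatIsoToRingEquiv D.lineChart.isPrime D.lineChart.f_ne_zero
    D.lineChart.g_notMem ((comap_ideal_chartIso _ D.c).trans D.specIdeal_eq)

end CurveChart

section PairFrame

variable {P X : Scheme.{u}} (e : P ⟶ X)

/-- Pairs of functions on the preimage of an open set. -/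
def PairSections (V : X.Opens) : Type u := Γ(P, e ⁻¹ᵁ V) × Γ(P, e ⁻¹ᵁ V)

instance (V : X.Opens) : AddCommGroup (PairSections e V) :=
  inferInstanceAs (AddCommGroup (Γ(P, e ⁻¹ᵁ V) × Γ(P, e ⁻¹ᵁ V)))

instance (V : X.Opens) : Module Γ(X, V) (PairSections e V) :=
  Module.compHom (Γ(P, e ⁻¹ᵁ V) × Γ(P, e ⁻¹ᵁ V)) (e.app V).hom

theorem PairSections.smul_eq {V : X.Opens} (r : Γ(X, V)) (a : PairSections e V) :
    r • a = (e.app V r * a.1, e.app V r * a.2) := rfl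

/-- Restriction of pairs. -/
def PairSections.res {V W : X.Opens} (h : W ≤ V) (a : PairSections e V) : PairSections e W :=
  (P.presheaf.map (homOfLE (e.preimage_mono h)).op a.1,
    P.presheaf.map (homOfLE (e.preimage_mono h)).op a.2)

/-- Multiplication by a function on a larger open set. -/
def PairSections.mul {D : P.Opens} (ξ : Γ(P, D)) (V : X.Opens) (h : e ⁻¹ᵁ V ≤ D)
    (a : PairSections e V) : PairSections e V :=
  (P.presheaf.map (homOfLE h).op ξ * a.1, P.presheaf.map (homOfLE h).op ξ * a.2)

end PairFrame

section Biprod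
variable {X : Scheme.{u}} {L L' : X.Modules}

theorem biprod_section_eq {V : X.Opens} (m : Γ(L ⊞ L', V)) :
    m = (biprod.inl : L ⟶ L ⊞ L').app V ((biprod.fst : L ⊞ L' ⟶ L).app V m) +
      (biprod.inr : L' ⟶ L ⊞ L').app V ((biprod.snd : L ⊞ L' ⟶ L').app V m) :=
  congrArg (fun f : (L ⊞ L') ⟶ (L ⊞ L') ↦ f.app V m) (biprod.total (X := L) (Y := L')).symm

theorem exists_biprod_section {V : X.Opens} (a : Γ(L, V)) (b : Γ(L', V)) :
    ∃ m : Γ(L ⊞ L', V), (biprod.fst : L ⊞ L' ⟶ L).app V m = a ∧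
      (biprod.snd : L ⊞ L' ⟶ L').app V m = b := by
  have h1 : (biprod.fst : L ⊞ L' ⟶ L).app V ((biprod.inl : L ⟶ L ⊞ L').app V a) = a :=
    congrArg (fun f : L ⟶ L ↦ f.app V a) biprod.inl_fst
  have h2 : (biprod.fst : L ⊞ L' ⟶ L).app V ((biprod.inr : L' ⟶ L ⊞ L').app V b) = 0 :=
    congrArg (fun f : L' ⟶ L ↦ f.app V b) biprod.inr_fst
  have h3 : (biprod.snd : L ⊞ L' ⟶ L').app V ((biprod.inl : L ⟶ L ⊞ L').app V a) = 0 :=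
    congrArg (fun f : L ⟶ L' ↦ f.app V a) biprod.inl_snd
  have h4 : (biprod.snd : L ⊞ L' ⟶ L').app V ((biprod.inr : L' ⟶ L ⊞ L').app V b) = b :=
    congrArg (fun f : L' ⟶ L' ↦ f.app V b) biprod.inr_snd
  refine ⟨(biprod.inl : L ⟶ L ⊞ L').app V a + (biprod.inr : L' ⟶ L ⊞ L').app V b, ?_, ?_⟩
  · rw [map_add, h1, h2, add_zero]
  · rw [map_add, h3, h4, zero_add]

end Biprod

section TwistFrames
variable {A : Type u} {σ : Type*} [CommRing A] [SetLike σ A] [AddSubgroupClass σ A]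
variable {𝒜 : ℕ → σ} [GradedRing 𝒜] {f : Fin 2 → A} (hf : ∀ k, f k ∈ 𝒜 1)
  {X : Scheme.{u}} (e : Proj 𝒜 ⟶ X) {U : Fin 2 → X.Opens}

theorem app_map_section {X : Scheme.{u}} {M N : X.Modules} (φ : M ⟶ N) {V W : X.Opens} (h : W ≤ V)
    (m : Γ(M, V)) : φ.app W (M.presheaf.map (homOfLE h).op m) =
      N.presheaf.map (homOfLE h).op (φ.app V m) :=
  congrArg (fun f ↦ AddCommGrpCat.Hom.hom f m) (φ.mapPresheaf.naturality (homOfLE h).op)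

/-- The coordinates on `𝒪(-1) ⊕ 𝒪(-1)`. -/
def twistFrames (hU : ∀ k, e ⁻¹ᵁ (U k) ≤ Proj.basicOpen 𝒜 (f k)) :
    Frames U (PairSections e) (PairSections.res e)
      (fun V _ h ↦ PairSections.mul e (quotientFunction 𝒜 (hf 1) (hf 0)) V
        ((e.preimage_mono h).trans (hU 1)))
      ((Scheme.Modules.pushforward e).obj (twist 𝒜 (-1) ⊞ twist 𝒜 (-1))) where
  coord k V h m := (twistCoord 𝒜 (hf k) _ ((e.preimage_mono h).trans (hU k))
      ((biprod.fst : twist 𝒜 (-1) ⊞ twist 𝒜 (-1) ⟶ _).app (e ⁻¹ᵁ V) m),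
    twistCoord 𝒜 (hf k) _ ((e.preimage_mono h).trans (hU k))
      ((biprod.snd : twist 𝒜 (-1) ⊞ twist 𝒜 (-1) ⟶ _).app (e ⁻¹ᵁ V) m))
  map_add k V h m n := by
    refine Prod.ext ?_ ?_
    · exact (congrArg _ (map_add ((biprod.fst : twist 𝒜 (-1) ⊞ twist 𝒜 (-1) ⟶ _).app
        (e ⁻¹ᵁ V)).hom m n)).trans (twistCoord_add _ _ _ _ _)
    · exact (congrArg _ (map_add ((biprod.snd : twist 𝒜 (-1) ⊞ twist 𝒜 (-1) ⟶ _).app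
        (e ⁻¹ᵁ V)).hom m n)).trans (twistCoord_add _ _ _ _ _)
  map_smul k V h r m := by
    refine Eq.trans (Prod.ext ?_ ?_) (PairSections.smul_eq e r _).symm
    · exact (congrArg _ (Scheme.Modules.Hom.app_smul (biprod.fst : twist 𝒜 (-1) ⊞ twist 𝒜 (-1) ⟶ _)
        (e.app V r) m)).trans (twistCoord_smul _ _ _ _ _)
    · exact (congrArg _ (Scheme.Modules.Hom.app_smul (biprod.snd : twist 𝒜 (-1) ⊞ twist 𝒜 (-1) ⟶ _)
        (e.app V r) m)).trans (twistCoord_smul _ _ _ _ _)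
  bijective k V h := by
    refine ⟨fun m n hmn ↦ ?_, fun a ↦ ?_⟩
    · refine (biprod_section_eq (L := twist 𝒜 (-1)) (L' := twist 𝒜 (-1)) (V := e ⁻¹ᵁ V) m).trans
        (Eq.trans ?_ (biprod_section_eq (L := twist 𝒜 (-1)) (L' := twist 𝒜 (-1))
          (V := e ⁻¹ᵁ V) n).symm)
      exact congrArg₂ (fun a b ↦ (biprod.inl : twist 𝒜 (-1) ⟶ _ ⊞ twist 𝒜 (-1)).app _ a +
        (biprod.inr : twist 𝒜 (-1) ⟶ twist 𝒜 (-1) ⊞ _).app _ b)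
        ((twistCoord 𝒜 (hf k) _ _).injective (congrArg Prod.fst hmn))
        ((twistCoord 𝒜 (hf k) _ _).injective (congrArg Prod.snd hmn))
    · obtain ⟨m, h1, h2⟩ := exists_biprod_section
        ((twistCoord 𝒜 (hf k) _ ((e.preimage_mono h).trans (hU k))).symm a.1)
        ((twistCoord 𝒜 (hf k) _ ((e.preimage_mono h).trans (hU k))).symm a.2)
      refine ⟨m, Prod.ext ?_ ?_⟩
      · exact (congrArg _ h1).trans (Equiv.apply_symm_apply _ _)
      · exact (congrArg _ h2).trans (Equiv.apply_symm_apply _ _)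
  map_res k V W h hW m := by
    refine Prod.ext ?_ ?_
    · exact (congrArg _ (app_map_section (biprod.fst : twist 𝒜 (-1) ⊞ twist 𝒜 (-1) ⟶ _)
        (e.preimage_mono hW) m)).trans (twistCoord_map _ _ _ _ _ _)
    · exact (congrArg _ (app_map_section (biprod.snd : twist 𝒜 (-1) ⊞ twist 𝒜 (-1) ⟶ _)
        (e.preimage_mono hW) m)).trans (twistCoord_map _ _ _ _ _ _)
  coord_zero V h₀ h₁ m := Prod.ext
    (twistCoord_change (hf 0) (hf 1) _ ((e.preimage_mono h₀).trans (hU 0))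
      ((e.preimage_mono h₁).trans (hU 1)) _)
    (twistCoord_change (hf 0) (hf 1) _ ((e.preimage_mono h₀).trans (hU 0))
      ((e.preimage_mono h₁).trans (hU 1)) _)

end TwistFrames

section NormalFrames
open IsConormalFrame
variable {Z Y : Scheme.{u}} {i : Z ⟶ Y}

theorem normalValue_restrict {V : Z.Opens} {W W' : Y.Opens} (hW : W' ≤ W) (hV : V ≤ i ⁻¹ᵁ W')
    (m : Γ(Y, W)) (hm : i.app W m = 0) (hm' : i.app W' (Y.presheaf.map (homOfLE hW).op m) = 0)
    (φ : dualSections (conormalSheaf i) V) :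
    normalValue hV (Y.presheaf.map (homOfLE hW).op m) hm' φ =
      normalValue (hV.trans (i.preimage_mono hW)) m hm φ := by
  rw [normalValue, normalValue, ← conormalSection_map hW m hm, map_map_apply]

theorem normalValue_mul {V : Z.Opens} {W : Y.Opens} (hV : V ≤ i ⁻¹ᵁ W)
    (r m : Γ(Y, W)) (hm : i.app W m = 0) (hrm : i.app W (r * m) = 0)
    (φ : dualSections (conormalSheaf i) V) :
    normalValue hV (r * m) hrm φ =
      Z.presheaf.map (homOfLE hV).op (i.app W r) * normalValue hV m hm φ := by
  rw [normalValue, normalValue, conormalSection_smul r m hm, Scheme.Modules.map_smul,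
    LinearMap.map_smul]
  rfl

theorem normalValue_congr {V : Z.Opens} {W : Y.Opens} (hV : V ≤ i ⁻¹ᵁ W) {m m' : Γ(Y, W)}
    (e : m = m') (hm : i.app W m = 0) (φ : dualSections (conormalSheaf i) V) :
    normalValue hV m hm φ = normalValue hV m' (e ▸ hm) φ := by subst e; rfl

theorem normalValue_smul {V : Z.Opens} {W : Y.Opens} (hV : V ≤ i ⁻¹ᵁ W) (m : Γ(Y, W))
    (hm : i.app W m = 0) (r : Γ(Z, V)) (φ : dualSections (conormalSheaf i) V) :
    normalValue hV m hm (r • φ) = r * normalValue hV m hm φ := by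
  change Z.presheaf.map (homOfLE (le_refl V)).op r * normalValue hV m hm φ = _
  have : (homOfLE (le_refl V)).op = 𝟙 (op V) := rfl
  rw [this, CategoryTheory.Functor.map_id]; rfl

theorem normalValue_map {V V' : Z.Opens} {W : Y.Opens} (hV : V ≤ i ⁻¹ᵁ W) (h : V' ≤ V) (m : Γ(Y, W))
    (hm : i.app W m = 0) (φ : dualSections (conormalSheaf i) V) :
    normalValue (h.trans hV) m hm (dualRestrict _ h φ) =
      Z.presheaf.map (homOfLE h).op (normalValue hV m hm φ) := by
  refine Eq.trans ?_ (dualSections_map φ le_rfl h h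
    ((conormalSheaf i).presheaf.map (homOfLE hV).op (conormalSection m hm)))
  change φ.1 _ _ = φ.1 _ _
  rw [map_map_apply]

/-- The coordinates on the normal sheaf. -/
def normalFrames {Ω : Fin 2 → Y.Opens} {f g : ∀ k, Γ(Y, Ω k)} {τ : Γ(Y, Ω 1)}
    (h : ∀ k, IsConormalFrame i (Ω k) (f k) (g k))
    (hf : Y.presheaf.map (homOfLE (inf_le_left : Ω 0 ⊓ Ω 1 ≤ _)).op (f 0) =
      Y.presheaf.map (homOfLE (inf_le_right : Ω 0 ⊓ Ω 1 ≤ _)).op (τ * f 1))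
    (hg : Y.presheaf.map (homOfLE (inf_le_left : Ω 0 ⊓ Ω 1 ≤ _)).op (g 0) =
      Y.presheaf.map (homOfLE (inf_le_right : Ω 0 ⊓ Ω 1 ≤ _)).op (τ * g 1))
    {P : Scheme.{u}} (e : P ⟶ Z) [IsIso e] {D : P.Opens} (ξ : Γ(P, D)) (hD : e ⁻¹ᵁ i ⁻¹ᵁ (Ω 1) ≤ D)
    (hξ : P.presheaf.map (homOfLE hD).op ξ = e.app _ (i.app _ τ)) :
    Frames (fun k ↦ i ⁻¹ᵁ (Ω k)) (PairSections e) (PairSections.res e)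
      (fun V _ h ↦ PairSections.mul e ξ V ((e.preimage_mono h).trans hD)) (normalSheaf i) where
  coord k V hV φ := (e.app V (normalValue hV (f k) (h k).app_left φ),
    e.app V (normalValue hV (g k) (h k).app_right φ))
  map_add k V hV φ ψ := Prod.ext (map_add (e.app V).hom _ _) (map_add (e.app V).hom _ _)
  map_smul k V hV r φ := by
    refine Eq.trans (Prod.ext ?_ ?_) (PairSections.smul_eq e r _).symm
    · exact (congrArg _ (normalValue_smul hV _ _ r φ)).trans (map_mul (e.app V).hom _ _)
    · exact (congrArg _ (normalValue_smul hV _ _ r φ)).trans (map_mul (e.app V).hom _ _)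
  bijective k V hV := by
    have hb : Function.Bijective (e.app V) := ConcreteCategory.bijective_of_isIso _
    refine ⟨fun φ ψ hφ ↦ (h k).normalValue_ext hV (hb.1 (congrArg Prod.fst hφ))
      (hb.1 (congrArg Prod.snd hφ)), fun a ↦ ?_⟩
    obtain ⟨a₁, h1⟩ := hb.2 a.1
    obtain ⟨a₂, h2⟩ := hb.2 a.2
    obtain ⟨φ, h3, h4⟩ := (h k).exists_normalValue_eq hV a₁ a₂
    exact ⟨φ, Prod.ext ((congrArg _ h3).trans h1) ((congrArg _ h4).trans h2)⟩
  map_res k V W hV hW φ := Prod.ext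
    ((congrArg _ (normalValue_map hV hW _ _ φ)).trans (app_map_apply hW _))
    ((congrArg _ (normalValue_map hV hW _ _ φ)).trans (app_map_apply hW _))
  coord_zero V h₀ h₁ φ := by
    have key (a : Γ(Y, Ω 0)) (b : Γ(Y, Ω 1)) (ha : i.app _ a = 0) (hb : i.app _ b = 0)
        (hab : Y.presheaf.map (homOfLE (inf_le_left : Ω 0 ⊓ Ω 1 ≤ _)).op a =
          Y.presheaf.map (homOfLE (inf_le_right : Ω 0 ⊓ Ω 1 ≤ _)).op (τ * b)) :
        e.app V (normalValue h₀ a ha φ) =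
          P.presheaf.map (homOfLE ((e.preimage_mono h₁).trans hD)).op ξ *
            e.app V (normalValue h₁ b hb φ) := by
      have hV : V ≤ i ⁻¹ᵁ (Ω 0 ⊓ Ω 1) := le_inf h₀ h₁
      have ha' : i.app _ (Y.presheaf.map (homOfLE (inf_le_left : Ω 0 ⊓ Ω 1 ≤ _)).op a) = 0 := by
        rw [app_map_apply, ha, map_zero]
      have hb' : i.app _ (τ * b) = 0 := by rw [map_mul, hb, mul_zero]
      have e1 := normalValue_restrict inf_le_left hV a ha ha' φ
      have e2 := normalValue_congr hV hab ha' φ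
      have e3 := normalValue_restrict inf_le_right hV (τ * b) hb' (hab ▸ ha') φ
      have e4 := normalValue_mul h₁ τ b hb hb' φ
      have e5 := e1.symm.trans (e2.trans (e3.trans e4))
      rw [e5, map_mul, app_map_apply, ← hξ, map_map_section]
    exact Prod.ext (key _ _ _ _ hf) (key _ _ _ _ hg)

end NormalFrames

section ChartSections

theorem topIso_sectionsHom {P Y : Scheme.{u}} {R : CommRingCat.{u}} (c : Spec R ⟶ Y)
    [IsOpenImmersion c] (g : P ⟶ Y) {V : P.Opens} (hV : V ≤ g ⁻¹ᵁ c ''ᵁ ⊤) (j : V.toScheme ⟶ Spec R)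
    (h : j ≫ c = V.ι ≫ g) (r : R) : V.topIso.hom (sectionsHom j r) =
      P.presheaf.map (homOfLE hV).op (g.app _ ((chartIso c).hom r)) := by
  have key (q q' : V.toScheme ⟶ Y) (h : q = q') (e e') :
      q.appLE (c ''ᵁ ⊤) ⊤ e = q'.appLE (c ''ᵁ ⊤) ⊤ e' := by subst h; rfl
  have h4 : V.ι.appLE V ⊤ (by simp) ≫ V.topIso.hom = 𝟙 _ := by
    rw [Scheme.Opens.ι_appLE, Scheme.Opens.topIso_hom]
    exact (P.presheaf.map_comp _ _).symm.trans (P.presheaf.map_id _)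
  have h1 : (c.appIso ⊤).hom ≫ j.appTop ≫ V.topIso.hom = g.appLE (c ''ᵁ ⊤) V hV := by
    have h2 : (c.appIso ⊤).hom ≫ j.appLE ⊤ ⊤ (show ⊤ ≤ j ⁻¹ᵁ ⊤ from le_rfl) =
        g.appLE (c ''ᵁ ⊤) V hV ≫ V.ι.appLE V ⊤ (by simp) := by
      rw [Scheme.Hom.appIso_hom', Scheme.Hom.appLE_comp_appLE, Scheme.Hom.appLE_comp_appLE]
      exact key _ _ h _ _
    have h5 : j.appTop = j.appLE ⊤ ⊤ le_rfl := j.app_eq_appLE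
    rw [h5, ← Category.assoc, h2, Category.assoc, h4, Category.comp_id]
  have h3 := congrArg (fun φ ↦ φ.hom ((chartIso c).hom r)) h1
  refine Eq.trans ?_ h3
  have h6 : (chartIso c).hom ≫ (c.appIso ⊤).hom = (Scheme.ΓSpecIso R).inv := by
    exact (Category.assoc (Scheme.ΓSpecIso R).inv (c.appIso ⊤).inv (c.appIso ⊤).hom).trans
      (by rw [Iso.inv_hom_id, Category.comp_id])
  exact congrArg (fun φ ↦ V.topIso.hom (j.appTop (φ.hom r))) h6.symm

end ChartSections

section NormalBundle
attribute [local instance] MvPolynomial.gradedAlgebra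
open Polynomial

/-- The inverse image along an isomorphism of a direct image. -/
def pullbackIsoOfIsoPushforward {P Z : Scheme.{u}} (e : P ⟶ Z) [IsIso e] {N : Z.Modules}
    {L : P.Modules} (θ : N ≅ (Scheme.Modules.pushforward e).obj L) :
    (Scheme.Modules.pullback e).obj N ≅ L :=
  (Scheme.Modules.pullback e).mapIso θ ≪≫
    ((Scheme.Modules.restrictFunctorIsoPullback e).app _).symm ≪≫
      (Scheme.Modules.restrictFunctorAdjCounitIso e).app L

namespace CurveAtlas
variable {K : Type u} [Field K] {Y : Scheme.{u}} {s : Y ⟶ Spec (.of K)} {Z : Closeds Y}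
  (D : CurveAtlas s Z)

/-- The affine open subsets of the atlas. -/
def Ω (k : Fin 2) : Y.Opens := (D.chart k).c ''ᵁ ⊤

theorem map_sec_eq {a : (D.chart 0).R} {b : (D.chart 1).R}
    (H : ∀ {T : Scheme.{u}} (j₀ : T ⟶ Spec (D.chart 0).R) (j₁ : T ⟶ Spec (D.chart 1).R),
      j₀ ≫ (D.chart 0).c = j₁ ≫ (D.chart 1).c → (sectionsHom j₀).hom a = (sectionsHom j₁).hom b) :
    Y.presheaf.map (homOfLE (inf_le_left : D.Ω 0 ⊓ D.Ω 1 ≤ _)).op ((D.chart 0).sec a) =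
      Y.presheaf.map (homOfLE (inf_le_right : D.Ω 0 ⊓ D.Ω 1 ≤ _)).op ((D.chart 1).sec b) := by
  have key (k) (hk : D.Ω 0 ⊓ D.Ω 1 ≤ D.Ω k) : ∃ j : (D.Ω 0 ⊓ D.Ω 1).toScheme ⟶ Spec (D.chart k).R,
      j ≫ (D.chart k).c = (D.Ω 0 ⊓ D.Ω 1).ι ∧ ∀ r, (D.Ω 0 ⊓ D.Ω 1).topIso.hom (sectionsHom j r) =
        Y.presheaf.map (homOfLE hk).op ((D.chart k).sec r) := by
    have h1 : Set.range (D.Ω 0 ⊓ D.Ω 1).ι ⊆ Set.range (D.chart k).c := by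
      rw [Scheme.Opens.range_ι]
      intro y hy
      obtain ⟨q, -, hq⟩ := hk hy
      exact ⟨q, hq⟩
    have h2 := IsOpenImmersion.lift_fac (D.chart k).c (D.Ω 0 ⊓ D.Ω 1).ι h1
    refine ⟨_, h2, fun r ↦ ?_⟩
    refine (topIso_sectionsHom (D.chart k).c (𝟙 Y) hk _ (h2.trans (Category.comp_id _).symm) r).trans ?_
    rw [Scheme.Hom.id_app]
    rfl
  obtain ⟨j₀, h0, h0'⟩ := key 0 inf_le_left
  obtain ⟨j₁, h1, h1'⟩ := key 1 inf_le_right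
  exact (h0' a).symm.trans ((congrArg _ (H j₀ j₁ (h0.trans h1.symm))).trans (h1' b))

theorem map_quotientFunction {Y : Scheme.{u}} {R : CommRingCat.{u}} (c : Spec R ⟶ Y)
    [IsOpenImmersion c] (g : Proj (lineGrading K) ⟶ Y) (ev : R ⟶ .of K[X])
    (h : lineChartι K 1 ≫ g = Spec.map ev ≫ c)
    (hV : g ⁻¹ᵁ c ''ᵁ ⊤ = Proj.basicOpen (lineGrading K) (MvPolynomial.X 1)) (τ : R)
    (hτ : ev τ = X) :
    (Proj (lineGrading K)).presheaf.map (homOfLE hV.le).op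
      (quotientFunction (lineGrading K) (X_mem_lineGrading K 1) (X_mem_lineGrading K 0)) =
        g.app _ ((chartIso c).hom τ) := by
  have hF : Spec.map (CommRingCat.ofHom (fromLineAway K 1)) ≫ Proj.awayι (lineGrading K) _
    (X_mem_lineGrading K 1) zero_lt_one = lineChartι K 1 := rfl
  have h0 : Proj.awayι (lineGrading K) _ (X_mem_lineGrading K 1) zero_lt_one =
      Spec.map (inv (CommRingCat.ofHom (fromLineAway K 1))) ≫ lineChartι K 1 := by
    rw [← hF, ← Category.assoc, ← Spec.map_comp, IsIso.hom_inv_id, Spec.map_id, Category.id_comp]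
  let b : (Proj.basicOpen (lineGrading K) (MvPolynomial.X 1)).toScheme ⟶ Spec _ :=
    Proj.basicOpenToSpec (lineGrading K) (MvPolynomial.X 1)
  have h1 : (b ≫ Spec.map (ev ≫ inv (CommRingCat.ofHom (fromLineAway K 1)))) ≫ c =
      (Proj.basicOpen (lineGrading K) (MvPolynomial.X 1)).ι ≫ g := by
    rw [Spec.map_comp, Category.assoc, Category.assoc, ← h, ← Category.assoc (Spec.map _), ← h0,
      ← Category.assoc]
    refine congrArg (· ≫ g) ?_
    exact (congrArg (· ≫ _) (Proj.basicOpenIsoSpec_hom (lineGrading K) _ (X_mem_lineGrading K 1)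
      zero_lt_one).symm).trans (Iso.hom_inv_id_assoc _ _)
  have h2 := topIso_sectionsHom c g hV.ge _ h1 τ
  have h3 : (ev ≫ inv (CommRingCat.ofHom (fromLineAway K 1))).hom τ = lineCoord K 1 0 := by
    have h4 : (CommRingCat.ofHom (fromLineAway K 1)).hom (lineCoord K 1 0) = X :=
      fromLineAway_lineCoord K (by decide)
    refine (congrArg (inv (CommRingCat.ofHom (fromLineAway K 1))).hom (hτ.trans h4.symm)).trans ?_
    exact congrArg (fun φ ↦ φ.hom (lineCoord K 1 0))
      (IsIso.hom_inv_id (CommRingCat.ofHom (fromLineAway K 1)))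
  rw [sectionsHom_comp_SpecMap] at h2
  have h5 : quotientFunction (lineGrading K) (X_mem_lineGrading K 1) (X_mem_lineGrading K 0) =
      (Proj.basicOpen (lineGrading K) (MvPolynomial.X 1)).topIso.hom (sectionsHom b
        (lineCoord K 1 0)) := by
    have h6 : sectionsHom b ≫ (Proj.basicOpen (lineGrading K) (MvPolynomial.X 1)).topIso.hom =
        Proj.awayToSection (lineGrading K) (MvPolynomial.X 1) := by
      rw [sectionsHom]
      refine (congrArg (fun q ↦ (_ ≫ q) ≫ _) (Proj.basicOpenToSpec_app_top (lineGrading K) _)).trans ?_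
      refine (congrArg (· ≫ _) (Iso.inv_hom_id_assoc _ _)).trans ?_
      refine (Category.assoc _ _ _).trans ?_
      exact (congrArg (_ ≫ ·) (Iso.inv_hom_id _)).trans (Category.comp_id _)
    exact congrArg (fun q ↦ q.hom (lineCoord K 1 0)) h6.symm
  have h6 := h5.trans ((congrArg (fun r ↦ (Proj.basicOpen (lineGrading K)
    (MvPolynomial.X 1)).topIso.hom (sectionsHom b r)) h3.symm).trans h2)
  rw [h6, map_map_section]
  exact congrArg (fun q ↦ q.hom (g.app _ ((chartIso c).hom τ)))
    ((Proj (lineGrading K)).presheaf.map_id (op (g ⁻¹ᵁ c ''ᵁ ⊤)))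

theorem hasNormalBundleNegOneNegOne (D : CurveAtlas s Z) : HasNormalBundleNegOneNegOne s Z := by
  obtain ⟨e, ev, h, hs⟩ := D.exists_iso
  refine ⟨e, hs, ⟨?_⟩⟩
  have hU (k) : e.hom ⁻¹ᵁ reducedι Z ⁻¹ᵁ D.Ω k = Proj.basicOpen (lineGrading K) (MvPolynomial.X k) := by
    obtain ⟨-, -, -, -, h5⟩ := h k
    rw [← opensRange_lineChartι]
    refine TopologicalSpace.Opens.ext (Set.ext fun x ↦ ?_)
    have h6 : e.hom x ∈ Set.range (lineChartι K k ≫ e.hom) ↔ reducedι Z (e.hom x) ∈ D.Ω k := by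
      rw [h5]
      exact ⟨fun ⟨q, hq⟩ ↦ ⟨q, trivial, hq⟩, fun ⟨q, _, hq⟩ ↦ ⟨q, hq⟩⟩
    refine h6.symm.trans ⟨fun ⟨q, hq⟩ ↦ ⟨q, ?_⟩, fun ⟨q, hq⟩ ↦ ⟨q, congrArg _ hq⟩⟩
    exact (ConcreteCategory.bijective_of_isIso e.hom.base).1 hq
  have hcov : reducedι Z ⁻¹ᵁ D.Ω 0 ⊔ reducedι Z ⁻¹ᵁ D.Ω 1 = ⊤ := by
    refine eq_top_iff.2 fun z _ ↦ ?_
    have hz : reducedι Z z ∈ Z := (mem_support_vanishingIdeal _ _).1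
        ((Scheme.IdealSheafData.range_subschemeι (.vanishingIdeal Z)).le ⟨z, rfl⟩)
    obtain ⟨k, q, hq⟩ := D.exists_mem_range _ hz
    have hk : z ∈ reducedι Z ⁻¹ᵁ D.Ω k := ⟨q, trivial, hq⟩
    fin_cases k
    exacts [Or.inl hk, Or.inr hk]
  have hsec (k) (a b : (D.chart k).R) : (D.chart k).sec (a * b) = (D.chart k).sec a *
      (D.chart k).sec b := map_mul (chartIso (D.chart k).c).hom.hom a b
  have hξ := map_quotientFunction (D.chart 1).c (e.hom ≫ reducedι Z) (CommRingCat.ofHom (ev 1))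
    ((h 1).2.2.2.1) (hU 1) (D.chart 1).τ (h 1).2.1
  have F := normalFrames (i := reducedι Z) (fun k ↦ (D.chart k).isConormalFrame)
    ((D.map_sec_eq D.f_eq).trans (congrArg _ (hsec 1 _ _)))
    ((D.map_sec_eq D.g_eq).trans (congrArg _ (hsec 1 _ _))) e.hom
    (quotientFunction (lineGrading K) (X_mem_lineGrading K 1) (X_mem_lineGrading K 0)) (hU 1).le
    (hξ.trans (congrArg (fun q ↦ q.hom ((D.chart 1).sec (D.chart 1).τ))
      (Scheme.Hom.comp_app e.hom (reducedι Z) (D.Ω 1))))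
  have F' := twistFrames (X_mem_lineGrading K) e.hom (U := fun k ↦ reducedι Z ⁻¹ᵁ D.Ω k)
    (fun k ↦ (hU k).le)
  exact pullbackIsoOfIsoPushforward e.hom (Frames.iso F F' hcov)

end CurveAtlas
end NormalBundle

section BlowupCharts

theorem SpecMap_chartIso_inv {Y : Scheme.{u}} {R : CommRingCat.{u}} (c : Spec R ⟶ Y)
    [IsOpenImmersion c] :
    chartMap ⟨c ''ᵁ ⊤, (isAffineOpen_top _).image_of_isOpenImmersion c⟩ (chartIso c).inv = c := by
  have h := (eq_chartMap_iff c ⟨c ''ᵁ ⊤, (isAffineOpen_top _).image_of_isOpenImmersion c⟩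
    (c.preimage_image_eq ⊤).ge (chartIso c).inv (Scheme.ΓSpecIso R).inv).2 (by
      rw [← Scheme.Hom.appIso_hom', chartIso]
      refine (Category.assoc (c.appIso ⊤).hom (Scheme.ΓSpecIso R).hom _).trans ?_
      exact (congrArg (_ ≫ ·) (Iso.hom_inv_id _)).trans (Category.comp_id _))
  refine Eq.trans ?_ h
  rw [← Category.assoc, ← SpecMap_ΓSpecIso_hom, ← Spec.map_comp, Iso.inv_hom_id, Spec.map_id,
    Category.id_comp]

theorem exists_factor {X Y : Scheme.{u}} {π : Y ⟶ X} {M : X.IdealSheafData} {U : X.affineOpens}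
    {R S : CommRingCat.{u}} {φ : Γ(X, U) ⟶ R} {c : Spec R ⟶ Y} [IsOpenImmersion c]
    (hc : c ≫ π = chartMap U φ) {a : Γ(X, U)} (ha : a ∈ M.ideal U)
    (hr : c.opensRange = chartLocus π M U a) (hM : IsEffectiveCartier (M.comap π))
    (ψ : Γ(X, U) ⟶ S) (g : Spec S ⟶ Y) (hg : g ≫ π = chartMap U ψ)
    (hS : IsEffectiveCartier (M.comap (g ≫ π)))
    (hψ : (M.ideal U).map ψ.hom = Ideal.span {ψ.hom a}) :
    ∃ σ : R ⟶ S, g = Spec.map σ ≫ c ∧ φ ≫ σ = ψ := by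
  have h1 : Set.range g ⊆ Set.range c := by
    rintro _ ⟨q, rfl⟩
    have h2 := mem_chartLocus_chartMap M U ψ hψ (one_mul _).symm q
      (fun h ↦ q.isPrime.ne_top ((Ideal.eq_top_iff_one _).2 h))
    rw [← hg, ← preimage_chartLocus g π M hM hS U a ha, ← hr] at h2
    exact h2
  have h3 : Spec.map (Spec.preimage (IsOpenImmersion.lift c g h1)) ≫ c = g := by
    rw [Spec.map_preimage, IsOpenImmersion.lift_fac]
  refine ⟨_, h3.symm, ?_⟩
  rw [← h3, Category.assoc, hc, chartMap, chartMap, ← Category.assoc, ← Spec.map_comp,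
    cancel_mono] at hg
  exact Spec.map_injective hg

theorem IsBlowupChart.comp_symm {A B R : Type u} [CommRing A] [CommRing B] [CommRing R]
    {φ : A →+* R} {I : Ideal B} {a : A} (e : A ≃+* B) (h : IsBlowupChart φ (I.comap (e : A →+* B)) a) :
    IsBlowupChart (φ.comp (e.symm : B →+* A)) I (e a) := by
  have h1 : I = (I.comap (e : A →+* B)).map (e : A →+* B) :=
    (Ideal.map_comap_of_surjective _ e.surjective I).symm
  have h2 {T : Type u} [CommRing T] (ψ : B →+* T) :
      I.map ψ = (I.comap (e : A →+* B)).map (ψ.comp (e : A →+* B)) := by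
    rw [← Ideal.map_map, ← h1]
  have h3 : (φ.comp (e.symm : B →+* A)).comp (e : A →+* B) = φ := by ext; simp
  refine ⟨h.mem, by simpa using h.mem_nonZeroDivisors, ?_, fun ψ hψ hI ↦ ?_⟩
  · rw [h2, h3, h.map_eq]; simp
  · obtain ⟨χ, hχ, hu⟩ := h.existsUnique_lift (ψ.comp (e : A →+* B)) hψ (by rw [← h2, hI]; rfl)
    refine ⟨χ, ?_, fun χ' hχ' ↦ hu χ' ?_⟩
    · dsimp only
      rw [← RingHom.comp_assoc, hχ]; ext; simp
    · rw [← hχ', RingHom.comp_assoc, h3]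

/-- The charts of the blow-up of a subscheme that is cut out by two equations in an affine chart. -/
theorem IsBlowup.exists_two_charts {W Y : Scheme.{u}} {a : W ⟶ Y} {I : Y.IdealSheafData}
    (ha : IsBlowup a I) {R : CommRingCat.{u}} (c : Spec R ⟶ Y) [IsOpenImmersion c] (d : Fin 2 → R)
    (hI : specIdeal (I.comap c) = Ideal.span {d 0, d 1}) {S : Fin 2 → CommRingCat.{u}}
    (ψ : ∀ l, R ⟶ S l) (hψ : ∀ l, IsBlowupChart (ψ l).hom (specIdeal (I.comap c)) (d l))
    {v : ∀ l, S l} (hv : ∀ l l', l' ≠ l → (ψ l).hom (d l') = (ψ l).hom (d l) * v l) :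
    ∃ j : ∀ l : Fin 2, Spec (S l) ⟶ W, (∀ l, IsOpenImmersion (j l) ∧
      j l ≫ a = Spec.map (ψ l) ≫ c ∧
      specIdeal ((I.comap a).comap (j l)) = Ideal.span {(ψ l).hom (d l)} ∧
      ∀ (l' : Fin 2) (q : Spec (S l)), v l ∉ q.asIdeal → j l q ∈ Set.range (j l')) ∧
    ∀ w, a w ∈ Set.range c → ∃ l, w ∈ Set.range (j l) := by
  let U : Y.affineOpens := ⟨c ''ᵁ ⊤, (isAffineOpen_top _).image_of_isOpenImmersion c⟩
  let ρ : R ≃+* Γ(Y, U) := (chartIso c).commRingCatIsoToRingEquiv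
  have hI0 : (I.ideal U).comap (ρ : R →+* Γ(Y, U)) = specIdeal (I.comap c) :=
    comap_ideal_chartIso I c
  have hI : I.ideal U = Ideal.span {ρ (d 0), ρ (d 1)} := by
    have h := Ideal.map_comap_of_surjective (ρ : R →+* Γ(Y, U)) ρ.surjective (I.ideal U)
    rw [← h, hI0, hI, Ideal.map_span, Set.image_pair]; rfl
  let φ (l : Fin 2) : Γ(Y, U) ⟶ S l := (chartIso c).inv ≫ ψ l
  have hφ (l : Fin 2) (r : R) : (φ l).hom (ρ r) = (ψ l).hom r :=
    congrArg (ψ l).hom (ρ.symm_apply_apply r)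
  have hmem (l) : ρ (d l) ∈ I.ideal U := by
    rw [hI]; fin_cases l
    exacts [Ideal.subset_span (Or.inl rfl), Ideal.subset_span (Or.inr rfl)]
  have hch (l) : IsBlowupChart (φ l).hom (I.ideal U) (ρ (d l)) := (hI0 ▸ hψ l).comp_symm ρ
  have hmap (l) : chartMap U (φ l) = Spec.map (ψ l) ≫ c := by
    conv_rhs => rw [← SpecMap_chartIso_inv c]
    exact (congrArg (· ≫ _) (Spec.map_comp _ _)).trans (Category.assoc _ _ _)
  choose j hj hja hjr using fun l ↦ ha.exists_chart (hmem l) ((hch l).isChart I U (φ l))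
  refine ⟨j, fun l ↦ ⟨hj l, (hja l).trans (hmap l), ?_, fun l' q hq ↦ ?_⟩, fun w hw ↦ ?_⟩
  · rw [← Scheme.IdealSheafData.comap_comp, hja, specIdeal_comap_chartMap, (hch l).map_eq, hφ]
  · obtain ⟨u, hu, huq⟩ : ∃ u : S l, (ψ l).hom (d l') = u * (ψ l).hom (d l) ∧ u ∉ q.asIdeal := by
      obtain rfl | hll := eq_or_ne l' l
      · exact ⟨1, (one_mul _).symm, fun h ↦ q.isPrime.ne_top ((Ideal.eq_top_iff_one _).2 h)⟩
      · exact ⟨v l, by rw [hv l l' hll, mul_comm], hq⟩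
    have h1 := mem_chartLocus_chartMap I U (φ l) (r := (φ l).hom (ρ (d l))) (hch l).map_eq
      (a := ρ (d l')) (by rw [hφ, hφ]; exact hu) q huq
    have := hj l
    rw [← hja, ← preimage_chartLocus (j l) a I ha.isEffectiveCartier
      (ha.isEffectiveCartier.comap_comp (j l)) U _ (hmem l'), ← hjr] at h1
    exact h1
  · have hw' : a w ∈ U.1 := by
      obtain ⟨q, hq⟩ := hw
      exact ⟨q, trivial, hq⟩
    obtain ⟨b, hb, hwb⟩ := exists_mem_chartLocus a I ha.isEffectiveCartier w U hw' _ hI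
    obtain rfl | rfl : b = ρ (d 0) ∨ b = ρ (d 1) := hb
    exacts [⟨0, (hjr 0).ge hwb⟩, ⟨1, (hjr 1).ge hwb⟩]

namespace CurveChart
variable {K : Type u} [Field K] {Y : Scheme.{u}} {s : Y ⟶ Spec (.of K)} {Z : Closeds Y}
  (D : CurveChart s Z)

/-- The numerators of the coordinates `g / f` and `f / g` on the blow-up of the curve. -/
def num (l : Fin 2) : D.R := ![D.g, D.f] l

/-- The denominators of the coordinates `g / f` and `f / g` on the blow-up of the curve. -/
def den (l : Fin 2) : D.R := ![D.f, D.g] l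

/-- The coordinate rings of the charts of the blow-up of the curve. -/
abbrev S (l : Fin 2) : Type u := BlowupRing D.R (D.num l) (D.den l)

theorem span_num_den (l : Fin 2) : Ideal.span {D.num l, D.den l} = Ideal.span {D.f, D.g} := by
  fin_cases l
  exacts [congrArg Ideal.span (Set.pair_comm _ _), rfl]

theorem den_ne_zero (l : Fin 2) : D.den l ≠ 0 := by
  fin_cases l
  exacts [D.lineChart.f_ne_zero, fun h ↦ D.lineChart.g_notMem ((show D.g = 0 from h) ▸ zero_mem _)]

theorem den_dvd (l : Fin 2) (c d : D.R) (h : D.num l * c = D.den l * d) : D.den l ∣ c := by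
  have := D.lineChart.isDomain
  fin_cases l
  · refine Ideal.mem_span_singleton.1 ((D.lineChart.isPrime.mem_or_mem ?_).resolve_left
      D.lineChart.g_notMem)
    exact Ideal.mem_span_singleton.2 ⟨d, h⟩
  · have h1 : D.g * d ∈ Ideal.span {D.f} := Ideal.mem_span_singleton.2 ⟨c, h.symm⟩
    obtain ⟨e, rfl⟩ := Ideal.mem_span_singleton.1
      ((D.lineChart.isPrime.mem_or_mem h1).resolve_left D.lineChart.g_notMem)
    exact ⟨e, mul_left_cancel₀ D.lineChart.f_ne_zero (h.trans (mul_left_comm D.g D.f e))⟩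

theorem isDomain_S (l : Fin 2) : IsDomain (D.S l) :=
  have := D.lineChart.isDomain
  BlowupRing.isDomain (D.den_ne_zero l) (D.den_dvd l)

theorem of_ne_zero (l : Fin 2) {r : D.R} (h : r ≠ 0) : (BlowupRing.of r : D.S l) ≠ 0 :=
  have := D.lineChart.isDomain
  (map_ne_zero_iff _ (BlowupRing.of_injective (D.den_ne_zero l) (D.den_dvd l))).2 h

theorem exists_blowup_charts {W : Scheme.{u}} {a : W ⟶ Y}
    (ha : IsBlowup a (Scheme.IdealSheafData.vanishingIdeal Z)) :
    ∃ j : ∀ l : Fin 2, Spec (.of (D.S l)) ⟶ W, (∀ l, IsOpenImmersion (j l) ∧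
      j l ≫ a = Spec.map (CommRingCat.ofHom BlowupRing.of) ≫ D.c ∧
      specIdeal (((Scheme.IdealSheafData.vanishingIdeal Z).comap a).comap (j l)) =
        Ideal.span {BlowupRing.of (D.den l)} ∧
      ∀ (l' : Fin 2) (q : Spec (.of (D.S l))),
        BlowupRing.frac ∉ PrimeSpectrum.asIdeal (R := D.S l) q → j l q ∈ Set.range (j l')) ∧
    ∀ w, a w ∈ Set.range D.c → ∃ l, w ∈ Set.range (j l) := by
  have := D.lineChart.isDomain
  have hn (l l' : Fin 2) (h : l' ≠ l) : D.den l' = D.num l := by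
    obtain ⟨rfl, rfl⟩ | ⟨rfl, rfl⟩ : (l = 0 ∧ l' = 1) ∨ (l = 1 ∧ l' = 0) := by omega
    exacts [rfl, rfl]
  refine ha.exists_two_charts D.c D.den D.specIdeal_eq
    (fun l ↦ CommRingCat.ofHom (BlowupRing.of : D.R →+* D.S l)) (fun l ↦ ?_)
    (v := fun l ↦ (BlowupRing.frac : D.S l)) fun l l' h ↦ ?_
  · rw [D.specIdeal_eq, ← D.span_num_den l]
    exact BlowupRing.isBlowupChart (D.den_ne_zero l) (D.den_dvd l)
  · rw [hn l l' h]
    exact BlowupRing.of_eq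

end CurveChart
end BlowupCharts

section ExceptionalDivisor
open Polynomial
attribute [local instance] MvPolynomial.gradedAlgebra Polynomial.algebra

theorem notMem_of_isUnit_sectionsHom {T : Scheme.{u}} {R : CommRingCat.{u}} (j : T ⟶ Spec R) {r : R}
    (h : IsUnit ((sectionsHom j).hom r)) (t : T) :
    r ∉ PrimeSpectrum.asIdeal (R := R) (j t) := by
  rw [← mem_basicOpen_specIso]
  have h1 : t ∈ T.basicOpen ((sectionsHom j).hom r) := by rw [T.basicOpen_of_isUnit h]; trivial
  have h2 : j ⁻¹ᵁ (Spec R).basicOpen ((specIso R).hom.hom r) =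
      T.basicOpen ((sectionsHom j).hom r) := Scheme.preimage_basicOpen j _
  exact h2.ge h1

theorem CurveAtlas.τ_notMem {K : Type u} [Field K] {Y : Scheme.{u}} {s : Y ⟶ Spec (.of K)}
    {Z : Closeds Y} (D : CurveAtlas s Z) {k l : Fin 2} (hkl : k ≠ l) (q : Spec (D.chart k).R)
    (hq : (D.chart k).c q ∈ Set.range (D.chart l).c) :
    (D.chart k).τ ∉ PrimeSpectrum.asIdeal (R := (D.chart k).R) q := by
  obtain ⟨q', hq'⟩ := hq
  obtain ⟨rfl, rfl⟩ | ⟨rfl, rfl⟩ : (k = 0 ∧ l = 1) ∨ (k = 1 ∧ l = 0) := by omega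
  · obtain ⟨t, rfl, -⟩ := Scheme.Pullback.exists_preimage_pullback q q' hq'.symm
    exact notMem_of_isUnit_sectionsHom _ (.of_mul_eq_one _ (D.τ_mul_of_comp (pullback.fst _ _)
      (pullback.snd _ _) pullback.condition)) t
  · obtain ⟨t, -, rfl⟩ := Scheme.Pullback.exists_preimage_pullback q' q hq'
    exact notMem_of_isUnit_sectionsHom _ (.of_mul_eq_one_right _ (D.τ_mul_of_comp (pullback.fst _ _)
      (pullback.snd _ _) pullback.condition)) t

theorem isPullback_polynomial (R S : Type u) [CommRing R] [CommRing S] [Algebra R S] :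
    IsPullback (Spec.map (CommRingCat.ofHom (C : S →+* S[X])))
      (Spec.map (CommRingCat.ofHom (mapRingHom (algebraMap R S))))
      (Spec.map (CommRingCat.ofHom (algebraMap R S))) (Spec.map (CommRingCat.ofHom C)) :=
  isPullback_SpecMap_of_isPushout _ _ _ _ (CommRingCat.isPushout_of_isPushout R S R[X] S[X])

/-- The coordinates of the product of two curves that are covered by affine lines. -/
theorem exists_product_chart {K : Type u} [Field K] {Z Z' : Scheme.{u}} {f : Z ⟶ Spec (.of K)}
    {f' : Z' ⟶ Spec (.of K)} {b : Spec (.of K[X]) ⟶ Z} {b' : Spec (.of K[X]) ⟶ Z'}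
    [IsOpenImmersion b] [IsOpenImmersion b'] (hb : b ≫ f = Spec.map (CommRingCat.ofHom C))
    (hb' : b' ≫ f' = Spec.map (CommRingCat.ofHom C)) :
    ∃ (i : Spec (.of K[X][X]) ⟶ pullback f f') (_ : IsOpenImmersion i),
      i ≫ pullback.fst f f' = Spec.map (CommRingCat.ofHom C) ≫ b ∧
      i ≫ pullback.snd f f' = Spec.map (CommRingCat.ofHom (mapRingHom C)) ≫ b' ∧
      Set.range i = pullback.fst f f' ⁻¹' Set.range b ∩ pullback.snd f f' ⁻¹' Set.range b' := by
  let c : Spec (.of K[X]) ⟶ Spec (.of K) := Spec.map (CommRingCat.ofHom C)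
  have h : IsPullback (Spec.map (CommRingCat.ofHom (C : K[X] →+* K[X][X])))
      (Spec.map (CommRingCat.ofHom (mapRingHom C))) c c := isPullback_polynomial K K[X]
  have e₁ : c ≫ 𝟙 _ = b ≫ f := by rw [Category.comp_id, hb]
  have e₂ : c ≫ 𝟙 _ = b' ≫ f' := by rw [Category.comp_id, hb']
  let m := pullback.map c c f f' b b' (𝟙 _) e₁ e₂
  refine ⟨h.isoPullback.hom ≫ m, inferInstance, ?_, ?_, ?_⟩
  · rw [Category.assoc, pullback.lift_fst, IsPullback.isoPullback_hom_fst_assoc]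
  · rw [Category.assoc, pullback.lift_snd, IsPullback.isoPullback_hom_snd_assoc]
  · refine Eq.trans ?_ (Scheme.Pullback.range_map (f := c) (g := c) f f' b b' (𝟙 _) e₁ e₂)
    exact congrArg Opens.carrier (Scheme.Hom.opensRange_comp_of_isIso h.isoPullback.hom m)

variable {K : Type u} [Field K] {Y Y' W : Scheme.{u}} {s : Y ⟶ Spec (.of K)} {s' : Y' ⟶ Spec (.of K)}
  {Z : Closeds Y} {Z' : Closeds Y'}

/-- The reduction of a chart of the blow-up of the curve to the exceptional divisor. -/
theorem CurveChart.exists_ev_S (D : CurveChart s Z) {ev : D.R →+* K[X]}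
    (h : Function.Surjective ev) (hk : RingHom.ker ev = Ideal.span {D.f, D.g}) (l : Fin 2) :
    ∃ E : D.S l →+* K[X][X], Function.Surjective E ∧ E.comp BlowupRing.of = C.comp ev ∧
      E BlowupRing.frac = X ∧ RingHom.ker E = Ideal.span {BlowupRing.of (D.den l)} := by
  rw [← D.span_num_den l] at hk
  have h1 : ev (D.num l) = 0 := hk.ge (Ideal.subset_span (by simp))
  have h2 : ev (D.den l) = 0 := hk.ge (Ideal.subset_span (by simp))
  have h3 : (C.comp ev) (D.num l) = (C.comp ev) (D.den l) * (X : K[X][X]) := by simp [h1, h2]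
  have h4 : (BlowupRing.lift (C.comp ev) X h3).comp BlowupRing.of = C.comp ev :=
    RingHom.ext fun r ↦ BlowupRing.lift_of _ _ h3 r
  have h5 := BlowupRing.lift_frac (C.comp ev) X h3
  refine ⟨BlowupRing.lift (C.comp ev) X h3, fun p ↦ ?_, h4, h5, BlowupRing.ker_lift_polynomial ev hk h3⟩
  induction p using Polynomial.induction_on' with
  | add p q hp hq =>
    obtain ⟨a, rfl⟩ := hp
    obtain ⟨b, rfl⟩ := hq
    exact ⟨a + b, map_add _ _ _⟩
  | monomial n r =>
    obtain ⟨r, rfl⟩ := h r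
    refine ⟨BlowupRing.of r * BlowupRing.frac ^ n, ?_⟩
    rw [map_mul, map_pow, h5, ← C_mul_X_pow_eq_monomial]
    exact congrArg (· * X ^ n) (RingHom.congr_fun h4 r)

theorem exists_subscheme_hom {a : W ⟶ Y} (I : Y.IdealSheafData) {L : W.IdealSheafData}
    (h : L = I.comap a) : ∃ e : L.subscheme ⟶ I.subscheme, e ≫ I.subschemeι = L.subschemeι ≫ a := by
  subst h
  exact ⟨(I.comapIso a).hom ≫ pullback.snd _ _, by
    rw [Category.assoc, ← pullback.condition, Scheme.IdealSheafData.comapIso_hom_fst_assoc]⟩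

theorem CurveAtlas.exists_isPullback (D : CurveAtlas s Z) (D' : CurveAtlas s' Z') {a : W ⟶ Y}
    {b : W ⟶ Y'} (ha : IsBlowup a (Scheme.IdealSheafData.vanishingIdeal Z))
    (hab : (Scheme.IdealSheafData.vanishingIdeal Z).comap a =
      (Scheme.IdealSheafData.vanishingIdeal Z').comap b) (hs : a ≫ s = b ≫ s')
    (hσ : ∀ k l (j : Spec (.of ((D.chart k).S l)) ⟶ W) [IsOpenImmersion j],
      j ≫ a = Spec.map (CommRingCat.ofHom BlowupRing.of) ≫ (D.chart k).c →
      ∃ σ : (D'.chart l).R ⟶ .of ((D.chart k).S l), j ≫ b = Spec.map σ ≫ (D'.chart l).c ∧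
        σ.hom (D'.chart l).τ = BlowupRing.frac) :
    ∃ (e : ((Scheme.IdealSheafData.vanishingIdeal Z).comap a).subscheme ⟶ reducedSubscheme Z)
      (e' : ((Scheme.IdealSheafData.vanishingIdeal Z).comap a).subscheme ⟶ reducedSubscheme Z'),
      e ≫ reducedι Z = ((Scheme.IdealSheafData.vanishingIdeal Z).comap a).subschemeι ≫ a ∧
      e' ≫ reducedι Z' = ((Scheme.IdealSheafData.vanishingIdeal Z).comap a).subschemeι ≫ b ∧
      IsPullback e e' (reducedι Z ≫ s) (reducedι Z' ≫ s') := by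
  obtain ⟨L, hL⟩ : ∃ L, L = (Scheme.IdealSheafData.vanishingIdeal Z).comap a := ⟨_, rfl⟩
  obtain ⟨e, he⟩ : ∃ e : L.subscheme ⟶ reducedSubscheme Z, e ≫ reducedι Z = L.subschemeι ≫ a :=
    exists_subscheme_hom _ hL
  obtain ⟨e', he'⟩ : ∃ e' : L.subscheme ⟶ reducedSubscheme Z',
      e' ≫ reducedι Z' = L.subschemeι ≫ b := exists_subscheme_hom _ (hL.trans hab)
  rw [← hL]
  refine ⟨e, e', he, he', ?_⟩
  have hcomm : e ≫ reducedι Z ≫ s = e' ≫ reducedι Z' ≫ s' := by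
    rw [reassoc_of% he, reassoc_of% he', hs]
  have : Mono (reducedι Z) := inferInstanceAs (Mono (Scheme.IdealSheafData.subschemeι _))
  have : Mono (reducedι Z') := inferInstanceAs (Mono (Scheme.IdealSheafData.subschemeι _))
  choose j hj hcov using fun k ↦ (D.chart k).exists_blowup_charts ha
  have hjo (k l) : IsOpenImmersion (j k l) := (hj k l).1
  choose σ hσb hστ using fun k l ↦ hσ k l (j k l) (hj k l).2.1
  obtain ⟨θ, ev, hev, -⟩ := D.exists_iso
  obtain ⟨θ', ev', hev', -⟩ := D'.exists_iso
  choose E hE1 hE2 hE3 hE4 using fun k ↦ (D.chart k).exists_ev_S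
    (surjective_of_comp_eq_C (hev k).1 (hev k).2.1) (hev k).2.2.1
  choose c hc hcι hcr using fun k l ↦ exists_subscheme_chart L (j k l) (CommRingCat.ofHom (E k l))
    (hE1 k l) ((hE4 k l).trans (hL ▸ (hj k l).2.2.1.symm))
  let β (k) : Spec (.of K[X]) ⟶ reducedSubscheme Z := lineChartι K k ≫ θ.hom
  let β' (k) : Spec (.of K[X]) ⟶ reducedSubscheme Z' := lineChartι K k ≫ θ'.hom
  have hβ (k) : β k ≫ reducedι Z = Spec.map (CommRingCat.ofHom (ev k)) ≫ (D.chart k).c :=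
    (Category.assoc _ _ _).trans (hev k).2.2.2.1
  have hβ' (k) : β' k ≫ reducedι Z' = Spec.map (CommRingCat.ofHom (ev' k)) ≫ (D'.chart k).c :=
    (Category.assoc _ _ _).trans (hev' k).2.2.2.1
  have hβs (k) : β k ≫ reducedι Z ≫ s = Spec.map (CommRingCat.ofHom C) := by
    rw [reassoc_of% hβ k, (D.chart k).comp_eq, ← Spec.map_comp, ← (hev k).1]
    rfl
  have hβs' (k) : β' k ≫ reducedι Z' ≫ s' = Spec.map (CommRingCat.ofHom C) := by
    rw [reassoc_of% hβ' k, (D'.chart k).comp_eq, ← Spec.map_comp, ← (hev' k).1]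
    rfl
  have hce (k l) : c k l ≫ e = Spec.map (CommRingCat.ofHom C) ≫ β k := by
    rw [← cancel_mono (reducedι Z), Category.assoc, he, reassoc_of% hcι k l, (hj k l).2.1,
      Category.assoc, hβ, ← Category.assoc, ← Category.assoc, ← Spec.map_comp, ← Spec.map_comp,
      ← CommRingCat.ofHom_comp, ← CommRingCat.ofHom_comp, hE2]
  have hcι' (k l) : (c k l ≫ e') ≫ reducedι Z' =
      Spec.map (σ k l ≫ CommRingCat.ofHom (E k l)) ≫ (D'.chart l).c := by
    rw [Category.assoc, he', reassoc_of% hcι k l, hσb, Spec.map_comp, Category.assoc]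
  have hce' (k l) : c k l ≫ e' = Spec.map (CommRingCat.ofHom (mapRingHom C)) ≫ β' l := by
    have h1 : Set.range (c k l ≫ e') ⊆ Set.range (β' l) := by
      rintro _ ⟨q, rfl⟩
      refine (hev' l).2.2.2.2.ge ?_
      rw [Set.mem_preimage, ← Scheme.Hom.comp_apply, hcι']
      exact ⟨_, rfl⟩
    let m := Spec.preimage (IsOpenImmersion.lift (β' l) _ h1)
    have h2 : Spec.map m ≫ β' l = c k l ≫ e' := by
      rw [Spec.map_preimage, IsOpenImmersion.lift_fac]
    have h3 : CommRingCat.ofHom (ev' l) ≫ m = σ k l ≫ CommRingCat.ofHom (E k l) := by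
      apply Spec.map_injective
      rw [← cancel_mono (D'.chart l).c, ← hcι', ← h2, Spec.map_comp, Category.assoc, Category.assoc,
        hβ']
    have h4 : m.hom X = X := by
      have h := congrArg (fun φ ↦ φ.hom (D'.chart l).τ) h3
      refine ((congrArg m.hom (hev' l).2.1).symm.trans h).trans ?_
      exact (congrArg (E k l) (hστ k l)).trans (hE3 k l)
    have h5 : CommRingCat.ofHom C ≫ m = CommRingCat.ofHom (C.comp C) := by
      apply Spec.map_injective
      rw [Spec.map_comp, ← hβs' l, ← Category.assoc, h2, Category.assoc, ← hcomm,
        ← Category.assoc, hce, Category.assoc, hβs, ← Spec.map_comp]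
      rfl
    have h6 : m.hom = mapRingHom C := by
      refine Polynomial.ringHom_ext (fun r ↦ ?_) (h4.trans (map_X _).symm)
      exact (congrArg (fun φ ↦ φ.hom r) h5).trans (map_C _).symm
    rw [← h2, ← h6]
    rfl
  have hiso : IsIso (pullback.lift e e' hcomm) := by
    refine isIso_of_charts _ fun x ↦ ?_
    have hcv (x) : ∃ k, x ∈ Set.range (β k) := by
      obtain ⟨k, q, hq⟩ := exists_mem_range_lineChartι K (θ.inv x)
      exact ⟨k, q, (congrArg θ.hom hq).trans (Scheme.inv_hom_apply θ x)⟩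
    have hcv' (x) : ∃ k, x ∈ Set.range (β' k) := by
      obtain ⟨k, q, hq⟩ := exists_mem_range_lineChartι K (θ'.inv x)
      exact ⟨k, q, (congrArg θ'.hom hq).trans (Scheme.inv_hom_apply θ' x)⟩
    obtain ⟨k, hk⟩ := hcv (pullback.fst (reducedι Z ≫ s) (reducedι Z' ≫ s') x)
    obtain ⟨l, hl⟩ := hcv' (pullback.snd (reducedι Z ≫ s) (reducedι Z' ≫ s') x)
    obtain ⟨i, hi, hi1, hi2, hir⟩ := exists_product_chart (hβs k) (hβs' l)
    refine ⟨_, _, i, c k l, 𝟙 _, hi, hc k l, inferInstance, hir.ge ⟨hk, hl⟩, ?_, fun z hz ↦ ?_⟩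
    · apply pullback.hom_ext
      · rw [Category.assoc, pullback.lift_fst, Category.id_comp, hi1, hce]
      · rw [Category.assoc, pullback.lift_snd, Category.id_comp, hi2, hce']
    · obtain ⟨hz1, hz2⟩ := hir.le hz
      have h1 : e z ∈ Set.range (β k) := by
        rw [← pullback.lift_fst e e' hcomm]; exact hz1
      have h2 : e' z ∈ Set.range (β' l) := by
        rw [← pullback.lift_snd e e' hcomm]; exact hz2
      have h3 : a (L.subschemeι z) ∈ Set.range (D.chart k).c := by
        rw [← Scheme.Hom.comp_apply, ← he]
        exact (hev k).2.2.2.2.le h1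
      have h4 : b (L.subschemeι z) ∈ Set.range (D'.chart l).c := by
        rw [← Scheme.Hom.comp_apply, ← he']
        exact (hev' l).2.2.2.2.le h2
      rw [hcr k l]
      obtain ⟨l', q, hq⟩ := hcov k _ h3
      obtain rfl | hll := eq_or_ne l' l
      · exact ⟨q, hq⟩
      · have h5 : b (j k l' q) = (D'.chart l').c (Spec.map (σ k l') q) := by
          rw [← Scheme.Hom.comp_apply, hσb, Scheme.Hom.comp_apply]
        rw [← hq, h5] at h4
        have h6 := D'.τ_notMem hll _ h4
        have h7 : BlowupRing.frac ∉ PrimeSpectrum.asIdeal (R := (D.chart k).S l') q := by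
          rw [← hστ k l']; exact h6
        rw [Set.mem_preimage, ← hq]
        exact (hj k l').2.2.2 l q h7
  exact .of_iso_pullback ⟨hcomm⟩ (asIso (pullback.lift e e' hcomm)) (pullback.lift_fst _ _ _)
    (pullback.lift_snd _ _ _)

end ExceptionalDivisor

section Flop

theorem span_pair_mul_left {A : Type*} [CommRing A] (a b : A) :
    Ideal.span {a * b, a} = Ideal.span {a} := by
  rw [Set.pair_comm, span_pair_mul_right]

variable {K : Type u} [Field K] {X : Scheme.{u}} {s : X ⟶ Spec (.of K)} {B C : Closeds X}
  {p : X} {U : X.affineOpens} {x y z : Γ(X, U)}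

namespace FlopCharts
variable {Y : IteratedBlowup B C} (D : FlopCharts s p U x y z Y)

theorem exists_coords (h : HasFlopCoords s B C p U x y z) (k : Fin 2) :
    ∃ φ : Γ(X, U) ⟶ ((D.atlas h).chart k).R, ((D.atlas h).chart k).c ≫ Y.toBase = chartMap U φ ∧
      ∃ u w, u ≠ 0 ∧ φ.hom x = ((D.atlas h).chart k).f * u ∧ φ.hom z = ((D.atlas h).chart k).g * u ∧
        φ.hom y = ((D.atlas h).chart k).f * w := by
  fin_cases k
  · have : IsDomain D.R₂ := D.isChartTwo.lineChart.isDomain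
    exact ⟨D.φ₂, D.c₂_comp, (1 : D.R₂), D.t₂, (one_ne_zero : (1 : D.R₂) ≠ 0), (mul_one _).symm, (mul_one _).symm,
      D.isChartTwo.eq_y⟩
  · refine ⟨D.φ₁, D.c₁_comp, D.t₁, (1 : D.R₁), ?_, D.isChartOne.eq_x,
      D.isChartOne.eq_z.trans (mul_comm _ _), (mul_one _).symm⟩
    rintro (h0 : D.t₁ = 0)
    obtain ⟨ev, -, h1, -⟩ := D.isChartOne.lineChart.exists_ev
    rw [h0, map_zero] at h1
    exact Polynomial.X_ne_zero h1.symm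

theorem exists_locus (h : HasFlopCoords s B C p U x y z) (k : Fin 2) :
    ∃ φ : Γ(X, U) ⟶ ((D.atlas h).chart k).R, ((D.atlas h).chart k).c ≫ Y.toBase = chartMap U φ ∧
      ((D.atlas h).chart k).c.opensRange = chartLocus Y.toBase
        (Scheme.IdealSheafData.vanishingIdeal B * unionIdeal B C) U (x * ![x, y] k) ∧
      φ.hom (![y, x] k) = φ.hom (![x, y] k) * ((D.atlas h).chart k).τ := by
  fin_cases k
  exacts [⟨D.φ₂, D.c₂_comp, D.range₂, D.isChartTwo.eq_y⟩,
    ⟨D.φ₁, D.c₁_comp, D.range₁, D.isChartOne.eq_x⟩]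

end FlopCharts

/-- The pullback of the blown up ideal to a ring in which one of `x, z` divides the other. -/
theorem map_ideal_eq {A S : Type*} [CommRing A] [CommRing S] (ψ : A →+* S) {x y z : A} (l : Fin 2)
    {v w : S} (hl : ψ (![z, x] l) = ψ (![x, z] l) * v) (hy : ψ x * w = ψ z * ψ y) :
    (Ideal.span {x, z} * Ideal.span {x, z * y}).map ψ = Ideal.span {ψ (x * ![x, z] l)} := by
  have h1 : Ideal.span {ψ x, ψ z} = Ideal.span {ψ (![x, z] l)} := by
    fin_cases l
    · exact (congrArg (fun r ↦ Ideal.span {ψ x, r}) hl).trans (span_pair_mul_right _ _)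
    · exact (congrArg (fun r ↦ Ideal.span {r, ψ z}) hl).trans (span_pair_mul_left _ _)
  rw [Ideal.map_mul, Ideal.map_span, Ideal.map_span, Set.image_pair, Set.image_pair, map_mul, ← hy,
    span_pair_mul_right, h1, Ideal.span_singleton_mul_span_singleton, map_mul, mul_comm]

theorem HasFlopCoords.isAtiyahFlop (h : HasFlopCoords s B C p U x y z) (hp : IsClosed {p})
    (Y : IteratedBlowup B C) (Y' : IteratedBlowup C B) :
    HasNormalBundleNegOneNegOne (Y.toBase ≫ s) (Y.fiberCurve p) ∧
      ∃ φ : Y.X₂ ⤏ Y'.X₂,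
        (φ.compHom Y'.toBase = Y.toBase.toRationalMap ∧
          ∀ ψ : Y.X₂ ⤏ Y'.X₂, ψ.compHom Y'.toBase = Y.toBase.toRationalMap → ψ = φ) ∧
        IsAtiyahFlop (Y.toBase ≫ s) (Y'.toBase ≫ s) φ (Y.fiberCurve p) := by
  obtain ⟨D⟩ := h.nonempty_flopCharts hp Y
  obtain ⟨D'⟩ := h.symm.nonempty_flopCharts hp Y'
  have hN := (D.atlas h).hasNormalBundleNegOneNegOne
  have hsm' := h.symm.isSmallResolution hp Y'
  rw [unionIdeal, sup_comm] at hsm'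
  obtain ⟨φ, hφ, W, a, b, ha, hb, hab, hW, f, hf, hfs, hft, hfe⟩ :=
    (h.isSmallResolution hp Y).exists_flop hsm'
      (Scheme.IdealSheafData.vanishingIdeal_antimono le_sup_left)
      (Scheme.IdealSheafData.vanishingIdeal_antimono le_sup_right)
  have hcompl {V : Scheme.{u}} (Z : Closeds V) :
      supportCompl (Scheme.IdealSheafData.vanishingIdeal Z) = Z.compl :=
    Opens.ext (by simp [supportCompl])
  refine ⟨hN, φ, hφ, hN, fun y hy ↦ (D.atlas h).isRegularLocalRing y hy, Y'.fiberCurve p,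
    (D'.atlas h.symm).hasNormalBundleNegOneNegOne,
    fun y hy ↦ (D'.atlas h.symm).isRegularLocalRing y hy, W, a, b, ha, hb, hab, ?_, f, hf,
    hfs.trans (hcompl _), hft.trans (hcompl _), hfe⟩
  refine (D.atlas h).exists_isPullback (D'.atlas h.symm) ha hab
    (by rw [← Category.assoc, hW, Category.assoc]) fun k l ↦ ?_
  have hA := D.exists_coords h k
  have hA' := D'.exists_locus h.symm l
  revert hA hA'
  generalize (D.atlas h).chart k = A
  generalize (D'.atlas h.symm).chart l = A'
  rintro ⟨φ₁, hφ₁, u, w, hu, hx, hz, hy⟩ ⟨φ₂, hφ₂, hr, hτ⟩ j hj hja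
  let ψ : Γ(X, U) ⟶ .of (A.S l) := φ₁ ≫ CommRingCat.ofHom BlowupRing.of
  have hψ (r) : ψ.hom r = BlowupRing.of (φ₁.hom r) := rfl
  have hn : φ₁.hom (![z, x] l) = A.num l * u := by
    fin_cases l
    exacts [hz, hx]
  have hd : φ₁.hom (![x, z] l) = A.den l * u := by
    fin_cases l
    exacts [hx, hz]
  have hv : ψ.hom (![z, x] l) = ψ.hom (![x, z] l) * BlowupRing.frac := by
    rw [hψ, hψ, hn, hd, map_mul, map_mul, BlowupRing.of_eq]; ring
  have hg : (j ≫ b) ≫ Y'.toBase = chartMap U ψ := by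
    rw [Category.assoc, ← hW, reassoc_of% hja, hφ₁, chartMap, chartMap, Spec.map_comp,
      Category.assoc]
  have hM := (h.symm.isBlowup_toBase Y').isEffectiveCartier
  have hMb := hb.comap_isEffectiveCartier hM
  rw [← Scheme.IdealSheafData.comap_comp] at hMb
  have hmap : ((Scheme.IdealSheafData.vanishingIdeal C * unionIdeal C B).ideal U).map ψ.hom =
      Ideal.span {ψ.hom (x * ![x, z] l)} := by
    rw [h.symm.ideal_mul]
    refine map_ideal_eq ψ.hom l hv (w := BlowupRing.of (A.g * w)) ?_
    rw [hψ, hψ, hψ, hx, hz, hy, ← map_mul, ← map_mul]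
    congr 1; ring
  have hmem : x * ![x, z] l ∈
      (Scheme.IdealSheafData.vanishingIdeal C * unionIdeal C B).ideal U := by
    rw [h.symm.ideal_mul, mul_comm x]
    refine Ideal.mul_mem_mul (Ideal.subset_span ?_) (Ideal.subset_span (Or.inl rfl))
    fin_cases l
    exacts [Or.inl rfl, Or.inr rfl]
  obtain ⟨σ, hσ, hσ'⟩ := exists_factor hφ₂ hmem hr hM ψ (j ≫ b) hg
    (by rw [Category.assoc]; exact hMb.comap_comp j) hmap
  refine ⟨σ, hσ, ?_⟩
  have := A.isDomain_S l
  have := A.lineChart.isDomain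
  have h1 := congrArg σ.hom hτ
  rw [map_mul] at h1
  have h2 (r) : σ.hom (φ₂.hom r) = ψ.hom r := congrArg (fun χ ↦ χ.hom r) hσ'
  rw [h2, h2, hv] at h1
  refine (mul_left_cancel₀ ?_ h1).symm
  rw [hψ, hd]
  exact A.of_ne_zero l (mul_ne_zero (A.den_ne_zero l) hu)

end Flop

section LocalAlgebra
open IsLocalRing

theorem height_map_mk_of_lt {S : Type*} [CommRing S] {p q m : Ideal S} (hp : p.IsPrime) (hq : q.IsPrime) (hm : m.IsPrime)
    (h1 : p < q) (h2 : q < m) : 2 ≤ (m.map (Ideal.Quotient.mk p)).height := by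
  have hq' := Ideal.isPrime_map_quotientMk_of_isPrime h1.le
  have hm' := Ideal.isPrime_map_quotientMk_of_isPrime (h1.trans h2).le
  have hp' := Ideal.isPrime_map_quotientMk_of_isPrime (le_refl p)
  have hlt : ∀ {a b : Ideal S}, p ≤ a → a < b →
      a.map (Ideal.Quotient.mk p) < b.map (Ideal.Quotient.mk p) := fun {a b} hpa hab ↦
    lt_of_le_of_ne (Ideal.map_mono hab.le) fun e ↦ hab.ne (by
      have h3 := congrArg (Ideal.comap (Ideal.Quotient.mk p)) e
      rwa [Ideal.comap_map_quotientMk, Ideal.comap_map_quotientMk, sup_eq_right.2 hpa,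
        sup_eq_right.2 (hpa.trans hab.le)] at h3)
  have h3 := Ideal.height_add_one_le_of_lt_of_isPrime (hlt le_rfl h1)
  have h4 := Ideal.height_add_one_le_of_lt_of_isPrime (hlt h1.le h2)
  refine le_trans ?_ h4
  have : (1 : ℕ∞) ≤ (q.map (Ideal.Quotient.mk p)).height := le_trans le_add_self h3
  calc (2 : ℕ∞) = 1 + 1 := by norm_num
    _ ≤ _ := by gcongr

variable {R : Type*} [CommRing R] [IsLocalRing R]

/-- The differentials at the closed point of the functions in an ideal. -/
def conormalSpan (I : Ideal R) : Submodule (ResidueField R) (CotangentSpace R) where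
  carrier := {v | ∃ g : maximalIdeal R, (g : R) ∈ I ∧ (maximalIdeal R).toCotangent g = v}
  zero_mem' := ⟨0, I.zero_mem, map_zero _⟩
  add_mem' := by
    rintro _ _ ⟨g, hg, rfl⟩ ⟨g', hg', rfl⟩
    exact ⟨g + g', I.add_mem hg hg', map_add _ _ _⟩
  smul_mem' := by
    rintro c _ ⟨g, hg, rfl⟩
    obtain ⟨r, rfl⟩ := residue_surjective c
    exact ⟨r • g, I.mul_mem_left r hg, map_smul _ _ _⟩

theorem mem_conormalSpan {I : Ideal R} (g : maximalIdeal R) (hg : (g : R) ∈ I) :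
    (maximalIdeal R).toCotangent g ∈ conormalSpan I := ⟨g, hg, rfl⟩

theorem exists_span_pair_eq {k V : Type*} [Field k] [AddCommGroup V] [Module k V]
    [FiniteDimensional k V] {W : Submodule k V} (hW : Module.finrank k W = 2) {e : V} (he : e ∈ W)
    (h0 : e ≠ 0) : ∃ e' ∈ W, Submodule.span k {e, e'} = W := by
  have h1 : Submodule.span k {e} ≤ W := (Submodule.span_singleton_le_iff_mem _ _).2 he
  have h2 : Submodule.span k {e} < W := lt_of_le_of_ne h1 fun h ↦ by
    have := finrank_span_singleton (K := k) h0
    rw [h] at this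
    omega
  obtain ⟨e', he', hn⟩ := SetLike.exists_of_lt h2
  have h3 : Submodule.span k {e, e'} ≤ W := by
    rw [Submodule.span_le]
    rintro _ (rfl | rfl)
    exacts [he, he']
  refine ⟨e', he', Submodule.eq_of_le_of_finrank_le h3 ?_⟩
  have h4 : Submodule.span k {e} < Submodule.span k {e, e'} :=
    lt_of_le_of_ne (Submodule.span_mono (by simp)) fun h ↦
      hn (h ▸ Submodule.subset_span (by simp))
  have h5 := Submodule.finrank_lt_finrank_of_lt h4
  rw [finrank_span_singleton h0] at h5
  omega

/-- Two ideals generating the maximal ideal have a common element with given differential in the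
intersection of their conormal spaces. -/
theorem exists_mem_inf {I J : Ideal R} (h : I ⊔ J = maximalIdeal R) {e : CotangentSpace R}
    (hI : e ∈ conormalSpan I) (hJ : e ∈ conormalSpan J) :
    ∃ x : maximalIdeal R, (x : R) ∈ I ∧ (x : R) ∈ J ∧ (maximalIdeal R).toCotangent x = e := by
  obtain ⟨b, hb, rfl⟩ := hI
  obtain ⟨c, hc, h1⟩ := hJ
  rw [Ideal.toCotangent_eq, sq] at h1
  nth_rewrite 1 [← h] at h1
  rw [Ideal.sup_mul] at h1
  obtain ⟨i, hi, j, hj, h2⟩ := Submodule.mem_sup.1 h1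
  have hi' := Ideal.mul_le_right hi
  refine ⟨⟨b + i, add_mem b.2 hi'⟩, I.add_mem hb (Ideal.mul_le_left hi), ?_, ?_⟩
  · have : (b : R) + i = c - j := by linear_combination h2
    change (b : R) + i ∈ J
    rw [this]
    exact J.sub_mem hc (Ideal.mul_le_left hj)
  · rw [Ideal.toCotangent_eq]
    simpa [sq] using Ideal.mul_mono_left (h ▸ le_sup_left) hi

variable [IsNoetherianRing R]

theorem le_of_le_sup_maximalIdeal_mul {I J : Ideal R} (h : J ≤ I ⊔ maximalIdeal R * J) : J ≤ I :=
  Submodule.le_of_le_smul_of_le_jacobson_bot (IsNoetherian.noetherian J)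
    (jacobson_eq_maximalIdeal ⊥ bot_ne_top).ge h

theorem maximalIdeal_eq_sup {I J : Ideal R} (hI : I ≤ maximalIdeal R) (hJ : J ≤ maximalIdeal R)
    (h : conormalSpan I ⊔ conormalSpan J = ⊤) : I ⊔ J = maximalIdeal R := by
  refine le_antisymm (sup_le hI hJ) (le_of_le_sup_maximalIdeal_mul fun g hg ↦ ?_)
  have h1 : (maximalIdeal R).toCotangent ⟨g, hg⟩ ∈ conormalSpan I ⊔ conormalSpan J :=
    h ▸ Submodule.mem_top
  obtain ⟨_, ⟨b, hb, rfl⟩, _, ⟨c, hc, rfl⟩, h2⟩ := Submodule.mem_sup.1 h1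
  rw [← map_add, Ideal.toCotangent_eq, sq] at h2
  refine Submodule.mem_sup.2 ⟨b + c, Submodule.add_mem_sup hb hc, g - (b + c), ?_, by ring⟩
  rw [← neg_mem_iff]
  simpa using h2

theorem maximalIdeal_le_of_span {I J : Ideal R} {x y z : maximalIdeal R}
    (h : I ⊔ J = maximalIdeal R)
    (hI : Submodule.span (ResidueField R)
      {(maximalIdeal R).toCotangent x, (maximalIdeal R).toCotangent y} = conormalSpan I)
    (hJ : Submodule.span (ResidueField R)
      {(maximalIdeal R).toCotangent x, (maximalIdeal R).toCotangent z} = conormalSpan J) :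
    maximalIdeal R = Ideal.span {(x : R), (y : R), (z : R)} := by
  have hle : ∀ {a b : maximalIdeal R} {I : Ideal R}, I ≤ maximalIdeal R →
      Submodule.span (ResidueField R) {(maximalIdeal R).toCotangent a,
        (maximalIdeal R).toCotangent b} = conormalSpan I →
      I ≤ Ideal.span {(a : R), (b : R)} ⊔ maximalIdeal R * maximalIdeal R := by
    intro a b I hI' hI g hg
    have h1 := mem_conormalSpan ⟨g, hI' hg⟩ hg
    rw [← hI] at h1
    obtain ⟨α, β, h2⟩ := Submodule.mem_span_pair.1 h1
    obtain ⟨α, rfl⟩ := residue_surjective α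
    obtain ⟨β, rfl⟩ := residue_surjective β
    have h3 : (maximalIdeal R).toCotangent (α • a + β • b) =
        (maximalIdeal R).toCotangent ⟨g, hI' hg⟩ := by
      rw [map_add, map_smul, map_smul]
      exact h2
    rw [eq_comm, Ideal.toCotangent_eq, sq] at h3
    refine Submodule.mem_sup.2 ⟨α * a + β * b, Ideal.mem_span_pair.2 ⟨α, β, rfl⟩,
      g - (α * a + β * b), h3, by ring⟩
  have hx : ∀ a : R, a ∈ ({(x : R), (y : R), (z : R)} : Set R) → a ∈ maximalIdeal R := by
    rintro _ (rfl | rfl | rfl)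
    exacts [x.2, y.2, z.2]
  refine le_antisymm (le_of_le_sup_maximalIdeal_mul ?_) (Ideal.span_le.2 hx)
  nth_rewrite 1 [← h]
  refine sup_le ((hle (h ▸ le_sup_left) hI).trans ?_) ((hle (h ▸ le_sup_right) hJ).trans ?_)
  · exact sup_le_sup_right (Ideal.span_mono (by rintro _ (rfl | rfl) <;> simp)) _
  · exact sup_le_sup_right (Ideal.span_mono (by rintro _ (rfl | rfl) <;> simp)) _

theorem eq_span_pair_of_isPrime {I : Ideal R} (hI : I.IsPrime) {x y z : R}
    (h : maximalIdeal R = Ideal.span {x, y, z}) (hx : x ∈ I) (hy : y ∈ I) (hz : z ∉ I) :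
    I = Ideal.span {x, y} := by
  have h1 : Ideal.span {x, y} ≤ I := Ideal.span_le.2 (by rintro _ (rfl | rfl) <;> assumption)
  refine le_antisymm (le_of_le_sup_maximalIdeal_mul fun b hb ↦ ?_) h1
  have hb' := le_maximalIdeal hI.ne_top hb
  rw [h, show ({x, y, z} : Set R) = {x, y} ∪ {z} by ext; simp; tauto, Ideal.span_union] at hb'
  obtain ⟨c, hc, d, hd, rfl⟩ := Submodule.mem_sup.1 hb'
  obtain ⟨r, rfl⟩ := Ideal.mem_span_singleton'.1 hd
  have hr : r ∈ I := (hI.mem_or_mem ((Ideal.add_mem_iff_right _ (h1 hc)).1 hb)).resolve_right hz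
  refine Submodule.add_mem_sup hc ?_
  rw [mul_comm r]
  exact Ideal.mul_mem_mul (h.ge (Ideal.subset_span (by simp))) hr

theorem isPrime_span_singleton {x y z : R} (h : maximalIdeal R = Ideal.span {x, y, z})
    (hdim : (3 : ℕ∞) ≤ (maximalIdeal R).height) : (Ideal.span {x}).IsPrime := by
  have hxm : x ∈ maximalIdeal R := h.ge (Ideal.subset_span (by simp))
  have hz : ∀ {q : Ideal R}, q.IsPrime → x ∈ q → y ∈ q → q ≠ maximalIdeal R → z ∉ q :=
    fun hq hx hy hne hz ↦ hne (le_antisymm (le_maximalIdeal hq.ne_top) (h.trans_le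
      (Ideal.span_le.2 (by rintro _ (rfl | rfl | rfl) <;> assumption))))
  obtain ⟨p, q, hp, hq, hpq, hqm, hxp⟩ : ∃ p q : Ideal R, p.IsPrime ∧ q.IsPrime ∧ p < q ∧
      q < maximalIdeal R ∧ x ∈ p := by
    have h1 := Ideal.height_le_height_add_one_of_mem hxm
    have hm := Ideal.isPrime_map_quotientMk_of_isPrime
      ((Ideal.span_singleton_le_iff_mem _).2 hxm)
    have h2 : ¬ ((maximalIdeal R).map (Ideal.Quotient.mk (Ideal.span {x}))).height ≤ (1 : ℕ) := fun h2 ↦ by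
      have h3 := hdim.trans (h1.trans (add_le_add_left h2 1))
      norm_num at h3
    rw [Ideal.height_le_iff] at h2
    push Not at h2
    obtain ⟨q, hq, hqm, hq1⟩ := h2
    obtain ⟨p, hp, hpq⟩ : ∃ p : Ideal (R ⧸ Ideal.span {x}), p.IsPrime ∧ p < q := by
      have h3 : ¬ q.height ≤ (0 : ℕ) := fun h3 ↦ by simpa using hq1.trans h3
      rw [Ideal.height_le_iff] at h3
      push Not at h3
      obtain ⟨p, hp, hpq, -⟩ := h3
      exact ⟨p, hp, hpq⟩
    have hc : ∀ {a b : Ideal (R ⧸ Ideal.span {x})}, a < b →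
        a.comap (Ideal.Quotient.mk _) < b.comap (Ideal.Quotient.mk _) := fun hab ↦
      lt_of_le_of_ne (Ideal.comap_mono hab.le) fun e ↦
        hab.ne (Ideal.comap_injective_of_surjective _ Ideal.Quotient.mk_surjective e)
    refine ⟨p.comap (Ideal.Quotient.mk _), q.comap (Ideal.Quotient.mk _), inferInstance,
      inferInstance, hc hpq, ?_, ?_⟩
    · have := hc hqm
      rwa [Ideal.comap_map_quotientMk, sup_eq_right.2
        ((Ideal.span_singleton_le_iff_mem _).2 hxm)] at this
    · rw [Ideal.mem_comap, Ideal.Quotient.eq_zero_iff_mem.2 (Ideal.mem_span_singleton_self x)]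
      exact p.zero_mem
  have hyp : y ∉ p := fun hy ↦ hpq.ne <|
    (eq_span_pair_of_isPrime hp h hxp hy (hz hp hxp hy (hpq.trans hqm).ne)).trans
      (eq_span_pair_of_isPrime hq h (hpq.le hxp) (hpq.le hy)
        (hz hq (hpq.le hxp) (hpq.le hy) hqm.ne)).symm
  have hle : p ⊔ Ideal.span {y} ≤ maximalIdeal R := sup_le (hpq.trans hqm).le
    ((Ideal.span_singleton_le_iff_mem _).2 (h.ge (Ideal.subset_span (by simp))))
  obtain ⟨q', hq', hqm'⟩ := Ideal.exists_minimalPrimes_le hle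
  have hqp : q'.IsPrime := hq'.1.1
  have hyq : y ∈ q' := hq'.1.2 (Ideal.mem_sup_right (Ideal.mem_span_singleton_self y))
  have hpq' : p ≤ q' := le_sup_left.trans hq'.1.2
  have hne : q' ≠ maximalIdeal R := fun e ↦ by
    have h1 := (height_map_mk_of_lt hp hq inferInstance hpq hqm).trans
      (Ideal.map_height_le_one_of_mem_minimalPrimes (e ▸ hq'))
    norm_num at h1
  have hpxy := hpq'.trans_eq
    (eq_span_pair_of_isPrime hqp h (hpq' hxp) hyq (hz hqp (hpq' hxp) hyq hne))
  have : p ≤ Ideal.span {x} := le_of_le_sup_maximalIdeal_mul fun b hb ↦ by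
    obtain ⟨α, β, rfl⟩ := Ideal.mem_span_pair.1 (hpxy hb)
    have hβ : β ∈ p := (hp.mem_or_mem
      ((Ideal.add_mem_iff_right _ (p.mul_mem_left α hxp)).1 hb)).resolve_right hyp
    refine Submodule.add_mem_sup (Ideal.mul_mem_left _ _ (Ideal.mem_span_singleton_self _)) ?_
    rw [mul_comm β]
    exact Ideal.mul_mem_mul (h.ge (Ideal.subset_span (by simp))) hβ
  rwa [← le_antisymm this ((Ideal.span_singleton_le_iff_mem _).2 hxp)]

/-- Local parameters adapted to two transversal curves in a regular local ring of dimension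
three. -/
theorem exists_local_coords (hfin : Module.finrank (ResidueField R) (CotangentSpace R) = 3)
    (hdim : (3 : ℕ∞) ≤ (maximalIdeal R).height) {I J : Ideal R} (hI : I.IsPrime) (hJ : J.IsPrime)
    (hI2 : Module.finrank (ResidueField R) (conormalSpan I) = 2)
    (hJ2 : Module.finrank (ResidueField R) (conormalSpan J) = 2)
    (hne : conormalSpan I ≠ conormalSpan J) :
    ∃ x y z : R, maximalIdeal R = Ideal.span {x, y, z} ∧ I = Ideal.span {x, y} ∧
      J = Ideal.span {x, z} ∧ (Ideal.span {x}).IsPrime ∧ x ≠ 0 ∧ y ∉ J ∧ z ∉ I := by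
  have h1 := Submodule.finrank_sup_add_finrank_inf_eq (conormalSpan I) (conormalSpan J)
  have h2 : conormalSpan I < conormalSpan I ⊔ conormalSpan J :=
    left_lt_sup.2 fun h ↦ hne (Submodule.eq_of_le_of_finrank_eq h (hJ2.trans hI2.symm)).symm
  have h3 := Submodule.finrank_lt_finrank_of_lt h2
  have h4 := Submodule.finrank_le (conormalSpan I ⊔ conormalSpan J)
  have h5 : conormalSpan I ⊔ conormalSpan J = ⊤ := Submodule.eq_top_of_finrank_eq (by omega)
  have h6 : conormalSpan I ⊓ conormalSpan J ≠ ⊥ := fun h ↦ by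
    rw [h, finrank_bot] at h1
    omega
  obtain ⟨e, he, he0⟩ := Submodule.exists_mem_ne_zero_of_ne_bot h6
  have hm := maximalIdeal_eq_sup (le_maximalIdeal hI.ne_top) (le_maximalIdeal hJ.ne_top) h5
  obtain ⟨x, hxI, hxJ, rfl⟩ := exists_mem_inf hm he.1 he.2
  obtain ⟨_, ⟨y, hyI, rfl⟩, hy⟩ := exists_span_pair_eq hI2 he.1 he0
  obtain ⟨_, ⟨z, hzJ, rfl⟩, hz⟩ := exists_span_pair_eq hJ2 he.2 he0
  have hxyz := maximalIdeal_le_of_span hm hy hz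
  have hyJ : (y : R) ∉ J := fun h ↦ hne <| Submodule.eq_of_le_of_finrank_eq (by
    rw [← hy, Submodule.span_le]
    rintro _ (rfl | rfl)
    exacts [he.2, mem_conormalSpan y h]) (hI2.trans hJ2.symm)
  have hzI : (z : R) ∉ I := fun h ↦ hne <| Eq.symm <| Submodule.eq_of_le_of_finrank_eq (by
    rw [← hz, Submodule.span_le]
    rintro _ (rfl | rfl)
    exacts [he.1, mem_conormalSpan z h]) (hJ2.trans hI2.symm)
  refine ⟨x, y, z, hxyz, eq_span_pair_of_isPrime hI hxyz hxI hyI hzI,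
    eq_span_pair_of_isPrime hJ (hxyz.trans (by rw [Set.pair_comm])) hxJ hzJ hyJ,
    isPrime_span_singleton hxyz hdim, fun h ↦ he0 ?_, hyJ, hzI⟩
  rw [show x = 0 from Subtype.ext h, map_zero]

end LocalAlgebra

section Dimension

/-- Translation of the variables of a polynomial ring. -/
def translate {K : Type*} [Field K] {n : ℕ} (a : Fin n → K) :
    MvPolynomial (Fin n) K ≃ₐ[K] MvPolynomial (Fin n) K :=
  AlgEquiv.ofAlgHom (MvPolynomial.aeval fun i ↦ MvPolynomial.X i + MvPolynomial.C (a i))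
    (MvPolynomial.aeval fun i ↦ MvPolynomial.X i - MvPolynomial.C (a i))
    (by ext; simp [← MvPolynomial.algebraMap_eq])
    (by ext; simp [← MvPolynomial.algebraMap_eq])

theorem height_vanishingIdeal_singleton {K : Type*} [Field K] {n : ℕ} (a : Fin n → K) :
    (MvPolynomial.vanishingIdeal K {a}).height = (MvPolynomial.vanishingIdeal K {(0 : Fin n → K)}).height := by
  have h : (MvPolynomial.vanishingIdeal K {(0 : Fin n → K)}).comap (translate a).toRingEquiv =
      MvPolynomial.vanishingIdeal K {a} := by
    ext f
    rw [Ideal.mem_comap, MvPolynomial.mem_vanishingIdeal_singleton_iff,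
      MvPolynomial.mem_vanishingIdeal_singleton_iff]
    have : (MvPolynomial.aeval (0 : Fin n → K)) ((translate a) f) = MvPolynomial.aeval a f := by
      rw [translate, AlgEquiv.ofAlgHom_apply, ← AlgHom.comp_apply, MvPolynomial.comp_aeval]
      simp
    exact Eq.congr_left this
  rw [← h, RingEquiv.height_comap]

theorem height_map_mk_eq_zero {R S : Type*} [CommRing R] [CommRing S] [Algebra R S]
    [Algebra.IsIntegral R S] (p : Ideal R) (hp : p.IsMaximal) (P : Ideal S)
    [hP : P.IsPrime] [hPp : P.LiesOver p] :
    (P.map (Ideal.Quotient.mk (p.map (algebraMap R S)))).height = 0 := by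
  have hle : p.map (algebraMap R S) ≤ P := Ideal.map_le_iff_le_comap.2 hPp.over.le
  have := Ideal.isPrime_map_quotientMk_of_isPrime hle
  have h : (P.map (Ideal.Quotient.mk (p.map (algebraMap R S)))).height ≤ (0 : ℕ) := by
    rw [Ideal.height_le_iff]
    intro q hq hqP
    exfalso
    have h1 : p ≤ (q.comap (Ideal.Quotient.mk (p.map (algebraMap R S)))).comap (algebraMap R S) := by
      rw [← Ideal.map_le_iff_le_comap]
      exact (Ideal.mk_ker (I := p.map (algebraMap R S))).ge.trans (Ideal.ker_le_comap _)
    have h2 := hp.eq_of_le Ideal.IsPrime.ne_top' h1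
    have h3 := Ideal.isMaximal_of_isIntegral_of_isMaximal_comap
      (q.comap (Ideal.Quotient.mk (p.map (algebraMap R S)))) (h2 ▸ hp)
    have h4 : q.comap (Ideal.Quotient.mk (p.map (algebraMap R S))) ≤ P :=
      (Ideal.comap_mono hqP.le).trans_eq (by rw [Ideal.comap_map_quotientMk, sup_eq_right.2 hle])
    have h5 := h3.eq_of_le hP.ne_top h4
    refine hqP.not_ge ?_
    rw [Ideal.map_le_iff_le_comap, h5]
  simpa using h

theorem exists_forall_isMaximal_height_eq (K A : Type*) [Field K] [IsAlgClosed K] [CommRing A]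
    [IsDomain A] [Algebra K A] [Algebra.FiniteType K A] :
    ∃ n : ℕ∞, ∀ m : Ideal A, m.IsMaximal → m.height = n := by
  obtain ⟨n, g, hg, hf⟩ := exists_finite_inj_algHom_of_fg K A
  algebraize [g.toRingHom]
  have := (faithfulSMul_iff_algebraMap_injective (MvPolynomial (Fin n) K) A).2 hg
  have : Module.Finite (MvPolynomial (Fin n) K) A := hf
  have : IsNoetherianRing A := Algebra.FiniteType.isNoetherianRing K A
  refine ⟨(MvPolynomial.vanishingIdeal K {(0 : Fin n → K)}).height, fun m hm ↦ ?_⟩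
  have hm' := Ideal.isMaximal_comap_of_isIntegral_of_isMaximal (R := MvPolynomial (Fin n) K) m
  obtain ⟨a, ha⟩ := MvPolynomial.isMaximal_iff_eq_vanishingIdeal_singleton.1 hm'
  have : m.LiesOver (m.under (MvPolynomial (Fin n) K)) := ⟨rfl⟩
  have hh := Ideal.height_eq_height_add_of_liesOver_of_hasGoingDown
    (m.under (MvPolynomial (Fin n) K)) m
  rw [hh, height_map_mk_eq_zero _ hm', add_zero, ← height_vanishingIdeal_singleton a]
  exact congrArg _ ha

end Dimension

section Spread

theorem exists_notMem_forall_mul_mem {A R : Type*} [CommRing A] [IsNoetherianRing A] [CommRing R]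
    [Algebra A R] (P : Ideal A) [P.IsPrime] [IsLocalization.AtPrime R P] (J : Ideal A) :
    ∃ f ∉ P, ∀ a, algebraMap A R a ∈ J.map (algebraMap A R) → f * a ∈ J := by
  obtain ⟨s, hs⟩ := IsNoetherian.noetherian ((J.map (algebraMap A R)).comap (algebraMap A R))
  have h1 : ∀ a : A, algebraMap A R a ∈ J.map (algebraMap A R) → ∃ f ∉ P, f * a ∈ J := by
    intro a ha
    obtain ⟨f, hf, h⟩ := (IsLocalization.algebraMap_mem_map_algebraMap_iff P.primeCompl R J a).1 ha
    exact ⟨f, hf, h⟩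
  choose! F hF hF' using h1
  have hsJ : ∀ a ∈ s, algebraMap A R a ∈ J.map (algebraMap A R) := fun a ha ↦
    hs.le (Submodule.subset_span ha)
  refine ⟨∏ a ∈ s, F a, fun h ↦ ?_, fun a ha ↦ ?_⟩
  · obtain ⟨a, ha, h⟩ := (Ideal.IsPrime.prod_mem_iff (hp := ‹_›)).1 h
    exact hF a (hsJ a ha) h
  · have h2 : (J.map (algebraMap A R)).comap (algebraMap A R) ≤
        J.colon {∏ a ∈ s, F a} := by
      rw [← hs, Submodule.span_le]
      intro b hb
      rw [SetLike.mem_coe, Submodule.mem_colon_singleton, smul_eq_mul]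
      obtain ⟨c, hc⟩ := Finset.dvd_prod_of_mem F hb
      rw [hc, show b * (F b * c) = c * (F b * b) by ring]
      exact J.mul_mem_left _ (hF' b (hsJ b hb))
    have h3 := Submodule.mem_colon_singleton.1 (h2 ha)
    rwa [smul_eq_mul, mul_comm] at h3

theorem exists_notMem_forall_mul_mem' {A R : Type*} [CommRing A] [IsNoetherianRing A] [CommRing R]
    [Algebra A R] (P : Ideal A) [P.IsPrime] [IsLocalization.AtPrime R P] {ι : Type*} [Fintype ι]
    (J : ι → Ideal A) :
    ∃ f ∉ P, ∀ i a, algebraMap A R a ∈ (J i).map (algebraMap A R) → f * a ∈ J i := by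
  choose f hf h using fun i ↦ exists_notMem_forall_mul_mem (R := R) P (J i)
  refine ⟨∏ i, f i, fun h0 ↦ ?_, fun i a ha ↦ ?_⟩
  · obtain ⟨i, -, hi⟩ := (Ideal.IsPrime.prod_mem_iff (hp := ‹_›)).1 h0
    exact hf i hi
  · obtain ⟨c, hc⟩ := Finset.dvd_prod_of_mem f (Finset.mem_univ i)
    rw [hc, show f i * c * a = c * (f i * a) by ring]
    exact (J i).mul_mem_left _ (h i a ha)

theorem mem_map_of_mem_map {A S R : Type*} [CommRing A] [CommRing S] [CommRing R]
    [Algebra A S] {g : A →+* R} {κ : S →+* R} (hκ : κ.comp (algebraMap A S) = g) {f : A}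
    [IsLocalization.Away f S] {J : Ideal A} (h : ∀ a, g a ∈ J.map g → f * a ∈ J) {c : S}
    (hc : κ c ∈ J.map g) : c ∈ J.map (algebraMap A S) := by
  obtain ⟨n, a, ha⟩ := IsLocalization.Away.surj f c
  have h1 : g a ∈ J.map g := by
    rw [← hκ, RingHom.comp_apply, ← ha, map_mul, hκ]
    exact Ideal.mul_mem_right _ _ hc
  have h2 := Ideal.mem_map_of_mem (algebraMap A S) (h a h1)
  have hu : IsUnit (algebraMap A S f) := IsLocalization.Away.algebraMap_isUnit f
  rw [map_mul, ← ha] at h2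
  exact (Ideal.mul_unit_mem_iff_mem _ (hu.pow n)).1 ((Ideal.unit_mul_mem_iff_mem _ hu).1 h2)

theorem exists_mul_unit_eq {A R : Type*} [CommRing A] [CommRing R] [Algebra A R] (M : Submonoid A)
    [IsLocalization M R] (r : R) : ∃ (a : A) (u : R), IsUnit u ∧ algebraMap A R a = r * u := by
  obtain ⟨⟨a, m⟩, h⟩ := IsLocalization.surj M r
  exact ⟨a, _, IsLocalization.map_units R m, h.symm⟩

end Spread

section Points
variable {K : Type u} [Field K] {X : Scheme.{u}} (s : X ⟶ Spec (.of K))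

theorem finiteType_structureHom [LocallyOfFiniteType s] (U : X.affineOpens) :
    (structureHom s U.1).FiniteType := by
  have h := s.finiteType_appLE (isAffineOpen_top _) U.2 le_top
  rw [structureHom, CommRingCat.hom_comp]
  exact RingHom.FiniteType.comp h (RingHom.FiniteType.of_surjective _
    (Scheme.ΓSpecIso (.of K)).symm.commRingCatIsoToRingEquiv.surjective)

theorem isNoetherianRing_section [LocallyOfFiniteType s] (U : X.affineOpens) :
    IsNoetherianRing Γ(X, U) := by
  have h := finiteType_structureHom s U
  algebraize [structureHom s U.1]
  exact Algebra.FiniteType.isNoetherianRing K _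

theorem mem_primeIdealOf_iff (U : X.affineOpens) {p : X} (hp : p ∈ U.1) (f : Γ(X, U)) :
    f ∈ (U.2.primeIdealOf ⟨p, hp⟩).asIdeal ↔
      X.presheaf.germ U.1 p hp f ∈ IsLocalRing.maximalIdeal (X.presheaf.stalk p) := by
  rw [U.2.primeIdealOf_eq_map_closedPoint]
  rfl

theorem ringKrullDim_stalk_eq_height (U : X.affineOpens) {p : X} (hp : p ∈ U.1) :
    ringKrullDim (X.presheaf.stalk p) = (U.2.primeIdealOf ⟨p, hp⟩).asIdeal.height := by
  let _ := X.presheaf.algebra_section_stalk (⟨p, hp⟩ : U.1)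
  have := U.2.isLocalization_stalk ⟨p, hp⟩
  exact IsLocalization.AtPrime.ringKrullDim_eq_height (U.2.primeIdealOf ⟨p, hp⟩).asIdeal _

/-- The residue field at a closed point of a scheme of finite type over an algebraically closed
field. -/
theorem exists_residue_map [IsAlgClosed K] [LocallyOfFiniteType s] (U : X.affineOpens) {p : X}
    (hp : p ∈ U.1) (hcl : IsClosed {p}) :
    ∃ ρ : Γ(X, U) →+* K, ρ.comp (structureHom s U.1) = RingHom.id K ∧
      RingHom.ker ρ = (U.2.primeIdealOf ⟨p, hp⟩).asIdeal := by
  have hm := U.2.primeIdealOf_isMaximal_of_isClosed ⟨p, hp⟩ hcl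
  have h := finiteType_structureHom s U
  algebraize [structureHom s U.1]
  let P := (U.2.primeIdealOf ⟨p, hp⟩).asIdeal
  let _ : Field (Γ(X, U) ⧸ P) := Ideal.Quotient.field P
  have : Module.Finite K (Γ(X, U) ⧸ P) := finite_of_finite_type_of_isJacobsonRing K _
  let e := RingEquiv.ofBijective (algebraMap K (Γ(X, U) ⧸ P))
    IsAlgClosed.algebraMap_bijective_of_isIntegral
  refine ⟨e.symm.toRingHom.comp (Ideal.Quotient.mk P), ?_, ?_⟩
  · ext k
    exact e.symm_apply_apply k
  · rw [RingHom.ker_comp_of_injective _ e.symm.injective, Ideal.mk_ker]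

variable [IsAlgClosed K] [IsIntegral X]

theorem exists_forall_isClosed_ringKrullDim_eq [LocallyOfFiniteType s] (U : X.affineOpens) (hU : (U.1 : Set X).Nonempty) :
    ∃ n : ℕ∞, ∀ p ∈ U.1, IsClosed {p} → ringKrullDim (X.presheaf.stalk p) = n := by
  have h := finiteType_structureHom s U
  algebraize [structureHom s U.1]
  have : Nonempty U.1 := hU.to_subtype
  obtain ⟨n, hn⟩ := exists_forall_isMaximal_height_eq K Γ(X, U)
  refine ⟨n, fun p hp hcl ↦ ?_⟩
  rw [ringKrullDim_stalk_eq_height U hp,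
    hn _ (U.2.primeIdealOf_isMaximal_of_isClosed ⟨p, hp⟩ hcl)]

/-- All closed points of a variety have codimension the dimension of the variety. -/
theorem ringKrullDim_stalk_eq_topologicalKrullDim [LocallyOfFiniteType s] {p : X} (hp : IsClosed {p}) :
    ringKrullDim (X.presheaf.stalk p) = topologicalKrullDim X := by
  have hJ : JacobsonSpace X := LocallyOfFiniteType.jacobsonSpace s
  have h1 (q : X) (hq : IsClosed {q}) :
      ringKrullDim (X.presheaf.stalk p) = ringKrullDim (X.presheaf.stalk q) := by
    obtain ⟨U, hU, hpU, -⟩ := exists_isAffineOpen_mem_and_subset (X := X) (x := p) (U := ⊤) trivial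
    obtain ⟨V, hV, hqV, -⟩ := exists_isAffineOpen_mem_and_subset (X := X) (x := q) (U := ⊤) trivial
    obtain ⟨n, hn⟩ := exists_forall_isClosed_ringKrullDim_eq s ⟨U, hU⟩ ⟨p, hpU⟩
    obtain ⟨m, hm⟩ := exists_forall_isClosed_ringKrullDim_eq s ⟨V, hV⟩ ⟨q, hqV⟩
    obtain ⟨w, ⟨hwU, hwV⟩, hw⟩ := nonempty_inter_closedPoints
      (nonempty_preirreducible_inter U.2 V.2 ⟨p, hpU⟩ ⟨q, hqV⟩)
      (U.2.inter V.2).isLocallyClosed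
    exact ((hn p hpU hp).trans (hn w hwU hw).symm).trans ((hm w hwV hw).trans (hm q hqV hq).symm)
  rw [topologicalKrullDim, Order.krullDim_eq_of_orderIso irreducibleSetEquivPoints,
    Order.krullDim_eq_iSup_coheight_of_nonempty, ringKrullDim_stalk_eq_coheight]
  refine congrArg _ (le_antisymm (le_iSup (fun a : X ↦ Order.coheight a) p) (iSup_le fun a ↦ ?_))
  obtain ⟨q, hqa, hq⟩ := nonempty_inter_closedPoints (Z := closure {a}) ⟨a, subset_closure rfl⟩
    isClosed_closure.isLocallyClosed
  have h2 := h1 q hq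
  rw [ringKrullDim_stalk_eq_coheight, ringKrullDim_stalk_eq_coheight] at h2
  rw [WithBot.coe_injective h2]
  exact Order.coheight_anti (specializes_iff_mem_closure.2 hqa)

end Points

section Tangent
open IsLocalRing
variable {X : Scheme.{u}} {Z : Closeds X} {p : X}

/-- The ideal of a closed subset in a local ring. -/
def stalkIdeal (Z : Closeds X) (U : X.affineOpens) (p : X) (hp : p ∈ U.1) :
    Ideal (X.presheaf.stalk p) :=
  ((Scheme.IdealSheafData.vanishingIdeal Z).ideal U).map (X.presheaf.germ U.1 p hp).hom

theorem germ_mem_stalkIdeal (U : X.affineOpens) (hp : p ∈ U.1) (V : X.affineOpens)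
    (hpV : p ∈ V.1) {f : Γ(X, V)} (hf : f ∈ (Scheme.IdealSheafData.vanishingIdeal Z).ideal V) :
    X.presheaf.germ V.1 p hpV f ∈ stalkIdeal Z U p hp := by
  obtain ⟨g, g', hgg, hpg⟩ := exists_basicOpen_le_affine_inter U.2 V.2 p ⟨hp, hpV⟩
  let D : X.affineOpens := ⟨X.basicOpen g, U.2.basicOpen g⟩
  have hDU : D ≤ U := X.basicOpen_le g
  have hDV : D ≤ V := (show X.basicOpen g ≤ V.1 from hgg ▸ X.basicOpen_le g')
  have h1 := Ideal.mem_map_of_mem (X.presheaf.map (homOfLE hDV).op).hom hf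
  rw [Scheme.IdealSheafData.map_ideal, ← Scheme.IdealSheafData.map_ideal _ hDU] at h1
  have h2 : X.presheaf.germ D.1 p hpg (X.presheaf.map (homOfLE hDV).op f) ∈
      stalkIdeal Z U p hp := by
    have h4 : (X.presheaf.germ D.1 p hpg).hom.comp (X.presheaf.map (homOfLE hDU).op).hom =
      (X.presheaf.germ U.1 p hp).hom :=
        congrArg CommRingCat.Hom.hom (X.presheaf.germ_res (homOfLE hDU) p hpg)
    rw [stalkIdeal, ← h4, ← Ideal.map_map]
    exact Ideal.mem_map_of_mem (X.presheaf.germ D.1 p hpg).hom h1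
  have h3 := congrArg (fun φ ↦ φ.hom f) (X.presheaf.germ_res (homOfLE hDV) p hpg)
  exact h3 ▸ h2

theorem germ_mem_maximalIdeal (hpZ : p ∈ Z) (U : X.affineOpens) (hp : p ∈ U.1) {f : Γ(X, U)}
    (hf : f ∈ (Scheme.IdealSheafData.vanishingIdeal Z).ideal U) :
    X.presheaf.germ U.1 p hp f ∈ maximalIdeal (X.presheaf.stalk p) := fun h ↦
  (mem_vanishingIdeal_iff Z U f).1 hf p hpZ ((X.mem_basicOpen f p hp).2 h)

theorem tangentSpace_eq_dualAnnihilator (hpZ : p ∈ Z) (U : X.affineOpens) (hp : p ∈ U.1) :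
    tangentSpace Z p = (conormalSpan (stalkIdeal Z U p hp)).dualAnnihilator := by
  ext v
  rw [Submodule.mem_dualAnnihilator]
  refine ⟨fun hv ↦ ?_, fun hv V hpV f hf hm ↦
    hv _ (mem_conormalSpan ⟨_, hm⟩ (germ_mem_stalkIdeal U hp V hpV hf))⟩
  rintro _ ⟨g, hg, rfl⟩
  let N : Ideal (X.presheaf.stalk p) := Submodule.map (maximalIdeal (X.presheaf.stalk p)).subtype
    (((LinearMap.ker v).restrictScalars (X.presheaf.stalk p)).comap
      (maximalIdeal (X.presheaf.stalk p)).toCotangent)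
  have hN : stalkIdeal Z U p hp ≤ N := Ideal.map_le_iff_le_comap.2 fun f hf ↦
    ⟨⟨_, germ_mem_maximalIdeal hpZ U hp hf⟩, hv U hp f hf _, rfl⟩
  obtain ⟨g', hg', h⟩ := hN hg
  rw [← Subtype.ext h]
  exact hg'

theorem isPrime_vanishingIdeal (hZ : IsIrreducible (Z : Set X)) (hpZ : p ∈ Z) (U : X.affineOpens)
    (hp : p ∈ U.1) : ((Scheme.IdealSheafData.vanishingIdeal Z).ideal U).IsPrime := by
  refine ⟨fun h ↦ ?_, fun {f g} hfg ↦ ?_⟩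
  · have h1 := germ_mem_maximalIdeal hpZ U hp (h ▸ Submodule.mem_top (x := (1 : Γ(X, U))))
    rw [map_one] at h1
    exact (maximalIdeal.isMaximal _).ne_top ((Ideal.eq_top_iff_one _).2 h1)
  · by_contra! h
    simp only [mem_vanishingIdeal_iff] at h hfg
    push Not at h
    obtain ⟨⟨a, ha, haf⟩, b, hb, hbg⟩ := h
    obtain ⟨c, hc, hcf, hcg⟩ := hZ.2 _ _ (X.basicOpen f).2 (X.basicOpen g).2 ⟨a, ha, haf⟩
      ⟨b, hb, hbg⟩
    exact hfg c hc (by rw [X.basicOpen_mul]; exact ⟨hcf, hcg⟩)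

end Tangent

section Coordinates
open IsLocalRing

variable {K : Type u} [Field K] {X : Scheme.{u}} {p : X}

theorem isPrime_stalkIdeal {Z : Closeds X} (hZ : IsIrreducible (Z : Set X)) (hpZ : p ∈ Z)
    (U : X.affineOpens) (hp : p ∈ U.1) : (stalkIdeal Z U p hp).IsPrime := by
  let _ := X.presheaf.algebra_section_stalk (⟨p, hp⟩ : U.1)
  have := U.2.isLocalization_stalk ⟨p, hp⟩
  refine IsLocalization.isPrime_of_isPrime_disjoint
    (U.2.primeIdealOf ⟨p, hp⟩).asIdeal.primeCompl (X.presheaf.stalk p) _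
    (isPrime_vanishingIdeal hZ hpZ U hp) (Set.disjoint_left.2 fun f hf hf' ↦ hf ?_)
  exact (mem_primeIdealOf_iff U hp f).2 (germ_mem_maximalIdeal hpZ U hp hf')

theorem finrank_conormalSpan {Z : Closeds X} (hpZ : p ∈ Z) (U : X.affineOpens) (hp : p ∈ U.1)
    [IsNoetherianRing (X.presheaf.stalk p)]
    (hX : Module.finrank (ResidueField (X.presheaf.stalk p)) (CotangentSpace (X.presheaf.stalk p)) = 3)
    (hZ : Module.finrank (ResidueField (X.presheaf.stalk p)) (tangentSpace Z p) = 1) :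
    Module.finrank (ResidueField (X.presheaf.stalk p)) (conormalSpan (stalkIdeal Z U p hp)) = 2 := by
  rw [tangentSpace_eq_dualAnnihilator hpZ U hp] at hZ
  have := Subspace.finrank_add_finrank_dualAnnihilator_eq (conormalSpan (stalkIdeal Z U p hp))
  omega

theorem span_pair_mul_unit {R : Type*} [CommRing R] {x y u v : R} (hu : IsUnit u) (hv : IsUnit v) :
    Ideal.span {x * u, y * v} = Ideal.span {x, y} := by
  rw [Ideal.span_insert, Ideal.span_insert, Ideal.span_singleton_mul_right_unit hu,
    Ideal.span_singleton_mul_right_unit hv]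

theorem span_triple_mul_unit {R : Type*} [CommRing R] {x y z u v w : R} (hu : IsUnit u)
    (hv : IsUnit v) (hw : IsUnit w) :
    Ideal.span {x * u, y * v, z * w} = Ideal.span {x, y, z} := by
  rw [Ideal.span_insert, Ideal.span_insert x, Ideal.span_singleton_mul_right_unit hu,
    span_pair_mul_unit hv hw]

/-- Ideals in a ring of sections are determined near a point by their stalks. -/
theorem exists_affine_forall_mem_map (U : X.affineOpens) (hp : p ∈ U.1) [IsNoetherianRing Γ(X, U)]
    {ι : Type*} [Fintype ι] (J : ι → Ideal Γ(X, U)) :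
    ∃ (V : X.affineOpens) (h : V ≤ U) (hpV : p ∈ V.1), ∀ i (c : Γ(X, V)),
      X.presheaf.germ V.1 p hpV c ∈ (J i).map (X.presheaf.germ U.1 p hp).hom →
      c ∈ (J i).map (X.presheaf.map (homOfLE h).op).hom := by
  let _ := X.presheaf.algebra_section_stalk (⟨p, hp⟩ : U.1)
  have := U.2.isLocalization_stalk ⟨p, hp⟩
  obtain ⟨f, hf, h⟩ := exists_notMem_forall_mul_mem' (R := X.presheaf.stalk p)
    (U.2.primeIdealOf ⟨p, hp⟩).asIdeal J
  have hpf : p ∈ X.basicOpen f := (X.mem_basicOpen f p hp).2 (by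
    have h1 := (mem_primeIdealOf_iff U hp f).not.1 hf
    simpa using h1)
  have := U.2.isLocalization_basicOpen f
  refine ⟨⟨X.basicOpen f, U.2.basicOpen f⟩, X.basicOpen_le f, hpf, fun i c hc ↦ ?_⟩
  exact mem_map_of_mem_map (g := (X.presheaf.germ U.1 p hp).hom)
    (κ := (X.presheaf.germ (X.basicOpen f) p hpf).hom)
    (congrArg CommRingCat.Hom.hom (X.presheaf.germ_res (homOfLE (X.basicOpen_le f)) p hpf))
    (f := f) (h i) hc

/-- Two curves which are smooth and transversal at their intersection point on a threefold have
local equations `x = y = 0` and `x = z = 0`. -/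
theorem exists_hasFlopCoords [IsAlgClosed K] (s : X ⟶ Spec (.of K)) [IsIntegral X]
    [LocallyOfFiniteType s] (hX : topologicalKrullDim X = 3) {B C : Closeds X}
    (hB : IsIrreducible (B : Set X)) (hC : IsIrreducible (C : Set X))
    (hp : (B : Set X) ∩ (C : Set X) = {p}) (hXp : IsRegularLocalRing (X.presheaf.stalk p))
    (hBp : Module.finrank (ResidueField (X.presheaf.stalk p)) (tangentSpace B p) = 1)
    (hCp : Module.finrank (ResidueField (X.presheaf.stalk p)) (tangentSpace C p) = 1)
    (hBC : tangentSpace B p ≠ tangentSpace C p) :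
    ∃ (U : X.affineOpens) (x y z : Γ(X, U)), HasFlopCoords s B C p U x y z := by
  have hpBC : p ∈ (B : Set X) ∩ C := hp ▸ rfl
  have hpB : p ∈ B := hpBC.1
  have hpC : p ∈ C := hpBC.2
  have hcl : IsClosed {p} := hp ▸ B.isClosed.inter C.isClosed
  have hdim := (ringKrullDim_stalk_eq_topologicalKrullDim s hcl).trans hX
  have hfin : Module.finrank (ResidueField (X.presheaf.stalk p))
      (CotangentSpace (X.presheaf.stalk p)) = 3 := by
    have := (IsRegularLocalRing.iff_finrank_cotangentSpace (X.presheaf.stalk p)).1 hXp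
    rw [hdim] at this
    exact_mod_cast this
  have hht : (3 : ℕ∞) ≤ (maximalIdeal (X.presheaf.stalk p)).height := by
    have := (maximalIdeal_height_eq_ringKrullDim (R := X.presheaf.stalk p)).trans hdim
    exact (WithBot.coe_injective this).ge
  obtain ⟨U₀, hU₀, hpU, -⟩ := exists_isAffineOpen_mem_and_subset (X := X) (x := p) (U := ⊤) trivial
  let U : X.affineOpens := ⟨U₀, hU₀⟩
  replace hpU : p ∈ U.1 := hpU
  have := isNoetherianRing_section s U
  obtain ⟨x₀, y₀, z₀, hm₀, hI₀, hJ₀, hx₀, hx0₀, hy₀, hz₀⟩ := exists_local_coords hfin hht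
    (isPrime_stalkIdeal hB hpB U hpU) (isPrime_stalkIdeal hC hpC U hpU)
    (finrank_conormalSpan hpB U hpU hfin hBp) (finrank_conormalSpan hpC U hpU hfin hCp)
    fun h ↦ hBC (by
      rw [tangentSpace_eq_dualAnnihilator hpB U hpU, tangentSpace_eq_dualAnnihilator hpC U hpU, h])
  have hlift : ∀ r : X.presheaf.stalk p, ∃ (a : Γ(X, U)) (u : X.presheaf.stalk p), IsUnit u ∧
      (X.presheaf.germ U.1 p hpU).hom a = r * u := by
    let _ := X.presheaf.algebra_section_stalk (⟨p, hpU⟩ : U.1)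
    have := U.2.isLocalization_stalk ⟨p, hpU⟩
    exact fun r ↦ exists_mul_unit_eq (U.2.primeIdealOf ⟨p, hpU⟩).asIdeal.primeCompl r
  obtain ⟨x, u, hu, hx⟩ := hlift x₀
  obtain ⟨y, v, hv, hy⟩ := hlift y₀
  obtain ⟨z, w, hw, hz⟩ := hlift z₀
  let G := (X.presheaf.germ U.1 p hpU).hom
  have hm : maximalIdeal (X.presheaf.stalk p) = Ideal.span {G x, G y, G z} := by
    rw [hm₀, ← span_triple_mul_unit hu hv hw, ← hx, ← hy, ← hz]
  have hI : stalkIdeal B U p hpU = Ideal.span {G x, G y} := by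
    rw [hI₀, ← span_pair_mul_unit hu hv, ← hx, ← hy]
  have hJ : stalkIdeal C U p hpU = Ideal.span {G x, G z} := by
    rw [hJ₀, ← span_pair_mul_unit hu hw, ← hx, ← hz]
  have hxp : (Ideal.span {G x}).IsPrime := by
    rw [← Ideal.span_singleton_mul_right_unit hu, ← hx] at hx₀
    exact hx₀
  have hx0 : G x ≠ 0 := fun h ↦ hx0₀ ((hu.mul_left_eq_zero).1 (hx.symm.trans h))
  have hyJ : G y ∉ stalkIdeal C U p hpU := fun h ↦
    hy₀ ((Ideal.mul_unit_mem_iff_mem _ hv).1 (hy ▸ h))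
  have hzI : G z ∉ stalkIdeal B U p hpU := fun h ↦
    hz₀ ((Ideal.mul_unit_mem_iff_mem _ hw).1 (hz ▸ h))
  obtain ⟨V, hVU, hpV, hV⟩ := exists_affine_forall_mem_map U hpU
    ![Ideal.span {x}, Ideal.span {x, y}, Ideal.span {x, z}, Ideal.span {x, y, z},
      (Scheme.IdealSheafData.vanishingIdeal B).ideal U,
      (Scheme.IdealSheafData.vanishingIdeal C).ideal U]
  obtain ⟨ρ, hρ, hρk⟩ := exists_residue_map s V hpV hcl
  let κ := (X.presheaf.germ V.1 p hpV).hom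
  let res := (X.presheaf.map (homOfLE hVU : V.1 ⟶ U.1).op).hom
  have hκ (a : Γ(X, U)) : κ (res a) = G a :=
    congrArg (fun φ ↦ φ.hom a) (X.presheaf.germ_res (homOfLE hVU) p hpV)
  have hBV : ((Scheme.IdealSheafData.vanishingIdeal B).ideal U).map res =
      (Scheme.IdealSheafData.vanishingIdeal B).ideal V := Scheme.IdealSheafData.map_ideal _ hVU
  have hCV : ((Scheme.IdealSheafData.vanishingIdeal C).ideal U).map res =
      (Scheme.IdealSheafData.vanishingIdeal C).ideal V := Scheme.IdealSheafData.map_ideal _ hVU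
  have k1 (c : Γ(X, V)) (hc : κ c ∈ Ideal.span {G x}) : c ∈ Ideal.span {res x} := by
    have := hV 0 c
    simp only [Matrix.cons_val_zero, Ideal.map_span, Set.image_singleton] at this
    exact this hc
  have k2 (c : Γ(X, V)) (hc : κ c ∈ Ideal.span {G x, G y}) : c ∈ Ideal.span {res x, res y} := by
    have := hV 1 c
    simp only [Matrix.cons_val_one, Matrix.cons_val_zero, Ideal.map_span, Set.image_pair] at this
    exact this hc
  have k3 (c : Γ(X, V)) (hc : κ c ∈ Ideal.span {G x, G z}) : c ∈ Ideal.span {res x, res z} := by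
    have := hV 2 c
    simp only [Matrix.cons_val, Ideal.map_span, Set.image_pair] at this
    exact this hc
  have k4 (c : Γ(X, V)) (hc : κ c ∈ Ideal.span {G x, G y, G z}) :
      c ∈ Ideal.span {res x, res y, res z} := by
    have := hV 3 c
    simp only [Matrix.cons_val, Ideal.map_span, Set.image_insert_eq, Set.image_singleton] at this
    exact this hc
  have k5 (c : Γ(X, V)) (hc : κ c ∈ stalkIdeal B U p hpU) :
      c ∈ (Scheme.IdealSheafData.vanishingIdeal B).ideal V := hBV ▸ hV 4 c hc
  have k6 (c : Γ(X, V)) (hc : κ c ∈ stalkIdeal C U p hpU) :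
      c ∈ (Scheme.IdealSheafData.vanishingIdeal C).ideal V := hCV ▸ hV 5 c hc
  have hBs : (Scheme.IdealSheafData.vanishingIdeal B).ideal V = Ideal.span {res x, res y} := by
    refine le_antisymm (fun c hc ↦ k2 c (hI ▸ germ_mem_stalkIdeal U hpU V hpV hc))
      (Ideal.span_le.2 ?_)
    rintro _ (rfl | rfl)
    · exact k5 _ (by rw [hκ, hI]; exact Ideal.subset_span (by simp))
    · exact k5 _ (by rw [hκ, hI]; exact Ideal.subset_span (by simp))
  have hCs : (Scheme.IdealSheafData.vanishingIdeal C).ideal V = Ideal.span {res x, res z} := by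
    refine le_antisymm (fun c hc ↦ k3 c (hJ ▸ germ_mem_stalkIdeal U hpU V hpV hc))
      (Ideal.span_le.2 ?_)
    rintro _ (rfl | rfl)
    · exact k6 _ (by rw [hκ, hJ]; exact Ideal.subset_span (by simp))
    · exact k6 _ (by rw [hκ, hJ]; exact Ideal.subset_span (by simp))
  have hzV : res z ∉ Ideal.span {res x, res y} := fun h ↦
    hzI (hκ z ▸ germ_mem_stalkIdeal U hpU V hpV (hBs.ge h))
  have hyV : res y ∉ Ideal.span {res x, res z} := fun h ↦
    hyJ (hκ y ▸ germ_mem_stalkIdeal U hpU V hpV (hCs.ge h))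
  have hreg (t : Γ(X, U)) (ht : G t ∉ Ideal.span {G x}) (c d : Γ(X, V))
      (h : res t * c = res x * d) : res x ∣ c := by
    have h1 := congrArg κ h
    rw [map_mul, map_mul, hκ, hκ] at h1
    exact Ideal.mem_span_singleton.1 (k1 c ((hxp.mem_or_mem
      (h1 ▸ Ideal.mul_mem_right _ _ (Ideal.mem_span_singleton_self _))).resolve_left ht))
  have hle1 : Ideal.span {G x} ≤ stalkIdeal B U p hpU := hI ▸ Ideal.span_mono (by simp)
  have hle2 : Ideal.span {G x} ≤ stalkIdeal C U p hpU := hJ ▸ Ideal.span_mono (by simp)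
  have : Nonempty V.1 := ⟨p, hpV⟩
  refine ⟨V, res x, res y, res z, hp, hpV, ⟨inferInstance, isNoetherianRing_section s V,
    fun h ↦ hx0 (by rw [← hκ, h, map_zero]), hBs ▸ isPrime_vanishingIdeal hB hpB V hpV,
    hCs ▸ isPrime_vanishingIdeal hC hpC V hpV, hzV, hyV, hreg y fun h ↦ hyJ (hle2 h),
    hreg z fun h ↦ hzI (hle1 h), ρ, hρ, hρk.trans (le_antisymm (fun c hc ↦ k4 c ?_) ?_)⟩, hBs, hCs⟩
  · exact hm.le ((mem_primeIdealOf_iff V hpV c).1 hc)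
  · rw [Ideal.span_le]
    rintro _ (rfl | rfl | rfl)
    all_goals
      refine (mem_primeIdealOf_iff V hpV _).2 (hm.ge ?_)
      refine (congrArg (· ∈ Ideal.span _) (hκ _)).mpr (Ideal.subset_span (by simp))

end Coordinates

end AtiyahFlop

end

theorem mainTheorem6 {K : Type u} [Field K] [IsAlgClosed K] [CharZero K]
    {X : Scheme.{u}} (s : X ⟶ Spec (.of K))
    [IsIntegral X] [IsSeparated s] [LocallyOfFiniteType s] [QuasiCompact s]
    (hX : topologicalKrullDim X = 3)
    (B C : Closeds X)
    (hB : IsIrreducible (B : Set X)) (hB_dim : topologicalKrullDim (B : Set X) = 1)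
    (hC : IsIrreducible (C : Set X)) (hC_dim : topologicalKrullDim (C : Set X) = 1)
    (p : X) (hp : (B : Set X) ∩ (C : Set X) = {p})
    (hXp : IsRegularLocalRing (X.presheaf.stalk p))
    (hBp : Module.finrank (IsLocalRing.ResidueField (X.presheaf.stalk p))
      (AtiyahFlop.tangentSpace B p) = 1)
    (hCp : Module.finrank (IsLocalRing.ResidueField (X.presheaf.stalk p))
      (AtiyahFlop.tangentSpace C p) = 1)
    (hBC : AtiyahFlop.tangentSpace B p ≠ AtiyahFlop.tangentSpace C p) :
    Nonempty (AtiyahFlop.IteratedBlowup B C) ∧ Nonempty (AtiyahFlop.IteratedBlowup C B) ∧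
    ∀ (Y : AtiyahFlop.IteratedBlowup B C) (Y' : AtiyahFlop.IteratedBlowup C B),
      AtiyahFlop.HasNormalBundleNegOneNegOne (Y.toBase ≫ s) (Y.fiberCurve p) ∧
      ∃ φ : Y.X₂ ⤏ Y'.X₂,
        (φ.compHom Y'.toBase = Y.toBase.toRationalMap ∧
          ∀ ψ : Y.X₂ ⤏ Y'.X₂, ψ.compHom Y'.toBase = Y.toBase.toRationalMap → ψ = φ) ∧
        AtiyahFlop.IsAtiyahFlop (Y.toBase ≫ s) (Y'.toBase ≫ s) φ (Y.fiberCurve p) := by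
  obtain ⟨U, x, y, z, h⟩ := AtiyahFlop.exists_hasFlopCoords s hX hB hC hp hXp hBp hCp hBC
  have hcl : IsClosed {p} := hp ▸ B.isClosed.inter C.isClosed
  exact ⟨AtiyahFlop.nonempty_iteratedBlowup B C, AtiyahFlop.nonempty_iteratedBlowup C B,
    fun Y Y' ↦ h.isAtiyahFlop hcl Y Y'⟩
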